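/- **Conventions.** A quantum polynomial-time algorithm (QPT) is a family of quantum circuits, indexed by the security parameter $n$, over a fixed finite universal set of admissible gates, such that a polynomial-time Turing machine on input $1^n$ prints a description of the $n$-th circuit. A QPT with oracles may in addition use oracle gates that apply given maps (from quantum registers to quantum registers) to a register of the circuit. A *classical* oracle for a function $g$ measures its query register in the computational basis and returns $|g(x)\rangle\langle g(x)|$ if the outcome is $x$. A function $\varepsilon:\mathbb N\to\mathbb R$ is negligible, written $\varepsilon\le\mathrm{negl}(n)$, if $n^d\varepsilon(n)\to 0$ for every $d$. Uniformly random choice is written $\leftarrow_R$. **Quantum-secure pseudorandom functions.** A function family $f:\{0,1\}^n\times\{0,1\}^{2n}\to\{0,1\}^{2n}$, $f_k=f(k,\cdot)$, that is computed by a polynomial-time uniform family of Boolean circuits is a *qPRF* if for every QPT $\mathcal D$ with a classical oracle $$\Bigl|\Pr_{k\leftarrow_R\{0,1\}^n}[\mathcal D^{f_k}(1^n)=1]-\Pr_{g\leftarrow_R\{\{0,1\}^{2n}\to\{0,1\}^{2n}\}}[\mathcal D^{g}(1^n)=1]\Bigr|\le\mathrm{negl}(n).$$ **Encryption schemes.**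 A *quantum symmetric-key encryption scheme* with $n$-bit keys consists of three QPTs: $\mathsf{KeyGen}$, which outputs a key $k\in\{0,1\}^n$ on input $1^n$; $\mathsf{Enc}$, which maps $k$ and a plaintext state (register $M$) to a ciphertext state (register $C$); and $\mathsf{Dec}$, which maps $k$ and a ciphertext state to a plaintext state; such that $\|\mathsf{Dec}_k\circ\mathsf{Enc}_k-\mathrm{id}_M\|_\diamond\le\mathrm{negl}(n)$ for all $k$ in the support of $\mathsf{KeyGen}(1^n)$. It is *IND-CCA1-secure* if for every pair $(\mathcal M,\mathcal D)$ of QPTs, where $\mathcal M$ has oracle access to $\mathsf{Enc}_k$ and $\mathsf{Dec}_k$ and outputs a state $\rho_{ME}$ of the plaintext register and an auxiliary register $E$, and where $\mathcal D$ has oracle access to $\mathsf{Enc}_k$, $$\Bigl|\Pr\bigl[\mathcal D\{(\mathsf{Enc}_k\otimes\mathbb 1_E)\rho_{ME}\}=1\bigr]-\Pr\bigl[\mathcal D\{(\mathsf{Enc}_k\otimes\mathbb 1_E)(|0\rangle\langle 0|_M\otimes\rho_E)\}=1\bigr]\Bigr|\le\mathrm{negl}(n),$$ where $\rho_E=\mathrm{tr}_M\rho_{ME}$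 and the probabilities are over $k\leftarrow\mathsf{KeyGen}(1^n)$ and the internal randomness of all algorithms. **The scheme.** For $s\in\{0,1\}^{2n}$ let $P_s=\prod_{j=1}^n X_j^{s_{2j-1}}Z_j^{s_{2j}}$ on $n$ qubits, where $X_j,Z_j$ are the Pauli operators on the $j$-th qubit. For a function family $f$ as above: 1. $\mathsf{KeyGen}(1^n)$ outputs $k\leftarrow_R\{0,1\}^n$. 2. $\mathsf{Enc}_k(\rho)$, for an $n$-qubit state $\rho$, chooses $r\leftarrow_R\{0,1\}^{2n}$ and outputs $|r\rangle\langle r|\otimes P_{f_k(r)}\,\rho\,P_{f_k(r)}^\dagger$. 3. $\mathsf{Dec}_k(\sigma)$, for a $3n$-qubit state $\sigma$, measures the first $2n$ qubits in the computational basis, obtains $r'\in\{0,1\}^{2n}$, applies $P_{f_k(r')}$ (by conjugation $\sigma'\mapsto P_{f_k(r')}\sigma' P_{f_k(r')}^\dagger$) to the remaining $n$ qubits, and outputs the result. **Lemma.** If $f$ is a qPRF, then this triple is an IND-CCA1-secure quantum symmetric-key encryption scheme: it is a quantum symmetric-key encryption scheme, and it is IND-CCA1-secure. -/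

import Mathlib

open scoped ENNReal

namespace QCrypt

noncomputable section

/-! ### Registers, states and maps -/

/-- Bit strings of length `n`; they label the computational basis of `n` qubits. -/
abbrev Bits (n : ℕ) : Type := Fin n → Bool

/-- Operators on the space of `n` qubits, written in the computational basis. -/
abbrev Op (n : ℕ) : Type := Matrix (Bits n) (Bits n) ℂ

/-- Linear maps from operators on `a` qubits to operators on `b` qubits. -/
abbrev QMap (a b : ℕ) : Type := Op a →ₗ[ℂ] Op b

/-- The string of `n` zeros. -/
def zeros (n : ℕ) : Bits n := fun _ => false

/-- The first `a` bits of a string of length `a + b`. -/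
def fstBits {a b : ℕ} (x : Bits (a + b)) : Bits a := fun i => x (Fin.castAdd b i)

/-- The last `b` bits of a string of length `a + b`. -/
def sndBits {a b : ℕ} (x : Bits (a + b)) : Bits b := fun i => x (Fin.natAdd a i)

/-- The operator `|x⟩⟨x|`. -/
def ketbra {n : ℕ} (x : Bits n) : Op n := Matrix.single x x 1

/-- The operator `ρ ⊗ σ`; the qubits of `ρ` come first. -/
def tensor {a b : ℕ} (ρ : Op a) (σ : Op b) : Op (a + b) :=
  Matrix.of fun x y => ρ (fstBits x) (fstBits y) * σ (sndBits x) (sndBits y)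

/-- Partial trace over the first `a` qubits. -/
def traceFst {a b : ℕ} (ρ : Op (a + b)) : Op b :=
  Matrix.of fun u v => ∑ w : Bits a, ρ (Fin.append w u) (Fin.append w v)

/-- `(Φ ⊗ id) ρ`, where `Φ` acts on the first `a` qubits and the identity on the last `e`. -/
def tensorId {a b : ℕ} (Φ : QMap a b) (e : ℕ) (ρ : Op (a + e)) : Op (b + e) :=
  Matrix.of fun x y =>
    Φ (Matrix.of fun u v => ρ (Fin.append u (sndBits x)) (Fin.append v (sndBits y)))
      (fstBits x) (fstBits y)

/-- The trace norm, i.e. the sum of the singular values. -/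
def traceNorm {n : ℕ} (A : Op n) : ℝ :=
  ∑ x, Real.sqrt ((Matrix.isHermitian_conjTranspose_mul_self A).eigenvalues x)

/-- The diamond norm: the supremum of `‖(Φ ⊗ id_e) ρ‖₁` over all `e` and all `ρ` with
`‖ρ‖₁ ≤ 1`. -/
def diamondNorm {a b : ℕ} (Φ : QMap a b) : ℝ≥0∞ :=
  ⨆ (e : ℕ) (ρ : Op (a + e)) (_ : traceNorm ρ ≤ 1), ENNReal.ofReal (traceNorm (tensorId Φ e ρ))

/-! ### Wires -/

/-- The bit on wire `i`. -/
def getBit {N : ℕ} (x : Bits N) (i : ℕ) : Bool := if h : i < N then x ⟨i, h⟩ else false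

/-- Replace the bit on wire `i` by `b`. -/
def setBit {N : ℕ} (x : Bits N) (i : ℕ) (b : Bool) : Bits N :=
  fun j => if (j : ℕ) = i then b else x j

/-- The bits on the wires `s, …, s + a - 1`. -/
def readReg {N : ℕ} (s a : ℕ) (x : Bits N) : Bits a := fun i => getBit x (s + i)

/-- Replace the bits on the wires `s, …, s + a - 1` by `u`. -/
def writeReg {N a : ℕ} (s : ℕ) (u : Bits a) (x : Bits N) : Bits N :=
  fun j => if h : s ≤ (j : ℕ) ∧ (j : ℕ) < s + a then u ⟨j - s, by omega⟩ else x j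

/-! ### Quantum circuits with oracle gates -/

/-- An oracle: an operation from `inN` qubits to `outN` qubits. -/
structure QOracle where
  inN : ℕ
  outN : ℕ
  map : QMap inN outN

/-- Gates, with the wires they act on. The non-oracle gates form a finite universal set of
admissible operations: `X`, `H`, `T`, `CNOT`, Toffoli (the target is the last wire), and
`reset`, which discards a qubit and replaces it by a fresh one in state `|0⟩`.
The gate `oracle q i j` applies the `q`-th oracle to the register that starts at wire `i`, and puts
the result into the register that starts at wire `j`. (Any wires can be moved to and from such
registers with `CNOT` gates.) -/
inductive Gate : Type
  | x (i : ℕ)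
  | h (i : ℕ)
  | t (i : ℕ)
  | cnot (c i : ℕ)
  | ccx (c d i : ℕ)
  | reset (i : ℕ)
  | oracle (q i j : ℕ)

def pauliX : Matrix Bool Bool ℂ := Matrix.of fun a b => if a = b then 0 else 1

def pauliZ : Matrix Bool Bool ℂ := Matrix.diagonal fun a => if a then -1 else 1

def hadamard : Matrix Bool Bool ℂ :=
  Matrix.of fun a b => (1 / Real.sqrt 2 : ℂ) * (if a && b then -1 else 1)

def tGate : Matrix Bool Bool ℂ :=
  Matrix.diagonal fun a => if a then Complex.exp (Real.pi / 4 * Complex.I) else 1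

/-- The one-qubit operator `u` on wire `i`, tensored with the identity on the other wires. -/
def oneQubit {N : ℕ} (u : Matrix Bool Bool ℂ) (i : ℕ) : Op N :=
  Matrix.of fun x y =>
    if ∀ j : Fin N, (j : ℕ) ≠ i → x j = y j then u (getBit x i) (getBit y i) else 0

/-- The operator that maps `|y⟩` to `|g y⟩`. -/
def basisMap {N : ℕ} (g : Bits N → Bits N) : Op N :=
  Matrix.of fun x y => if x = g y then 1 else 0

/-- The map `ρ ↦ U ρ U†`. -/
def conjBy {N : ℕ} (U ρ : Op N) : Op N := U * ρ * U.conjTranspose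

/-- Trace out the qubit on wire `i` and replace it by `|0⟩`. -/
def resetWire {N : ℕ} (i : ℕ) (ρ : Op N) : Op N :=
  Matrix.of fun x y =>
    if getBit x i = false ∧ getBit y i = false then
      ∑ b : Bool, ρ (setBit x i b) (setBit y i b)
    else 0

/-- Feed the register of `a` wires at `s` into `Φ`, discard the previous contents of the register
of `b` wires at `t` (disjoint from the first), and put the output of `Φ` there; the wires of the
first register are left in state `|0⟩`, and `Φ` is tensored with the identity on all other wires. -/
def applyReg {N a b : ℕ} (Φ : QMap a b) (s t : ℕ) (ρ : Op N) : Op N :=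
  Matrix.of fun x y =>
    if readReg s a x = zeros a ∧ readReg s a y = zeros a then
      ∑ w : Bits b,
        Φ (Matrix.of fun u v =>
            ρ (writeReg s u (writeReg t w x)) (writeReg s v (writeReg t w y)))
          (readReg t b x) (readReg t b y)
    else 0

/-- The operation of a gate on the state of `N` wires, given the oracles. -/
def Gate.apply (O : List QOracle) {N : ℕ} (g : Gate) (ρ : Op N) : Op N :=
  match g with
  | .x i => conjBy (oneQubit pauliX i) ρ
  | .h i => conjBy (oneQubit hadamard i) ρ
  | .t i => conjBy (oneQubit tGate i) ρ
  | .cnot c i => conjBy (basisMap fun y => setBit y i (xor (getBit y i) (getBit y c))) ρ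
  | .ccx c d i =>
      conjBy (basisMap fun y => setBit y i (xor (getBit y i) (getBit y c && getBit y d))) ρ
  | .reset i => resetWire i ρ
  | .oracle q i j =>
      match O[q]? with
      | some Φ => applyReg Φ.map i j ρ
      | none => ρ

/-- A gate is well formed on `N` wires, for oracles with the input and output sizes listed in
`sig`: its wires exist and are distinct, and for an oracle gate the oracle exists and its input
register and output register fit and are disjoint. -/
def Gate.WF (sig : List (ℕ × ℕ)) (N : ℕ) : Gate → Prop
  | .x i => i < N
  | .h i => i < N
  | .t i => i < N
  | .cnot c i => c < N ∧ i < N ∧ c ≠ i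
  | .ccx c d i => c < N ∧ d < N ∧ i < N ∧ c ≠ d ∧ c ≠ i ∧ d ≠ i
  | .reset i => i < N
  | .oracle q i j =>
      ∃ a b, sig[q]? = some (a, b) ∧ i + a ≤ N ∧ j + b ≤ N ∧ (i + a ≤ j ∨ j + b ≤ i)

/-- A quantum circuit: the number of wires and the list of gates, in the order of application. -/
structure QCircuit where
  width : ℕ
  gates : List Gate

/-- The circuit is well formed as a circuit from `a` qubits to `b` qubits. -/
def QCircuit.WF (sig : List (ℕ × ℕ)) (a b : ℕ) (C : QCircuit) : Prop :=
  a ≤ C.width ∧ b ≤ C.width ∧ ∀ g ∈ C.gates, g.WF sig C.width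

/-- Put an `a`-qubit state on the first `a` of `N` wires, the other wires being in state `|0⟩`. -/
def loadInput {a : ℕ} (N : ℕ) (ρ : Op a) : Op N :=
  Matrix.of fun x y =>
    if (∀ j : Fin N, a ≤ (j : ℕ) → x j = false ∧ y j = false) then
      ρ (readReg 0 a x) (readReg 0 a y)
    else 0

/-- Trace out all but the first `b` of `N` wires. -/
def keepOutput {N : ℕ} (b : ℕ) (ρ : Op N) : Op b :=
  Matrix.of fun u v =>
    ∑ z : Bits N, if readReg 0 b z = zeros b then ρ (writeReg 0 u z) (writeReg 0 v z) else 0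

/-- The output state (`b` qubits) of the circuit with oracles `O` on the input state `ρ`
(`a` qubits). -/
def QCircuit.run (O : List QOracle) (C : QCircuit) {a : ℕ} (b : ℕ) (ρ : Op a) : Op b :=
  keepOutput b (C.gates.foldl (fun τ g => g.apply O τ) (loadInput C.width ρ))

/-! ### Classical circuits -/

/-- A NAND gate: the wire `dst` gets the negated conjunction of the wires `src₁` and `src₂`. -/
structure BGate where
  src₁ : ℕ
  src₂ : ℕ
  dst : ℕ

/-- A Boolean circuit: the number of wires and the list of gates, in the order of application. -/
structure BCircuit where
  width : ℕ
  gates : List BGate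

def BCircuit.WF (a b : ℕ) (C : BCircuit) : Prop :=
  a ≤ C.width ∧ b ≤ C.width ∧
    ∀ g ∈ C.gates, g.src₁ < C.width ∧ g.src₂ < C.width ∧ g.dst < C.width

def BGate.apply {N : ℕ} (g : BGate) (x : Bits N) : Bits N :=
  setBit x g.dst (!(getBit x g.src₁ && getBit x g.src₂))

/-- The output of the circuit: the input is written on the first wires, the other wires start with
value `0`, and the output is read from the first `b` wires. -/
def BCircuit.eval (C : BCircuit) {a : ℕ} (b : ℕ) (u : Bits a) : Bits b :=
  readReg 0 b (C.gates.foldl (fun x g => g.apply x) (writeReg 0 u (zeros C.width)))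

/-! ### Descriptions of circuits and polynomial-time uniformity -/

/-- The alphabet in which descriptions of circuits are written. -/
inductive Sym : Type
  | tick | sep | x | h | t | cnot | ccx | reset | oracle | nand
  deriving DecidableEq

/-- A number in unary, followed by a separator. -/
def encodeNum (i : ℕ) : List Sym := List.replicate i Sym.tick ++ [Sym.sep]

def Gate.encode : Gate → List Sym
  | .x i => Sym.x :: encodeNum i
  | .h i => Sym.h :: encodeNum i
  | .t i => Sym.t :: encodeNum i
  | .cnot c i => Sym.cnot :: (encodeNum c ++ encodeNum i)
  | .ccx c d i => Sym.ccx :: (encodeNum c ++ encodeNum d ++ encodeNum i)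
  | .reset i => Sym.reset :: encodeNum i
  | .oracle q i j => Sym.oracle :: (encodeNum q ++ encodeNum i ++ encodeNum j)

def BGate.encode (g : BGate) : List Sym :=
  Sym.nand :: (encodeNum g.src₁ ++ encodeNum g.src₂ ++ encodeNum g.dst)

/-- The description of a quantum circuit with `a` input qubits and `b` output qubits. -/
def QCircuit.encode (a b : ℕ) (C : QCircuit) : List Sym :=
  encodeNum a ++ encodeNum b ++ encodeNum C.width ++ C.gates.flatMap Gate.encode

/-- The description of a Boolean circuit with `a` input bits and `b` output bits. -/
def BCircuit.encode (a b : ℕ) (C : BCircuit) : List Sym :=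
  encodeNum a ++ encodeNum b ++ encodeNum C.width ++ C.gates.flatMap BGate.encode

/-- Some polynomial-time Turing machine prints the description `d n` on input `1ⁿ`. -/
def PolyTimeUniform (d : ℕ → List Sym) : Prop :=
  Nonempty (Turing.TM2ComputableInPolyTime Computability.unaryEncodeNat (id : List Sym → List Sym) d)

/-- A quantum polynomial-time algorithm: a polynomial-time uniform family of quantum circuits, the
`n`-th one with `a n` input qubits, `b n` output qubits, and gates for oracles of the sizes
`sig n`. -/
structure QPT (sig : ℕ → List (ℕ × ℕ)) (a b : ℕ → ℕ) where
  circuit : ℕ → QCircuit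
  wf : ∀ n, (circuit n).WF (sig n) (a n) (b n)
  uniform : PolyTimeUniform fun n => (circuit n).encode (a n) (b n)

/-- The output of the `n`-th circuit of the algorithm. -/
def QPT.run {sig : ℕ → List (ℕ × ℕ)} {a b : ℕ → ℕ} (A : QPT sig a b) (n : ℕ) (O : List QOracle)
    (ρ : Op (a n)) : Op (b n) :=
  (A.circuit n).run O (b n) ρ

/-- The only state of the empty register. -/
def blank : Op 0 := 1

/-- The probability that a one-qubit state yields `1` when measured. -/
def prOne (σ : Op 1) : ℝ := (σ (fun _ => true) (fun _ => true)).re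

/-- A function `ℕ → ℝ` is negligible if it tends to zero faster than every inverse polynomial. -/
def Negligible (ε : ℕ → ℝ) : Prop :=
  Asymptotics.SuperpolynomialDecay Filter.atTop (fun n : ℕ => (n : ℝ)) ε

/-! ### Pseudorandom functions -/

/-- The family is computed by a polynomial-time uniform family of Boolean circuits. -/
def PTComputable {m l : ℕ → ℕ} (f : ∀ n, Bits n → Bits (m n) → Bits (l n)) : Prop :=
  ∃ C : ℕ → BCircuit,
    (∀ n, (C n).WF (n + m n) (l n)) ∧
    (PolyTimeUniform fun n => (C n).encode (n + m n) (l n)) ∧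
    ∀ n k x, (C n).eval (l n) (Fin.append k x) = f n k x

/-- The admissible map of a classical oracle for `g`: the query register is measured in the
computational basis, and the answer to a query `x` is `|g x⟩⟨g x|`. -/
def classicalMap {a b : ℕ} (g : Bits a → Bits b) : QMap a b where
  toFun ρ := ∑ x, ρ x x • ketbra (g x)
  map_add' ρ σ := by simp [add_smul, Finset.sum_add_distrib]
  map_smul' c ρ := by simp [Finset.smul_sum, smul_smul]

def classicalOracle {a b : ℕ} (g : Bits a → Bits b) : QOracle := ⟨a, b, classicalMap g⟩

/-- Quantum-secure pseudorandom functions, secure against quantum polynomial-time distinguishers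
with classical oracle access. -/
def IsQPRF {m l : ℕ → ℕ} (f : ∀ n, Bits n → Bits (m n) → Bits (l n)) : Prop :=
  PTComputable f ∧
  ∀ D : QPT (fun n => [(m n, l n)]) (fun _ => 0) (fun _ => 1),
    Negligible fun n =>
      |(∑ k : Bits n, prOne (D.run n [classicalOracle (f n k)] blank)) / Fintype.card (Bits n) -
        (∑ g : Bits (m n) → Bits (l n), prOne (D.run n [classicalOracle g] blank)) /
          Fintype.card (Bits (m n) → Bits (l n))|

/-! ### Symmetric-key encryption of quantum states -/

/-- The data of a symmetric-key scheme with `n`-bit keys, `m n`-qubit plaintexts and `c n`-qubit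
ciphertexts: the distribution of the keys, and the encryption and decryption maps for each key. -/
structure SKEData (m c : ℕ → ℕ) where
  keyGen : ∀ n, PMF (Bits n)
  enc : ∀ n, Bits n → QMap (m n) (c n)
  dec : ∀ n, Bits n → QMap (c n) (m n)

/-- The data form a quantum symmetric-key encryption scheme: key generation, encryption and
decryption are quantum polynomial-time algorithms (without oracles), and decryption after encryption
is the identity up to a negligible error in the diamond norm. -/
def SKEData.IsScheme {m c : ℕ → ℕ} (S : SKEData m c) : Prop :=
  (∃ K : QPT (fun _ => []) (fun _ => 0) (fun n => n), ∀ n,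
    K.run n [] blank = ∑ k : Bits n, ((S.keyGen n k).toReal : ℂ) • ketbra k) ∧
  (∃ E : QPT (fun _ => []) (fun n => n + m n) c, ∀ n k ρ,
    E.run n [] (tensor (ketbra k) ρ) = S.enc n k ρ) ∧
  (∃ D : QPT (fun _ => []) (fun n => n + c n) m, ∀ n k σ,
    D.run n [] (tensor (ketbra k) σ) = S.dec n k σ) ∧
  ∃ ε : ℕ → ℝ, Negligible ε ∧ ∀ n, ∀ k ∈ (S.keyGen n).support,
    diamondNorm (S.dec n k ∘ₗ S.enc n k - LinearMap.id) ≤ ENNReal.ofReal (ε n)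

/-- The encryption oracle with key `k`. -/
def SKEData.encOracle {m c : ℕ → ℕ} (S : SKEData m c) (n : ℕ) (k : Bits n) : QOracle :=
  ⟨m n, c n, S.enc n k⟩

/-- The decryption oracle with key `k`. -/
def SKEData.decOracle {m c : ℕ → ℕ} (S : SKEData m c) (n : ℕ) (k : Bits n) : QOracle :=
  ⟨c n, m n, S.dec n k⟩

/-- An adversary for indistinguishability under non-adaptive chosen ciphertext attacks: a message
generator with access to the encryption and decryption oracles, whose output consists of a plaintext
register and `e n` qubits of auxiliary information, and a distinguisher with access to the
encryption oracle, whose input consists of a ciphertext and the auxiliary information. -/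
structure CCA1Adversary (m c : ℕ → ℕ) where
  e : ℕ → ℕ
  generator : QPT (fun n => [(m n, c n), (c n, m n)]) (fun _ => 0) (fun n => m n + e n)
  distinguisher : QPT (fun n => [(m n, c n)]) (fun n => c n + e n) (fun _ => 1)

/-- The state of plaintext and auxiliary information produced by the message generator. -/
def CCA1Adversary.challenge {m c : ℕ → ℕ} (A : CCA1Adversary m c) (S : SKEData m c) (n : ℕ)
    (k : Bits n) : Op (m n + A.e n) :=
  A.generator.run n [S.encOracle n k, S.decOracle n k] blank

/-- The probability that the distinguisher outputs `1` when the plaintext register of the state `ρ`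
is encrypted. -/
def CCA1Adversary.prAccept {m c : ℕ → ℕ} (A : CCA1Adversary m c) (S : SKEData m c) (n : ℕ)
    (k : Bits n) (ρ : Op (m n + A.e n)) : ℝ :=
  prOne (A.distinguisher.run n [S.encOracle n k] (tensorId (S.enc n k) (A.e n) ρ))

/-- Indistinguishability of the encryption of the challenge from the encryption of the zero state,
under non-adaptive chosen ciphertext attacks. -/
def SKEData.INDCCA1 {m c : ℕ → ℕ} (S : SKEData m c) : Prop :=
  ∀ A : CCA1Adversary m c,
    Negligible fun n =>
      |(∑ k : Bits n, (S.keyGen n k).toReal * A.prAccept S n k (A.challenge S n k)) -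
        ∑ k : Bits n, (S.keyGen n k).toReal *
          A.prAccept S n k (tensor (ketbra (zeros (m n))) (traceFst (A.challenge S n k)))|

/-! ### The scheme -/

/-- The quantum one-time pad operator on `n` qubits with key `r`: on the `j`-th qubit (counted from
zero) it is `X ^ r (2 j) * Z ^ r (2 j + 1)`. -/
def pad {n : ℕ} (r : Bits (2 * n)) : Op n :=
  Matrix.of fun x y => ∏ j : Fin n,
    (pauliX ^ (r ⟨2 * j, by omega⟩).toNat * pauliZ ^ (r ⟨2 * j + 1, by omega⟩).toNat) (x j) (y j)

/-- Encryption with the function `φ`: `|r⟩⟨r| ⊗ P ρ P†` with `P = P_{φ(r)}` for uniformly random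
`r`. -/
def padEnc {n : ℕ} (φ : Bits (2 * n) → Bits (2 * n)) : QMap n (2 * n + n) where
  toFun ρ := (1 / Fintype.card (Bits (2 * n)) : ℂ) •
    ∑ r, tensor (ketbra r) (conjBy (pad (φ r)) ρ)
  map_add' ρ σ := by
    rw [← smul_add, ← Finset.sum_add_distrib]
    congr 1
    refine Finset.sum_congr rfl fun r _ => ?_
    ext x y
    simp [tensor, conjBy, Matrix.add_mul, mul_add]
  map_smul' z ρ := by
    ext x y
    simp [tensor, conjBy, Matrix.sum_apply, Finset.mul_sum, mul_left_comm]

/-- Decryption with the function `φ`: the first `2 * n` qubits are measured, and if the outcome is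
`r`, then the operator `P_{φ(r)}` is applied to the other `n` qubits. -/
def padDec {n : ℕ} (φ : Bits (2 * n) → Bits (2 * n)) : QMap (2 * n + n) n where
  toFun σ := ∑ r, conjBy (pad (φ r)) (Matrix.of fun x y => σ (Fin.append r x) (Fin.append r y))
  map_add' ρ σ := by
    rw [← Finset.sum_add_distrib]
    refine Finset.sum_congr rfl fun r _ => ?_
    simp only [conjBy]
    rw [← Matrix.add_mul, ← Matrix.mul_add]
    rfl
  map_smul' z ρ := by
    rw [RingHom.id_apply, Finset.smul_sum]
    refine Finset.sum_congr rfl fun r _ => ?_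
    simp only [conjBy]
    rw [← Matrix.smul_mul, ← Matrix.mul_smul]
    rfl

/-- The symmetric-key scheme of a function family `f`. -/
def prfScheme (f : ∀ n, Bits n → Bits (2 * n) → Bits (2 * n)) :
    SKEData (fun n => n) (fun n => 2 * n + n) where
  keyGen n := PMF.uniformOfFintype (Bits n)
  enc n k := padEnc (f n k)
  dec n k := padDec (f n k)

end

end QCrypt

/-! Decryption inverts encryption exactly. The square of a Pauli string is a scalar sign, and signs
cancel under conjugation, so `padDec_comp_padEnc` is an identity of maps and the error in the
diamond norm is zero.

Security is a hybrid argument. For a function `φ` let `gameValue` be the acceptance probability when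
encryption and decryption use `φ` and the plaintext register is kept (`b = true`) or zeroed (`b =
false`). For each `b` one circuit with the single classical oracle `φ` reproduces this probability
exactly (`prOne_gameCircuit`), and these circuits form a polynomial-time uniform family
(`uniform_gameCircuit`). The qPRF property, used once for each `b`, therefore replaces `f n k` by a
uniformly random function at negligible cost.

For random `φ` the two averages differ by at most the number of gates divided by `4 ^ n`
(`abs_avg_gameValue_sub_le`). Expand the challenge encryption over its random string `r`. Each
oracle is a sum of completely positive pieces, one for each value of the random or measured string;
make a hole by omitting the piece of `r` everywhere except in the challenge. Then `φ r` occurs in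
the challenge only, may be replaced by a fresh uniform pad key (`card_mul_sum_apply`), and the
quantum one-time pad erases the plaintext (`sum_tensorId_encPart`). With holes, both games have the
same average.

The cost of a hole is measured by the trace that it loses: the run with holes is dominated by the
full run (`runGates_dominates`), so acceptance drops by at most the drop of the trace. In the
generator, the losses for all `r` together are at most one unit of trace per gate, because the
pieces of an oracle sum to a trace-preserving map (`sum_loss_runGates_le`); this covers decryption
queries as well. The distinguisher knows `r`, but has only the encryption oracle, whose piece at `r`
carries the weight `4 ^ (-n)` on every state. The absence of decryption queries after the challenge
is essential at this point.

Two technical layers support this. Circuits are evaluated on matrix units `|x⟩⟨y|`; a classical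
circuit is described there by the bits it computes and the bits it discards (`runGates_classical`).
Uniformity is proved with actual stack machines: `PolyTimeUniform.translate` prints a new
description from two given ones, and all circuits are obtained from it. -/

namespace QCrypt

/-! ### Polynomial-time stack machines: embedding, composition, resource bounds -/

open Turing

/-! ### Runs of stack machines -/

/-- `b` is reached from `a` in exactly `t` steps of `f`. -/
def Steps {α : Type} (f : α → Option α) (t : ℕ) (a b : α) : Prop :=
  (flip bind f)^[t] (some a) = some b

theorem Steps.refl {α : Type} (f : α → Option α) (a : α) : Steps f 0 a a := rfl

theorem Steps.trans {α : Type} {f : α → Option α} {s t : ℕ} {a b c : α} (h : Steps f s a b)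
    (h' : Steps f t b c) : Steps f (s + t) a c := by
  unfold Steps at *
  rw [Nat.add_comm, Function.iterate_add_apply, h, h']

theorem Steps.head {α : Type} {f : α → Option α} {t : ℕ} {a b c : α} (h : f a = some b)
    (h' : Steps f t b c) : Steps f (t + 1) a c := by
  rw [Nat.add_comm]
  refine Steps.trans (b := b) ?_ h'
  simpa [Steps, flip] using h

theorem Steps.cases_head {α : Type} {f : α → Option α} {t : ℕ} {a c : α}
    (h : Steps f (t + 1) a c) : ∃ b, f a = some b ∧ Steps f t b c := by
  unfold Steps at h
  rw [Function.iterate_succ_apply] at h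
  cases hb : f a with
  | none =>
    have h0 : ∀ t, (flip bind f)^[t] (none : Option α) = none := fun t => by
      induction t with
      | zero => rfl
      | succ t ih => rw [Function.iterate_succ_apply]; exact ih
    have : flip bind f (some a) = none := by simpa [flip] using hb
    rw [this, h0] at h
    cases h
  | some b =>
    refine ⟨b, rfl, ?_⟩
    have : flip bind f (some a) = some b := by simpa [flip] using hb
    rwa [this] at h

section Embed

variable {K K' : Type} [DecidableEq K] [DecidableEq K'] {Γ : K → Type} {Γ' : K' → Type}
  {Λ Λ' σ σ' : Type}

/-- A statement as a statement of a machine with more stacks, labels and internal states; halting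
is replaced by a jump to `ex` if `ex` is a label. -/
def embed (ι : K → K') (e : ∀ k, Γ k ≃ Γ' (ι k)) (get : σ' → σ) (put : σ' → σ → σ')
    (f : Λ → Λ') (ex : Option Λ') : TM2.Stmt Γ Λ σ → TM2.Stmt Γ' Λ' σ'
  | .push k g q => .push (ι k) (fun v => e k (g (get v))) (embed ι e get put f ex q)
  | .peek k g q =>
      .peek (ι k) (fun v s => put v (g (get v) (s.map (e k).symm))) (embed ι e get put f ex q)
  | .pop k g q =>
      .pop (ι k) (fun v s => put v (g (get v) (s.map (e k).symm))) (embed ι e get put f ex q)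
  | .load a q => .load (fun v => put v (a (get v))) (embed ι e get put f ex q)
  | .branch p q₁ q₂ =>
      .branch (fun v => p (get v)) (embed ι e get put f ex q₁) (embed ι e get put f ex q₂)
  | .goto l => .goto fun v => f (l (get v))
  | .halt => match ex with
    | some l => .goto fun _ => l
    | none => .halt

/-- The label of the big machine that corresponds to a label of the embedded one. -/
def exitLabel (f : Λ → Λ') (ex : Option Λ') : Option Λ → Option Λ'
  | some l => some (f l)
  | none => ex

variable {ι : K → K'} (e : ∀ k, Γ k ≃ Γ' (ι k)) {get : σ' → σ} {put : σ' → σ → σ'}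
  (f : Λ → Λ') (ex : Option Λ')

/-- The configuration `c'` of the big machine corresponds to `c`; the other stacks are `T`. -/
structure Simulates (put : σ' → σ → σ') (T : ∀ k, List (Γ' k)) (w : σ')
    (c : TM2.Cfg Γ Λ σ) (c' : TM2.Cfg Γ' Λ' σ') : Prop where
  label : c'.l = exitLabel f ex c.l
  var : c'.var = put w c.var
  stk : ∀ k, c'.stk (ι k) = (c.stk k).map (e k)
  frame : ∀ k', (∀ k, ι k ≠ k') → c'.stk k' = T k'

variable {e f ex}

/-- An embedded statement touches the big machine only through `get`, `put` and the stacks `ι k`.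
The laws of `get` and `put` let it read back exactly what it stored, and injectivity of `ι` keeps
distinct stacks apart, so all other stacks and the rest of the internal state are a frame. -/
theorem simulates_stepAux (hι : Function.Injective ι) (hgp : ∀ w a, get (put w a) = a)
    (hpp : ∀ w a b, put (put w a) b = put w b) (T : ∀ k, List (Γ' k)) (w : σ')
    (s : TM2.Stmt Γ Λ σ) (v : σ) (S : ∀ k, List (Γ k)) (S' : ∀ k, List (Γ' k))
    (hS : ∀ k, S' (ι k) = (S k).map (e k)) (hT : ∀ k', (∀ k, ι k ≠ k') → S' k' = T k') :
    Simulates e f ex put T w (TM2.stepAux s v S)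
      (TM2.stepAux (embed ι e get put f ex s) (put w v) S') := by
  have upd : ∀ (S : ∀ k, List (Γ k)) (S' : ∀ k, List (Γ' k)) (k : K) (l : List (Γ k))
      (l' : List (Γ' (ι k))), (∀ k, S' (ι k) = (S k).map (e k)) → l' = l.map (e k) →
      ∀ j, Function.update S' (ι k) l' (ι j) = (Function.update S k l j).map (e j) := by
    intro S S' k l l' hS hl j
    by_cases h : j = k
    · subst h; simpa using hl
    · rw [Function.update_of_ne h, Function.update_of_ne (fun h' => h (hι h')), hS]
  have frm : ∀ (S' : ∀ k, List (Γ' k)) (k : K) (l' : List (Γ' (ι k))),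
      (∀ k', (∀ k, ι k ≠ k') → S' k' = T k') →
      ∀ k', (∀ k, ι k ≠ k') → Function.update S' (ι k) l' k' = T k' := by
    intro S' k l' hT k' hk'
    rw [Function.update_of_ne (fun h => hk' k h.symm), hT k' hk']
  induction s generalizing v S S' with
  | push k g q ih =>
    simp only [embed, TM2.stepAux, hgp]
    exact ih _ _ _ (upd _ _ _ _ _ hS (by simp [hS])) (frm _ _ _ hT)
  | peek k g q ih =>
    have h0 : Option.map (e k).symm (S' (ι k)).head? = (S k).head? := by
      rw [hS, List.head?_map]; cases (S k).head? <;> simp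
    simp only [embed, TM2.stepAux, hgp, hpp, h0]
    exact ih _ _ _ hS hT
  | pop k g q ih =>
    have h0 : Option.map (e k).symm (S' (ι k)).head? = (S k).head? := by
      rw [hS, List.head?_map]; cases (S k).head? <;> simp
    simp only [embed, TM2.stepAux, hgp, hpp, h0]
    exact ih _ _ _ (upd _ _ _ _ _ hS (by simp [hS])) (frm _ _ _ hT)
  | load a q ih =>
    simp only [embed, TM2.stepAux, hgp, hpp]
    exact ih _ _ _ hS hT
  | branch p q₁ q₂ ih₁ ih₂ =>
    simp only [embed, TM2.stepAux, hgp]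
    cases p v
    · exact ih₂ _ _ _ hS hT
    · exact ih₁ _ _ _ hS hT
  | goto l =>
    simp only [embed, TM2.stepAux, hgp]
    exact ⟨rfl, rfl, hS, hT⟩
  | halt =>
    cases ex <;> exact ⟨rfl, rfl, hS, hT⟩

/-- Each statement is translated to a single statement, so step counts are preserved exactly; a
halted configuration corresponds to the label `ex`. -/
theorem simulates_steps (hι : Function.Injective ι) (hgp : ∀ w a, get (put w a) = a)
    (hpp : ∀ w a b, put (put w a) b = put w b) {M : Λ → TM2.Stmt Γ Λ σ}
    {M' : Λ' → TM2.Stmt Γ' Λ' σ'} (hM : ∀ l, M' (f l) = embed ι e get put f ex (M l))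
    (T : ∀ k, List (Γ' k)) (w : σ') {t : ℕ} {c d : TM2.Cfg Γ Λ σ} {c' : TM2.Cfg Γ' Λ' σ'}
    (h : Steps (TM2.step M) t c d) (hc : Simulates e f ex put T w c c') :
    ∃ d', Simulates e f ex put T w d d' ∧ Steps (TM2.step M') t c' d' := by
  induction t generalizing c c' with
  | zero =>
    have : c = d := Option.some.inj h
    subst this
    exact ⟨c', hc, rfl⟩
  | succ t ih =>
    obtain ⟨b, hb, h⟩ := h.cases_head
    obtain ⟨l, v, S⟩ := c
    cases l with
    | none => simp at hb
    | some l =>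
      obtain ⟨l', v', S'⟩ := c'
      obtain ⟨h1, h2, h3, h4⟩ := hc
      simp only [exitLabel] at h1 h2 h3 h4
      subst h1 h2
      simp only [TM2.step, Option.some.injEq] at hb
      subst hb
      obtain ⟨d', hd, hs⟩ := ih h
        (simulates_stepAux (get := get) hι hgp hpp T w (M l) v S S' h3 h4)
      refine ⟨d', hd, hs.head ?_⟩
      simp [TM2.step, hM]

/-- A halting run of a machine, as part of the run of a machine in which it is embedded. -/
theorem steps_embed (hι : Function.Injective ι) (hgp : ∀ w a, get (put w a) = a)
    (hpp : ∀ w a b, put (put w a) b = put w b) {M : Λ → TM2.Stmt Γ Λ σ}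
    {M' : Λ' → TM2.Stmt Γ' Λ' σ'} (hM : ∀ l, M' (f l) = embed ι e get put f ex (M l))
    {t : ℕ} {l : Λ} {v v₁ : σ} {S S₁ : ∀ k, List (Γ k)}
    (h : Steps (TM2.step M) t ⟨some l, v, S⟩ ⟨none, v₁, S₁⟩) (w : σ')
    {S' S₁' : ∀ k, List (Γ' k)} (hS : ∀ k, S' (ι k) = (S k).map (e k))
    (hS₁ : ∀ k, S₁' (ι k) = (S₁ k).map (e k)) (hT : ∀ k', (∀ k, ι k ≠ k') → S₁' k' = S' k') :
    Steps (TM2.step M') t ⟨some (f l), put w v, S'⟩ ⟨ex, put w v₁, S₁'⟩ := by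
  obtain ⟨⟨l', v', R⟩, ⟨h1, h2, h3, h4⟩, hs⟩ := simulates_steps (T := S') (w := w)
    (c' := ⟨some (f l), put w v, S'⟩) hι hgp hpp hM h ⟨rfl, rfl, hS, fun _ _ => rfl⟩
  simp only [exitLabel] at h1 h2 h3 h4
  subst h1 h2
  have : R = S₁' := by
    funext k'
    by_cases hk : ∃ k, ι k = k'
    · obtain ⟨k, rfl⟩ := hk
      rw [h3, hS₁]
    · push Not at hk
      rw [h4 k' hk, hT k' hk]
  rwa [this] at hs

end Embed

/-! ### Lengths of stacks -/

section Length

variable {K : Type} [DecidableEq K] {Γ : K → Type} {Λ σ : Type}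

/-- The number of push operations in a statement. -/
def pushCount : TM2.Stmt Γ Λ σ → ℕ
  | .push _ _ q => pushCount q + 1
  | .peek _ _ q => pushCount q
  | .pop _ _ q => pushCount q
  | .load _ q => pushCount q
  | .branch _ q₁ q₂ => pushCount q₁ + pushCount q₂
  | .goto _ => 0
  | .halt => 0

/-- Counting the pushes of both arms of a branch is wasteful, but gives a bound that does not depend
on the state. -/
theorem length_stepAux_le (s : TM2.Stmt Γ Λ σ) (v : σ) (S : ∀ k, List (Γ k)) (k : K) :
    ((TM2.stepAux s v S).stk k).length ≤ (S k).length + pushCount s := by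
  induction s generalizing v S with
  | push j g q ih =>
    refine (ih _ _).trans ?_
    by_cases h : k = j
    · subst h; simp [pushCount]; omega
    · rw [Function.update_of_ne h]; simp [pushCount]
  | peek j g q ih => exact ih _ _
  | pop j g q ih =>
    refine (ih _ _).trans ?_
    by_cases h : k = j
    · subst h; simp [pushCount]
    · rw [Function.update_of_ne h]; simp [pushCount]
  | load a q ih => exact ih _ _
  | branch p q₁ q₂ ih₁ ih₂ =>
    simp only [TM2.stepAux, pushCount]
    cases p v
    · exact (ih₂ _ _).trans (by omega)
    · exact (ih₁ _ _).trans (by omega)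
  | goto l => simp [TM2.stepAux]
  | halt => simp [TM2.stepAux]

/-- Running time bounds the lengths of stacks. This eventually limits the sizes of circuits, and
with them the number of oracle queries. -/
theorem length_steps_le {M : Λ → TM2.Stmt Γ Λ σ} {B : ℕ} (hB : ∀ l, pushCount (M l) ≤ B)
    {t : ℕ} {c d : TM2.Cfg Γ Λ σ} (h : Steps (TM2.step M) t c d) (k : K) :
    (d.stk k).length ≤ (c.stk k).length + t * B := by
  induction t generalizing c with
  | zero =>
    have : c = d := Option.some.inj h
    subst this
    simp
  | succ t ih =>
    obtain ⟨b, hb, h⟩ := h.cases_head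
    obtain ⟨l, v, S⟩ := c
    cases l with
    | none => simp at hb
    | some l =>
      simp only [TM2.step, Option.some.injEq] at hb
      subst hb
      refine (ih h).trans ?_
      have := length_stepAux_le (M l) v S k
      have := hB l
      simp only
      rw [Nat.succ_mul]
      omega

end Length

/-! ### Polynomially bounded functions -/

/-- The function is bounded by a polynomial. -/
def PolyBdd (t : ℕ → ℕ) : Prop := ∃ p : Polynomial ℕ, ∀ n, t n ≤ p.eval n

theorem PolyBdd.mono {s t : ℕ → ℕ} (ht : PolyBdd t) (h : ∀ n, s n ≤ t n) : PolyBdd s :=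
  let ⟨p, hp⟩ := ht
  ⟨p, fun n => (h n).trans (hp n)⟩

theorem PolyBdd.const (c : ℕ) : PolyBdd fun _ => c := ⟨Polynomial.C c, by simp⟩

theorem PolyBdd.id : PolyBdd fun n => n := ⟨Polynomial.X, by simp⟩

theorem PolyBdd.add {s t : ℕ → ℕ} (hs : PolyBdd s) (ht : PolyBdd t) :
    PolyBdd fun n => s n + t n :=
  let ⟨p, hp⟩ := hs
  let ⟨q, hq⟩ := ht
  ⟨p + q, fun n => by simpa using Nat.add_le_add (hp n) (hq n)⟩

theorem PolyBdd.mul {s t : ℕ → ℕ} (hs : PolyBdd s) (ht : PolyBdd t) :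
    PolyBdd fun n => s n * t n :=
  let ⟨p, hp⟩ := hs
  let ⟨q, hq⟩ := ht
  ⟨p * q, fun n => by simpa using Nat.mul_le_mul (hp n) (hq n)⟩

/-- The coefficients are natural numbers, so bounds may be substituted into polynomials. -/
theorem polynomial_eval_mono (p : Polynomial ℕ) {a b : ℕ} (h : a ≤ b) : p.eval a ≤ p.eval b := by
  induction p using Polynomial.induction_on' with
  | add p q hp hq => simpa using Nat.add_le_add hp hq
  | monomial k c => simpa using Nat.mul_le_mul_left c (Nat.pow_le_pow_left h k)

theorem PolyBdd.eval {t : ℕ → ℕ} (ht : PolyBdd t) (p : Polynomial ℕ) :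
    PolyBdd fun n => p.eval (t n) :=
  let ⟨q, hq⟩ := ht
  ⟨p.comp q, fun n => by
    rw [Polynomial.eval_comp]
    exact polynomial_eval_mono p (hq n)⟩

theorem PolyBdd.comp {s t : ℕ → ℕ} (hs : PolyBdd s) (ht : PolyBdd t) :
    PolyBdd fun n => s (t n) :=
  let ⟨p, hp⟩ := hs
  (ht.eval p).mono fun n => hp (t n)

end QCrypt

namespace QCrypt

open Turing

/-! ### Program fragments on stacks of symbols -/

instance : Fintype Sym where
  elems := {.tick, .sep, .x, .h, .t, .cnot, .ccx, .reset, .oracle, .nand}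
  complete s := by cases s <;> decide

/-- A program on stacks of symbols, with one symbol of working memory. -/
structure Frag (K : Type) where
  Λ : Type
  fin : Fintype Λ
  main : Λ
  code : Λ → TM2.Stmt (fun _ : K => Sym) Λ (Option Sym)

namespace Frag

variable {K : Type} [DecidableEq K]

/-- The program takes the stacks `S` to the stacks `S'` in at most `t` steps. -/
def Runs (F : Frag K) (S : K → List Sym) (t : ℕ) (S' : K → List Sym) : Prop :=
  ∀ v, ∃ v' s, s ≤ t ∧ Steps (TM2.step F.code) s ⟨some F.main, v, S⟩ ⟨none, v', S'⟩

theorem Runs.mono {F : Frag K} {S S' : K → List Sym} {s t : ℕ} (h : F.Runs S s S') (hst : s ≤ t) :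
    F.Runs S t S' := fun v =>
  let ⟨v', r, hr, hs⟩ := h v
  ⟨v', r, hr.trans hst, hs⟩

/-- The code of a part of a bigger program. -/
def part {Λ Λ' : Type} (f : Λ → Λ') (ex : Option Λ') :
    TM2.Stmt (fun _ : K => Sym) Λ (Option Sym) → TM2.Stmt (fun _ : K => Sym) Λ' (Option Sym) :=
  embed id (fun _ => Equiv.refl Sym) id (fun _ v => v) f ex

/-- The special case of an embedding in which the part shares all stacks and the working symbol with
the whole program. -/
theorem steps_part {Λ Λ' : Type} {f : Λ → Λ'} {ex : Option Λ'}
    {M : Λ → TM2.Stmt (fun _ : K => Sym) Λ (Option Sym)}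
    {M' : Λ' → TM2.Stmt (fun _ : K => Sym) Λ' (Option Sym)} (hM : ∀ l, M' (f l) = part f ex (M l))
    {t : ℕ} {l : Λ} {v v₁ : Option Sym} {S S₁ : K → List Sym}
    (h : Steps (TM2.step M) t ⟨some l, v, S⟩ ⟨none, v₁, S₁⟩) :
    Steps (TM2.step M') t ⟨some (f l), v, S⟩ ⟨ex, v₁, S₁⟩ :=
  steps_embed (ι := id) (e := fun _ => Equiv.refl Sym) (get := id) (put := fun _ v => v)
    Function.injective_id (fun _ _ => rfl) (fun _ _ _ => rfl) hM h none (by simp) (by simp)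
    (fun k' h => absurd rfl (h k'))

/-- Push symbols. -/
def emit (l : List (K × Sym)) : Frag K where
  Λ := Unit
  fin := inferInstance
  main := ()
  code _ := l.foldr (fun p q => .push p.1 (fun _ => p.2) q) .halt

/-- The stacks after pushing symbols. -/
def pushAll (l : List (K × Sym)) (S : K → List Sym) : K → List Sym :=
  l.foldl (fun S p => Function.update S p.1 (p.2 :: S p.1)) S

/-- All pushes belong to one statement, hence to one step. -/
theorem runs_emit (l : List (K × Sym)) (S : K → List Sym) : (emit l).Runs S 1 (pushAll l S) := by
  intro v
  refine ⟨v, 1, le_rfl, Steps.head (b := ⟨none, v, pushAll l S⟩) ?_ (Steps.refl _ _)⟩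
  simp only [TM2.step, emit, Option.some.injEq, pushAll]
  induction l generalizing S with
  | nil => rfl
  | cons p l ih => simp only [List.foldr_cons, TM2.stepAux, List.foldl_cons, ih]

/-- One program after the other. -/
def seq (F G : Frag K) : Frag K where
  Λ := F.Λ ⊕ G.Λ
  fin := by
    haveI := F.fin
    haveI := G.fin
    infer_instance
  main := .inl F.main
  code
    | .inl l => part .inl (some (.inr G.main)) (F.code l)
    | .inr l => part .inr none (G.code l)

theorem Runs.seq {F G : Frag K} {S S' S'' : K → List Sym} {s t : ℕ} (hF : F.Runs S s S')
    (hG : G.Runs S' t S'') : (F.seq G).Runs S (s + t) S'' := by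
  intro v
  obtain ⟨v', r, hr, hs⟩ := hF v
  obtain ⟨v'', r', hr', hs'⟩ := hG v'
  refine ⟨v'', r + r', Nat.add_le_add hr hr', Steps.trans (b := ⟨some (.inr G.main), v', S'⟩)
    (steps_part (M' := (F.seq G).code) (f := .inl) (fun _ => rfl) hs)
    (steps_part (M' := (F.seq G).code) (f := .inr) (fun _ => rfl) hs')⟩

/-- Pop a symbol from the stack `k`, run the program that belongs to this symbol (or to the empty
stack), and start again or halt, depending on the symbol. -/
def popLoop (k : K) (M : Option Sym → Frag K) (c : Option Sym → Bool) : Frag K where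
  Λ := Option (Σ s, (M s).Λ)
  fin := by
    haveI := fun s => (M s).fin
    infer_instance
  main := none
  code
    | none => .pop k (fun _ s => s) (.goto fun s => some ⟨s, (M s).main⟩)
    | some ⟨s, l⟩ => part (fun l => some ⟨s, l⟩) (if c s then some none else none) ((M s).code l)

theorem Runs.popLoop_exit {k : K} {M : Option Sym → Frag K} {c : Option Sym → Bool}
    {S S' : K → List Sym} {t : ℕ} (hc : c (S k).head? = false)
    (h : (M (S k).head?).Runs (Function.update S k (S k).tail) t S') :
    (popLoop k M c).Runs S (t + 1) S' := by
  intro v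
  obtain ⟨v', r, hr, hs⟩ := h (S k).head?
  refine ⟨v', r + 1, Nat.add_le_add_right hr 1, Steps.head
    (b := ⟨some (some ⟨(S k).head?, (M (S k).head?).main⟩), (S k).head?,
      Function.update S k (S k).tail⟩) rfl ?_⟩
  have := steps_part (M' := (popLoop k M c).code) (f := fun l => some ⟨(S k).head?, l⟩)
    (fun _ => rfl) hs
  rwa [hc] at this

theorem Runs.popLoop_cont {k : K} {M : Option Sym → Frag K} {c : Option Sym → Bool}
    {S S' S'' : K → List Sym} {t t' : ℕ} (hc : c (S k).head? = true)
    (h : (M (S k).head?).Runs (Function.update S k (S k).tail) t S')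
    (h' : (popLoop k M c).Runs S' t' S'') :
    (popLoop k M c).Runs S (t + 1 + t') S'' := by
  intro v
  obtain ⟨v', r, hr, hs⟩ := h (S k).head?
  obtain ⟨v'', r', hr', hs'⟩ := h' v'
  refine ⟨v'', r + 1 + r', by omega, Steps.trans (b := ⟨some none, v', S'⟩) (Steps.head
    (b := ⟨some (some ⟨(S k).head?, (M (S k).head?).main⟩), (S k).head?,
      Function.update S k (S k).tail⟩) rfl ?_) hs'⟩
  have := steps_part (M' := (popLoop k M c).code) (f := fun l => some ⟨(S k).head?, l⟩)
    (fun _ => rfl) hs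
  rwa [hc] at this

end Frag

/-! ### Stacks prepared in polynomial time -/

section Prep

variable {K : Type} [DecidableEq K] [Fintype K]

/-- The contents of two families of stacks. -/
def sumStacks {K X : Type} {Γ : K → Type} {Γ' : X → Type} (S : ∀ k, List (Γ k))
    (T : ∀ x, List (Γ' x)) : ∀ y, List (Sum.elim Γ Γ' y)
  | .inl k => S k
  | .inr x => T x

theorem update_sumStacks_inl {K X : Type} [DecidableEq K] [DecidableEq X] {Γ : K → Type}
    {Γ' : X → Type} (S : ∀ k, List (Γ k)) (T : ∀ x, List (Γ' x)) (k : K) (l : List (Γ k)) :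
    Function.update (sumStacks S T) (.inl k) l = sumStacks (Function.update S k l) T := by
  funext z
  rcases z with z | z
  · by_cases h : z = k
    · subst h
      exact (Function.update_self (β := fun z => List (Sum.elim Γ Γ' z)) _ _ _).trans
        (Function.update_self (β := fun z => List (Γ z)) _ _ _).symm
    · exact (Function.update_of_ne (β := fun z => List (Sum.elim Γ Γ' z))
        (fun h' => h (Sum.inl_injective h')) _ _).trans
        (Function.update_of_ne (β := fun z => List (Γ z)) h _ _).symm
  · rfl

theorem update_sumStacks_inr {K X : Type} [DecidableEq K] [DecidableEq X] {Γ : K → Type}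
    {Γ' : X → Type} (S : ∀ k, List (Γ k)) (T : ∀ x, List (Γ' x)) (x : X) (l : List (Γ' x)) :
    Function.update (sumStacks S T) (.inr x) l = sumStacks S (Function.update T x l) := by
  funext z
  rcases z with z | z
  · rfl
  · by_cases h : z = x
    · subst h
      exact (Function.update_self (β := fun z => List (Sum.elim Γ Γ' z)) _ _ _).trans
        (Function.update_self (β := fun z => List (Γ' z)) _ _ _).symm
    · exact (Function.update_of_ne (β := fun z => List (Sum.elim Γ Γ' z))
        (fun h' => h (Sum.inr_injective h')) _ _).trans
        (Function.update_of_ne (β := fun z => List (Γ' z)) h _ _).symm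

section Move

variable {K Λ σ : Type} [DecidableEq K] {Γ : K → Type} {M : Λ → TM2.Stmt Γ Λ σ} {k j : K}
  {f : σ → Option (Γ k) → σ} {p : σ → Bool} {g : σ → Γ j} {l : Λ} {l' : σ → Λ}
  {q : TM2.Stmt Γ Λ σ} {v : σ} {S : ∀ k, List (Γ k)}

/-- One step of a loop that moves the symbols of the stack `k` to the stack `j`. -/
theorem step_move_cons (hM : M l = .pop k f (.branch p (.push j g (.goto l')) q)) (hk : j ≠ k)
    {a : Γ k} {r : List (Γ k)} (hS : S k = a :: r) {w : σ} (hw : f v (some a) = w)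
    (hp : p w = true) :
    TM2.step M ⟨some l, v, S⟩ = some ⟨some (l' w), w,
      Function.update (Function.update S k r) j (g w :: S j)⟩ := by
  simp [TM2.step, hM, TM2.stepAux, hS, hw, hp, Function.update_of_ne hk]

theorem step_move_nil (hM : M l = .pop k f (.branch p (.push j g (.goto l')) q)) (hS : S k = [])
    {w : σ} (hw : f v none = w) (hp : p w = false) :
    TM2.step M ⟨some l, v, S⟩ = some (TM2.stepAux q w S) := by
  have : Function.update S k [] = S := by rw [← hS, Function.update_eq_self]
  simp [TM2.step, hM, TM2.stepAux, hS, hw, hp, this]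

end Move

/-- Some machine, with the stacks `K` and some auxiliary stacks, runs in polynomial time and, on the
input `1ⁿ` on an auxiliary stack, leaves `S n` on the stacks `K`. -/
def Prep (S : ℕ → K → List Sym) : Prop :=
  ∃ (X : Type) (_ : DecidableEq X) (_ : Fintype X) (Γ : X → Type) (x₀ : X) (e : Γ x₀ ≃ Bool)
    (Λ : Type) (_ : Fintype Λ) (σ : Type) (_ : Fintype σ) (v₀ : σ) (main : Λ)
    (M : Λ → TM2.Stmt (Sum.elim (fun _ : K => Sym) Γ) Λ σ) (p : Polynomial ℕ),
    ∀ n, ∃ t ≤ p.eval n, Steps (TM2.step M) t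
      ⟨some main, v₀, sumStacks (fun _ => [])
        (Function.update (fun _ => []) x₀ (List.replicate n (e.symm true)))⟩
      ⟨none, v₀, sumStacks (S n) fun _ => []⟩

/-- The input as a stack of ticks. -/
theorem Prep.input (k : K) :
    Prep fun n => Function.update (fun _ => []) k (List.replicate n Sym.tick) := by
  let M : Unit → TM2.Stmt (Sum.elim (fun _ : K => Sym) fun _ : Unit => Bool) Unit Bool :=
    fun _ => .pop (.inr ()) (fun _ s => s.isSome) (.branch id
      (.push (.inl k) (fun _ => Sym.tick) (.goto fun _ => ())) (.load (fun _ => false) .halt))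
  have key : ∀ n v (l : List Sym), Steps (TM2.step M) (n + 1)
      ⟨some (), v, sumStacks (Function.update (fun _ => []) k l) fun _ => List.replicate n true⟩
      ⟨none, false, sumStacks
        (Function.update (fun _ => []) k (List.replicate n Sym.tick ++ l)) fun _ => []⟩ := by
    intro n
    induction n with
    | zero =>
      intro v l
      refine Steps.head ?_ (Steps.refl _ _)
      refine congrArg (fun T => some (⟨none, false, T⟩ : TM2.Cfg _ _ _)) ?_
      funext y
      rcases y with y | y <;> simp [sumStacks, Function.update]
    | succ n ih =>
      intro v l
      refine Steps.head ?_ ((show List.replicate (n + 1) Sym.tick ++ l =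
        List.replicate n Sym.tick ++ Sym.tick :: l by
          rw [List.replicate_succ']; simp) ▸ ih true (Sym.tick :: l))
      refine congrArg (fun T => some (⟨some (), true, T⟩ : TM2.Cfg _ _ _)) ?_
      funext y
      rcases y with y | y
      · by_cases h : y = k
        · subst h; simp [sumStacks, Function.update]
        · simp [sumStacks, Function.update, h]
      · simp [sumStacks, Function.update]
  refine ⟨Unit, inferInstance, inferInstance, fun _ => Bool, (), Equiv.refl _, Unit, inferInstance,
    Bool, inferInstance, false, (), M, Polynomial.X + 1, fun n => ⟨n + 1, by simp, ?_⟩⟩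
  have := key n false []
  rw [Function.update_eq_self, List.append_nil] at this
  convert this using 3
  funext y
  simp

/-- A program that runs in polynomial time on prepared stacks. -/
theorem Prep.run {S S' : ℕ → K → List Sym} (h : Prep S) (F : Frag K) {t : ℕ → ℕ}
    (ht : PolyBdd t) (hF : ∀ n, F.Runs (S n) (t n) (S' n)) : Prep S' := by
  obtain ⟨X, iX, iX', Γ, x₀, e, Λ, iΛ, σ, iσ, v₀, main, M, p, hM⟩ := h
  obtain ⟨q, hq⟩ := ht
  have := F.fin
  let i₁ : TM2.Stmt (Sum.elim (fun _ : K => Sym) Γ) Λ σ →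
      TM2.Stmt (Sum.elim (fun _ : K => Sym) Γ) (Λ ⊕ F.Λ ⊕ Unit) (σ × Option Sym) :=
    embed id (fun _ => Equiv.refl _) Prod.fst (fun w v => (v, w.2)) .inl
      (some (.inr (.inl F.main)))
  let i₂ : TM2.Stmt (fun _ : K => Sym) F.Λ (Option Sym) →
      TM2.Stmt (Sum.elim (fun _ : K => Sym) Γ) (Λ ⊕ F.Λ ⊕ Unit) (σ × Option Sym) :=
    embed .inl (fun _ => Equiv.refl _) Prod.snd (fun w v => (w.1, v)) (fun l => .inr (.inl l))
      (some (.inr (.inr ())))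
  -- The extra last label clears the working symbol of `F`, because the machine has to end in its
  -- initial internal state.
  let M' : Λ ⊕ F.Λ ⊕ Unit →
      TM2.Stmt (Sum.elim (fun _ : K => Sym) Γ) (Λ ⊕ F.Λ ⊕ Unit) (σ × Option Sym) :=
    Sum.elim (fun l => i₁ (M l)) (Sum.elim (fun l => i₂ (F.code l))
      fun _ => .load (fun v => (v.1, none)) .halt)
  refine ⟨X, iX, iX', Γ, x₀, e, Λ ⊕ F.Λ ⊕ Unit, inferInstance, σ × Option Sym,
    inferInstance, (v₀, none), .inl main, M', p + q + 1, fun n => ?_⟩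
  obtain ⟨t₁, ht₁, h₁⟩ := hM n
  obtain ⟨v', t₂, ht₂, h₂⟩ := hF n none
  refine ⟨t₁ + (t₂ + 1), ?_, ?_⟩
  · have := hq n
    simp only [Polynomial.eval_add, Polynomial.eval_one]
    omega
  refine Steps.trans (b := ⟨some (.inr (.inl F.main)), (v₀, none), sumStacks (S n) fun _ => []⟩)
    ?_ (Steps.trans (b := ⟨some (.inr (.inr ())), (v₀, v'), sumStacks (S' n) fun _ => []⟩) ?_ ?_)
  · exact steps_embed (M' := M') (ι := id) (e := fun _ => Equiv.refl _) (get := Prod.fst)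
      (put := fun w v => (v, w.2)) Function.injective_id (fun _ _ => rfl) (fun _ _ _ => rfl)
      (fun _ => rfl) h₁ (v₀, none) (by simp) (by simp) (fun k' h => absurd rfl (h k'))
  · refine steps_embed (M' := M') (ι := Sum.inl) (Γ' := Sum.elim (fun _ : K => Sym) Γ)
      (e := fun _ => Equiv.refl _)
      (f := fun l => .inr (.inl l)) (ex := some (.inr (.inr ())))
      (get := Prod.snd) (put := fun w v => (w.1, v)) Sum.inl_injective (fun _ _ => rfl)
      (fun _ _ _ => rfl) (fun _ => rfl) h₂ (v₀, none)
      (S' := sumStacks (S n) fun _ => []) (S₁' := sumStacks (S' n) fun _ => [])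
      (fun k => (List.map_id (S n k)).symm) (fun k => (List.map_id (S' n k)).symm)
      (fun k' h => ?_)
    rcases k' with k' | k'
    · exact absurd rfl (h k')
    · rfl
  · exact Steps.head rfl (Steps.refl _ _)

theorem unaryEncodeNat_eq (n : ℕ) : Computability.unaryEncodeNat n = List.replicate n true := by
  induction n with
  | zero => rfl
  | succ n ih => rw [Computability.unaryEncodeNat, ih, List.replicate_succ]

theorem stk_initList (tm : FinTM2) (s : List (tm.Γ tm.k₀)) :
    (initList tm s).stk = Function.update (fun _ => []) tm.k₀ s := by
  funext x
  by_cases hx : x = tm.k₀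
  · subst hx; simp [initList]
  · simp [hx, initList]

theorem stk_haltList (tm : FinTM2) (s : List (tm.Γ tm.k₁)) :
    (haltList tm s).stk = Function.update (fun _ => []) tm.k₁ s := by
  funext x
  by_cases hx : x = tm.k₁
  · subst hx; simp [haltList]
  · simp [hx, haltList]

/-- The run of a machine that prints `d n`. -/
theorem PolyTimeUniform.exists_machine {d : ℕ → List Sym} (h : PolyTimeUniform d) :
    ∃ (X : Type) (_ : DecidableEq X) (_ : Fintype X) (Γ : X → Type) (x₀ x₁ : X)
      (e : Γ x₀ ≃ Bool) (e' : Γ x₁ ≃ Sym)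
      (Λ : Type) (_ : Fintype Λ) (σ : Type) (_ : Fintype σ) (v₀ : σ) (main : Λ)
      (M : Λ → TM2.Stmt Γ Λ σ) (p : Polynomial ℕ),
      ∀ n, ∃ t ≤ p.eval n, Steps (TM2.step M) t
        ⟨some main, v₀, Function.update (fun _ => []) x₀ (List.replicate n (e.symm true))⟩
        ⟨none, v₀, Function.update (fun _ => []) x₁ ((d n).map e'.symm)⟩ := by
  obtain ⟨⟨⟨⟨k₀, k₁, Γ, Λ, main, σ, v₀, m⟩, e, e'⟩, p, hM⟩⟩ := h
  refine ⟨_, inferInstance, inferInstance, Γ, k₀, k₁, e, e', Λ, inferInstance, σ, inferInstance,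
    v₀, main, m, p, fun n => ?_⟩
  obtain ⟨⟨t, h⟩, ht⟩ := hM n
  refine ⟨t, by simpa [unaryEncodeNat_eq] using ht, ?_⟩
  have h' : Steps (TM2.step m) t ⟨some main, v₀, (initList ⟨k₀, k₁, Γ, Λ, main, σ, v₀, m⟩
      ((Computability.unaryEncodeNat n).map e.symm)).stk⟩
      ⟨none, v₀, (haltList ⟨k₀, k₁, Γ, Λ, main, σ, v₀, m⟩ ((d n).map e'.symm)).stk⟩ := h
  convert h' using 2
  · rw [stk_initList, unaryEncodeNat_eq, List.map_replicate]
  · rw [stk_haltList]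

theorem exists_pushCount_le {K Λ σ : Type} {Γ : K → Type} [Fintype Λ]
    (M : Λ → TM2.Stmt Γ Λ σ) : ∃ B, ∀ l, pushCount (M l) ≤ B :=
  ⟨∑ l, pushCount (M l), fun l =>
    Finset.single_le_sum (f := fun l => pushCount (M l)) (fun _ _ => Nat.zero_le _)
      (Finset.mem_univ l)⟩

/-- A finite program pushes boundedly many symbols per step, so a polynomial running time forces an
output of polynomial length. -/
theorem PolyTimeUniform.length {d : ℕ → List Sym} (h : PolyTimeUniform d) :
    PolyBdd fun n => (d n).length := by
  obtain ⟨X, _, _, Γ, x₀, x₁, e, e', Λ, _, σ, _, v₀, main, M, p, hM⟩ := h.exists_machine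
  obtain ⟨B, hB⟩ := exists_pushCount_le M
  -- The summand `n` accounts for a machine whose output stack is also its input stack.
  refine PolyBdd.mono (t := fun n => n + p.eval n * B)
    (PolyBdd.id.add ((PolyBdd.id.eval p).mul (PolyBdd.const B))) fun n => ?_
  obtain ⟨t, ht, h⟩ := hM n
  have h := length_steps_le hB h x₁
  simp only [Function.update_self, List.length_map] at h
  refine h.trans (Nat.add_le_add ?_ (Nat.mul_le_mul_right B ht))
  by_cases hx : x₁ = x₀
  · subst hx; simp
  · simp [Function.update_of_ne hx]

/-- A call of a machine that prints `d n`. -/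
theorem Prep.call {S : ℕ → K → List Sym} (h : Prep S) {d : ℕ → List Sym} (hd : PolyTimeUniform d)
    {k k' : K} (hkk : k' ≠ k) (hk : ∀ n, S n k = List.replicate n Sym.tick)
    (hk' : ∀ n, S n k' = []) :
    Prep fun n => Function.update (Function.update (S n) k []) k' (d n).reverse := by
  -- Moving the printed description off the stack of the called machine takes time proportional to
  -- its length, which therefore needs a bound as well.
  obtain ⟨r, hr⟩ := hd.length
  obtain ⟨X, iX, iX', Γ, x₀, e, Λ, iΛ, σ, iσ, v₀, main, M, p, hM⟩ := h
  obtain ⟨Y, iY, iY', Δ, y₀, y₁, a, a', Ω, iΩ, τ, iτ, w₀, main', N, q, hN⟩ := hd.exists_machine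
  let W := Sum.elim (fun _ : K => Sym) (Sum.elim Γ Δ)
  let i₁ : TM2.Stmt (Sum.elim (fun _ : K => Sym) Γ) Λ σ →
      TM2.Stmt W ((Λ ⊕ Ω) ⊕ Bool) (σ × τ × Option Sym) :=
    embed (Sum.map id .inl) (fun y => match y with
      | .inl _ => Equiv.refl _
      | .inr _ => Equiv.refl _)
      Prod.fst (fun w v => (v, w.2)) (fun l => .inl (.inl l)) (some (.inr false))
  let i₂ : TM2.Stmt Δ Ω τ → TM2.Stmt W ((Λ ⊕ Ω) ⊕ Bool) (σ × τ × Option Sym) :=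
    embed (fun y => .inr (.inr y)) (fun _ => Equiv.refl _) (fun w => w.2.1)
      (fun w v => (w.1, v, w.2.2)) (fun l => .inl (.inr l)) (some (.inr true))
  -- The label `inr false` turns the ticks on `k` into the input of the called machine; the label
  -- `inr true` drains its output to `k'`.
  let M' : (Λ ⊕ Ω) ⊕ Bool → TM2.Stmt W ((Λ ⊕ Ω) ⊕ Bool) (σ × τ × Option Sym) :=
    Sum.elim (Sum.elim (fun l => i₁ (M l)) (fun l => i₂ (N l))) fun b => bif b then
      .pop (.inr (.inr y₁)) (fun v s => (v.1, v.2.1, Option.map a' s))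
        (.branch (fun v => v.2.2.isSome)
          (.push (.inl k') (fun v => v.2.2.getD Sym.tick) (.goto fun _ => .inr true)) .halt)
      else .pop (.inl k) (fun v s => (v.1, v.2.1, s)) (.branch (fun v => v.2.2.isSome)
        (.push (.inr (.inr y₀)) (fun _ => a.symm true) (.goto fun _ => .inr false))
        (.goto fun _ => .inl (.inr main')))
  let st (A : K → List Sym) (B : ∀ y, List (Δ y)) : ∀ z, List (W z) :=
    sumStacks A (sumStacks (fun _ => []) B)
  have hst₁ : ∀ j A B l, Function.update (st A B) (.inl j) l = st (Function.update A j l) B :=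
    fun j A B l => update_sumStacks_inl A _ j l
  have hst₂ : ∀ A B y l, Function.update (st A B) (.inr (.inr y)) l =
      st A (Function.update B y l) := fun A B y l =>
    (update_sumStacks_inr (Γ' := Sum.elim Γ Δ) A _ (Sum.inr y) l).trans
      (congrArg (sumStacks A) (update_sumStacks_inr (Γ := Γ) _ B y l))
  have hst₃ : ∀ A B j r y l, Function.update (Function.update (st A B) (.inl j) r)
      (.inr (.inr y)) l = st (Function.update A j r) (Function.update B y l) :=
    fun A B j r y l => (congrArg (fun F => Function.update F (.inr (.inr y)) l)
      (hst₁ j A B r)).trans (hst₂ _ B y l)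
  have hst₄ : ∀ A B j r y l, Function.update (Function.update (st A B) (.inr (.inr y)) l)
      (.inl j) r = st (Function.update A j r) (Function.update B y l) :=
    fun A B j r y l => (congrArg (fun F => Function.update F (.inl j) r)
      (hst₂ A B y l)).trans (hst₁ j A _ r)
  have move₁ : ∀ m A l s, A k = List.replicate m Sym.tick → Steps (TM2.step M') (m + 1)
      ⟨some (.inr false), (v₀, w₀, s), st A (Function.update (fun _ => []) y₀ l)⟩
      ⟨some (.inl (.inr main')), (v₀, w₀, none), st (Function.update A k [])
        (Function.update (fun _ => []) y₀ (List.replicate m (a.symm true) ++ l))⟩ := by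
    intro m
    induction m with
    | zero =>
      intro A l s hA
      refine Steps.head (step_move_nil (l := (Sum.inr false : (Λ ⊕ Ω) ⊕ Bool))
        (k := Sum.inl k) (j := Sum.inr (Sum.inr y₀)) rfl (w := (v₀, w₀, none)) hA rfl rfl) ?_
      have : Function.update A k [] = A := by
        rw [show ([] : List Sym) = A k from hA.symm, Function.update_eq_self]
      rw [this]
      exact Steps.refl _ _
    | succ m ih =>
      intro A l s hA
      have := ih (Function.update A k (List.replicate m Sym.tick)) (a.symm true :: l)
        (some Sym.tick) (by simp)
      rw [Function.update_idem] at this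
      refine Steps.head ((step_move_cons (l := (Sum.inr false : (Λ ⊕ Ω) ⊕ Bool))
        (k := Sum.inl k) (j := Sum.inr (Sum.inr y₀)) rfl Sum.inr_ne_inl
        (w := (v₀, w₀, some Sym.tick)) (hA.trans List.replicate_succ) rfl rfl).trans
        (congrArg (fun T => some (⟨some (Sum.inr false), (v₀, w₀, some Sym.tick), T⟩ :
          TM2.Cfg W ((Λ ⊕ Ω) ⊕ Bool) _)) ((hst₃ _ _ _ _ _ _).trans
          (congrArg (st _) (a₂ := Function.update (fun _ => []) y₀ (a.symm true :: l)) ?_)))) ?_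
      · refine (Function.update_idem (β := fun y => List (Δ y)) (a := y₀) _ _ _).trans ?_
        refine congrArg (fun r => Function.update (fun _ => []) y₀ (a.symm true :: r)) ?_
        exact Function.update_self (β := fun y => List (Δ y)) y₀ l (fun _ => [])
      · rw [show List.replicate (m + 1) (a.symm true) ++ l =
          List.replicate m (a.symm true) ++ a.symm true :: l by
            rw [List.replicate_succ']; simp]
        exact this
  -- Popping one stack onto another reverses the order; hence the reversed description in the
  -- statement.
  have move₂ : ∀ (l : List Sym) A s, Steps (TM2.step M') (l.length + 1)
      ⟨some (.inr true), (v₀, w₀, s), st A (Function.update (fun _ => []) y₁ (l.map a'.symm))⟩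
      ⟨none, (v₀, w₀, none), st (Function.update A k' (l.reverse ++ A k')) fun _ => []⟩ := by
    intro l
    induction l with
    | nil =>
      intro A s
      refine Steps.head (step_move_nil (l := (Sum.inr true : (Λ ⊕ Ω) ⊕ Bool))
        (k := Sum.inr (Sum.inr y₁)) (j := Sum.inl k') rfl (w := (v₀, w₀, none))
        (show Function.update (fun y => ([] : List (Δ y))) y₁ [] y₁ = [] by simp) rfl rfl) ?_
      have : Function.update (fun y => ([] : List (Δ y))) y₁ [] = fun _ => [] :=
        Function.update_eq_self y₁ fun y => ([] : List (Δ y))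
      rw [List.map_nil, this]
      simp only [List.reverse_nil, List.nil_append, Function.update_eq_self]
      exact Steps.refl _ _
    | cons c l ih =>
      intro A s
      have := ih (Function.update A k' (c :: A k')) (some c)
      rw [Function.update_idem] at this
      refine Steps.head ((step_move_cons (l := (Sum.inr true : (Λ ⊕ Ω) ⊕ Bool))
        (k := Sum.inr (Sum.inr y₁)) (j := Sum.inl k') rfl Sum.inl_ne_inr
        (w := (v₀, w₀, some c)) (a := a'.symm c) (r := l.map a'.symm)
        (Function.update_self (β := fun y => List (Δ y)) y₁ (a'.symm c :: l.map a'.symm)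
          fun _ => [])
        (congrArg (fun s => (v₀, w₀, s)) (congrArg some (a'.apply_symm_apply c))) rfl).trans
        (congrArg (fun T => some (⟨some (Sum.inr true), (v₀, w₀, some c), T⟩ :
          TM2.Cfg W ((Λ ⊕ Ω) ⊕ Bool) _)) ((hst₄ _ _ _ _ _ _).trans
          (congrArg (st _) (a₂ := Function.update (fun _ => []) y₁ (l.map a'.symm)) ?_)))) ?_
      · exact Function.update_idem (β := fun y => List (Δ y)) (a := y₁) _ _ _
      · rw [show (c :: l).reverse ++ A k' =
          l.reverse ++ Function.update A k' (c :: A k') k' by simp]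
        exact this
  refine ⟨X ⊕ Y, inferInstance, inferInstance, Sum.elim Γ Δ, .inl x₀, e, (Λ ⊕ Ω) ⊕ Bool,
    inferInstance, σ × τ × Option Sym, inferInstance, (v₀, w₀, none), .inl (.inl main), M',
    p + (Polynomial.X + 1) + q + (r + 1), fun n => ?_⟩
  obtain ⟨t₁, ht₁, h₁⟩ := hM n
  obtain ⟨t₂, ht₂, h₂⟩ := hN n
  refine ⟨t₁ + ((n + 1) + (t₂ + ((d n).length + 1))), ?_, ?_⟩
  · have : (d n).length ≤ r.eval n := hr n
    simp only [Polynomial.eval_add, Polynomial.eval_one, Polynomial.eval_X]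
    omega
  have e₁ := move₁ n (S n) [] none (hk n)
  have e₂ := move₂ (d n) (Function.update (S n) k []) none
  rw [Function.update_of_ne hkk, hk', List.append_nil] at e₂
  rw [List.append_nil] at e₁
  have g₁ : Steps (TM2.step M') t₁ ⟨some (Sum.inl (Sum.inl main)), (v₀, w₀, none),
      sumStacks (fun _ => []) (sumStacks (Function.update (fun _ => []) x₀
        (List.replicate n (e.symm true))) fun _ => [])⟩
      ⟨some (Sum.inr false), (v₀, w₀, none), st (S n) (Function.update (fun _ => []) y₀ [])⟩ := by
    rw [show Function.update (fun y => ([] : List (Δ y))) y₀ [] = fun _ => [] from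
      Function.update_eq_self y₀ fun y => ([] : List (Δ y))]
    refine steps_embed (M' := M') (ι := Sum.map id Sum.inl) (Γ' := W)
      (e := fun y => match y with
        | .inl _ => Equiv.refl _
        | .inr _ => Equiv.refl _) (f := fun l => .inl (.inl l)) (ex := some (.inr false))
      (get := Prod.fst)
      (put := fun w v => (v, w.2)) (Sum.map_injective.2 ⟨Function.injective_id, Sum.inl_injective⟩)
      (fun _ _ => rfl) (fun _ _ _ => rfl) (fun _ => rfl) h₁ (v₀, w₀, none) ?_ ?_ ?_
    · rintro (z | z) <;> exact (List.map_id _).symm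
    · rintro (z | z) <;> exact (List.map_id _).symm
    · rintro (z | z | z) hz
      · exact absurd rfl (hz (.inl z))
      · exact absurd rfl (hz (.inr z))
      · rfl
  have g₂ : Steps (TM2.step M') t₂ ⟨some (Sum.inl (Sum.inr main')), (v₀, w₀, none),
      st (Function.update (S n) k []) (Function.update (fun _ => []) y₀
        (List.replicate n (a.symm true)))⟩
      ⟨some (Sum.inr true), (v₀, w₀, none), st (Function.update (S n) k [])
        (Function.update (fun _ => []) y₁ ((d n).map a'.symm))⟩ := by
    refine steps_embed (M' := M') (ι := fun y => Sum.inr (Sum.inr y)) (Γ' := W)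
      (e := fun _ => Equiv.refl _) (f := fun l => .inl (.inr l)) (ex := some (.inr true))
      (get := fun w => w.2.1)
      (put := fun w v => (w.1, v, w.2.2)) (fun _ _ h => Sum.inr_injective (Sum.inr_injective h))
      (fun _ _ => rfl) (fun _ _ _ => rfl) (fun _ => rfl) h₂ (v₀, w₀, none)
      (S₁' := st _ (Function.update (fun _ => []) y₁ ((d n).map a'.symm))) ?_ ?_ ?_
    · exact fun z => (List.map_id _).symm
    · exact fun z => (List.map_id _).symm
    · rintro (z | z | z) hz
      · rfl
      · rfl
      · exact absurd rfl (hz z)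
  have g₃ : st (Function.update (Function.update (S n) k []) k' (d n).reverse) (fun _ => []) =
      sumStacks (Function.update (Function.update (S n) k []) k' (d n).reverse) fun _ => [] := by
    funext z
    rcases z with z | z | z <;> rfl
  have g₄ : (fun y => ([] : List (Sum.elim Γ Δ y))) = sumStacks (fun _ => []) fun _ => [] := by
    funext z
    rcases z with z | z <;> rfl
  rw [g₃] at e₂
  have g₅ : Function.update (fun y => ([] : List (Sum.elim Γ Δ y))) (.inl x₀)
      (List.replicate n (e.symm true)) = sumStacks (Function.update (fun _ => []) x₀
        (List.replicate n (e.symm true))) fun _ => [] := by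
    rw [g₄]
    exact update_sumStacks_inl _ _ _ _
  rw [← g₅] at g₁
  exact g₁.trans (e₁.trans (g₂.trans e₂))

/-- A prepared stack can be printed. -/
theorem Prep.polyTimeUniform {d : ℕ → List Sym} {k : K}
    (h : Prep fun n => Function.update (fun _ => []) k (d n)) : PolyTimeUniform d := by
  obtain ⟨X, iX, iX', Γ, x₀, e, Λ, iΛ, σ, iσ, v₀, main, M, p, hM⟩ := h
  have iΓ : Fintype (Γ x₀) := Fintype.ofEquiv _ e.symm
  let tm : FinTM2 := @FinTM2.mk (K ⊕ X) inferInstance inferInstance (.inr x₀) (.inl k)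
    (Sum.elim (fun _ : K => Sym) Γ) Λ main iΛ σ v₀ iσ iΓ M
  refine ⟨⟨⟨tm, e, Equiv.refl _⟩, p, fun n => ?_⟩⟩
  choose t ht hs using hM
  refine ⟨⟨t n, ?_⟩, by simpa [unaryEncodeNat_eq] using ht n⟩
  have h₀ : (fun y => ([] : List (Sum.elim (fun _ : K => Sym) Γ y))) =
      sumStacks (fun _ => []) (fun _ => []) := by
    funext z
    rcases z with z | z <;> rfl
  have h₁ : (initList tm ((Computability.unaryEncodeNat n).map e.symm)).stk =
      sumStacks (fun _ => [])
        (Function.update (fun _ => []) x₀ (List.replicate n (e.symm true))) := by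
    rw [stk_initList, ← update_sumStacks_inr, ← h₀, unaryEncodeNat_eq]
    erw [List.map_replicate]
    rfl
  have h₂ : (haltList tm (List.map (Equiv.refl Sym).symm (d n))).stk =
      sumStacks (Function.update (fun _ => []) k (d n)) (fun _ => []) := by
    rw [stk_haltList, ← update_sumStacks_inl, ← h₀]
    erw [List.map_id]
  have := hs n
  rw [← h₁, ← h₂] at this
  exact this

end Prep

end QCrypt

/-! ### A small language of programs that print and read descriptions -/

namespace QCrypt

/-! ### Programs that print circuits -/

/-- The stacks of the printing programs: the output (in reverse), two working stacks, numbers in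
unary (the first of them is the loop counter), and descriptions of circuits to be read. -/
inductive Reg : Type
  | out | tmp | rem | num (i : Fin 10) | src (b : Bool)
  deriving DecidableEq, Fintype

/-- The contents of the contents of a printing program. -/
structure Store where
  out : List Sym
  tmp : List Sym
  rem : ℕ
  num : Fin 10 → ℕ
  src : Bool → List Sym

namespace Store

def contents (s : Store) : Reg → List Sym
  | .out => s.out
  | .tmp => s.tmp
  | .rem => List.replicate s.rem Sym.tick
  | .num i => List.replicate (s.num i) Sym.tick
  | .src b => s.src b

/-- The total size of all contents but the output. -/
def size (s : Store) : ℕ :=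
  s.tmp.length + s.rem + ∑ i, s.num i + ∑ b, (s.src b).length

/-- The working stacks are empty. -/
structure Clean (s : Store) : Prop where
  tmp : s.tmp = []
  rem : s.rem = 0
  num : s.num 0 = 0

theorem num_le_size (s : Store) (i : Fin 10) : s.num i ≤ s.size := by
  have := Finset.single_le_sum (f := s.num) (fun _ _ => Nat.zero_le _) (Finset.mem_univ i)
  unfold size
  omega

theorem length_src_le_size (s : Store) (b : Bool) : (s.src b).length ≤ s.size := by
  have := Finset.single_le_sum (f := fun b => (s.src b).length) (fun _ _ => Nat.zero_le _)
    (Finset.mem_univ b)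
  unfold size

  omega

@[ext]
theorem ext' {s t : Store} (h₁ : s.out = t.out) (h₂ : s.tmp = t.tmp) (h₃ : s.rem = t.rem)
    (h₄ : s.num = t.num) (h₅ : s.src = t.src) : s = t := by
  cases s; cases t; simp_all

theorem update_out (s : Store) (l : List Sym) :
    Function.update s.contents .out l = { s with out := l }.contents := by
  funext k; cases k <;> simp [contents]

theorem update_tmp (s : Store) (l : List Sym) :
    Function.update s.contents .tmp l = { s with tmp := l }.contents := by
  funext k; cases k <;> simp [contents]

theorem update_rem (s : Store) (m : ℕ) :
    Function.update s.contents .rem (List.replicate m Sym.tick) = { s with rem := m }.contents := by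
  funext k; cases k <;> simp [contents]

theorem update_num (s : Store) (i : Fin 10) (m : ℕ) :
    Function.update s.contents (.num i) (List.replicate m Sym.tick) =
      { s with num := Function.update s.num i m }.contents := by
  funext k
  cases k with
  | num j => by_cases h : j = i
             · subst h; simp [contents]
             · simp [contents, h]
  | _ => simp [contents]

theorem update_src (s : Store) (b : Bool) (l : List Sym) :
    Function.update s.contents (.src b) l = { s with src := Function.update s.src b l }.contents := by
  funext k
  cases k with
  | src c => by_cases h : c = b
             · subst h; simp [contents]
             · simp [contents, h]
  | _ => simp [contents]

end Store

namespace Frag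

/-- Do nothing. -/
def skip : Frag Reg := emit []

theorem runs_skip (s : Reg → List Sym) : skip.Runs s 1 s := runs_emit [] s

/-- Run `F` for each symbol of the stack `k`. -/
def forTicks (k : Reg) (F : Frag Reg) : Frag Reg :=
  popLoop k (fun s => bif s.isSome then F else skip) Option.isSome

/-- The family `A` is the loop invariant: `A l` are the stacks after `l` rounds. The loop consumes
its own counter, so `F` starts from `A l` with one tick already removed. Besides the rounds there is
one last pop of the empty stack, followed by `skip`. -/
theorem runs_forTicks {k : Reg} {F : Frag Reg} {t : ℕ} (m : ℕ) (A : ℕ → Reg → List Sym)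
    (hA : ∀ l ≤ m, A l k = List.replicate (m - l) Sym.tick)
    (hF : ∀ l < m, F.Runs (Function.update (A l) k (List.replicate (m - (l + 1)) Sym.tick)) t
      (A (l + 1))) :
    (forTicks k F).Runs (A 0) (m * (t + 1) + 2) (A m) := by
  induction m generalizing A with
  | zero =>
    have h0 : A 0 k = [] := hA 0 le_rfl
    have h1 : Function.update (A 0) k (A 0 k).tail = A 0 := by
      rw [h0, List.tail_nil, ← h0, Function.update_eq_self]
    refine (Runs.popLoop_exit (S' := A 0) (t := 1) (by simp [h0]) ?_).mono (by omega)
    rw [h1, h0]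
    exact runs_skip _
  | succ m ih =>
    have h0 : A 0 k = Sym.tick :: List.replicate m Sym.tick := hA 0 (Nat.zero_le _)
    have h1 := hF 0 (Nat.succ_pos m)
    have h2 := ih (fun l => A (l + 1)) (fun l hl => by rw [hA (l + 1) (by omega)]; congr 1; omega)
      (fun l hl => by have := hF (l + 1) (by omega); rwa [show m + 1 - (l + 1 + 1) =
        m - (l + 1) by omega] at this)
    refine (Runs.popLoop_cont (S' := A 1) (t := t) (by simp [h0]) ?_ h2).mono ?_
    · rw [h0]; exact h1
    · rw [Nat.succ_mul]; omega

/-- Add a copy of the number `i` to the stack `k`. -/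
def copyNum (i : Fin 10) (k : Reg) : Frag Reg :=
  (forTicks (.num i) (emit [(.tmp, Sym.tick), (k, Sym.tick)])).seq
    (forTicks .tmp (emit [(.num i, Sym.tick)]))

/-- Reading a stack destroys it, so a copy is made on `tmp` at the same time and moved back
afterwards. The snapshots `B l` after `l` ticks leave `out` and `rem` open, so that one proof serves
both targets. -/
theorem runs_copyNum_aux (i : Fin 10) (k : Reg) (s : Store) (hs : s.tmp = [])
    (B : ℕ → Store) (hB : ∀ l, B l = { s with
      tmp := List.replicate l Sym.tick
      num := Function.update s.num i (s.num i - l)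
      out := (B l).out
      rem := (B l).rem })
    (h0 : (B 0).out = s.out) (h0' : (B 0).rem = s.rem)
    (hk : ∀ l, pushAll [(.tmp, Sym.tick), (k, Sym.tick)] { B l with
        num := Function.update s.num i (s.num i - (l + 1)) }.contents = (B (l + 1)).contents) :
    (copyNum i k).Runs s.contents (4 * s.num i + 4)
      { s with out := (B (s.num i)).out, rem := (B (s.num i)).rem }.contents := by
  have e0 : (B 0).contents = s.contents := by
    congr 1
    rw [hB 0]
    ext1 <;> simp [hs, h0, h0']
  have r1 := runs_forTicks (k := .num i) (F := emit [(.tmp, Sym.tick), (k, Sym.tick)]) (t := 1)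
    (s.num i) (fun l => (B l).contents) (fun l _ => by rw [hB l]; simp [Store.contents])
    (fun l _ => by
      rw [Store.update_num, ← hk l, hB l]
      simp only [Function.update_idem]
      exact runs_emit _ _)
  let m := s.num i
  have r2 := runs_forTicks (k := .tmp) (F := emit [(.num i, Sym.tick)]) (t := 1)
    m (fun l => { s with
      tmp := List.replicate (m - l) Sym.tick
      num := Function.update s.num i l
      out := (B m).out
      rem := (B m).rem }.contents) (fun l _ => rfl)
    (fun l _ => by
      have := runs_emit [(.num i, Sym.tick)] { s with
        tmp := List.replicate (m - (l + 1)) Sym.tick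
        num := Function.update s.num i l
        out := (B m).out
        rem := (B m).rem }.contents
      simp only [pushAll, List.foldl_cons, List.foldl_nil] at this
      rw [show Sym.tick :: Store.contents _ (.num i) = List.replicate (l + 1) Sym.tick by
        simp [Store.contents, List.replicate_succ], Store.update_num] at this
      simp only [Function.update_idem] at this
      rw [Store.update_tmp]
      exact this)
  rw [e0] at r1
  refine (r1.seq (S'' := { s with out := (B m).out, rem := (B m).rem }.contents) ?_).mono
    (t := 4 * s.num i + 4) (s := s.num i * (1 + 1) + 2 + (m * (1 + 1) + 2))
    (by simp only [m]; omega)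
  have e1 : (B m).contents = { s with
      tmp := List.replicate (m - 0) Sym.tick
      num := Function.update s.num i 0
      out := (B m).out
      rem := (B m).rem }.contents := by
    congr 1
    conv_lhs => rw [hB m]
    simp [m]
  have e2 : { s with out := (B m).out, rem := (B m).rem }.contents = { s with
      tmp := List.replicate (m - m) Sym.tick
      num := Function.update s.num i m
      out := (B m).out
      rem := (B m).rem }.contents := by
    simp [m, hs]
  rw [e2]
  exact e1 ▸ r2

theorem runs_copyNum_out (i : Fin 10) (s : Store) (hs : s.tmp = []) :
    (copyNum i .out).Runs s.contents (4 * s.num i + 4)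
      { s with out := List.replicate (s.num i) Sym.tick ++ s.out }.contents := by
  refine runs_copyNum_aux i .out s hs (fun l => { s with
      tmp := List.replicate l Sym.tick
      num := Function.update s.num i (s.num i - l)
      out := List.replicate l Sym.tick ++ s.out }) (fun l => rfl) rfl rfl (fun l => ?_)
  simp only [pushAll, List.foldl_cons, List.foldl_nil, Store.update_tmp, Store.update_out]
  simp only [Store.contents, List.replicate_succ, List.cons_append]

theorem runs_copyNum_rem (i : Fin 10) (s : Store) (hs : s.tmp = []) :
    (copyNum i .rem).Runs s.contents (4 * s.num i + 4)
      { s with rem := s.rem + s.num i }.contents := by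
  refine runs_copyNum_aux i .rem s hs (fun l => { s with
      tmp := List.replicate l Sym.tick
      num := Function.update s.num i (s.num i - l)
      rem := s.rem + l }) (fun l => rfl) rfl rfl (fun l => ?_)
  simp only [pushAll, List.foldl_cons, List.foldl_nil, Store.update_tmp]
  rw [show Sym.tick :: Store.contents _ .rem = List.replicate (s.rem + (l + 1)) Sym.tick by
    simp [Store.contents, List.replicate_succ, ← Nat.add_assoc], Store.update_rem]
  simp only [Store.contents, List.replicate_succ]

/-- Set the number `i` to zero. -/
def clearNum (i : Fin 10) : Frag Reg := forTicks (.num i) skip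

theorem runs_clearNum (i : Fin 10) (s : Store) :
    (clearNum i).Runs s.contents (2 * s.num i + 2)
      { s with num := Function.update s.num i 0 }.contents := by
  have := runs_forTicks (k := .num i) (F := skip) (t := 1) (s.num i)
    (fun l => { s with num := Function.update s.num i (s.num i - l) }.contents)
    (fun l _ => by simp [Store.contents]) (fun l _ => by
      rw [Store.update_num]
      simp only [Function.update_idem]
      exact runs_skip _)
  simp only [Nat.sub_zero, Nat.sub_self, Function.update_eq_self] at this
  exact this.mono (by omega)

end Frag

/-! ### Printing with loops -/

/-- A piece of output: a symbol, or a number in unary. -/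
inductive Item : Type
  | sym (c : Sym)
  | num (i : Fin 10)

def Item.print (v : Fin 10 → ℕ) : Item → List Sym
  | .sym c => [c]
  | .num i => List.replicate (v i) Sym.tick

def Item.frag : Item → Frag Reg
  | .sym c => .emit [(.out, c)]
  | .num i => .copyNum i .out

/-- The text printed by a list of items. -/
def printItems (v : Fin 10 → ℕ) (l : List Item) : List Sym := l.flatMap (Item.print v)

def itemsFrag : List Item → Frag Reg
  | [] => .skip
  | a :: l => a.frag.seq (itemsFrag l)

/-- Append text to the output. -/
def Store.write (s : Store) (l : List Sym) : Store := { s with out := l.reverse ++ s.out }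

theorem Store.write_write (s : Store) (l l' : List Sym) :
    (s.write l).write l' = s.write (l ++ l') := by
  simp [Store.write]

theorem Item.runs_frag (a : Item) (s : Store) (hs : s.tmp = []) {M : ℕ} (hM : ∀ i, s.num i ≤ M) :
    a.frag.Runs s.contents (4 * M + 4) (s.write (a.print s.num)).contents := by
  cases a with
  | sym c =>
    have := Frag.runs_emit [(.out, c)] s.contents
    simp only [Frag.pushAll, List.foldl_cons, List.foldl_nil, Store.update_out] at this
    exact this.mono (by omega)
  | num i =>
    have := Frag.runs_copyNum_out i s hs
    rw [Store.write, Item.print, List.reverse_replicate]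
    exact this.mono (by have := hM i; omega)

theorem runs_itemsFrag (l : List Item) (s : Store) (hs : s.tmp = []) {M : ℕ}
    (hM : ∀ i, s.num i ≤ M) :
    (itemsFrag l).Runs s.contents (l.length * (4 * M + 4) + 1)
      (s.write (printItems s.num l)).contents := by
  induction l generalizing s with
  | nil => exact (Frag.runs_skip _).mono (by omega)
  | cons a l ih =>
    have h := (a.runs_frag s hs hM).seq (ih (s.write (a.print s.num)) hs hM)
    rw [Store.write_write] at h
    refine h.mono ?_
    simp only [List.length_cons, Nat.succ_mul]
    omega

/-- A printing command: an item, or a loop. The bound of the loop is the sum of some numbers; the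
counter is the number with index zero. -/
inductive PrintCmd : Type
  | item (a : Item)
  | loop (bound : List (Fin 10)) (body : List Item)

/-- The sum of some numbers. -/
def sumNum (v : Fin 10 → ℕ) (l : List (Fin 10)) : ℕ := (l.map v).sum

def PrintCmd.print (v : Fin 10 → ℕ) : PrintCmd → List Sym
  | .item a => a.print v
  | .loop bound body =>
      (List.range (sumNum v bound)).flatMap fun l => printItems (Function.update v 0 l) body

/-- Add the sum of some numbers to the stack `rem`. -/
def boundFrag : List (Fin 10) → Frag Reg
  | [] => .skip
  | i :: l => (Frag.copyNum i .rem).seq (boundFrag l)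

def PrintCmd.frag : PrintCmd → Frag Reg
  | .item a => a.frag
  | .loop bound body => (boundFrag bound).seq ((Frag.forTicks .rem
      ((itemsFrag body).seq (.emit [(.num 0, Sym.tick)]))).seq (.clearNum 0))

theorem runs_boundFrag (l : List (Fin 10)) (s : Store) (hs : s.tmp = []) {M : ℕ}
    (hM : ∀ i, s.num i ≤ M) :
    (boundFrag l).Runs s.contents (l.length * (4 * M + 4) + 1)
      { s with rem := s.rem + sumNum s.num l }.contents := by
  induction l generalizing s with
  | nil => exact (Frag.runs_skip _).mono (by omega)
  | cons a l ih =>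
    have h := (Frag.runs_copyNum_rem a s hs).seq (ih { s with rem := s.rem + s.num a } hs hM)
    simp only [Nat.add_assoc] at h
    refine h.mono ?_
    have := hM a
    simp only [List.length_cons, Nat.succ_mul]
    omega

theorem sumNum_le {v : Fin 10 → ℕ} {M : ℕ} (hM : ∀ i, v i ≤ M) (l : List (Fin 10)) :
    sumNum v l ≤ l.length * M := by
  induction l with
  | nil => simp [sumNum]
  | cons a l ih =>
    have := hM a
    simp only [sumNum, List.map_cons, List.sum_cons, List.length_cons, Nat.succ_mul] at *
    omega

/-- The program works in polynomial time. -/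
def Frag.Does (F : Frag Reg) (P : Store → Prop) (f : Store → Store) : Prop :=
  ∃ t, PolyBdd t ∧ ∀ M s, P s → s.size ≤ M → F.Runs s.contents (t M) (f s).contents

/-- The time bounds are functions of the size, so the second one applies only if the first program
does not enlarge the store. The output is not part of the size, and printing thus never enlarges it.
-/
theorem Frag.Does.seq {F G : Frag Reg} {P Q : Store → Prop} {f g : Store → Store} (hF : F.Does P f)
    (hG : G.Does Q g) (hPQ : ∀ s, P s → Q (f s)) (hs : ∀ s, P s → (f s).size ≤ s.size) :
    (F.seq G).Does P fun s => g (f s) :=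
  let ⟨t, ht, h⟩ := hF
  let ⟨t', ht', h'⟩ := hG
  ⟨fun n => t n + t' n, ht.add ht', fun M s hP hM =>
    (h M s hP hM).seq (h' M (f s) (hPQ s hP) ((hs s hP).trans hM))⟩

/-- A loop accumulates its bound in `rem`, consumes it tick by tick, and counts the rounds in the
number with index zero, which a clean store has at zero and which is cleared at the end. -/
theorem PrintCmd.does_frag (c : PrintCmd) :
    c.frag.Does Store.Clean fun s => s.write (c.print s.num) := by
  cases c with
  | item a =>
    exact ⟨fun M => 4 * M + 4, ((PolyBdd.const 4).mul PolyBdd.id).add (PolyBdd.const 4),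
      fun M s hs hM => a.runs_frag s hs.tmp fun i => (s.num_le_size i).trans hM⟩
  | loop bound body =>
    -- `T M` bounds every given number as well as the sum of the `bound.length` numbers that limit
    -- the counter. The body has to be timed with `T M`, since the counter may exceed `M`.
    let T : ℕ → ℕ := fun M => (bound.length + 1) * M
    have hT : PolyBdd T := (PolyBdd.const _).mul PolyBdd.id
    let U : ℕ → ℕ := fun M => body.length * (4 * T M + 4) + 1
    have hU : PolyBdd U := ((PolyBdd.const _).mul
      (((PolyBdd.const 4).mul hT).add (PolyBdd.const 4))).add (PolyBdd.const 1)
    refine ⟨fun M => (bound.length * (4 * M + 4) + 1) +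
      ((T M * (U M + 1 + 1) + 2) + (2 * T M + 2)),
      (((PolyBdd.const _).mul (((PolyBdd.const 4).mul PolyBdd.id).add (PolyBdd.const 4))).add
        (PolyBdd.const 1)).add
        (((hT.mul ((hU.add (PolyBdd.const 1)).add (PolyBdd.const 1))).add (PolyBdd.const 2)).add
        (((PolyBdd.const 2).mul hT).add (PolyBdd.const 2))), fun M s hs hM => ?_⟩
    have hM' : ∀ i, s.num i ≤ M := fun i => (s.num_le_size i).trans hM
    let m := sumNum s.num bound
    have hm : m ≤ T M := (sumNum_le hM' bound).trans (Nat.mul_le_mul_right M (by omega))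
    have hMT : M ≤ T M := Nat.le_mul_of_pos_left M (by omega)
    let w : ℕ → List Sym := fun l => (List.range l).flatMap fun l =>
      printItems (Function.update s.num 0 l) body
    have r1 := runs_boundFrag bound s hs.tmp hM'
    rw [hs.rem, Nat.zero_add] at r1
    have r2 := Frag.runs_forTicks (k := .rem)
      (F := (itemsFrag body).seq (.emit [(.num 0, Sym.tick)])) (t := U M + 1) m
      (fun l => ({ s with
        rem := m - l
        num := Function.update s.num 0 l }.write (w l)).contents) (fun l _ => rfl) (fun l hl => by
          rw [Store.update_rem]
          let s' : Store := { s with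
            rem := m - (l + 1)
            num := Function.update s.num 0 l }.write (w l)
          have h1 := runs_itemsFrag body s' hs.tmp (M := T M) (fun i => by
            by_cases hi : i = 0
            · subst hi; simp only [s', Store.write, Function.update_self]; omega
            · simp only [s', Store.write, Function.update_of_ne hi]; exact (hM' i).trans hMT)
          have h2 := Frag.runs_emit [(.num 0, Sym.tick)]
            (s'.write (printItems s'.num body)).contents
          simp only [Frag.pushAll, List.foldl_cons, List.foldl_nil] at h2
          rw [show Sym.tick :: Store.contents _ (.num 0) = List.replicate (l + 1) Sym.tick by
            simp [Store.contents, s', Store.write, List.replicate_succ], Store.update_num] at h2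
          have h3 := h1.seq h2
          have e : ({ s'.write (printItems s'.num body) with
              num := Function.update (s'.write (printItems s'.num body)).num 0 (l + 1) } :
              Store) = ({ s with
                rem := m - (l + 1)
                num := Function.update s.num 0 (l + 1) } : Store).write (w (l + 1)) := by
            refine Store.ext' ?_ rfl rfl ?_ rfl
            · simp [s', Store.write, w, List.range_succ]
            · simp [s', Store.write]
          rw [e] at h3
          exact h3)
    have r3 := Frag.runs_clearNum 0 ({ s with
        rem := m - m
        num := Function.update s.num 0 m }.write (w m))
    have e0 : { s with rem := m }.contents = ({ s with
        rem := m - 0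
        num := Function.update s.num 0 0 }.write (w 0)).contents := by
      have : Function.update s.num 0 0 = s.num := by rw [← hs.num, Function.update_eq_self]
      simp [Store.write, w, this]
    have r12 := r1.seq (e0 ▸ (r2.seq r3))
    have e1 : ({ ({ s with
        rem := m - m
        num := Function.update s.num 0 m } : Store).write (w m) with
        num := Function.update (({ s with
        rem := m - m
        num := Function.update s.num 0 m } : Store).write (w m)).num 0 0 } : Store) =
        s.write (PrintCmd.print s.num (.loop bound body)) := by
      have : Function.update s.num 0 0 = s.num := by rw [← hs.num, Function.update_eq_self]
      ext1
      · simp [Store.write, w, PrintCmd.print, m]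
      · rfl
      · simp [Store.write, hs.rem]
      · simp [Store.write, this]
      · rfl
    rw [e1] at r12
    refine r12.mono (Nat.add_le_add_left (Nat.add_le_add (Nat.add_le_add_right
      (Nat.mul_le_mul_right _ hm) _) ?_) _)
    simp only [Store.write, Function.update_self]
    omega

/-- The program that belongs to a list of printing commands. -/
def printFrag : List PrintCmd → Frag Reg
  | [] => .skip
  | c :: l => c.frag.seq (printFrag l)

def printAll (v : Fin 10 → ℕ) (l : List PrintCmd) : List Sym := l.flatMap (PrintCmd.print v)

theorem Store.Clean.write {s : Store} (hs : s.Clean) (l : List Sym) : (s.write l).Clean :=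
  ⟨hs.tmp, hs.rem, hs.num⟩

theorem does_printFrag (l : List PrintCmd) :
    (printFrag l).Does Store.Clean fun s => s.write (printAll s.num l) := by
  induction l with
  | nil => exact ⟨fun _ => 1, PolyBdd.const 1, fun _ s _ _ => Frag.runs_skip _⟩
  | cons c l ih =>
    have := c.does_frag.seq ih (fun s hs => hs.write _) (fun s _ => le_rfl)
    simp only [Store.write_write] at this
    exact this

end QCrypt

namespace QCrypt

/-! ### Reading descriptions of circuits -/

namespace Frag

/-- Read a number from the description `b` and add it to the number `i`. -/
def readNum (b : Bool) (i : Fin 10) : Frag Reg :=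
  popLoop (.src b) (fun s => if s = some Sym.tick then emit [(.num i, Sym.tick)] else skip)
    fun s => s = some Sym.tick

theorem runs_readNum (b : Bool) (i : Fin 10) (a : ℕ) (rest : List Sym) (s : Store)
    (h : s.src b = encodeNum a ++ rest) :
    (readNum b i).Runs s.contents (2 * a + 2)
      { s with
        num := Function.update s.num i (s.num i + a)
        src := Function.update s.src b rest }.contents := by
  induction a generalizing s with
  | zero =>
    have h0 : s.contents (.src b) = Sym.sep :: rest := h
    refine Runs.popLoop_exit (t := 1) (by simp [h0]) ?_
    have : Function.update s.num i (s.num i + 0) = s.num := by simp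
    rw [h0, this, List.tail_cons, Store.update_src]
    exact runs_skip _
  | succ a ih =>
    have h0 : s.contents (.src b) = Sym.tick :: (encodeNum a ++ rest) := by
      change s.src b = _
      rw [h, encodeNum, encodeNum, List.replicate_succ, List.cons_append, List.cons_append]
    have h1 := ih { s with
      num := Function.update s.num i (s.num i + 1)
      src := Function.update s.src b (encodeNum a ++ rest) } (by simp)
    simp only [Function.update_idem, Function.update_self] at h1
    rw [show s.num i + 1 + a = s.num i + (a + 1) by omega] at h1
    refine (Runs.popLoop_cont (t := 1) (by simp [h0]) ?_ h1).mono (by omega)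
    rw [h0, List.tail_cons, Store.update_src]
    have h2 := runs_emit [(.num i, Sym.tick)]
      { s with src := Function.update s.src b (encodeNum a ++ rest) }.contents
    simp only [Frag.pushAll, List.foldl_cons, List.foldl_nil] at h2
    rw [show Sym.tick :: Store.contents _ (.num i) = List.replicate (s.num i + 1) Sym.tick by
      simp [Store.contents, List.replicate_succ], Store.update_num] at h2
    simpa using h2

/-- Read numbers. -/
def readNums (b : Bool) : List (Fin 10) → Frag Reg
  | [] => skip
  | i :: l => (readNum b i).seq (readNums b l)

/-- Add numbers. -/
def addNums (v : Fin 10 → ℕ) (l : List (Fin 10)) (a : List ℕ) : Fin 10 → ℕ :=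
  (l.zip a).foldl (fun v p => Function.update v p.1 (v p.1 + p.2)) v

theorem runs_readNums (b : Bool) (l : List (Fin 10)) (a : List ℕ) (hl : l.length = a.length)
    (rest : List Sym) (s : Store) (h : s.src b = a.flatMap encodeNum ++ rest) {M : ℕ}
    (hM : ∀ c ∈ a, c ≤ M) :
    (readNums b l).Runs s.contents (a.length * (2 * M + 2) + 1)
      { s with
        num := addNums s.num l a
        src := Function.update s.src b rest }.contents := by
  induction l generalizing a s with
  | nil =>
    cases a with
    | nil =>
      have : Function.update s.src b rest = s.src := by
        rw [show rest = s.src b by simp [h], Function.update_eq_self]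
      rw [this]
      exact (runs_skip _).mono (by simp)
    | cons c a => simp at hl
  | cons i l ih =>
    cases a with
    | nil => simp at hl
    | cons c a =>
      rw [List.flatMap_cons, List.append_assoc] at h
      have h1 := runs_readNum b i c _ s h
      have h2 := ih a (by simpa using hl) { s with
        num := Function.update s.num i (s.num i + c)
        src := Function.update s.src b (a.flatMap encodeNum ++ rest) } (by simp)
        (fun d hd => hM d (by simp [hd]))
      simp only [Function.update_idem] at h2
      refine (h1.seq h2).mono ?_
      have := hM c (by simp)
      simp only [List.length_cons, Nat.succ_mul]
      omega

/-- Run `F` if the number `i` is zero, otherwise decrease it and run `G`. -/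
def ifZero (i : Fin 10) (F G : Frag Reg) : Frag Reg :=
  popLoop (.num i) (fun s => if s.isSome then G else F) fun _ => false

theorem runs_ifZero_zero {i : Fin 10} {F G : Frag Reg} {s s' : Store} {t : ℕ} (hi : s.num i = 0)
    (h : F.Runs s.contents t s'.contents) : (ifZero i F G).Runs s.contents (t + 1) s'.contents := by
  have h0 : s.contents (.num i) = [] := by simp [Store.contents, hi]
  refine Runs.popLoop_exit rfl ?_
  have h1 : Function.update s.contents (.num i) (s.contents (.num i)).tail = s.contents := by
    rw [h0, List.tail_nil, ← h0, Function.update_eq_self]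
  rw [h1, h0]
  exact h

theorem runs_ifZero_succ {i : Fin 10} {F G : Frag Reg} {s s' : Store} {t a : ℕ}
    (hi : s.num i = a + 1)
    (h : G.Runs { s with num := Function.update s.num i a }.contents t s'.contents) :
    (ifZero i F G).Runs s.contents (t + 1) s'.contents := by
  have h0 : s.contents (.num i) = Sym.tick :: List.replicate a Sym.tick := by
    simp [Store.contents, hi, List.replicate_succ]
  refine Runs.popLoop_exit rfl ?_
  rw [h0, List.tail_cons, Store.update_num]
  exact h

/-- Run a program for each symbol of the description `b`. -/
def forSrc (b : Bool) (F : Sym → Frag Reg) : Frag Reg :=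
  popLoop (.src b) (fun s => s.elim skip F) Option.isSome

/-- Translate a list of gates. Each gate is described by its tag and further symbols, which are read
by the program that belongs to the tag. -/
theorem runs_forSrc {G : Type} {b : Bool} {F : Sym → Frag Reg} {tag : G → Sym}
    {enc : G → List Sym} {E : (Fin 10 → ℕ) → G → List Sym} {t : ℕ} {s : Store}
    (hs : s.Clean) (hs' : ∀ i : Fin 10, i ∈ [1, 2, 3] → s.num i = 0)
    (gs : List G) (hF : ∀ g ∈ gs, ∀ s' : Store, s'.Clean → s'.num = s.num → s'.size ≤ s.size →
      ∀ rest, s'.src b = enc g ++ rest → (F (tag g)).Runs s'.contents t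
        { s'.write (E s.num g) with src := Function.update s'.src b rest }.contents)
    (h : s.src b = gs.flatMap fun g => tag g :: enc g) :
    (forSrc b F).Runs s.contents (s.size * (t + 1) + 2)
      { s.write (gs.flatMap (E s.num)) with src := Function.update s.src b [] }.contents := by
  -- The induction is over the gates still to be read. The store changes on the way, but its size
  -- never exceeds the initial one, so the same `t` serves for all gates.
  have key : ∀ gs' : List G, (∀ g ∈ gs', g ∈ gs) → ∀ s' : Store, s'.Clean → s'.num = s.num →
      s'.size ≤ s.size → s'.src b = (gs'.flatMap fun g => tag g :: enc g) →
      (forSrc b F).Runs s'.contents (gs'.length * (t + 1) + 2)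
      { s'.write (gs'.flatMap (E s.num)) with src := Function.update s'.src b [] }.contents := by
    intro gs'
    induction gs' with
    | nil =>
      intro _ s' _ _ _ h
      have h0 : s'.contents (.src b) = [] := by simpa [Store.contents] using h
      refine (Runs.popLoop_exit (t := 1) (by simp [h0]) ?_).mono (by omega)
      rw [h0, List.tail_nil, Store.update_src]
      exact runs_skip _
    | cons g gs' ih =>
      intro hg s' hs'c hnum hsz h
      let rest := gs'.flatMap fun g => tag g :: enc g
      have h0 : s'.contents (.src b) = tag g :: (enc g ++ rest) := by
        simpa [Store.contents, rest] using h
      have hsrc : s'.src b = tag g :: (enc g ++ rest) := h0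
      have hlen : ∀ l : List Sym, l.length ≤ (s'.src b).length →
          ∑ c, (Function.update s'.src b l c).length ≤ ∑ c, (s'.src c).length := by
        intro l hl
        refine Finset.sum_le_sum fun c _ => ?_
        by_cases hc : c = b
        · subst hc; simpa using hl
        · rw [Function.update_of_ne hc]
      have hsz' : ∀ l : List Sym, l.length ≤ (s'.src b).length → ∀ w,
          ({ s'.write w with src := Function.update s'.src b l } : Store).size ≤ s.size := by
        intro l hl w
        have := hlen l hl
        unfold Store.size Store.write at *
        simp only at *
        omega
      have h1 := hF g (hg g (by simp)) { s' with
        src := Function.update s'.src b (enc g ++ rest) } ⟨hs'c.tmp, hs'c.rem, hs'c.num⟩ hnum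
        (hsz' _ (by simp [hsrc]) []) rest (by simp)
      have h2 := ih (fun g hg' => hg g (by simp [hg']))
        { s'.write (E s.num g) with src := Function.update s'.src b rest }
        ⟨hs'c.tmp, hs'c.rem, hs'c.num⟩ hnum (hsz' _ (by simp [hsrc]; omega) _) (by simp [rest])
      simp only [Function.update_idem] at h1 h2
      have e1 : ∀ w w' (f : Bool → List Sym), ({ ({ s'.write w with src := f } : Store).write w' with
          src := Function.update s'.src b [] } : Store) =
          { s'.write (w ++ w') with src := Function.update s'.src b [] } := by
        intro w w' f
        simp [Store.write]
      rw [e1] at h2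
      refine (Runs.popLoop_cont (t := t) (by simp [h0]) ?_ h2).mono ?_
      · rw [h0, List.tail_cons, Store.update_src]
        exact h1
      · rw [List.length_cons, Nat.succ_mul]; omega
  refine (key gs (fun _ h => h) s hs rfl le_rfl h).mono ?_
  -- Every gate contributes at least its tag to the description.
  have : gs.length ≤ (s.src b).length := by
    rw [h, List.length_flatMap]
    clear h hF key
    induction gs with
    | nil => simp
    | cons g gs ih => simp only [List.length_cons, List.map_cons, List.sum_cons] at ih ⊢; omega
  have := Nat.mul_le_mul_right (t + 1) (this.trans (s.length_src_le_size b))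
  omega

/-- Read the numbers that describe a gate, run `F`, and clear the numbers. -/
def onGate (b : Bool) (l : List (Fin 10)) (F : Frag Reg) : Frag Reg :=
  (readNums b l).seq (F.seq ((clearNum 1).seq ((clearNum 2).seq (clearNum 3))))

/-- The numbers 1, 2 and 3 are reserved for the arguments of the current gate. `F` may spoil them,
leaving `v`, since they are cleared before the next gate is read. -/
theorem runs_onGate {b : Bool} {l : List (Fin 10)} {F : Frag Reg} {a : List ℕ}
    (hl : l.length = a.length) (ha : a.length ≤ 3) {rest : List Sym} {s : Store}
    (hs' : ∀ i : Fin 10, i ∈ [1, 2, 3] → s.num i = 0)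
    (h : s.src b = a.flatMap encodeNum ++ rest) {w : List Sym} {v : Fin 10 → ℕ} {t : ℕ}
    (hF : F.Runs { s with
      num := addNums s.num l a
      src := Function.update s.src b rest }.contents t { s.write w with
      num := v
      src := Function.update s.src b rest }.contents)
    (hv : ∀ i : Fin 10, i ∉ [1, 2, 3] → v i = s.num i)
    (hvM : ∀ i : Fin 10, i ∈ [1, 2, 3] → v i ≤ s.size) :
    (onGate b l F).Runs s.contents (20 * s.size + 20 + t)
      { s.write w with src := Function.update s.src b rest }.contents := by
  have hM : ∀ c ∈ a, c ≤ s.size := by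
    intro c hc
    refine le_trans ?_ (s.length_src_le_size b)
    rw [h, List.length_append, List.length_flatMap]
    refine le_trans ?_ (Nat.le_add_right _ _)
    refine le_trans ?_ (List.single_le_sum (fun _ _ => Nat.zero_le _) _
      (List.mem_map.2 ⟨c, hc, rfl⟩))
    simp [encodeNum]
  have h1 := runs_readNums b l a hl rest s h hM
  have h2 := runs_clearNum 1 { s.write w with
      num := v
      src := Function.update s.src b rest }
  have h3 := runs_clearNum 2 { s.write w with
      num := Function.update v 1 0
      src := Function.update s.src b rest }
  have h4 := runs_clearNum 3 { s.write w with
      num := Function.update (Function.update v 1 0) 2 0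
      src := Function.update s.src b rest }
  have e : Function.update (Function.update (Function.update v 1 0) 2 0) 3 0 = s.num := by
    funext i
    by_cases hi : i ∈ ([1, 2, 3] : List (Fin 10))
    · rw [hs' i hi]
      simp only [List.mem_cons, List.not_mem_nil, or_false] at hi
      rcases hi with rfl | rfl | rfl <;> simp
    · rw [← hv i hi]
      simp only [List.mem_cons, List.not_mem_nil, or_false, not_or] at hi
      rw [Function.update_of_ne hi.2.2, Function.update_of_ne hi.2.1, Function.update_of_ne hi.1]
  simp only at h2 h3 h4
  rw [e] at h4
  refine (h1.seq (hF.seq (h2.seq (h3.seq h4)))).mono ?_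
  have i1 := hvM 1 (by simp)
  have i2 := hvM 2 (by simp)
  have i3 := hvM 3 (by simp)
  have j2 : Function.update v 1 0 2 = v 2 := by simp
  have j3 : Function.update (Function.update v 1 0) 2 0 3 = v 3 := by simp
  rw [j2, j3]
  -- At most three numbers are read and three are cleared, which together takes at most `12 * s.size
  -- + 13` steps.
  have : a.length * (2 * s.size + 2) ≤ 3 * (2 * s.size + 2) := Nat.mul_le_mul_right _ ha
  omega

end Frag

end QCrypt

/-! ### Circuits as linear maps, evaluated on matrix units -/

namespace QCrypt

/-! ### Wires -/

section Wires

variable {N : ℕ}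

theorem getBit_of_lt (x : Bits N) {i : ℕ} (h : i < N) : getBit x i = x ⟨i, h⟩ := by
  simp [getBit, h]

@[simp] theorem getBit_val (x : Bits N) (i : Fin N) : getBit x i = x i := by
  simp [getBit]

theorem bits_ext {x y : Bits N} (h : ∀ i < N, getBit x i = getBit y i) : x = y := by
  funext i
  simpa using h i i.2

theorem getBit_setBit (x : Bits N) (i j : ℕ) (b : Bool) :
    getBit (setBit x i b) j = if j = i ∧ j < N then b else getBit x j := by
  by_cases h : j < N
  · simp [getBit, setBit, h]
  · simp [getBit, h]

theorem getBit_setBit_self (x : Bits N) {i : ℕ} (hi : i < N) (b : Bool) :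
    getBit (setBit x i b) i = b := by
  simp [getBit_setBit, hi]

theorem getBit_setBit_of_ne (x : Bits N) {i j : ℕ} (h : j ≠ i) (b : Bool) :
    getBit (setBit x i b) j = getBit x j := by
  simp [getBit_setBit, h]

theorem getBit_zeros (i : ℕ) : getBit (zeros N) i = false := by
  simp [getBit, zeros]

theorem getBit_writeReg {a : ℕ} (s : ℕ) (u : Bits a) (x : Bits N) (i : ℕ) (hi : i < N) :
    getBit (writeReg s u x) i = if s ≤ i ∧ i < s + a then getBit u (i - s) else getBit x i := by
  rw [getBit_of_lt _ hi, getBit_of_lt _ hi, writeReg]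
  simp only
  split_ifs with h
  · rw [getBit_of_lt _ (by omega)]
  · rfl

theorem getBit_readReg (s a : ℕ) (x : Bits N) (i : ℕ) (hi : i < a) :
    getBit (readReg s a x) i = getBit x (s + i) := by
  rw [getBit_of_lt _ hi, readReg]

theorem setBit_getBit (x : Bits N) (i : ℕ) : setBit x i (getBit x i) = x :=
  bits_ext fun j hj => by
    rw [getBit_setBit]
    split_ifs with h
    · rw [h.1]
    · rfl

theorem readReg_eq_iff {s a : ℕ} {x y : Bits N} :
    readReg s a x = readReg s a y ↔ ∀ i < a, getBit x (s + i) = getBit y (s + i) := by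
  constructor
  · intro h i hi
    rw [← getBit_readReg s a x i hi, h, getBit_readReg s a y i hi]
  · exact fun h => funext fun i => h i i.2

/-- A string is determined by its two disjoint registers and its remaining wires. In this form,
equations between written strings inside sums over register contents can be solved for the summation
index. -/
theorem writeReg_writeReg_eq_iff {i j a b : ℕ} (hi : i + a ≤ N) (hj : j + b ≤ N)
    (hij : i + a ≤ j ∨ j + b ≤ i) (u : Bits a) (w : Bits b) (c x : Bits N) :
    writeReg i u (writeReg j w c) = x ↔ u = readReg i a x ∧ w = readReg j b x ∧
      ∀ k < N, ¬(i ≤ k ∧ k < i + a) → ¬(j ≤ k ∧ k < j + b) → getBit c k = getBit x k := by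
  constructor
  · rintro rfl
    refine ⟨bits_ext fun k hk => ?_, bits_ext fun k hk => ?_, fun k hk h₁ h₂ => ?_⟩
    · rw [getBit_readReg _ _ _ _ hk, getBit_writeReg _ _ _ _ (by omega), if_pos (by omega)]
      congr 1; omega
    · rw [getBit_readReg _ _ _ _ hk, getBit_writeReg _ _ _ _ (by omega), if_neg (by omega),
        getBit_writeReg _ _ _ _ (by omega), if_pos (by omega)]
      congr 1; omega
    · rw [getBit_writeReg _ _ _ _ hk, if_neg h₁, getBit_writeReg _ _ _ _ hk, if_neg h₂]
  · rintro ⟨rfl, rfl, h⟩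
    refine bits_ext fun k hk => ?_
    rw [getBit_writeReg _ _ _ _ hk]
    split_ifs with h₁
    · rw [getBit_readReg _ _ _ _ (by omega)]; congr 1; omega
    · rw [getBit_writeReg _ _ _ _ hk]
      split_ifs with h₂
      · rw [getBit_readReg _ _ _ _ (by omega)]; congr 1; omega
      · exact h k hk h₁ h₂

theorem writeReg_eq_iff {i a : ℕ} (hi : i + a ≤ N) (u : Bits a) (c x : Bits N) :
    writeReg i u c = x ↔ u = readReg i a x ∧
      ∀ k < N, ¬(i ≤ k ∧ k < i + a) → getBit c k = getBit x k := by
  have h0 : writeReg (N := N) 0 (zeros 0) c = c := by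
    refine bits_ext fun k hk => ?_
    rw [getBit_writeReg _ _ _ _ hk, if_neg (by omega)]
  have := writeReg_writeReg_eq_iff (j := 0) (b := 0) hi (by omega) (by omega) u (zeros 0) c x
  rw [h0] at this
  rw [this]
  constructor
  · rintro ⟨h₁, -, h₂⟩
    exact ⟨h₁, fun k hk h => h₂ k hk h (by omega)⟩
  · rintro ⟨h₁, h₂⟩
    exact ⟨h₁, funext fun k => k.elim0, fun k hk h _ => h₂ k hk h⟩

end Wires

/-! ### Gates on basis operators -/

/-- The operator `|x⟩⟨y|`. -/
abbrev ketbra₂ {N : ℕ} (x y : Bits N) : Op N := Matrix.single x y 1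

theorem op_eq_sum {N : ℕ} (ρ : Op N) : ρ = ∑ x, ∑ y, ρ x y • ketbra₂ x y := by
  conv_lhs => rw [Matrix.matrix_eq_sum_single ρ]
  simp [Matrix.smul_single]

/-- Two linear maps agree if they agree on the operators `|x⟩⟨y|`. -/
theorem linearMap_op_ext {N : ℕ} {V : Type*} [AddCommMonoid V] [Module ℂ V] {f g : Op N →ₗ[ℂ] V}
    (h : ∀ x y, f (ketbra₂ x y) = g (ketbra₂ x y)) : f = g := by
  ext ρ : 1
  rw [op_eq_sum ρ]
  simp only [map_sum, map_smul, h]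

theorem ite_and_one (p q : Prop) [Decidable p] [Decidable q] [Decidable (p ∧ q)] :
    (if p ∧ q then 1 else 0 : ℂ) = (if p then 1 else 0) * (if q then 1 else 0) := by
  by_cases p <;> by_cases q <;> simp [*]

section Conj

variable {N : ℕ}

theorem conjBy_ketbra₂_apply (U : Op N) (x y a b : Bits N) :
    conjBy U (ketbra₂ x y) a b = U a x * star (U b y) := by
  rw [conjBy, Matrix.mul_apply, Finset.sum_eq_single y]
  · rw [Matrix.mul_single_apply_same, Matrix.conjTranspose_apply, mul_one]
  · intro z _ hz
    rw [Matrix.mul_single_apply_of_ne (hbj := hz), zero_mul]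
  · intro h; exact absurd (Finset.mem_univ _) h

theorem ketbra₂_apply (x y a b : Bits N) :
    ketbra₂ x y a b = (if a = x then 1 else 0) * (if b = y then 1 else 0 : ℂ) := by
  change Matrix.single x y (1 : ℂ) a b = _
  rw [Matrix.single_apply]
  by_cases h₁ : x = a <;> by_cases h₂ : y = b <;> simp [h₁, h₂, eq_comm]

theorem conjBy_basisMap (g : Bits N → Bits N) (x y : Bits N) :
    conjBy (basisMap g) (ketbra₂ x y) = ketbra₂ (g x) (g y) := by
  ext a b
  rw [conjBy_ketbra₂_apply, ketbra₂_apply, basisMap]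
  simp only [Matrix.of_apply, apply_ite star, star_one, star_zero]

theorem oneQubit_apply (u : Matrix Bool Bool ℂ) {i : ℕ} (hi : i < N) (a x : Bits N) :
    (oneQubit u i : Op N) a x =
      ∑ b, u b (getBit x i) * if a = setBit x i b then 1 else 0 := by
  rw [oneQubit, Matrix.of_apply]
  have key : ∀ b, a = setBit x i b ↔ (∀ j : Fin N, (j : ℕ) ≠ i → a j = x j) ∧ b = getBit a i := by
    intro b
    constructor
    · rintro rfl
      refine ⟨fun j hj => by simp [setBit, hj], by rw [getBit_setBit_self _ hi]⟩
    · rintro ⟨h, rfl⟩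
      refine bits_ext fun j hj => ?_
      rw [getBit_setBit]
      split_ifs with h'
      · rw [h'.1]
      · rw [getBit_of_lt _ hj, getBit_of_lt _ hj]
        exact h ⟨j, hj⟩ fun hji => h' ⟨hji, hj⟩
  simp only [key]
  split_ifs with h
  · have : ∀ b, ((∀ j : Fin N, (j : ℕ) ≠ i → a j = x j) ∧ b = getBit a i) ↔ b = getBit a i :=
      fun b => ⟨fun h => h.2, fun hb => ⟨h, hb⟩⟩
    simp only [this, mul_ite, mul_one, mul_zero, Finset.sum_ite_eq', Finset.mem_univ, if_true]
  · simp [h]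

theorem conjBy_oneQubit (u : Matrix Bool Bool ℂ) {i : ℕ} (hi : i < N) (x y : Bits N) :
    conjBy (oneQubit u i) (ketbra₂ x y) = ∑ b, ∑ c,
      (u b (getBit x i) * star (u c (getBit y i))) • ketbra₂ (setBit x i b) (setBit y i c) := by
  ext a d
  rw [conjBy_ketbra₂_apply, oneQubit_apply u hi, oneQubit_apply u hi, star_sum,
    Finset.sum_mul_sum]
  simp only [Matrix.sum_apply, Matrix.smul_apply, ketbra₂_apply, smul_eq_mul]
  refine Finset.sum_congr rfl fun b _ => Finset.sum_congr rfl fun c _ => ?_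
  simp only [star_mul', apply_ite star, star_one, star_zero]
  ring

/-- The partial trace over wire `i` annihilates a matrix unit whose row and column differ there. All
loss of coherence in non-oracle gates is of this kind. -/
theorem resetWire_ketbra₂ {i : ℕ} (hi : i < N) (x y : Bits N) :
    resetWire i (ketbra₂ x y) = if getBit x i = getBit y i then
      ketbra₂ (setBit x i false) (setBit y i false) else 0 := by
  have key : ∀ (a x : Bits N) b, setBit a i b = x ↔
      b = getBit x i ∧ ∀ j < N, j ≠ i → getBit a j = getBit x j := by
    intro a x b
    constructor
    · rintro rfl
      refine ⟨by rw [getBit_setBit_self _ hi], fun j hj hji => ?_⟩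
      rw [getBit_setBit_of_ne _ hji]
    · rintro ⟨rfl, h⟩
      refine bits_ext fun j hj => ?_
      rw [getBit_setBit]
      split_ifs with h'
      · rw [h'.1]
      · exact h j hj fun hji => h' ⟨hji, hj⟩
  have key' : ∀ a x : Bits N, (a = setBit x i false) ↔
      getBit a i = false ∧ ∀ j < N, j ≠ i → getBit a j = getBit x j := by
    intro a x
    rw [eq_comm, key]
    constructor
    · exact fun h => ⟨h.1.symm, fun j hj hji => (h.2 j hj hji).symm⟩
    · exact fun h => ⟨h.1.symm, fun j hj hji => (h.2 j hj hji).symm⟩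
  ext a d
  rw [resetWire, Matrix.of_apply]
  simp only [ketbra₂_apply, key]
  by_cases hxy : getBit x i = getBit y i
  · rw [if_pos hxy, ketbra₂_apply]
    simp only [key', ← hxy]
    by_cases ha : ∀ j < N, j ≠ i → getBit a j = getBit x j
    · by_cases hd : ∀ j < N, j ≠ i → getBit d j = getBit y j
      · simp only [eq_true ha, eq_true hd, and_true]
        cases getBit x i <;> cases getBit a i <;> cases getBit d i <;> simp
      · simp only [eq_false hd, and_false, if_false, mul_zero, Finset.sum_const_zero, ite_self]
    · simp only [eq_false ha, and_false, if_false, zero_mul, Finset.sum_const_zero, ite_self]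
  · rw [if_neg hxy]
    have : ∀ b, ((if b = getBit x i ∧ (∀ j < N, j ≠ i → getBit a j = getBit x j) then 1 else 0) *
        if b = getBit y i ∧ (∀ j < N, j ≠ i → getBit d j = getBit y j) then 1 else 0 : ℂ) = 0 := by
      intro b
      by_cases hb : b = getBit x i
      · rw [if_neg (c := b = getBit y i ∧ _) (fun h => hxy (hb ▸ h.1)), mul_zero]
      · rw [if_neg (c := b = getBit x i ∧ _) (fun h => hb h.1), zero_mul]
    simp only [this, Finset.sum_const_zero, ite_self]
    rfl

/-- The linear map that takes `|p⟩⟨q|` to `|F p⟩⟨G q|`. -/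
def relocate {b : ℕ} (F G : Bits b → Bits N) : Op b →ₗ[ℂ] Op N where
  toFun A := ∑ p, ∑ q, A p q • ketbra₂ (F p) (G q)
  map_add' A B := by simp [add_smul, Finset.sum_add_distrib]
  map_smul' c A := by simp [Finset.smul_sum]

theorem relocate_apply {b : ℕ} (F G : Bits b → Bits N) (A : Op b) :
    relocate F G A = ∑ p, ∑ q, A p q • ketbra₂ (F p) (G q) := rfl

theorem relocate_ketbra₂ {b : ℕ} (F G : Bits b → Bits N) (p q : Bits b) :
    relocate F G (ketbra₂ p q) = ketbra₂ (F p) (G q) := by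
  rw [relocate_apply, Finset.sum_eq_single p, Finset.sum_eq_single q]
  · simp
  · intro q' _ h; simp [ketbra₂_apply, h]
  · simp
  · intro p' _ h; simp [ketbra₂_apply, h]
  · simp

/-- The old contents of the output register are traced out and hence have to agree in row and
column. The wires outside both registers are spectators, and `relocate` inserts the output of `Φ`
next to them. -/
theorem applyReg_ketbra₂ {a b i j : ℕ} (Φ : QMap a b) (hi : i + a ≤ N) (hj : j + b ≤ N)
    (hij : i + a ≤ j ∨ j + b ≤ i) (x y : Bits N) :
    applyReg Φ i j (ketbra₂ x y) = if readReg j b x = readReg j b y then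
      relocate (fun p => writeReg i (zeros a) (writeReg j p x))
        (fun p => writeReg i (zeros a) (writeReg j p y))
        (Φ (ketbra₂ (readReg i a x) (readReg i a y))) else 0 := by
  -- Agreement on the spectator wires.
  let Ag : Bits N → Bits N → Prop := fun c x =>
    ∀ k < N, ¬(i ≤ k ∧ k < i + a) → ¬(j ≤ k ∧ k < j + b) → getBit c k = getBit x k
  have Agsymm : ∀ c x, Ag c x ↔ Ag x c := fun c x =>
    ⟨fun h k h₁ h₂ h₃ => (h k h₁ h₂ h₃).symm, fun h k h₁ h₂ h₃ => (h k h₁ h₂ h₃).symm⟩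
  have key : ∀ (u : Bits a) (w : Bits b) (c x : Bits N), writeReg i u (writeReg j w c) = x ↔
      u = readReg i a x ∧ w = readReg j b x ∧ Ag c x := writeReg_writeReg_eq_iff hi hj hij
  have key' : ∀ (p : Bits b) (c x : Bits N), c = writeReg i (zeros a) (writeReg j p x) ↔
      readReg i a c = zeros a ∧ p = readReg j b c ∧ Ag c x := by
    intro p c x
    rw [eq_comm, key, eq_comm, Agsymm]
  ext c d
  rw [applyReg, Matrix.of_apply]
  have inner : ∀ w : Bits b, (Matrix.of fun u v => (ketbra₂ x y : Op N)
      (writeReg i u (writeReg j w c)) (writeReg i v (writeReg j w d)) : Op a) =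
      ((if w = readReg j b x ∧ Ag c x then 1 else 0) *
        (if w = readReg j b y ∧ Ag d y then 1 else 0) : ℂ) •
        ketbra₂ (readReg i a x) (readReg i a y) := by
    intro w
    ext u v
    rw [Matrix.of_apply, Matrix.smul_apply, ketbra₂_apply, ketbra₂_apply]
    simp only [key, smul_eq_mul]
    simp only [ite_and_one]
    ring
  simp only [inner, map_smul, Matrix.smul_apply, smul_eq_mul]
  by_cases hxy : readReg j b x = readReg j b y
  · rw [if_pos hxy, relocate_apply]
    simp only [Matrix.sum_apply, Matrix.smul_apply, ketbra₂_apply, key', smul_eq_mul, ← hxy]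
    by_cases hc : Ag c x
    · by_cases hd : Ag d y
      · simp only [eq_true hc, eq_true hd, and_true]
        by_cases h₁ : readReg i a c = zeros a
        · by_cases h₂ : readReg i a d = zeros a
          · simp [h₁, h₂]
          · simp [h₂]
        · simp [h₁]
      · simp [hd]
    · simp [hc]
  · rw [if_neg hxy]
    have : ∀ w : Bits b, ((if w = readReg j b x ∧ Ag c x then 1 else 0) *
        (if w = readReg j b y ∧ Ag d y then 1 else 0) : ℂ) = 0 := by
      intro w
      by_cases hb : w = readReg j b x
      · rw [if_neg (c := w = readReg j b y ∧ _) (fun h => hxy (hb ▸ h.1)), mul_zero]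
      · rw [if_neg (c := w = readReg j b x ∧ _) (fun h => hb h.1), zero_mul]
    simp [this]

theorem loadInput_ketbra₂ {a : ℕ} (ha : a ≤ N) (u v : Bits a) :
    loadInput N (ketbra₂ u v) =
      ketbra₂ (writeReg 0 u (zeros N)) (writeReg 0 v (zeros N)) := by
  have key : ∀ (u : Bits a) (c : Bits N), c = writeReg 0 u (zeros N) ↔
      (∀ j : Fin N, a ≤ (j : ℕ) → c j = false) ∧ readReg 0 a c = u := by
    intro u c
    rw [eq_comm, writeReg_eq_iff (by omega)]
    constructor
    · rintro ⟨h₁, h₂⟩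
      refine ⟨fun j hj => ?_, h₁.symm⟩
      have := h₂ j j.2 (by omega)
      rw [getBit_zeros, getBit_val] at this
      exact this.symm
    · rintro ⟨h₁, h₂⟩
      refine ⟨h₂.symm, fun k hk h => ?_⟩
      rw [getBit_zeros, getBit_of_lt _ hk]
      exact (h₁ ⟨k, hk⟩ (by simp only; omega)).symm
  ext c d
  rw [loadInput, Matrix.of_apply]
  simp only [ketbra₂_apply, key]
  have : (∀ j : Fin N, a ≤ (j : ℕ) → c j = false ∧ d j = false) ↔
      (∀ j : Fin N, a ≤ (j : ℕ) → c j = false) ∧ ∀ j : Fin N, a ≤ (j : ℕ) → d j = false :=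
    ⟨fun h => ⟨fun j hj => (h j hj).1, fun j hj => (h j hj).2⟩,
      fun h j hj => ⟨h.1 j hj, h.2 j hj⟩⟩
  simp only [this]
  by_cases h₁ : ∀ j : Fin N, a ≤ (j : ℕ) → c j = false
  · by_cases h₂ : ∀ j : Fin N, a ≤ (j : ℕ) → d j = false
    · rw [if_pos ⟨h₁, h₂⟩]
      simp only [eq_true h₁, eq_true h₂, true_and]
    · simp [h₂]
  · simp [h₁]

theorem keepOutput_ketbra₂ {b : ℕ} (hb : b ≤ N) (x y : Bits N) :
    keepOutput b (ketbra₂ x y) =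
      if ∀ k < N, b ≤ k → getBit x k = getBit y k then
        ketbra₂ (readReg 0 b x) (readReg 0 b y) else 0 := by
  have key : ∀ (u : Bits b) (z x : Bits N), writeReg 0 u z = x ↔ u = readReg 0 b x ∧
      ∀ k < N, b ≤ k → getBit z k = getBit x k := by
    intro u z x
    rw [writeReg_eq_iff (by omega)]
    refine and_congr_right fun _ => forall_congr' fun k => forall_congr' fun hk => ?_
    exact ⟨fun h hb => h (by omega), fun h hb => h (by omega)⟩
  ext u v
  rw [keepOutput, Matrix.of_apply]
  simp only [ketbra₂_apply, key]
  -- In `keepOutput` the kept wires of the summation index are normalised to zero, so the traced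
  -- wires determine it: `z₀` is the only index that contributes.
  let z₀ : Bits N := writeReg 0 (zeros b) x
  have hz₀ : ∀ z : Bits N, z = z₀ ↔ readReg 0 b z = zeros b ∧
      ∀ k < N, b ≤ k → getBit z k = getBit x k := by
    intro z
    rw [eq_comm, key, eq_comm]
    refine and_congr_right fun _ => forall_congr' fun k => forall_congr' fun _ =>
      forall_congr' fun _ => eq_comm
  rw [Finset.sum_eq_single z₀]
  · have h := (hz₀ z₀).1 rfl
    simp only [if_pos h.1, eq_true h.2, and_true]
    have : (∀ k < N, b ≤ k → getBit z₀ k = getBit y k) ↔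
        ∀ k < N, b ≤ k → getBit x k = getBit y k :=
      forall_congr' fun k => forall_congr' fun h₁ => forall_congr' fun h₂ => by
        rw [h.2 k h₁ h₂]
    simp only [this]
    by_cases hxy : ∀ k < N, b ≤ k → getBit x k = getBit y k
    · rw [if_pos hxy, ketbra₂_apply]
      simp only [eq_true hxy, and_true]
    · rw [if_neg hxy]
      simp only [eq_false hxy, and_false, if_false, mul_zero]
      rfl
  · intro z _ hz
    rw [Ne, hz₀] at hz
    split_ifs <;> simp_all
  · intro h; exact absurd (Finset.mem_univ _) h

end Conj

end QCrypt

namespace QCrypt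

/-! ### Running lists of gates -/

theorem conjBy_add {N : ℕ} (U ρ σ : Op N) : conjBy U (ρ + σ) = conjBy U ρ + conjBy U σ := by
  simp only [conjBy, ← Matrix.add_mul, ← Matrix.mul_add]

theorem conjBy_smul {N : ℕ} (U ρ : Op N) (c : ℂ) : conjBy U (c • ρ) = c • conjBy U ρ := by
  rw [conjBy, conjBy, Matrix.mul_smul, Matrix.smul_mul]

theorem resetWire_add {N : ℕ} (i : ℕ) (ρ σ : Op N) :
    resetWire i (ρ + σ) = resetWire i ρ + resetWire i σ := by
  ext x y
  simp only [resetWire, Matrix.of_apply, Matrix.add_apply, Finset.sum_add_distrib]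
  split_ifs <;> simp

theorem resetWire_smul {N : ℕ} (i : ℕ) (c : ℂ) (ρ : Op N) :
    resetWire i (c • ρ) = c • resetWire i ρ := by
  ext x y
  simp only [resetWire, Matrix.of_apply, Matrix.smul_apply, smul_eq_mul]
  split_ifs <;> simp [mul_add]

theorem applyReg_add {N a b : ℕ} (Φ : QMap a b) (s t : ℕ) (ρ σ : Op N) :
    applyReg Φ s t (ρ + σ) = applyReg Φ s t ρ + applyReg Φ s t σ := by
  ext x y
  simp only [applyReg, Matrix.of_apply, Matrix.add_apply]
  split_ifs
  · rw [← Finset.sum_add_distrib]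
    refine Finset.sum_congr rfl fun w _ => ?_
    rw [← Matrix.add_apply, ← map_add]
    rfl
  · simp

theorem applyReg_smul {N a b : ℕ} (Φ : QMap a b) (s t : ℕ) (c : ℂ) (ρ : Op N) :
    applyReg Φ s t (c • ρ) = c • applyReg Φ s t ρ := by
  ext x y
  simp only [applyReg, Matrix.of_apply, Matrix.smul_apply]
  split_ifs
  · rw [Finset.smul_sum]
    refine Finset.sum_congr rfl fun w _ => ?_
    rw [← Matrix.smul_apply, ← map_smul]
    rfl
  · simp

/-- The operation of a gate, as a linear map. -/
noncomputable def Gate.lin (O : List QOracle) (N : ℕ) (g : Gate) : Op N →ₗ[ℂ] Op N where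
  toFun := g.apply O
  map_add' ρ σ := by
    cases g <;> simp only [Gate.apply, conjBy_add, resetWire_add]
    split
    · exact applyReg_add ..
    · rfl
  map_smul' c ρ := by
    cases g <;> simp only [Gate.apply, conjBy_smul, resetWire_smul, RingHom.id_apply]
    split
    · exact applyReg_smul ..
    · rfl

theorem Gate.lin_apply (O : List QOracle) {N : ℕ} (g : Gate) (ρ : Op N) :
    g.lin O N ρ = g.apply O ρ := rfl

/-- The operation of a list of gates, as a linear map. -/
noncomputable def runGates (O : List QOracle) (N : ℕ) : List Gate → Op N →ₗ[ℂ] Op N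
  | [] => LinearMap.id
  | g :: gs => runGates O N gs ∘ₗ g.lin O N

@[simp] theorem runGates_nil (O : List QOracle) {N : ℕ} (ρ : Op N) : runGates O N [] ρ = ρ := rfl

theorem runGates_cons (O : List QOracle) {N : ℕ} (g : Gate) (gs : List Gate) (ρ : Op N) :
    runGates O N (g :: gs) ρ = runGates O N gs (g.lin O N ρ) := rfl

theorem runGates_append (O : List QOracle) {N : ℕ} (gs hs : List Gate) (ρ : Op N) :
    runGates O N (gs ++ hs) ρ = runGates O N hs (runGates O N gs ρ) := by
  induction gs generalizing ρ with
  | nil => rfl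
  | cons g gs ih => exact ih _

theorem foldl_apply_eq_runGates (O : List QOracle) {N : ℕ} (gs : List Gate) (ρ : Op N) :
    gs.foldl (fun τ g => g.apply O τ) ρ = runGates O N gs ρ := by
  induction gs generalizing ρ with
  | nil => rfl
  | cons g gs ih => exact ih _

theorem QCircuit.run_eq (O : List QOracle) (C : QCircuit) {a : ℕ} (b : ℕ) (ρ : Op a) :
    C.run O b ρ = keepOutput b (runGates O C.width C.gates (loadInput C.width ρ)) := by
  rw [QCircuit.run, foldl_apply_eq_runGates]

/-! ### Assignments of bits to all wires -/

/-- The values of the first `N` wires. -/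
def ket (N : ℕ) (s : ℕ → Bool) : Bits N := fun i => s i

/-- The values of the wires `i, …, i + a - 1`. -/
def readWires (i a : ℕ) (s : ℕ → Bool) : Bits a := fun l => s (i + l)

/-- Replace the values of the wires `i, …, i + a - 1`. -/
def writeWires {a : ℕ} (i : ℕ) (u : Bits a) (s : ℕ → Bool) : ℕ → Bool :=
  fun j => if h : i ≤ j ∧ j < i + a then u ⟨j - i, by omega⟩ else s j

section Ket

variable {N : ℕ}

theorem getBit_ket (s : ℕ → Bool) {i : ℕ} (hi : i < N) : getBit (ket N s) i = s i := by
  simp [getBit_of_lt _ hi, ket]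

theorem setBit_ket (s : ℕ → Bool) (i : ℕ) (b : Bool) :
    setBit (ket N s) i b = ket N (Function.update s i b) := by
  funext j; simp [setBit, ket, Function.update_apply]

theorem writeReg_ket {a : ℕ} (i : ℕ) (u : Bits a) (s : ℕ → Bool) :
    writeReg i u (ket N s) = ket N (writeWires i u s) := rfl

theorem readReg_ket {i a : ℕ} (h : i + a ≤ N) (s : ℕ → Bool) :
    readReg i a (ket N s) = readWires i a s := by
  funext l; simp only [readReg, readWires]; rw [getBit_ket]; omega

theorem ket_congr {s t : ℕ → Bool} (h : ∀ i < N, s i = t i) : ket N s = ket N t := by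
  funext i; exact h i i.2

theorem readWires_eq_iff {i a : ℕ} {s t : ℕ → Bool} :
    readWires i a s = readWires i a t ↔ ∀ l < a, s (i + l) = t (i + l) :=
  ⟨fun h l hl => congrFun h ⟨l, hl⟩, fun h => funext fun l => h l l.2⟩

theorem writeWires_of_mem {a i : ℕ} (u : Bits a) (s : ℕ → Bool) {l : ℕ} (hl : l < a) :
    writeWires i u s (i + l) = u ⟨l, hl⟩ := by
  rw [writeWires, dif_pos (by omega)]
  congr 1; simp

theorem writeWires_of_notMem {a i : ℕ} (u : Bits a) (s : ℕ → Bool) {j : ℕ}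
    (hj : ¬(i ≤ j ∧ j < i + a)) : writeWires i u s j = s j := by
  rw [writeWires, dif_neg hj]

theorem readWires_writeWires {a i : ℕ} (u : Bits a) (s : ℕ → Bool) :
    readWires i a (writeWires i u s) = u := by
  funext l; exact writeWires_of_mem u s l.2

theorem readWires_writeWires_of_disjoint {a b i j : ℕ} (u : Bits b) (s : ℕ → Bool)
    (h : i + a ≤ j ∨ j + b ≤ i) :
    readWires i a (writeWires j u s) = readWires i a s := by
  funext l; exact writeWires_of_notMem _ _ (by omega)

/-- The operator `|s⟩⟨t|` on the first `N` wires. -/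
abbrev kb (N : ℕ) (s t : ℕ → Bool) : Op N := ketbra₂ (ket N s) (ket N t)

end Ket

/-! ### Classical gates -/

/-- The effect of the gates `X`, `CNOT`, Toffoli and `reset` on bits. -/
def Gate.act : Gate → (ℕ → Bool) → ℕ → Bool
  | .x i, s => Function.update s i (!s i)
  | .cnot c i, s => Function.update s i (xor (s i) (s c))
  | .ccx c d i, s => Function.update s i (xor (s i) (s c && s d))
  | .reset i, s => Function.update s i false
  | .h _, s => s
  | .t _, s => s
  | .oracle _ _ _, s => s

/-- The bit that a gate discards. -/
def Gate.leak : Gate → (ℕ → Bool) → List Bool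
  | .reset i, s => [s i]
  | _, _ => []

/-- The gates `X`, `CNOT`, Toffoli and `reset` on the first `N` wires. -/
def Gate.IsClassical (N : ℕ) : Gate → Prop
  | .x i => i < N
  | .cnot c i => c < N ∧ i < N
  | .ccx c d i => c < N ∧ d < N ∧ i < N
  | .reset i => i < N
  | _ => False

/-- The effect of a list of classical gates on bits. -/
def actGates : List Gate → (ℕ → Bool) → ℕ → Bool
  | [], s => s
  | g :: gs, s => actGates gs (g.act s)

/-- The bits that a list of classical gates discards. -/
def leakGates : List Gate → (ℕ → Bool) → List Bool
  | [], _ => []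
  | g :: gs, s => g.leak s ++ leakGates gs (g.act s)

theorem actGates_append (gs hs : List Gate) (s : ℕ → Bool) :
    actGates (gs ++ hs) s = actGates hs (actGates gs s) := by
  induction gs generalizing s with
  | nil => rfl
  | cons g gs ih => exact ih _

theorem leakGates_append (gs hs : List Gate) (s : ℕ → Bool) :
    leakGates (gs ++ hs) s = leakGates gs s ++ leakGates hs (actGates gs s) := by
  induction gs generalizing s with
  | nil => rfl
  | cons g gs ih => simp [leakGates, actGates, ih]

/-- The number of discarded bits depends on the gates only. Hence an equality of concatenated lists
of discarded bits splits into equalities of the parts. -/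
theorem length_leakGates (gs : List Gate) (s t : ℕ → Bool) :
    (leakGates gs s).length = (leakGates gs t).length := by
  induction gs generalizing s t with
  | nil => rfl
  | cons g gs ih =>
    rw [leakGates, leakGates, List.length_append, List.length_append, ih (g.act s) (g.act t)]
    cases g <;> rfl

theorem leakGates_append_eq_iff (gs hs : List Gate) (s t : ℕ → Bool) :
    leakGates (gs ++ hs) s = leakGates (gs ++ hs) t ↔ leakGates gs s = leakGates gs t ∧
      leakGates hs (actGates gs s) = leakGates hs (actGates gs t) := by
  rw [leakGates_append, leakGates_append]
  exact ⟨fun h => List.append_inj h (length_leakGates gs s t), fun h => by rw [h.1, h.2]⟩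

section Classical

variable {N : ℕ}

/-- Reversible gates permute the basis states, and `reset` traces out one bit. So the coherence
between `s` and `t` survives exactly if both discard the same bits. This reduces the analysis of
classical circuits to statements about Boolean assignments. -/
theorem runGates_classical (O : List QOracle) (gs : List Gate)
    (hgs : ∀ g ∈ gs, g.IsClassical N) (s t : ℕ → Bool) :
    runGates O N gs (kb N s t) =
      if leakGates gs s = leakGates gs t then kb N (actGates gs s) (actGates gs t) else 0 := by
  have one : ∀ g : Gate, g.IsClassical N → ∀ s t, g.lin O N (kb N s t) =
      if g.leak s = g.leak t then kb N (g.act s) (g.act t) else 0 := by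
    intro g hg s t
    rw [Gate.lin_apply]
    cases g with
    | x i =>
      have : (oneQubit pauliX i : Op N) = basisMap fun y => setBit y i (!getBit y i) := by
        ext a y
        rw [oneQubit_apply _ hg]
        simp only [basisMap, pauliX, Matrix.of_apply, Fintype.sum_bool]
        rcases Bool.eq_false_or_eq_true (getBit y i) with h | h <;> simp [h]
      rw [Gate.apply, this, conjBy_basisMap, getBit_ket _ hg, getBit_ket _ hg, setBit_ket,
        setBit_ket]
      simp [Gate.leak, Gate.act]
    | cnot c i =>
      rw [Gate.apply, conjBy_basisMap, getBit_ket _ hg.1, getBit_ket _ hg.1, getBit_ket _ hg.2,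
        getBit_ket _ hg.2, setBit_ket, setBit_ket]
      simp [Gate.leak, Gate.act]
    | ccx c d i =>
      obtain ⟨h₁, h₂, h₃⟩ := hg
      rw [Gate.apply, conjBy_basisMap, getBit_ket _ h₁, getBit_ket _ h₁, getBit_ket _ h₂,
        getBit_ket _ h₂, getBit_ket _ h₃, getBit_ket _ h₃, setBit_ket, setBit_ket]
      simp [Gate.leak, Gate.act]
    | reset i =>
      rw [Gate.apply, resetWire_ketbra₂ hg, getBit_ket _ hg, getBit_ket _ hg, setBit_ket,
        setBit_ket]
      simp [Gate.leak, Gate.act]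
    | h i => exact hg.elim
    | t i => exact hg.elim
    | oracle q i j => exact hg.elim
  induction gs generalizing s t with
  | nil => simp [leakGates, actGates]
  | cons g gs ih =>
    rw [runGates_cons, one g (hgs g List.mem_cons_self)]
    have hl : leakGates (g :: gs) s = leakGates (g :: gs) t ↔ g.leak s = g.leak t ∧
        leakGates gs (g.act s) = leakGates gs (g.act t) := by
      have := leakGates_append_eq_iff [g] gs s t
      simpa [leakGates, actGates] using this
    by_cases h : g.leak s = g.leak t
    · rw [if_pos h, ih (fun g' h' => hgs g' (List.mem_cons_of_mem _ h'))]
      simp only [hl, eq_true h, true_and]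
      rfl
    · rw [if_neg h, map_zero, if_neg fun h' => h (hl.1 h').1]

/-- `X l` plays the role of a loop invariant: the assignment before round `l`. -/
theorem actGates_flatMap_range (body : ℕ → List Gate) (X : ℕ → ℕ → Bool) (c : ℕ)
    (h : ∀ l < c, actGates (body l) (X l) = X (l + 1)) :
    actGates ((List.range c).flatMap body) (X 0) = X c := by
  induction c with
  | zero => rfl
  | succ c ih =>
    rw [List.range_succ, List.flatMap_append, actGates_append, ih fun l hl => h l (by omega),
      List.flatMap_singleton, h c (by omega)]

theorem leakGates_flatMap_range_iff (body : ℕ → List Gate) (X Y : ℕ → ℕ → Bool) (c : ℕ)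
    (hX : ∀ l < c, actGates (body l) (X l) = X (l + 1))
    (hY : ∀ l < c, actGates (body l) (Y l) = Y (l + 1)) :
    leakGates ((List.range c).flatMap body) (X 0) = leakGates ((List.range c).flatMap body) (Y 0) ↔
      ∀ l < c, leakGates (body l) (X l) = leakGates (body l) (Y l) := by
  induction c with
  | zero => simp [leakGates]
  | succ c ih =>
    rw [List.range_succ, List.flatMap_append, leakGates_append_eq_iff,
      ih (fun l hl => hX l (by omega)) (fun l hl => hY l (by omega)),
      actGates_flatMap_range _ X _ fun l hl => hX l (by omega),
      actGates_flatMap_range _ Y _ fun l hl => hY l (by omega), List.flatMap_singleton]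
    constructor
    · rintro ⟨h₁, h₂⟩ l hl
      rcases Nat.lt_succ_iff_lt_or_eq.1 hl with h | rfl
      exacts [h₁ l h, h₂]
    · exact fun h => ⟨fun l hl => h l (by omega), h c (by omega)⟩

/-- Exchange the registers of `c` wires at `i` and `j`. -/
def swapBlock (i j c : ℕ) : List Gate :=
  (List.range c).flatMap fun l =>
    [.cnot (i + l) (j + l), .cnot (j + l) (i + l), .cnot (i + l) (j + l)]

/-- Add the register of `c` wires at `i` to the one at `j`. -/
def copyBlock (i j c : ℕ) : List Gate :=
  (List.range c).flatMap fun l => [.cnot (i + l) (j + l)]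

/-- Reset the register of `c` wires at `i`. -/
def resetBlock (i c : ℕ) : List Gate :=
  (List.range c).flatMap fun l => [.reset (i + l)]

/-- Measure the register of `c` wires at `i`, using scratch wires at `j`. -/
def measureBlock (i j c : ℕ) : List Gate :=
  (List.range c).flatMap fun l => [.cnot (i + l) (j + l), .reset (j + l)]

def swapWires (i j c : ℕ) (s : ℕ → Bool) : ℕ → Bool := fun k =>
  if i ≤ k ∧ k < i + c then s (k - i + j) else if j ≤ k ∧ k < j + c then s (k - j + i) else s k

def addWires (i j c : ℕ) (s : ℕ → Bool) : ℕ → Bool := fun k =>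
  if j ≤ k ∧ k < j + c then xor (s k) (s (k - j + i)) else s k

def clearWires (i c : ℕ) (s : ℕ → Bool) : ℕ → Bool := fun k =>
  if i ≤ k ∧ k < i + c then false else s k

/-- Three `CNOT` gates exchange two bits; after `l` rounds the first `l` pairs have been exchanged.
-/
theorem act_swapBlock {i j c : ℕ} (h : i + c ≤ j ∨ j + c ≤ i) (s : ℕ → Bool) :
    actGates (swapBlock i j c) s = swapWires i j c s := by
  have h₀ : swapWires i j 0 s = s := by
    funext k; simp only [swapWires]; rw [if_neg (by omega), if_neg (by omega)]
  conv_lhs => rw [← h₀]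
  refine actGates_flatMap_range _ (fun l => swapWires i j l s) c fun l hl => ?_
  have e₁ : swapWires i j l s (i + l) = s (i + l) := by
    simp only [swapWires]; rw [if_neg (by omega), if_neg (by omega)]
  have e₂ : swapWires i j l s (j + l) = s (j + l) := by
    simp only [swapWires]; rw [if_neg (by omega), if_neg (by omega)]
  have e₃ : swapWires i j (l + 1) s (i + l) = s (j + l) := by
    simp only [swapWires]; rw [if_pos (by omega)]; congr 1; omega
  have e₄ : swapWires i j (l + 1) s (j + l) = s (i + l) := by
    simp only [swapWires]; rw [if_neg (by omega), if_pos (by omega)]; congr 1; omega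
  have hij : i + l ≠ j + l := by omega
  funext k
  simp only [actGates, Gate.act]
  by_cases h₁ : k = i + l
  · subst h₁
    simp only [Function.update_self, Function.update_of_ne hij, Function.update_of_ne hij.symm,
      e₁, e₂, e₃]
    cases s (i + l) <;> cases s (j + l) <;> rfl
  · by_cases h₂ : k = j + l
    · subst h₂
      simp only [Function.update_self, Function.update_of_ne hij, Function.update_of_ne hij.symm,
        e₁, e₂, e₄]
      cases s (i + l) <;> cases s (j + l) <;> rfl
    · rw [Function.update_of_ne h₂, Function.update_of_ne h₁, Function.update_of_ne h₂]
      simp only [swapWires]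
      split_ifs <;> first | rfl | omega

theorem leak_swapBlock (i j c : ℕ) (s : ℕ → Bool) : leakGates (swapBlock i j c) s = [] := by
  rw [swapBlock]
  generalize List.range c = ls
  induction ls generalizing s with
  | nil => rfl
  | cons l ls ih => rw [List.flatMap_cons, leakGates_append, ih]; rfl

theorem act_copyBlock {i j c : ℕ} (h : i + c ≤ j ∨ j + c ≤ i) (s : ℕ → Bool) :
    actGates (copyBlock i j c) s = addWires i j c s := by
  have h₀ : addWires i j 0 s = s := by
    funext k; simp only [addWires]; rw [if_neg (by omega)]
  conv_lhs => rw [← h₀]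
  refine actGates_flatMap_range _ (fun l => addWires i j l s) c fun l hl => ?_
  funext k
  simp only [actGates, Gate.act, Function.update_apply, addWires]
  grind

theorem leak_copyBlock (i j c : ℕ) (s : ℕ → Bool) : leakGates (copyBlock i j c) s = [] := by
  rw [copyBlock]
  generalize List.range c = ls
  induction ls generalizing s with
  | nil => rfl
  | cons l ls ih => rw [List.flatMap_cons, leakGates_append, ih]; rfl

theorem act_resetBlock (i c : ℕ) (s : ℕ → Bool) :
    actGates (resetBlock i c) s = clearWires i c s := by
  have h₀ : clearWires i 0 s = s := by
    funext k; simp only [clearWires]; rw [if_neg (by omega)]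
  conv_lhs => rw [← h₀]
  refine actGates_flatMap_range _ (fun l => clearWires i l s) c fun l hl => ?_
  funext k
  simp only [actGates, Gate.act, Function.update_apply, clearWires]
  grind

theorem leak_resetBlock_iff (i c : ℕ) (s t : ℕ → Bool) :
    leakGates (resetBlock i c) s = leakGates (resetBlock i c) t ↔
      ∀ l < c, s (i + l) = t (i + l) := by
  have h₀ : ∀ s, clearWires i 0 s = s := fun s => by
    funext k; simp only [clearWires]; rw [if_neg (by omega)]
  have hX : ∀ s, ∀ l < c, actGates [Gate.reset (i + l)] (clearWires i l s) =
      clearWires i (l + 1) s := by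
    intro s l _
    funext k
    simp only [actGates, Gate.act, Function.update_apply, clearWires]
    grind
  have := leakGates_flatMap_range_iff (fun l => [Gate.reset (i + l)])
    (fun l => clearWires i l s) (fun l => clearWires i l t) c (hX s) (hX t)
  simp only [h₀] at this
  rw [resetBlock, this]
  refine forall_congr' fun l => forall_congr' fun _ => ?_
  simp [leakGates, Gate.leak, clearWires]

theorem act_measureBlock {i j c : ℕ} (h : i + c ≤ j ∨ j + c ≤ i) (s : ℕ → Bool)
    (hs : ∀ l < c, s (j + l) = false) : actGates (measureBlock i j c) s = s := by
  refine actGates_flatMap_range _ (fun _ => s) c fun l hl => ?_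
  funext k
  simp only [actGates, Gate.act, Function.update_apply]
  grind

/-- Discarding a copy of a bit amounts to measuring it. The scratch wires have to be zero for the
`CNOT` to produce a faithful copy. -/
theorem leak_measureBlock_iff {i j c : ℕ} (h : i + c ≤ j ∨ j + c ≤ i) (s t : ℕ → Bool)
    (hs : ∀ l < c, s (j + l) = false) (ht : ∀ l < c, t (j + l) = false) :
    leakGates (measureBlock i j c) s = leakGates (measureBlock i j c) t ↔
      ∀ l < c, s (i + l) = t (i + l) := by
  have hX : ∀ s : ℕ → Bool, (∀ l < c, s (j + l) = false) → ∀ l < c,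
      actGates [Gate.cnot (i + l) (j + l), Gate.reset (j + l)] s = s := by
    intro s hs l hl
    funext k
    simp only [actGates, Gate.act, Function.update_apply]
    grind
  rw [measureBlock, leakGates_flatMap_range_iff _ (fun _ => s) (fun _ => t) c (hX s hs) (hX t ht)]
  refine forall_congr' fun l => forall_congr' fun hl => ?_
  simp [leakGates, Gate.leak, Gate.act, hs l hl, ht l hl]

theorem isClassical_flatMap_range {body : ℕ → List Gate} {c : ℕ}
    (h : ∀ l < c, ∀ g ∈ body l, g.IsClassical N) :
    ∀ g ∈ (List.range c).flatMap body, g.IsClassical N := by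
  intro g hg
  obtain ⟨l, hl, hg⟩ := List.mem_flatMap.1 hg
  exact h l (List.mem_range.1 hl) g hg

theorem isClassical_swapBlock {i j c : ℕ} (hi : i + c ≤ N) (hj : j + c ≤ N) :
    ∀ g ∈ swapBlock i j c, g.IsClassical N :=
  isClassical_flatMap_range fun l hl g hg => by
    simp only [List.mem_cons, List.not_mem_nil, or_false] at hg
    rcases hg with rfl | rfl | rfl <;> exact ⟨by omega, by omega⟩

theorem isClassical_copyBlock {i j c : ℕ} (hi : i + c ≤ N) (hj : j + c ≤ N) :
    ∀ g ∈ copyBlock i j c, g.IsClassical N :=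
  isClassical_flatMap_range fun l hl g hg => by
    simp only [List.mem_cons, List.not_mem_nil, or_false] at hg
    subst hg; exact ⟨by omega, by omega⟩

theorem isClassical_resetBlock {i c : ℕ} (hi : i + c ≤ N) :
    ∀ g ∈ resetBlock i c, g.IsClassical N :=
  isClassical_flatMap_range fun l hl g hg => by
    simp only [List.mem_cons, List.not_mem_nil, or_false] at hg
    subst hg; exact (by omega : i + l < N)

theorem isClassical_measureBlock {i j c : ℕ} (hi : i + c ≤ N) (hj : j + c ≤ N) :
    ∀ g ∈ measureBlock i j c, g.IsClassical N :=
  isClassical_flatMap_range fun l hl g hg => by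
    simp only [List.mem_cons, List.not_mem_nil, or_false] at hg
    rcases hg with rfl | rfl
    exacts [⟨by omega, by omega⟩, (by omega : j + l < N)]

theorem run_swapBlock (O : List QOracle) {i j c : ℕ} (hi : i + c ≤ N) (hj : j + c ≤ N)
    (h : i + c ≤ j ∨ j + c ≤ i) (s t : ℕ → Bool) :
    runGates O N (swapBlock i j c) (kb N s t) =
      kb N (swapWires i j c s) (swapWires i j c t) := by
  rw [runGates_classical O _ (isClassical_swapBlock hi hj), leak_swapBlock, leak_swapBlock,
    if_pos rfl, act_swapBlock h, act_swapBlock h]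

theorem run_copyBlock (O : List QOracle) {i j c : ℕ} (hi : i + c ≤ N) (hj : j + c ≤ N)
    (h : i + c ≤ j ∨ j + c ≤ i) (s t : ℕ → Bool) :
    runGates O N (copyBlock i j c) (kb N s t) =
      kb N (addWires i j c s) (addWires i j c t) := by
  rw [runGates_classical O _ (isClassical_copyBlock hi hj), leak_copyBlock, leak_copyBlock,
    if_pos rfl, act_copyBlock h, act_copyBlock h]

theorem run_resetBlock (O : List QOracle) {i c : ℕ} (hi : i + c ≤ N) (s t : ℕ → Bool) :
    runGates O N (resetBlock i c) (kb N s t) = if readWires i c s = readWires i c t then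
      kb N (clearWires i c s) (clearWires i c t) else 0 := by
  rw [runGates_classical O _ (isClassical_resetBlock hi), act_resetBlock, act_resetBlock]
  simp only [leak_resetBlock_iff, readWires_eq_iff]

end Classical

end QCrypt

/-! ### Circuits for the one-time pad, for encryption and for decryption -/

namespace QCrypt

/-! ### The quantum one-time pad on basis operators -/

/-- The sign `(-1) ^ b`. -/
def sgn (b : Bool) : ℂ := if b then -1 else 1

theorem star_sgn (b : Bool) : star (sgn b) = sgn b := by cases b <;> simp [sgn]

theorem sgn_mul_self (b : Bool) : sgn b * sgn b = 1 := by cases b <;> simp [sgn]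

/-- The sign that the pad with key `s` gives to the basis state `u`. -/
def padSign {n : ℕ} (s : Bits (2 * n)) (u : Bits n) : ℂ :=
  ∏ j : Fin n, sgn (s ⟨2 * j + 1, by omega⟩ && u j)

/-- The basis state to which the pad with key `s` takes the basis state `u`. -/
def padShift {n : ℕ} (s : Bits (2 * n)) (u : Bits n) : Bits n :=
  fun j => xor (u j) (s ⟨2 * j, by omega⟩)

section Pad

variable {n : ℕ}

theorem star_padSign (s : Bits (2 * n)) (u : Bits n) : star (padSign s u) = padSign s u := by
  simp only [padSign, star_prod, star_sgn]

theorem padSign_mul_self (s : Bits (2 * n)) (u : Bits n) : padSign s u * padSign s u = 1 := by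
  simp only [padSign, ← Finset.prod_mul_distrib, sgn_mul_self, Finset.prod_const_one]

theorem padShift_padShift (s : Bits (2 * n)) (u : Bits n) : padShift s (padShift s u) = u := by
  funext j; simp [padShift]

/-- Each factor `X ^ a * Z ^ b` is a monomial matrix, so the pad takes a basis state to a single
shifted basis state with a sign. -/
theorem pad_apply (s : Bits (2 * n)) (x u : Bits n) :
    pad s x u = if x = padShift s u then padSign s u else 0 := by
  have h : ∀ (a b x u : Bool), (pauliX ^ a.toNat * pauliZ ^ b.toNat) x u =
      if x = xor u a then sgn (b && u) else 0 := by
    intro a b x u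
    cases a <;> cases b <;> cases x <;> cases u <;>
      simp [pauliX, pauliZ, sgn, Matrix.mul_apply, Matrix.one_apply]
  simp only [pad, Matrix.of_apply, h]
  rw [Finset.prod_ite_zero]
  simp only [Finset.mem_univ, true_implies, padSign, padShift, funext_iff]

theorem conjBy_pad (s : Bits (2 * n)) (u v : Bits n) :
    conjBy (pad s) (ketbra₂ u v) =
      (padSign s u * padSign s v) • ketbra₂ (padShift s u) (padShift s v) := by
  ext a b
  rw [conjBy_ketbra₂_apply, pad_apply, pad_apply, Matrix.smul_apply, ketbra₂_apply, smul_eq_mul]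
  simp only [apply_ite star, star_padSign, star_zero]
  split_ifs <;> simp

theorem tensor_ketbra_ketbra₂ {a b : ℕ} (r : Bits a) (u v : Bits b) :
    tensor (ketbra r) (ketbra₂ u v) = ketbra₂ (Fin.append r u) (Fin.append r v) := by
  have h : ∀ (x : Bits (a + b)) (u : Bits b), x = Fin.append r u ↔ fstBits x = r ∧ sndBits x = u := by
    intro x u
    constructor
    · rintro rfl
      exact ⟨funext fun i => by simp [fstBits], funext fun i => by simp [sndBits]⟩
    · rintro ⟨rfl, rfl⟩
      exact (Fin.append_castAdd_natAdd (f := x)).symm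
  ext x y
  change ketbra₂ r r (fstBits x) (fstBits y) * ketbra₂ u v (sndBits x) (sndBits y) = _
  simp only [ketbra₂_apply, h, ite_and_one]
  ring

theorem padEnc_ketbra₂ (g : Bits (2 * n) → Bits (2 * n)) (u v : Bits n) :
    padEnc g (ketbra₂ u v) = (1 / 2 : ℂ) ^ (2 * n) • ∑ r, (padSign (g r) u * padSign (g r) v) •
      ketbra₂ (Fin.append r (padShift (g r) u)) (Fin.append r (padShift (g r) v)) := by
  have h : ∀ (c : ℂ) (r : Bits (2 * n)) (ρ : Op n), tensor (ketbra r) (c • ρ) =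
      c • tensor (ketbra r) ρ := by
    intro c r ρ
    ext x y
    simp [tensor]; ring
  change (1 / Fintype.card (Bits (2 * n)) : ℂ) •
    ∑ r, tensor (ketbra r) (conjBy (pad (g r)) (ketbra₂ u v)) = _
  congr 1
  · simp
  · refine Finset.sum_congr rfl fun r _ => ?_
    rw [conjBy_pad, h, tensor_ketbra_ketbra₂]

theorem padDec_ketbra₂ (g : Bits (2 * n) → Bits (2 * n)) (p q : Bits (2 * n + n)) :
    padDec g (ketbra₂ p q) = if fstBits p = fstBits q then
      (padSign (g (fstBits p)) (sndBits p) * padSign (g (fstBits p)) (sndBits q)) •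
        ketbra₂ (padShift (g (fstBits p)) (sndBits p)) (padShift (g (fstBits p)) (sndBits q))
      else 0 := by
  have h : ∀ (r : Bits (2 * n)) (x : Bits n) (p : Bits (2 * n + n)), Fin.append r x = p ↔
      r = fstBits p ∧ x = sndBits p := by
    intro r u x
    constructor
    · rintro rfl
      exact ⟨funext fun i => by simp [fstBits], funext fun i => by simp [sndBits]⟩
    · rintro ⟨rfl, rfl⟩
      exact Fin.append_castAdd_natAdd (f := x)
  have e : ∀ r : Bits (2 * n), (Matrix.of fun x y => (ketbra₂ p q : Op (2 * n + n))
      (Fin.append r x) (Fin.append r y) : Op n) =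
      ((if r = fstBits p then 1 else 0) * (if r = fstBits q then 1 else 0) : ℂ) •
        ketbra₂ (sndBits p) (sndBits q) := by
    intro r
    ext x y
    rw [Matrix.of_apply, Matrix.smul_apply, ketbra₂_apply, ketbra₂_apply]
    simp only [h, ite_and_one, smul_eq_mul]
    ring
  change ∑ r, conjBy (pad (g r)) (Matrix.of fun x y => (ketbra₂ p q : Op (2 * n + n))
      (Fin.append r x) (Fin.append r y)) = _
  simp only [e, conjBy_smul, conjBy_pad]
  rw [Finset.sum_eq_single (fstBits p)]
  · by_cases hpq : fstBits p = fstBits q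
    · simp [hpq]
    · simp [hpq]
  · intro r _ hr
    simp [hr]
  · simp

end Pad

/-! ### Coins and controlled pads -/

/-- Put fair coins into the register of `c` wires at `i`, using the scratch wire `m`. -/
def coinBlock (m i c : ℕ) : List Gate :=
  (List.range c).flatMap fun l => [.h (i + l), .cnot (i + l) m, .reset m]

/-- Apply the pad, with the key in the register at `2 * n`, to the register of `n` wires at `d`. -/
def padBlock (n d : ℕ) : List Gate :=
  (List.range n).flatMap fun l =>
    [.h (d + l), .cnot (2 * n + 2 * l + 1) (d + l), .h (d + l), .cnot (2 * n + 2 * l) (d + l)]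

section Blocks

variable {N : ℕ}

theorem runGates_flatMap_range (O : List QOracle) (body : ℕ → List Gate) (X Y : ℕ → ℕ → Bool)
    (w : ℕ → ℂ) (c : ℕ)
    (h : ∀ l < c, runGates O N (body l) (kb N (X l) (Y l)) = w l • kb N (X (l + 1)) (Y (l + 1))) :
    runGates O N ((List.range c).flatMap body) (kb N (X 0) (Y 0)) =
      (∏ l ∈ Finset.range c, w l) • kb N (X c) (Y c) := by
  induction c with
  | zero => simp
  | succ c ih =>
    rw [List.range_succ, List.flatMap_append, runGates_append, ih fun l hl => h l (by omega),
      List.flatMap_singleton, map_smul, h c (by omega), smul_smul, Finset.prod_range_succ]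

theorem lin_h (O : List QOracle) {i : ℕ} (hi : i < N) (s t : ℕ → Bool) :
    (Gate.h i).lin O N (kb N s t) = ∑ b, ∑ c, (hadamard b (s i) * star (hadamard c (t i))) •
      kb N (Function.update s i b) (Function.update t i c) := by
  rw [Gate.lin_apply, Gate.apply, conjBy_oneQubit _ hi]
  simp only [getBit_ket _ hi, setBit_ket]

theorem inv_sqrt_two_mul_self : (1 / Real.sqrt 2 : ℂ) * (1 / Real.sqrt 2 : ℂ) = 1 / 2 := by
  rw [div_mul_div_comm, ← Complex.ofReal_mul, Real.mul_self_sqrt (by norm_num)]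
  norm_num

theorem star_hadamard (a b : Bool) : star (hadamard a b) = hadamard a b := by
  simp only [hadamard, Matrix.of_apply]
  split_ifs <;> simp

/-- The Hadamard gate produces a uniform superposition; copying the bit to `m` and discarding the
copy removes the off-diagonal terms, which leaves a fair classical bit. -/
theorem run_coin (O : List QOracle) {m i : ℕ} (hm : m < N) (hi : i < N) (him : i ≠ m)
    (s t : ℕ → Bool) (hs : s i = false) (ht : t i = false) (hs' : s m = false)
    (ht' : t m = false) :
    runGates O N [.h i, .cnot i m, .reset m] (kb N s t) =
      (1 / 2 : ℂ) • ∑ b, kb N (Function.update s i b) (Function.update t i b) := by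
  have key : ∀ b c, runGates O N [.cnot i m, .reset m]
      (kb N (Function.update s i b) (Function.update t i c)) =
      if b = c then kb N (Function.update s i b) (Function.update t i c) else 0 := by
    intro b c
    have act : ∀ (s : ℕ → Bool) b, s m = false →
        actGates [.cnot i m, .reset m] (Function.update s i b) = Function.update s i b := by
      intro s b hs
      funext k
      by_cases hk : k = m
      · subst hk; simp [actGates, Gate.act, Function.update_of_ne him.symm, hs]
      · simp [actGates, Gate.act, hk]
    rw [runGates_classical O _ ?_, act s b hs', act t c ht']
    · simp [leakGates, Gate.leak, Gate.act, Function.update_of_ne him.symm, hs', ht']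
    · intro g hg
      simp only [List.mem_cons, List.not_mem_nil, or_false] at hg
      rcases hg with rfl | rfl
      exacts [⟨hi, hm⟩, hm]
  rw [runGates_cons, lin_h O hi]
  simp only [map_sum, map_smul, key, star_hadamard]
  rw [Finset.smul_sum]
  refine Finset.sum_congr rfl fun b _ => ?_
  rw [Finset.sum_eq_single b, if_pos rfl]
  · rw [hs, ht]
    congr 1
    simp only [hadamard, Matrix.of_apply, Bool.and_false, Bool.false_eq_true, if_false, mul_one,
      inv_sqrt_two_mul_self]
  · intro c _ hc
    rw [if_neg (Ne.symm hc), smul_zero]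
  · simp

theorem writeWires_snoc {c i : ℕ} (r : Bits c) (b : Bool) (s : ℕ → Bool) :
    writeWires i (Fin.snoc (α := fun _ => Bool) r b : Bits (c + 1)) s =
      Function.update (writeWires i r s) (i + c) b := by
  funext k
  rw [Function.update_apply]
  by_cases hk : k = i + c
  · subst hk
    rw [if_pos rfl, writeWires_of_mem _ _ (Nat.lt_succ_self c)]
    exact Fin.snoc_last (α := fun _ => Bool) b r
  · rw [if_neg hk]
    by_cases h : i ≤ k ∧ k < i + c
    · obtain ⟨l, rfl⟩ := Nat.exists_eq_add_of_le h.1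
      have hl : l < c := by omega
      rw [writeWires_of_mem _ _ (by omega : l < c + 1), writeWires_of_mem _ _ hl]
      exact Fin.snoc_castSucc (α := fun _ => Bool) b r ⟨l, hl⟩
    · rw [writeWires_of_notMem _ _ (by omega), writeWires_of_notMem _ _ h]

/-- Each coin leaves the scratch wire at zero, so a single scratch wire serves all coins. -/
theorem run_coinBlock (O : List QOracle) {m i c : ℕ} (hm : m < N) (hi : i + c ≤ N)
    (him : m < i ∨ i + c ≤ m) (s t : ℕ → Bool) (hs : ∀ l < c, s (i + l) = false)
    (ht : ∀ l < c, t (i + l) = false) (hs' : s m = false) (ht' : t m = false) :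
    runGates O N (coinBlock m i c) (kb N s t) =
      (1 / 2 : ℂ) ^ c • ∑ r : Bits c, kb N (writeWires i r s) (writeWires i r t) := by
  induction c with
  | zero =>
    have : ∀ (r : Bits 0) (s : ℕ → Bool), writeWires i r s = s := fun r s => by
      funext k; exact writeWires_of_notMem _ _ (by omega)
    simp [coinBlock, this]
  | succ c ih =>
    have ih' := ih (by omega) (by omega) (fun l hl => hs l (by omega)) fun l hl => ht l (by omega)
    rw [coinBlock] at ih' ⊢
    rw [List.range_succ, List.flatMap_append, runGates_append, ih', List.flatMap_singleton,
      map_smul, map_sum, pow_succ, mul_smul]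
    congr 1
    have step : ∀ r : Bits c, runGates O N [.h (i + c), .cnot (i + c) m, .reset m]
        (kb N (writeWires i r s) (writeWires i r t)) = (1 / 2 : ℂ) • ∑ b : Bool,
        kb N (writeWires i (Fin.snoc (α := fun _ => Bool) r b : Bits (c + 1)) s)
          (writeWires i (Fin.snoc (α := fun _ => Bool) r b : Bits (c + 1)) t) := by
      intro r
      simp only [writeWires_snoc]
      refine run_coin O hm (by omega) (by omega) _ _ ?_ ?_ ?_ ?_ <;>
        rw [writeWires_of_notMem _ _ (by omega)]
      exacts [hs c (by omega), ht c (by omega), hs', ht']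
    simp only [step]
    rw [← Finset.smul_sum]
    congr 1
    rw [← (Fin.snocEquiv fun _ : Fin (c + 1) => Bool).sum_comp, Fintype.sum_prod_type,
      Finset.sum_comm]
    rfl

/-- Conjugating `CNOT` by Hadamard gates on the target gives a controlled `Z`. -/
theorem run_controlled_z (O : List QOracle) {d u : ℕ} (hd : d < N) (hu : u < N) (hdu : d ≠ u)
    (s t : ℕ → Bool) :
    runGates O N [.h u, .cnot d u, .h u] (kb N s t) =
      (sgn (s d && s u) * sgn (t d && t u)) • kb N s t := by
  -- Operators whose row and column carry the superpositions `α` and `β` on wire `u`. All three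
  -- gates preserve this form and act on `α` and `β` separately.
  let B (α β : Bool → ℂ) : Op N := ∑ b, ∑ c, (α b * β c) •
    kb N (Function.update s u b) (Function.update t u c)
  have hB : ∀ α β, (Gate.h u).lin O N (B α β) =
      B (fun b => ∑ a, hadamard b a * α a) (fun b => ∑ a, hadamard b a * β a) := by
    intro α β
    simp only [B, map_add, map_smul, lin_h O hu, Function.update_self, Function.update_idem,
      star_hadamard, Fintype.sum_bool]
    module
  have cB : ∀ α β, (Gate.cnot d u).lin O N (B α β) =
      B (fun b => α (xor b (s d))) (fun b => β (xor b (t d))) := by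
    intro α β
    have one : ∀ s t : ℕ → Bool, (Gate.cnot d u).lin O N (kb N s t) =
        kb N (Function.update s u (xor (s u) (s d))) (Function.update t u (xor (t u) (t d))) := by
      intro s t
      have := runGates_classical O [Gate.cnot d u] (N := N) (by simp [Gate.IsClassical, hd, hu]) s t
      simpa [runGates_cons, leakGates, Gate.leak, actGates, Gate.act] using this
    simp only [B, map_add, map_smul, one, Function.update_self, Function.update_idem,
      Function.update_of_ne hdu, Fintype.sum_bool]
    cases s d <;> cases t d <;> simp only [Bool.xor_false, Bool.xor_true, Bool.not_true,
      Bool.not_false]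
    all_goals abel
  have start : kb N s t = B (fun b => if b = s u then 1 else 0) (fun b => if b = t u then 1 else 0) := by
    simp only [B]
    rw [Finset.sum_eq_single (s u), Finset.sum_eq_single (t u)]
    · simp
    · intro c _ hc; simp [hc]
    · simp
    · intro c _ hc; simp [hc]
    · simp
  -- The identity `H * X ^ d * H = Z ^ d`, applied to a basis state.
  have fin : ∀ x d : Bool, (fun b => ∑ a, hadamard b a * ∑ a', hadamard (xor a d) a' *
      (if a' = x then 1 else 0)) = fun b => sgn (d && x) * if b = x then 1 else 0 := by
    intro x d
    have h := inv_sqrt_two_mul_self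
    have h' : (Real.sqrt 2 : ℂ)⁻¹ * (Real.sqrt 2 : ℂ)⁻¹ = 1 / 2 := by simpa using h
    funext b
    cases b <;> cases x <;> cases d <;>
      simp [hadamard, sgn, h'] <;> norm_num
  rw [runGates_cons, runGates_cons, runGates_cons, runGates_nil, start, hB, cB, hB, fin, fin]
  simp only [B, Finset.smul_sum, smul_smul]
  refine Finset.sum_congr rfl fun b _ => Finset.sum_congr rfl fun c _ => ?_
  congr 1
  ring

/-- On every qubit the controlled `Z` comes before the controlled `X`, in accordance with the
product `X ^ a * Z ^ b` in `pad`. The key register ends at `4 * n ≤ d`, so it is not disturbed. -/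
theorem run_padBlock (O : List QOracle) {n d : ℕ} (hd : 4 * n ≤ d) (hN : d + n ≤ N)
    (s t : ℕ → Bool) :
    runGates O N (padBlock n d) (kb N s t) =
      (padSign (readWires (2 * n) (2 * n) s) (readWires d n s) *
        padSign (readWires (2 * n) (2 * n) t) (readWires d n t)) •
      kb N (writeWires d (padShift (readWires (2 * n) (2 * n) s) (readWires d n s)) s)
        (writeWires d (padShift (readWires (2 * n) (2 * n) t) (readWires d n t)) t) := by
  -- The assignment after `l` qubits have been shifted. The sign of qubit `l` is computed while that
  -- qubit still has its original value.
  let X (s : ℕ → Bool) (l k : ℕ) : Bool :=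
    if d ≤ k ∧ k < d + l then xor (s k) (s (2 * n + 2 * (k - d))) else s k
  have X0 : ∀ s, X s 0 = s := fun s => by funext k; simp only [X]; rw [if_neg (by omega)]
  have Xn : ∀ s, X s n = writeWires d (padShift (readWires (2 * n) (2 * n) s) (readWires d n s)) s := by
    intro s
    funext k
    by_cases h : d ≤ k ∧ k < d + n
    · obtain ⟨l, rfl⟩ := Nat.exists_eq_add_of_le h.1
      rw [writeWires_of_mem _ _ (by omega : l < n)]
      simp only [X, padShift, readWires]
      rw [if_pos h]
      simp
    · rw [writeWires_of_notMem _ _ h]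
      simp only [X]
      rw [if_neg h]
  have step : ∀ s, ∀ l < n, (Gate.cnot (2 * n + 2 * l) (d + l)).act (X s l) = X s (l + 1) := by
    intro s l hl
    funext k
    simp only [Gate.act, Function.update_apply, X]
    by_cases hk : k = d + l
    · subst hk
      rw [if_pos rfl, if_neg (by omega), if_neg (by omega), if_pos (by omega)]
      simp
    · rw [if_neg hk]
      simp only [show (d ≤ k ∧ k < d + l) ↔ (d ≤ k ∧ k < d + (l + 1)) by omega]
  have main := runGates_flatMap_range (N := N) O (fun l =>
    [.h (d + l), .cnot (2 * n + 2 * l + 1) (d + l), .h (d + l), .cnot (2 * n + 2 * l) (d + l)])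
    (X s) (X t) (fun l => sgn (s (2 * n + 2 * l + 1) && s (d + l)) *
      sgn (t (2 * n + 2 * l + 1) && t (d + l))) n fun l hl => by
    have e : ∀ s, X s l (2 * n + 2 * l + 1) = s (2 * n + 2 * l + 1) := fun s => by
      simp only [X]; rw [if_neg (by omega)]
    have e' : ∀ s, X s l (d + l) = s (d + l) := fun s => by
      simp only [X]; rw [if_neg (by omega)]
    rw [show ∀ a b c d : Gate, [a, b, c, d] = [a, b, c] ++ [d] from fun _ _ _ _ => rfl,
      runGates_append, run_controlled_z O (by omega) (by omega) (by omega), map_smul, e, e, e', e',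
      runGates_classical O _ (by simp [Gate.IsClassical]; omega)]
    simp only [leakGates, Gate.leak, if_true, actGates, step _ l hl, List.append_nil]
  rw [X0, X0, Xn, Xn] at main
  rw [padBlock, main]
  congr 1
  simp only [padSign, ← Finset.prod_mul_distrib, Finset.prod_range]
  rfl

end Blocks

end QCrypt

namespace QCrypt

/-! ### Encryption and decryption with a subroutine for the function -/

theorem writeWires_apply {a : ℕ} (i : ℕ) (u : Bits a) (s : ℕ → Bool) (k : ℕ) :
    writeWires i u s k = if i ≤ k ∧ k < i + a then getBit u (k - i) else s k := by
  rw [writeWires]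
  split_ifs with h
  · rw [getBit_of_lt]
  · rfl

theorem readWires_add_fst {i a b : ℕ} (s : ℕ → Bool) :
    fstBits (readWires i (a + b) s) = readWires i a s := rfl

theorem readWires_add_snd {i a b : ℕ} (s : ℕ → Bool) :
    sndBits (readWires i (a + b) s) = readWires (i + a) b s := by
  funext l; simp [sndBits, readWires, add_assoc]

theorem getBit_append {a b : ℕ} (u : Bits a) (v : Bits b) (k : ℕ) :
    getBit (Fin.append u v : Bits (a + b)) k = if k < a then getBit u k else getBit v (k - a) := by
  by_cases h : k < a
  · rw [if_pos h, getBit_of_lt _ h, getBit_of_lt _ (by omega)]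
    exact Fin.append_left u v ⟨k, h⟩
  · rw [if_neg h]
    by_cases h' : k < a + b
    · rw [getBit_of_lt _ h', getBit_of_lt _ (by omega)]
      have := Fin.append_right u v ⟨k - a, by omega⟩
      rw [← this]
      congr 1
      ext
      simp only [Fin.val_natAdd]
      omega
    · simp [getBit, h', show ¬ k - a < b by omega]

theorem writeWires_append {i a b : ℕ} (u : Bits a) (v : Bits b) (s : ℕ → Bool) :
    writeWires i (Fin.append u v : Bits (a + b)) s = writeWires i u (writeWires (i + a) v s) := by
  funext k
  simp only [writeWires_apply, getBit_append]
  split_ifs <;> first | rfl | omega | (congr 1; omega)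

/-- The state after the query in the register of `2 * n` wires at `0` has been answered by `g` in
the register at `2 * n`. -/
def answered {n : ℕ} (g : Bits (2 * n) → Bits (2 * n)) (s : ℕ → Bool) : ℕ → Bool :=
  writeWires 0 (zeros (2 * n)) (writeWires (2 * n) (g (readWires 0 (2 * n) s)) s)

/-- On the basis states that satisfy `P`, the list of gates measures the register of `2 * n` wires
at `0` and replaces the measured string by its image under `g` in the register at `2 * n`. -/
def Answers (O : List QOracle) (N : ℕ) {n : ℕ} (orc : List Gate) (g : Bits (2 * n) → Bits (2 * n))
    (P : (ℕ → Bool) → Prop) : Prop :=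
  ∀ s t, P s → P t → runGates O N orc (kb N s t) =
    if readWires 0 (2 * n) s = readWires 0 (2 * n) t then kb N (answered g s) (answered g t) else 0

/-- Replace the `n` qubits at `j + 2 * n` by their encryption at `j`. -/
def encCore (n : ℕ) (orc : List Gate) (j : ℕ) : List Gate :=
  coinBlock (4 * n) j (2 * n) ++ copyBlock j 0 (2 * n) ++ orc ++ padBlock n (j + 2 * n) ++
    resetBlock (2 * n) (2 * n)

/-- Replace the ciphertext at `i` by its decryption at `i + 2 * n`. -/
def decCore (n : ℕ) (orc : List Gate) (i : ℕ) : List Gate :=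
  copyBlock i 0 (2 * n) ++ orc ++ padBlock n (i + 2 * n) ++ resetBlock (2 * n) (2 * n)

section Core

variable {N n : ℕ} {O : List QOracle} {orc : List Gate} {g : Bits (2 * n) → Bits (2 * n)}
  {P : (ℕ → Bool) → Prop}

/-- The common tail of encryption and decryption. The query has been measured, so row and column
carry the same pad key; resetting the key register then destroys no further coherence. -/
theorem answered_run (h : Answers O N orc g P) {d : ℕ} (hd : 4 * n ≤ d) (hN : d + n ≤ N)
    {s t : ℕ → Bool} (hs : P s) (ht : P t) :
    runGates O N (orc ++ padBlock n d ++ resetBlock (2 * n) (2 * n)) (kb N s t) =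
      if readWires 0 (2 * n) s = readWires 0 (2 * n) t then
        (padSign (g (readWires 0 (2 * n) s)) (readWires d n s) *
          padSign (g (readWires 0 (2 * n) s)) (readWires d n t)) •
        kb N (clearWires 0 (4 * n)
            (writeWires d (padShift (g (readWires 0 (2 * n) s)) (readWires d n s)) s))
          (clearWires 0 (4 * n)
            (writeWires d (padShift (g (readWires 0 (2 * n) s)) (readWires d n t)) t))
        else 0 := by
  rw [runGates_append, runGates_append, h s t hs ht]
  by_cases hst : readWires 0 (2 * n) s = readWires 0 (2 * n) t
  · rw [if_pos hst, if_pos hst]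
    have e₁ : ∀ s, readWires (2 * n) (2 * n) (answered g s) = g (readWires 0 (2 * n) s) := by
      intro s
      rw [answered, readWires_writeWires_of_disjoint _ _ (by omega), readWires_writeWires]
    have e₂ : ∀ s, readWires d n (answered g s) = readWires d n s := by
      intro s
      rw [answered, readWires_writeWires_of_disjoint _ _ (by omega),
        readWires_writeWires_of_disjoint _ _ (by omega)]
    have e₃ : ∀ (u : Bits n) s, clearWires (2 * n) (2 * n) (writeWires d u (answered g s)) =
        clearWires 0 (4 * n) (writeWires d u s) := by
      intro u s
      funext k
      simp only [clearWires, writeWires_apply, answered, getBit_zeros]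
      grind
    rw [run_padBlock O hd hN, map_smul, run_resetBlock O (by omega), if_pos, e₁, e₁, e₂, e₂, e₃,
      e₃, hst]
    rw [readWires_writeWires_of_disjoint _ _ (by omega),
      readWires_writeWires_of_disjoint _ _ (by omega), e₁, e₁, hst]
  · rw [if_neg hst, if_neg hst, map_zero, map_zero]

/-- The coins are already classical, so copying them to the query register and measuring them there
has no additional effect. On the branch with coins `r` the answer `g r` serves as pad key, and all
wires below `4 * n` return to zero. -/
theorem run_encCore (h : Answers O N orc g P) {j : ℕ} (hj : 4 * n < j) (hN : j + (2 * n + n) ≤ N)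
    {s t : ℕ → Bool}
    (hs : ∀ r : Bits (2 * n), P (writeWires 0 r (writeWires j r s)))
    (ht : ∀ r : Bits (2 * n), P (writeWires 0 r (writeWires j r t)))
    (hs₀ : ∀ k ≤ 4 * n, s k = false) (ht₀ : ∀ k ≤ 4 * n, t k = false)
    (hs₁ : ∀ l < 2 * n, s (j + l) = false) (ht₁ : ∀ l < 2 * n, t (j + l) = false) :
    runGates O N (encCore n orc j) (kb N s t) =
      relocate (fun p : Bits (2 * n + n) => ket N (writeWires j p s))
        (fun p => ket N (writeWires j p t))
        (padEnc g (ketbra₂ (readWires (j + 2 * n) n s) (readWires (j + 2 * n) n t))) := by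
  have e₁ : ∀ (s : ℕ → Bool), (∀ k ≤ 4 * n, s k = false) → ∀ r : Bits (2 * n),
      addWires j 0 (2 * n) (writeWires j r s) = writeWires 0 r (writeWires j r s) := by
    intro s hs r
    funext k
    simp only [addWires, writeWires_apply]
    by_cases hk : k < 2 * n
    · rw [if_pos (by omega), if_neg (by omega), if_pos (by omega), if_pos (by omega),
        hs k (by omega), Bool.false_xor]
      congr 1; omega
    · rw [if_neg (by omega), if_neg (by omega : ¬(0 ≤ k ∧ k < 0 + 2 * n))]
  have e₂ : ∀ (s : ℕ → Bool) (r : Bits (2 * n)),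
      readWires (j + 2 * n) n (writeWires 0 r (writeWires j r s)) =
      readWires (j + 2 * n) n s := by
    intro s r
    rw [readWires_writeWires_of_disjoint _ _ (by omega),
      readWires_writeWires_of_disjoint _ _ (by omega)]
  have e₃ : ∀ (s : ℕ → Bool), (∀ k ≤ 4 * n, s k = false) → ∀ (r : Bits (2 * n)) (u : Bits n),
      clearWires 0 (4 * n) (writeWires (j + 2 * n) u (writeWires 0 r (writeWires j r s))) =
      writeWires j (Fin.append r u : Bits (2 * n + n)) s := by
    intro s hs r u
    funext k
    rw [writeWires_append]
    simp only [clearWires, writeWires_apply]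
    by_cases hk : k < 4 * n
    · rw [if_pos (by omega), if_neg (by omega), if_neg (by omega), hs k (by omega)]
    · rw [if_neg (by omega), if_neg (by omega : ¬(0 ≤ k ∧ k < 0 + 2 * n))]
      split_ifs <;> first | rfl | omega
  rw [encCore, runGates_append, runGates_append, runGates_append, runGates_append,
    run_coinBlock O (by omega) (by omega) (by omega) _ _ hs₁ ht₁ (hs₀ _ le_rfl) (ht₀ _ le_rfl),
    ← runGates_append, ← runGates_append, ← runGates_append]
  simp only [map_smul, map_sum]
  rw [padEnc_ketbra₂, map_smul, map_sum]
  congr 1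
  refine Finset.sum_congr rfl fun r _ => ?_
  rw [← List.append_assoc, ← List.append_assoc, List.append_assoc, List.append_assoc,
    runGates_append, run_copyBlock O (by omega) (by omega) (by omega), e₁ s hs₀, e₁ t ht₀,
    ← List.append_assoc, answered_run h (by omega) (by omega) (hs r) (ht r)]
  rw [readWires_writeWires, readWires_writeWires, if_pos rfl, e₂, e₂, e₃ s hs₀, e₃ t ht₀,
    map_smul, relocate_ketbra₂]

/-- Copying the string of the ciphertext to the query register and having it answered measures it,
just as `padDec` does. -/
theorem run_decCore (h : Answers O N orc g P) {i : ℕ} (hi : 4 * n < i) (hN : i + (2 * n + n) ≤ N)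
    {s t : ℕ → Bool}
    (hs : P (writeWires 0 (readWires i (2 * n) s) s))
    (ht : P (writeWires 0 (readWires i (2 * n) t) t))
    (hs₀ : ∀ k < 4 * n, s k = false) (ht₀ : ∀ k < 4 * n, t k = false) :
    runGates O N (decCore n orc i) (kb N s t) =
      relocate (fun p : Bits n => ket N (writeWires (i + 2 * n) p s))
        (fun p => ket N (writeWires (i + 2 * n) p t))
        (padDec g (ketbra₂ (readWires i (2 * n + n) s) (readWires i (2 * n + n) t))) := by
  have e₁ : ∀ (s : ℕ → Bool), (∀ k < 4 * n, s k = false) →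
      addWires i 0 (2 * n) s = writeWires 0 (readWires i (2 * n) s) s := by
    intro s hs
    funext k
    simp only [addWires, writeWires_apply]
    by_cases hk : k < 2 * n
    · rw [if_pos (by omega), if_pos (by omega), hs k (by omega), Bool.false_xor,
        getBit_of_lt _ (by omega)]
      simp only [readWires]
      congr 1; omega
    · rw [if_neg (by omega), if_neg (by omega)]
  have e₂ : ∀ (s : ℕ → Bool) (r : Bits (2 * n)),
      readWires (i + 2 * n) n (writeWires 0 r s) = readWires (i + 2 * n) n s := by
    intro s r
    rw [readWires_writeWires_of_disjoint _ _ (by omega)]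
  have e₃ : ∀ (s : ℕ → Bool), (∀ k < 4 * n, s k = false) → ∀ (r : Bits (2 * n)) (u : Bits n),
      clearWires 0 (4 * n) (writeWires (i + 2 * n) u (writeWires 0 r s)) =
      writeWires (i + 2 * n) u s := by
    intro s hs r u
    funext k
    simp only [clearWires, writeWires_apply]
    by_cases hk : k < 4 * n
    · rw [if_pos (by omega), if_neg (by omega), hs k (by omega)]
    · rw [if_neg (by omega), if_neg (by omega : ¬(0 ≤ k ∧ k < 0 + 2 * n))]
  rw [decCore, List.append_assoc, List.append_assoc, runGates_append,
    run_copyBlock O (by omega) (by omega) (by omega), e₁ s hs₀, e₁ t ht₀, ← List.append_assoc,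
    answered_run h (by omega) (by omega) hs ht, padDec_ketbra₂]
  simp only [readWires_writeWires, readWires_add_fst, readWires_add_snd, e₂, e₃ s hs₀, e₃ t ht₀]
  split_ifs
  · rw [map_smul, relocate_ketbra₂]
  · rw [map_zero]

theorem classicalMap_ketbra₂ {a b : ℕ} (g : Bits a → Bits b) (u v : Bits a) :
    classicalMap g (ketbra₂ u v) = if u = v then ketbra₂ (g u) (g u) else 0 := by
  change ∑ x, (ketbra₂ u v : Op a) x x • ketbra (g x) = _
  simp only [ketbra₂_apply]
  rw [Finset.sum_eq_single u]
  · by_cases h : u = v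
    · simp [h, ketbra]
    · simp [h]
  · intro x _ hx; simp [hx]
  · simp

/-- A gate for a classical oracle answers the query if the wires for the answer are zero. -/
theorem answers_oracle (g : Bits (2 * n) → Bits (2 * n)) (hN : 4 * n ≤ N) :
    Answers [classicalOracle g] N [.oracle 0 0 (2 * n)] g
      fun s => ∀ k, 2 * n ≤ k → k < 4 * n → s k = false := by
  intro s t hs ht
  have hst : readReg (2 * n) (2 * n) (ket N s) = readReg (2 * n) (2 * n) (ket N t) := by
    rw [readReg_ket (by omega), readReg_ket (by omega), readWires_eq_iff]
    intro l hl
    rw [hs _ (by omega) (by omega), ht _ (by omega) (by omega)]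
  rw [runGates_cons, runGates_nil, Gate.lin_apply]
  change applyReg (classicalMap g) 0 (2 * n) (ketbra₂ (ket N s) (ket N t)) = _
  rw [applyReg_ketbra₂ _ (by omega) (by omega) (by omega), if_pos hst, classicalMap_ketbra₂,
    readReg_ket (by omega), readReg_ket (by omega)]
  split_ifs with h
  · rw [relocate_ketbra₂, writeReg_ket, writeReg_ket, writeReg_ket, writeReg_ket]
    simp only [answered, ← h]
  · rw [map_zero]

end Core

end QCrypt

/-! ### Simulation of an adversary with a single classical oracle -/

namespace QCrypt

/-! ### Compiling circuits with encryption and decryption oracles -/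

theorem relocate_relocate {N a b : ℕ} (F G : Bits a → Bits N) (F' G' : Bits b → Bits a) (A : Op b) :
    relocate F G (relocate F' G' A) = relocate (F ∘ F') (G ∘ G') A := by
  rw [relocate_apply F' G', relocate_apply (F ∘ F')]
  simp only [map_sum, map_smul, relocate_ketbra₂, Function.comp_apply]

theorem map_relocate {N M b : ℕ} (Φ : Op N →ₗ[ℂ] Op M) (F G : Bits b → Bits N)
    (F' G' : Bits b → Bits M) (A : Op b)
    (h : ∀ p q, Φ (ketbra₂ (F p) (G q)) = ketbra₂ (F' p) (G' q)) :
    Φ (relocate F G A) = relocate F' G' A := by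
  simp only [relocate_apply, map_sum, map_smul, h]

/-- The encryption oracle for the function `g`. -/
noncomputable def padEncOracle {n : ℕ} (g : Bits (2 * n) → Bits (2 * n)) : QOracle :=
  ⟨n, 2 * n + n, padEnc g⟩

/-- The decryption oracle for the function `g`. -/
noncomputable def padDecOracle {n : ℕ} (g : Bits (2 * n) → Bits (2 * n)) : QOracle :=
  ⟨2 * n + n, n, padDec g⟩

/-- Gates for an encryption query. -/
def encGates (n : ℕ) (orc : List Gate) (i j : ℕ) : List Gate :=
  resetBlock j (3 * n) ++ swapBlock i (j + 2 * n) n ++ encCore n orc j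

/-- Gates for a decryption query. -/
def decGates (n : ℕ) (orc : List Gate) (i j : ℕ) : List Gate :=
  resetBlock j n ++ decCore n orc i ++ swapBlock (i + 2 * n) j n ++ resetBlock i (2 * n)

/-- The gates that simulate a gate of a circuit with encryption and decryption oracles, whose wires
start at `off`. -/
def compileGate (n off : ℕ) : Gate → List Gate
  | .x i => [.x (off + i)]
  | .h i => [.h (off + i)]
  | .t i => [.t (off + i)]
  | .cnot c i => [.cnot (off + c) (off + i)]
  | .ccx c d i => [.ccx (off + c) (off + d) (off + i)]
  | .reset i => [.reset (off + i)]
  | .oracle 0 i j => encGates n [.oracle 0 0 (2 * n)] (off + i) (off + j)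
  | .oracle (_ + 1) i j => decGates n [.oracle 0 0 (2 * n)] (off + i) (off + j)

/-- The assignment that is `u` on the wires from `off` on, and `0` elsewhere. -/
def shiftBits {W : ℕ} (off : ℕ) (u : Bits W) : ℕ → Bool := writeWires off u fun _ => false

section Shift

variable {N W : ℕ}

theorem shiftBits_apply (off : ℕ) (u : Bits W) (k : ℕ) :
    shiftBits off u k = if off ≤ k then getBit u (k - off) else false := by
  rw [shiftBits, writeWires_apply]
  split_ifs with h₁ h₂ h₂
  · rfl
  · omega
  · simp [getBit, show ¬ k - off < W by omega]
  · rfl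

theorem shiftBits_add (off : ℕ) (u : Bits W) (i : ℕ) : shiftBits off u (off + i) = getBit u i := by
  rw [shiftBits_apply, if_pos (by omega), Nat.add_sub_cancel_left]

theorem readWires_shiftBits (off i a : ℕ) (u : Bits W) :
    readWires (off + i) a (shiftBits off u) = readReg i a u := by
  funext l
  simp only [readWires, readReg, add_assoc, shiftBits_add]

theorem update_shiftBits (off : ℕ) (u : Bits W) {i : ℕ} (hi : i < W) (b : Bool) :
    Function.update (shiftBits off u) (off + i) b = shiftBits off (setBit u i b) := by
  funext k
  simp only [Function.update_apply, shiftBits_apply, getBit_setBit]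
  grind

theorem writeWires_shiftBits (off : ℕ) (u : Bits W) {i a : ℕ} (hi : i + a ≤ W) (w : Bits a) :
    writeWires (off + i) w (shiftBits off u) = shiftBits off (writeReg i w u) := by
  funext k
  simp only [writeWires_apply, shiftBits_apply]
  by_cases h : off ≤ k ∧ k - off < W
  · rw [getBit_writeReg _ _ _ _ h.2]
    simp only [if_pos h.1, show (off + i ≤ k ∧ k < off + i + a) ↔ (i ≤ k - off ∧ k - off < i + a) by
      omega, Nat.sub_sub]
  · rw [if_neg (by omega)]
    split_ifs with h'
    · simp [getBit, show ¬ k - off < W by omega]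
    · rfl

theorem setBit_ket_shiftBits (off : ℕ) (u : Bits W) {i : ℕ} (hi : i < W) (b : Bool) :
    setBit (ket N (shiftBits off u)) (off + i) b = ket N (shiftBits off (setBit u i b)) := by
  rw [setBit_ket, update_shiftBits _ _ hi]

theorem getBit_ket_shiftBits {off : ℕ} (hN : off + W ≤ N) (u : Bits W) {i : ℕ} (hi : i < W) :
    getBit (ket N (shiftBits off u)) (off + i) = getBit u i := by
  rw [getBit_ket _ (by omega), shiftBits_add]

/-- Put the `W` wires of a circuit on the wires from `off` on, the other wires being zero. -/
noncomputable def place (N off : ℕ) {W : ℕ} : Op W →ₗ[ℂ] Op N :=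
  relocate (fun u => ket N (shiftBits off u)) fun u => ket N (shiftBits off u)

theorem place_ketbra₂ (off : ℕ) (u v : Bits W) :
    place N off (ketbra₂ u v) = kb N (shiftBits off u) (shiftBits off v) := relocate_ketbra₂ _ _ _ _

end Shift

section Compile

variable {N W n off : ℕ} (φ : Bits (2 * n) → Bits (2 * n))

/-- `applyReg` discards the output register and leaves zeros in the input register. The reset does
the former; the swap of the message with cleared wires of the output register does the latter and
puts the message in the place where `encCore` expects it. -/
theorem run_encGates (hoff : 4 * n < off) (hN : off + W ≤ N) {i j : ℕ} (hi : i + n ≤ W)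
    (hj : j + (2 * n + n) ≤ W) (hij : i + n ≤ j ∨ j + (2 * n + n) ≤ i) (u v : Bits W) :
    runGates [classicalOracle φ] N (encGates n [.oracle 0 0 (2 * n)] (off + i) (off + j))
      (kb N (shiftBits off u) (shiftBits off v)) =
      place N off (applyReg (padEnc φ) i j (ketbra₂ u v)) := by
  let s (u : Bits W) : ℕ → Bool :=
    swapWires (off + i) (off + j + 2 * n) n (clearWires (off + j) (3 * n) (shiftBits off u))
  have hs₀ : ∀ u, ∀ k ≤ 4 * n, s u k = false := by
    intro u k hk
    simp only [s, swapWires, clearWires, shiftBits_apply]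
    rw [if_neg (by omega), if_neg (by omega), if_neg (by omega), if_neg (by omega)]
  have hs₁ : ∀ u, ∀ l < 2 * n, s u (off + j + l) = false := by
    intro u l hl
    simp only [s, swapWires, clearWires]
    rw [if_neg (by omega), if_neg (by omega), if_pos (by omega)]
  have hs : ∀ u, ∀ r : Bits (2 * n), (fun s : ℕ → Bool => ∀ k, 2 * n ≤ k → k < 4 * n → s k = false)
      (writeWires 0 r (writeWires (off + j) r (s u))) := by
    intro u r k h₁ h₂
    rw [writeWires_of_notMem _ _ (by omega), writeWires_of_notMem _ _ (by omega), hs₀ u k (by omega)]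
  have e₁ : ∀ u, readWires (off + j + 2 * n) n (s u) = readReg i n u := by
    intro u
    rw [← readWires_shiftBits off]
    funext l
    have hl := l.2
    simp only [readWires, s, swapWires, clearWires]
    rw [if_neg (by omega), if_pos (by omega), if_neg (by omega)]
    congr 1; omega
  have e₂ : ∀ u (p : Bits (2 * n + n)), writeWires (off + j) p (s u) =
      shiftBits off (writeReg i (zeros n) (writeReg j p u)) := by
    intro u p
    rw [← writeWires_shiftBits _ _ hi, ← writeWires_shiftBits _ _ hj]
    funext k
    simp only [writeWires_apply, s, swapWires, clearWires, getBit_zeros]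
    by_cases h₁ : off + i ≤ k ∧ k < off + i + n
    · rw [if_neg (by omega), if_pos h₁, if_pos (by omega), if_pos (by omega)]
    · rw [if_neg h₁, if_neg h₁]
      by_cases h₂ : off + j ≤ k ∧ k < off + j + (2 * n + n)
      · rw [if_pos h₂, if_pos h₂]
      · rw [if_neg h₂, if_neg h₂, if_neg (by omega), if_neg (by omega)]
  rw [encGates, runGates_append, runGates_append, run_resetBlock _ (by omega),
    applyReg_ketbra₂ _ hi hj hij]
  rw [readWires_shiftBits, readWires_shiftBits]
  by_cases h : readReg j (2 * n + n) u = readReg j (2 * n + n) v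
  · have h' : readReg j (3 * n) u = readReg j (3 * n) v := by
      rw [readReg_eq_iff] at h ⊢
      intro k hk; exact h k (by omega)
    rw [if_pos h, if_pos h', run_swapBlock _ (by omega) (by omega) (by omega),
      run_encCore (answers_oracle φ (by omega)) (by omega) (by omega) (hs u) (hs v) (hs₀ u) (hs₀ v)
      (hs₁ u) (hs₁ v), place, relocate_relocate, e₁, e₁]
    congr 2
    · funext p; exact congrArg _ (e₂ u p)
    · funext p; exact congrArg _ (e₂ v p)
  · have h' : ¬ readReg j (3 * n) u = readReg j (3 * n) v := by
      rw [readReg_eq_iff] at h ⊢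
      exact fun h' => h fun k hk => h' k (by omega)
    rw [if_neg h, if_neg h', map_zero, map_zero, map_zero]

/-- The message is decrypted in place and exchanged with the cleared output register. What remains
of the ciphertext is the measured string; it agrees in row and column whenever `padDec` is nonzero
there, so its final reset costs no coherence. -/
theorem run_decGates (hoff : 4 * n < off) (hN : off + W ≤ N) {i j : ℕ} (hi : i + (2 * n + n) ≤ W)
    (hj : j + n ≤ W) (hij : i + (2 * n + n) ≤ j ∨ j + n ≤ i) (u v : Bits W) :
    runGates [classicalOracle φ] N (decGates n [.oracle 0 0 (2 * n)] (off + i) (off + j))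
      (kb N (shiftBits off u) (shiftBits off v)) =
      place N off (applyReg (padDec φ) i j (ketbra₂ u v)) := by
  let s (u : Bits W) : ℕ → Bool := clearWires (off + j) n (shiftBits off u)
  have hs₀ : ∀ u, ∀ k < 4 * n, s u k = false := by
    intro u k hk
    simp only [s, clearWires, shiftBits_apply]
    rw [if_neg (by omega), if_neg (by omega)]
  have hs : ∀ u, (fun s : ℕ → Bool => ∀ k, 2 * n ≤ k → k < 4 * n → s k = false)
      (writeWires 0 (readWires (off + i) (2 * n) (s u)) (s u)) := by
    intro u k h₁ h₂
    rw [writeWires_of_notMem _ _ (by omega), hs₀ u k (by omega)]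
  have e₁ : ∀ u, readWires (off + i) (2 * n + n) (s u) = readReg i (2 * n + n) u := by
    intro u
    rw [← readWires_shiftBits off, readWires_eq_iff]
    intro l hl
    simp only [s, clearWires]
    rw [if_neg (by omega)]
  have e₃ : ∀ u (p : Bits n), readWires (off + i) (2 * n)
      (swapWires (off + i + 2 * n) (off + j) n (writeWires (off + i + 2 * n) p (s u))) =
      readReg i (2 * n) u := by
    intro u p
    rw [← readWires_shiftBits off, readWires_eq_iff]
    intro l hl
    simp only [s, clearWires, swapWires, writeWires_apply]
    rw [if_neg (by omega), if_neg (by omega), if_neg (by omega), if_neg (by omega)]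
  have e₂ : ∀ u (p : Bits n), clearWires (off + i) (2 * n)
      (swapWires (off + i + 2 * n) (off + j) n (writeWires (off + i + 2 * n) p (s u))) =
      shiftBits off (writeReg i (zeros (2 * n + n)) (writeReg j p u)) := by
    intro u p
    rw [← writeWires_shiftBits _ _ hi, ← writeWires_shiftBits _ _ hj]
    funext k
    simp only [writeWires_apply, s, swapWires, clearWires, getBit_zeros]
    by_cases h₁ : off + i ≤ k ∧ k < off + i + (2 * n + n)
    · rw [if_pos h₁]
      by_cases h₂ : k < off + i + 2 * n
      · rw [if_pos (by omega)]
      · rw [if_neg (by omega), if_pos (by omega), if_neg (by omega), if_pos (by omega)]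
    · rw [if_neg (by omega), if_neg h₁, if_neg (by omega)]
      by_cases h₂ : off + j ≤ k ∧ k < off + j + n
      · rw [if_pos h₂, if_pos h₂, if_pos (by omega)]
        congr 1; omega
      · rw [if_neg h₂, if_neg h₂, if_neg (by omega), if_neg h₂]
  rw [decGates, runGates_append, runGates_append, runGates_append, run_resetBlock _ (by omega),
    applyReg_ketbra₂ _ hi hj hij]
  rw [readWires_shiftBits, readWires_shiftBits]
  by_cases h : readReg j n u = readReg j n v
  · rw [if_pos h, if_pos h, run_decCore (answers_oracle φ (by omega)) (by omega) (by omega) (hs u)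
      (hs v) (hs₀ u) (hs₀ v), e₁, e₁, padDec_ketbra₂]
    by_cases hf : fstBits (readReg i (2 * n + n) u) = fstBits (readReg i (2 * n + n) v)
    · have hf' : readReg i (2 * n) u = readReg i (2 * n) v := hf
      rw [if_pos hf, map_smul, map_smul, map_smul, map_smul, map_smul, relocate_ketbra₂,
        run_swapBlock _ (by omega) (by omega) (by omega), run_resetBlock _ (by omega), e₃, e₃,
        if_pos hf', e₂, e₂, relocate_ketbra₂, place_ketbra₂]
    · rw [if_neg hf]
      simp only [map_zero]
  · rw [if_neg h, if_neg h]
    simp only [map_zero]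

theorem run_compileGate (hoff : 4 * n < off) (hN : off + W ≤ N) (g : Gate)
    (hg : g.WF [(n, 2 * n + n), (2 * n + n, n)] W) (u v : Bits W) :
    runGates [classicalOracle φ] N (compileGate n off g)
      (kb N (shiftBits off u) (shiftBits off v)) =
      place N off (g.apply [padEncOracle φ, padDecOracle φ] (ketbra₂ u v)) := by
  have one : ∀ (U : Matrix Bool Bool ℂ) (i : ℕ), i < W →
      conjBy (oneQubit U (off + i)) (kb N (shiftBits off u) (shiftBits off v)) =
      place N off (conjBy (oneQubit U i) (ketbra₂ u v)) := by
    intro U i hi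
    rw [conjBy_oneQubit _ (by omega), conjBy_oneQubit _ hi]
    simp only [map_sum, map_smul, place_ketbra₂, getBit_ket_shiftBits hN _ hi,
      setBit_ket_shiftBits _ _ hi]
  cases g with
  | x i => exact one _ i hg
  | h i => exact one _ i hg
  | t i => exact one _ i hg
  | cnot c i =>
    obtain ⟨hc, hi, -⟩ := hg
    simp only [compileGate, runGates_cons, runGates_nil, Gate.lin_apply, Gate.apply,
      conjBy_basisMap, getBit_ket_shiftBits hN _ hi, getBit_ket_shiftBits hN _ hc,
      setBit_ket_shiftBits _ _ hi, place_ketbra₂]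
  | ccx c d i =>
    obtain ⟨hc, hd, hi, -⟩ := hg
    simp only [compileGate, runGates_cons, runGates_nil, Gate.lin_apply, Gate.apply,
      conjBy_basisMap, getBit_ket_shiftBits hN _ hi, getBit_ket_shiftBits hN _ hc,
      getBit_ket_shiftBits hN _ hd, setBit_ket_shiftBits _ _ hi, place_ketbra₂]
  | reset i =>
    have hi : i < W := hg
    simp only [compileGate, runGates_cons, runGates_nil, Gate.lin_apply, Gate.apply]
    rw [resetWire_ketbra₂ (by omega), resetWire_ketbra₂ hi]
    simp only [getBit_ket_shiftBits hN _ hi, setBit_ket_shiftBits _ _ hi]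
    split_ifs
    · rw [place_ketbra₂]
    · rw [map_zero]
  | oracle q i j =>
    obtain ⟨a, b, hab, hi, hj, hij⟩ := hg
    match q, hab with
    | 0, hab =>
      simp only [List.getElem?_cons_zero, Option.some.injEq, Prod.mk.injEq] at hab
      obtain ⟨rfl, rfl⟩ := hab
      exact run_encGates φ hoff hN hi hj hij u v
    | 1, hab =>
      simp only [List.getElem?_cons_succ, List.getElem?_cons_zero, Option.some.injEq,
        Prod.mk.injEq] at hab
      obtain ⟨rfl, rfl⟩ := hab
      exact run_decGates φ hoff hN hi hj hij u v
    | q + 2, hab => simp at hab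

/-- Placed operators stay placed: between simulated gates all wires outside the `W` simulated ones
are zero again. Linearity reduces the comparison for one gate to matrix units. -/
theorem run_compile (hoff : 4 * n < off) (hN : off + W ≤ N) (gs : List Gate)
    (hgs : ∀ g ∈ gs, g.WF [(n, 2 * n + n), (2 * n + n, n)] W) (ρ : Op W) :
    runGates [classicalOracle φ] N (gs.flatMap (compileGate n off)) (place N off ρ) =
      place N off (runGates [padEncOracle φ, padDecOracle φ] W gs ρ) := by
  induction gs generalizing ρ with
  | nil => rfl
  | cons g gs ih =>
    rw [List.flatMap_cons, runGates_append, runGates_cons,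
      ← ih fun g' h => hgs g' (List.mem_cons_of_mem _ h)]
    congr 1
    have : (runGates [classicalOracle φ] N (compileGate n off g) ∘ₗ place N off) =
        place N off ∘ₗ g.lin [padEncOracle φ, padDecOracle φ] W :=
      linearMap_op_ext fun u v => by
        rw [LinearMap.comp_apply, place_ketbra₂, LinearMap.comp_apply, Gate.lin_apply]
        exact run_compileGate φ hoff hN g (hgs g List.mem_cons_self) u v
    exact LinearMap.congr_fun this ρ

end Compile

end QCrypt

namespace QCrypt

/-! ### Linearity of the maps on states -/

/-- `tensorId Φ e` as a linear map. -/
noncomputable def tensorIdMap {a b : ℕ} (Φ : QMap a b) (e : ℕ) : Op (a + e) →ₗ[ℂ] Op (b + e) where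
  toFun := tensorId Φ e
  map_add' ρ σ := by
    ext x y
    simp only [tensorId, Matrix.of_apply, Matrix.add_apply]
    rw [← Matrix.add_apply, ← map_add]
    rfl
  map_smul' c ρ := by
    ext x y
    simp only [tensorId, Matrix.of_apply, Matrix.smul_apply, RingHom.id_apply]
    rw [← Matrix.smul_apply, ← map_smul]
    rfl

/-- `loadInput` as a linear map. -/
def loadInputMap (a N : ℕ) : Op a →ₗ[ℂ] Op N where
  toFun := loadInput N
  map_add' ρ σ := by
    ext x y
    simp only [loadInput, Matrix.of_apply, Matrix.add_apply]
    split_ifs <;> simp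
  map_smul' c ρ := by
    ext x y
    simp only [loadInput, Matrix.of_apply, Matrix.smul_apply, RingHom.id_apply]
    split_ifs <;> simp

/-- `keepOutput` as a linear map. -/
def keepOutputMap (N b : ℕ) : Op N →ₗ[ℂ] Op b where
  toFun := keepOutput b
  map_add' ρ σ := by
    ext x y
    simp only [keepOutput, Matrix.of_apply, Matrix.add_apply, ← Finset.sum_add_distrib]
    refine Finset.sum_congr rfl fun z _ => ?_
    split_ifs <;> simp
  map_smul' c ρ := by
    ext x y
    simp only [keepOutput, Matrix.of_apply, Matrix.smul_apply, RingHom.id_apply, Finset.smul_sum]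
    refine Finset.sum_congr rfl fun z _ => ?_
    split_ifs <;> simp

/-- Replace the first `n` qubits by `|0⟩`. -/
def zeroFstMap (n e : ℕ) : Op (n + e) →ₗ[ℂ] Op (n + e) where
  toFun ρ := tensor (ketbra (zeros n)) (traceFst ρ)
  map_add' ρ σ := by
    ext x y
    simp [tensor, traceFst, Finset.sum_add_distrib, mul_add]
  map_smul' c ρ := by
    ext x y
    simp only [tensor, traceFst, Matrix.of_apply, Matrix.smul_apply, RingHom.id_apply,
      smul_eq_mul, ← Finset.mul_sum]
    ring

theorem tensorId_ketbra₂ {a b : ℕ} (Φ : QMap a b) (e : ℕ) (p q : Bits (a + e)) :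
    tensorId Φ e (ketbra₂ p q) =
      relocate (fun x => Fin.append x (sndBits p)) (fun x => Fin.append x (sndBits q))
        (Φ (ketbra₂ (fstBits p) (fstBits q))) := by
  have h : ∀ {b : ℕ} (u : Bits b) (w : Bits e) (p : Bits (b + e)), p = Fin.append u w ↔
      u = fstBits p ∧ sndBits p = w := by
    intro b u w x
    constructor
    · rintro rfl
      exact ⟨funext fun i => by simp [fstBits], funext fun i => by simp [sndBits]⟩
    · rintro ⟨rfl, rfl⟩
      exact (Fin.append_castAdd_natAdd (f := x)).symm
  have h' : ∀ (u : Bits a) (w : Bits e) (p : Bits (a + e)), Fin.append u w = p ↔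
      u = fstBits p ∧ sndBits p = w := fun u w p => by rw [eq_comm, h]
  ext x y
  rw [tensorId, Matrix.of_apply, relocate_apply]
  have inner : (Matrix.of fun u v => (ketbra₂ p q : Op (a + e))
      (Fin.append u (sndBits x)) (Fin.append v (sndBits y)) : Op a) =
      ((if sndBits p = sndBits x then 1 else 0) * (if sndBits q = sndBits y then 1 else 0) : ℂ) •
        ketbra₂ (fstBits p) (fstBits q) := by
    ext u v
    rw [Matrix.of_apply, Matrix.smul_apply, ketbra₂_apply, ketbra₂_apply]
    simp only [h', ite_and_one, smul_eq_mul]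
    ring
  rw [inner, map_smul, Matrix.smul_apply, smul_eq_mul]
  simp only [Matrix.sum_apply, Matrix.smul_apply, ketbra₂_apply, h, ite_and_one, smul_eq_mul,
    @eq_comm _ (sndBits x), @eq_comm _ (sndBits y)]
  rw [Finset.sum_eq_single (fstBits x), Finset.sum_eq_single (fstBits y)]
  · simp only [if_true]; ring
  · intro v _ hv; simp [hv]
  · simp
  · intro u _ hu; simp [hu]
  · simp

theorem traceFst_ketbra₂ {a b : ℕ} (p q : Bits (a + b)) :
    traceFst (ketbra₂ p q) =
      if fstBits p = fstBits q then ketbra₂ (sndBits p) (sndBits q) else 0 := by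
  have h : ∀ (u : Bits a) (w : Bits b) (p : Bits (a + b)), Fin.append u w = p ↔
      u = fstBits p ∧ w = sndBits p := by
    intro u w x
    constructor
    · rintro rfl
      exact ⟨funext fun i => by simp [fstBits], funext fun i => by simp [sndBits]⟩
    · rintro ⟨rfl, rfl⟩
      exact Fin.append_castAdd_natAdd (f := x)
  ext u v
  rw [traceFst, Matrix.of_apply]
  simp only [ketbra₂_apply, h, ite_and_one]
  rw [Finset.sum_eq_single (fstBits p)]
  · by_cases hpq : fstBits p = fstBits q
    · simp [hpq, ketbra₂_apply]
    · simp [hpq]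
  · intro w _ hw; simp [hw]
  · simp

/-! ### The distinguisher that runs the game -/

/-- The gates that encrypt the challenge of the message generator (with `W` wires, starting at
`4 * n + 1`) and hand it over to the distinguisher, whose wires start at `4 * n + 1 + W`. -/
def transferGates (n e W : ℕ) : List Gate :=
  swapBlock (4 * n + 1) (4 * n + 1 + W + 2 * n) (n + e) ++
    encCore n [.oracle 0 0 (2 * n)] (4 * n + 1 + W) ++ resetBlock (4 * n + 1) W

/-- The gates of the distinguisher that runs the game with the gates of the message generator (on
`W` wires) and of the distinguisher of an adversary. -/
def gameGates (n e W : ℕ) (b : Bool) (gen dist : List Gate) : List Gate :=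
  gen.flatMap (compileGate n (4 * n + 1)) ++ (if b then [] else resetBlock (4 * n + 1) n) ++
    transferGates n e W ++ dist.flatMap (compileGate n (4 * n + 1 + W)) ++
    [.cnot (4 * n + 1 + W) 0]

section Game

variable {N W V n e : ℕ} (φ : Bits (2 * n) → Bits (2 * n))

/-- The output of the generator is moved so that the message occupies the last `n` wires of the
future ciphertext and the auxiliary register follows directly, which is the input layout of the
distinguisher. Clearing the wires of the generator is the partial trace in `keepOutput`. -/
theorem run_transferGates (hW : n + e ≤ W) (hV : 2 * n + n + e ≤ V) (hN : 4 * n + 1 + W + V ≤ N)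
    (u v : Bits W) :
    runGates [classicalOracle φ] N (transferGates n e W) (place N (4 * n + 1) (ketbra₂ u v)) =
      place N (4 * n + 1 + W) (loadInput V (tensorId (padEnc φ) e
        (keepOutput (n + e) (ketbra₂ u v)))) := by
  let s (u : Bits W) : ℕ → Bool :=
    swapWires (4 * n + 1) (4 * n + 1 + W + 2 * n) (n + e) (shiftBits (4 * n + 1) u)
  have hs₀ : ∀ u, ∀ k ≤ 4 * n, s u k = false := by
    intro u k hk
    simp only [s, swapWires, shiftBits_apply]
    rw [if_neg (by omega), if_neg (by omega), if_neg (by omega)]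
  have getBit_out : ∀ (u : Bits W) {k}, W ≤ k → getBit u k = false := by
    intro u k hk
    simp [getBit, show ¬ k < W by omega]
  have hs₁ : ∀ u, ∀ l < 2 * n, s u (4 * n + 1 + W + l) = false := by
    intro u l hl
    simp only [s, swapWires, shiftBits_apply]
    rw [if_neg (by omega), if_neg (by omega), if_pos (by omega), getBit_out _ (by omega)]
  have hs : ∀ u, ∀ r : Bits (2 * n), (fun s : ℕ → Bool => ∀ k, 2 * n ≤ k → k < 4 * n → s k = false)
      (writeWires 0 r (writeWires (4 * n + 1 + W) r (s u))) := by
    intro u r k h₁ h₂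
    rw [writeWires_of_notMem _ _ (by omega), writeWires_of_notMem _ _ (by omega), hs₀ u k (by omega)]
  have e₁ : ∀ u, readWires (4 * n + 1 + W + 2 * n) n (s u) = fstBits (readReg 0 (n + e) u) := by
    intro u
    funext l
    have hl := l.2
    simp only [readWires, s, swapWires, shiftBits_apply, fstBits, readReg, Fin.val_castAdd]
    rw [if_neg (by omega), if_pos (by omega), if_pos (by omega)]
    congr 1; omega
  -- The swap has brought zeros to the first `n + e` wires of the generator. So clearing all `W`
  -- wires compares exactly the bits that `keepOutput` traces out.
  have e₂ : ∀ u (p : Bits (2 * n + n)), readWires (4 * n + 1) W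
      (writeWires (4 * n + 1 + W) p (s u)) = fun l : Fin W =>
        if (l : ℕ) < n + e then false else u l := by
    intro u p
    funext l
    have hl := l.2
    simp only [readWires, writeWires_apply, s, swapWires, shiftBits_apply]
    rw [if_neg (by omega)]
    by_cases h : (l : ℕ) < n + e
    · rw [if_pos (by omega), if_pos (by omega), getBit_out _ (by omega), if_pos h]
    · rw [if_neg (by omega), if_neg (by omega), if_pos (by omega), if_neg h, getBit_of_lt _ (by omega)]
      congr 1; ext; simp
  have cond : ((fun l : Fin W => if (l : ℕ) < n + e then false else u l) =
      fun l : Fin W => if (l : ℕ) < n + e then false else v l) ↔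
      ∀ k < W, n + e ≤ k → getBit u k = getBit v k := by
    rw [funext_iff]
    constructor
    · intro h k hk hk'
      have := h ⟨k, hk⟩
      simp only [if_neg (show ¬ k < n + e by omega)] at this
      rwa [getBit_of_lt _ hk, getBit_of_lt _ hk]
    · intro h l
      split_ifs with h'
      · rfl
      · have := h l l.2 (by omega)
        simpa using this
  have e₃ : ∀ u (p : Bits (2 * n + n)), ket N (clearWires (4 * n + 1) W
      (writeWires (4 * n + 1 + W) p (s u))) = ket N (shiftBits (4 * n + 1 + W)
        (writeReg 0 (Fin.append p (sndBits (readReg 0 (n + e) u))) (zeros V))) := by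
    intro u p
    refine ket_congr fun k hk => ?_
    rw [shiftBits_apply]
    simp only [clearWires]
    by_cases h₁ : k < 4 * n + 1 + W
    · rw [if_neg (show ¬ 4 * n + 1 + W ≤ k by omega)]
      split_ifs with h₂
      · rfl
      · rw [writeWires_of_notMem _ _ (by omega), hs₀ u k (by omega)]
    · rw [if_neg (by omega), if_pos (by omega), writeWires_apply]
      by_cases h₂ : k < 4 * n + 1 + W + V
      · rw [getBit_writeReg _ _ _ _ (by omega), getBit_zeros, Nat.sub_zero, getBit_append]
        by_cases h₃ : k < 4 * n + 1 + W + (2 * n + n)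
        · rw [if_pos (by omega), if_pos (by omega), if_pos (by omega)]
        · rw [if_neg (by omega)]
          simp only [s, swapWires, shiftBits_apply]
          rw [if_neg (by omega)]
          by_cases h₄ : k < 4 * n + 1 + W + (2 * n + n + e)
          · rw [if_pos (by omega), if_pos (by omega), if_pos (by omega), if_neg (by omega)]
            rw [getBit_of_lt (sndBits (readReg 0 (n + e) u)) (by omega)]
            simp only [sndBits, readReg, Fin.val_natAdd]
            congr 1; omega
          · rw [if_neg (by omega), if_pos (by omega), if_neg (by omega), getBit_out _ (by omega)]
      · rw [if_neg (by omega)]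
        simp only [s, swapWires, shiftBits_apply]
        rw [if_neg (by omega), if_neg (by omega), if_pos (by omega), getBit_out _ (by omega)]
        simp [getBit, show ¬ k - (4 * n + 1 + W) < V by omega]
  rw [place_ketbra₂, transferGates, runGates_append, runGates_append,
    run_swapBlock _ (by omega) (by omega) (by omega),
    run_encCore (answers_oracle φ (by omega)) (by omega) (by omega) (hs u) (hs v) (hs₀ u) (hs₀ v)
      (hs₁ u) (hs₁ v), e₁, e₁, keepOutput_ketbra₂ hW]
  by_cases h : ∀ k < W, n + e ≤ k → getBit u k = getBit v k
  · rw [if_pos h, tensorId_ketbra₂]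
    have hl : ∀ A, loadInputMap (2 * n + n + e) V A =
        relocate (fun u => writeReg 0 u (zeros V)) (fun u => writeReg 0 u (zeros V)) A := by
      refine LinearMap.congr_fun (linearMap_op_ext fun u v => ?_)
      rw [relocate_ketbra₂]
      exact loadInput_ketbra₂ (by omega) u v
    rw [show ∀ A : Op (2 * n + n + e), loadInput V A = loadInputMap _ V A from fun _ => rfl, hl,
      place, relocate_relocate, relocate_relocate]
    refine map_relocate _ _ _ _ _ _ fun p q => ?_
    rw [run_resetBlock _ (by omega), e₂, e₂, if_pos (cond.2 h), kb, e₃, e₃]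
    rfl
  · rw [if_neg h]
    have : tensorId (padEnc φ) e 0 = 0 := map_zero (tensorIdMap (padEnc φ) e)
    rw [this]
    have : loadInput V (0 : Op (2 * n + n + e)) = 0 := map_zero (loadInputMap _ V)
    rw [this, map_zero, relocate_apply]
    simp only [map_sum, map_smul]
    refine Finset.sum_eq_zero fun p _ => Finset.sum_eq_zero fun q _ => ?_
    rw [run_resetBlock _ (by omega), e₂, e₂, if_neg (fun h' => h (cond.1 h')), smul_zero]

/-- Resetting the message wires is the map that traces out the message and inserts `|0⟩`. The
operator is left existential because on a matrix unit the result is either a matrix unit or zero. -/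
theorem run_reset_message (hW : n + e ≤ W) (hN : 4 * n + 1 + W ≤ N) (O : List QOracle)
    (u v : Bits W) :
    ∃ ρ : Op W, runGates O N (resetBlock (4 * n + 1) n) (place N (4 * n + 1) (ketbra₂ u v)) =
        place N (4 * n + 1) ρ ∧
      keepOutput (n + e) ρ = zeroFstMap n e (keepOutput (n + e) (ketbra₂ u v)) := by
  have e₁ : ∀ u : Bits W, clearWires (4 * n + 1) n (shiftBits (4 * n + 1) u) =
      shiftBits (4 * n + 1) (writeReg 0 (zeros n) u) := by
    intro u
    rw [← writeWires_shiftBits _ _ (by omega)]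
    funext k
    simp only [clearWires, writeWires_apply, getBit_zeros, Nat.add_zero]
  have e₂ : ∀ u : Bits W, readWires (4 * n + 1) n (shiftBits (4 * n + 1) u) = readReg 0 n u :=
    fun u => readWires_shiftBits (4 * n + 1) 0 n u
  have e₃ : ∀ u : Bits W, fstBits (readReg 0 (n + e) u) = readReg 0 n u := fun u => rfl
  have e₄ : ∀ u : Bits W, readReg 0 (n + e) (writeReg 0 (zeros n) u) =
      Fin.append (zeros n) (sndBits (readReg 0 (n + e) u)) := by
    intro u
    refine bits_ext fun k hk => ?_
    rw [getBit_readReg _ _ _ _ hk, getBit_append, getBit_writeReg _ _ _ _ (by omega)]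
    by_cases h : k < n
    · rw [if_pos (by omega), if_pos h, getBit_zeros, getBit_zeros]
    · rw [if_neg (by omega), if_neg h, getBit_of_lt _ (by omega : k - n < e)]
      simp only [sndBits, readReg, Fin.val_natAdd]
      congr 1; omega
  rw [place_ketbra₂, run_resetBlock _ (by omega), e₂, e₂, keepOutput_ketbra₂ hW, e₁, e₁]
  by_cases h : readReg 0 n u = readReg 0 n v
  · refine ⟨ketbra₂ (writeReg 0 (zeros n) u) (writeReg 0 (zeros n) v), ?_, ?_⟩
    · rw [if_pos h, place_ketbra₂]
    · have cond : (∀ k < W, n + e ≤ k → getBit (writeReg 0 (zeros n) u) k =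
          getBit (writeReg 0 (zeros n) v) k) ↔ ∀ k < W, n + e ≤ k → getBit u k = getBit v k := by
        refine forall_congr' fun k => forall_congr' fun hk => forall_congr' fun hk' => ?_
        rw [getBit_writeReg _ _ _ _ hk, getBit_writeReg _ _ _ _ hk, if_neg (by omega),
          if_neg (by omega)]
      rw [keepOutput_ketbra₂ hW, e₄, e₄]
      simp only [cond]
      split_ifs with h'
      · change _ = tensor _ (traceFst _)
        rw [traceFst_ketbra₂, e₃, e₃, if_pos h, tensor_ketbra_ketbra₂]
      · rw [map_zero]
  · refine ⟨0, by rw [if_neg h, map_zero], ?_⟩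
    rw [show keepOutput (n + e) (0 : Op W) = 0 from map_zero (keepOutputMap W (n + e))]
    split_ifs
    · change _ = tensor _ (traceFst _)
      rw [traceFst_ketbra₂, e₃, e₃, if_neg h]
      ext x y; simp [tensor]
    · rw [map_zero]

theorem run_transfer (hW : n + e ≤ W) (hV : 2 * n + n + e ≤ V) (hN : 4 * n + 1 + W + V ≤ N)
    (ρ : Op W) :
    runGates [classicalOracle φ] N (transferGates n e W) (place N (4 * n + 1) ρ) =
      place N (4 * n + 1 + W) (loadInput V (tensorId (padEnc φ) e (keepOutput (n + e) ρ))) :=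
  LinearMap.congr_fun (f := runGates [classicalOracle φ] N (transferGates n e W) ∘ₗ
      place N (4 * n + 1)) (g := place N (4 * n + 1 + W) ∘ₗ loadInputMap _ V ∘ₗ
      tensorIdMap (padEnc φ) e ∘ₗ keepOutputMap W (n + e))
    (linearMap_op_ext fun u v => run_transferGates φ hW hV hN u v) ρ

theorem run_reset_transfer (hW : n + e ≤ W) (hV : 2 * n + n + e ≤ V)
    (hN : 4 * n + 1 + W + V ≤ N) (ρ : Op W) :
    runGates [classicalOracle φ] N (resetBlock (4 * n + 1) n ++ transferGates n e W)
        (place N (4 * n + 1) ρ) =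
      place N (4 * n + 1 + W) (loadInput V (tensorId (padEnc φ) e
        (zeroFstMap n e (keepOutput (n + e) ρ)))) :=
  LinearMap.congr_fun (f := runGates [classicalOracle φ] N
      (resetBlock (4 * n + 1) n ++ transferGates n e W) ∘ₗ
      place N (4 * n + 1)) (g := place N (4 * n + 1 + W) ∘ₗ loadInputMap _ V ∘ₗ
      tensorIdMap (padEnc φ) e ∘ₗ zeroFstMap n e ∘ₗ keepOutputMap W (n + e))
    (linearMap_op_ext fun u v => by
      obtain ⟨σ, h₁, h₂⟩ := run_reset_message (N := N) hW (by omega) [classicalOracle φ] u v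
      rw [LinearMap.comp_apply, runGates_append, h₁, run_transfer φ hW hV hN, h₂]
      rfl) ρ

/-- The answer is copied to wire zero, where the output is read, and everything else is traced out.
Copying destroys the off-diagonal entries of the answer qubit, but the acceptance probability is a
diagonal entry. -/
theorem run_copy_answer (hV : 1 ≤ V) {off : ℕ} (hoff : 0 < off) (hN : off + V ≤ N)
    (O : List QOracle) (ρ : Op V) :
    keepOutput 1 (runGates O N [.cnot off 0] (place N off ρ)) (fun _ => true) (fun _ => true) =
      keepOutput 1 ρ (fun _ => true) (fun _ => true) := by
  let ent : Op 1 →ₗ[ℂ] ℂ := Matrix.entryLinearMap ℂ ℂ (fun _ => true) (fun _ => true)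
  refine LinearMap.congr_fun (f := ent ∘ₗ keepOutputMap N 1 ∘ₗ runGates O N [.cnot off 0] ∘ₗ
    place N off) (g := ent ∘ₗ keepOutputMap V 1) (linearMap_op_ext fun u v => ?_) ρ
  change keepOutput 1 (runGates O N [.cnot off 0] (place N off (ketbra₂ u v))) _ _ =
    keepOutput 1 (ketbra₂ u v) _ _
  have hc := runGates_classical O [Gate.cnot off 0] (N := N)
    (by simp [Gate.IsClassical]; omega) (shiftBits off u) (shiftBits off v)
  simp only [leakGates, Gate.leak, if_true, List.append_nil] at hc
  rw [place_ketbra₂, hc, keepOutput_ketbra₂ (by omega), keepOutput_ketbra₂ hV]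
  have e₁ : ∀ u : Bits V, actGates [.cnot off 0] (shiftBits off u) =
      Function.update (shiftBits off u) 0 (getBit u 0) := by
    intro u
    have h₁ := shiftBits_add off u 0
    rw [Nat.add_zero] at h₁
    simp only [actGates, Gate.act, h₁]
    congr 1
    rw [shiftBits_apply, if_neg (by omega), Bool.false_xor]
  have e₂ : ∀ u : Bits V, readReg 0 1 (ket N (Function.update (shiftBits off u) 0 (getBit u 0))) =
      fun _ => getBit u 0 := by
    intro u
    rw [readReg_ket (by omega)]
    funext l
    rw [Subsingleton.elim l 0]
    simp [readWires]
  have e₃ : ∀ u : Bits V, readReg 0 1 u = fun _ => getBit u 0 := by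
    intro u
    funext l
    rw [Subsingleton.elim l 0]
    simp [readReg]
  rw [e₁, e₁, e₂, e₂, e₃, e₃]
  have cond : (∀ k < N, 1 ≤ k →
      getBit (ket N (Function.update (shiftBits off u) 0 (getBit u 0))) k =
      getBit (ket N (Function.update (shiftBits off v) 0 (getBit v 0))) k) ↔
      ∀ k < V, getBit u k = getBit v k := by
    constructor
    · intro h k hk
      have := h (off + k) (by omega) (by omega)
      rwa [getBit_ket _ (by omega), getBit_ket _ (by omega), Function.update_of_ne (by omega),
        Function.update_of_ne (by omega), shiftBits_add, shiftBits_add] at this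
    · intro h k hk hk'
      rw [bits_ext h]
  by_cases h : ∀ k < V, getBit u k = getBit v k
  · rw [if_pos (cond.2 h), if_pos fun k hk _ => h k hk]
  · rw [if_neg fun h' => h (cond.1 h')]
    split_ifs with h'
    -- In this case row and column differ in the answer bit alone, so the right-hand side is an
    -- off-diagonal unit and its entry at `(true, true)` is zero as well.
    · have h₀ : getBit u 0 ≠ getBit v 0 := by
        intro h₀
        refine h fun k hk => ?_
        rcases Nat.eq_zero_or_pos k with rfl | hk'
        exacts [h₀, h' k hk hk']
      rw [ketbra₂_apply, Matrix.zero_apply]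
      have : ∀ b : Bool, ((fun _ => true : Bits 1) = fun _ => b) ↔ true = b :=
        fun b => ⟨fun h => congrFun h 0, fun h => h ▸ rfl⟩
      simp only [this]
      generalize getBit u 0 = b at *
      generalize getBit v 0 = c at *
      cases b <;> cases c <;> simp_all
    · rfl

/-- A well-formed gate of the distinguisher can call oracle 0 only. Adding the decryption oracle to
its list changes nothing, so the simulation of the generator's gates applies to the distinguisher
too. -/
theorem apply_eq_of_wf {O : List QOracle} {a b : ℕ} {Φ : QMap a b} {g : Gate}
    (hg : g.WF [(a, b)] W) (ρ : Op W) :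
    g.apply [⟨a, b, Φ⟩] ρ = g.apply (⟨a, b, Φ⟩ :: O) ρ := by
  cases g with
  | oracle q i j =>
    obtain ⟨a', b', h, -⟩ := hg
    cases q with
    | zero => rfl
    | succ q => simp at h
  | _ => rfl

theorem runGates_eq_of_wf {O : List QOracle} {a b : ℕ} {Φ : QMap a b} {gs : List Gate}
    (hgs : ∀ g ∈ gs, g.WF [(a, b)] W) (ρ : Op W) :
    runGates [⟨a, b, Φ⟩] W gs ρ = runGates (⟨a, b, Φ⟩ :: O) W gs ρ := by
  induction gs generalizing ρ with
  | nil => rfl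
  | cons g gs ih =>
    rw [runGates_cons, runGates_cons, ih fun g' h => hgs g' (List.mem_cons_of_mem _ h),
      Gate.lin_apply, Gate.lin_apply, apply_eq_of_wf (hgs g List.mem_cons_self)]

theorem Gate.WF.append {sig sig' : List (ℕ × ℕ)} {g : Gate} (hg : g.WF sig W) :
    g.WF (sig ++ sig') W := by
  cases g with
  | oracle q i j =>
    obtain ⟨a, b, h, h'⟩ := hg
    refine ⟨a, b, ?_, h'⟩
    rw [List.getElem?_append_left, h]
    by_contra hq
    rw [List.getElem?_eq_none (by omega)] at h
    cases h
  | _ => exact hg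

/-- The probability of acceptance in the game with the function `φ`, with the challenge (`b = true`)
or with the zero state (`b = false`) encrypted. -/
noncomputable def gameValue (e : ℕ) (G D : QCircuit) (b : Bool)
    (φ : Bits (2 * n) → Bits (2 * n)) : ℝ :=
  prOne (D.run [padEncOracle φ] 1 (tensorId (padEnc φ) e
    ((if b then LinearMap.id else zeroFstMap n e)
      (G.run [padEncOracle φ, padDecOracle φ] (n + e) blank))))

/-- The circuit of the distinguisher that runs the game. -/
def gameCircuit (n e : ℕ) (b : Bool) (G D : QCircuit) : QCircuit :=
  ⟨4 * n + 1 + G.width + D.width, gameGates n e G.width b G.gates D.gates⟩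

/-- The simulation is exact, so any advantage in distinguishing the two functions in the game is an
advantage against the pseudorandom function without loss. -/
theorem prOne_gameCircuit (e : ℕ) (b : Bool) {G D : QCircuit}
    (hG : G.WF [(n, 2 * n + n), (2 * n + n, n)] 0 (n + e))
    (hD : D.WF [(n, 2 * n + n)] (2 * n + n + e) 1) :
    prOne ((gameCircuit n e b G D).run [classicalOracle φ] 1 blank) = gameValue e G D b φ := by
  obtain ⟨-, hGW, hGg⟩ := hG
  obtain ⟨hDV, hD₁, hDg⟩ := hD
  have hb : blank = ketbra₂ (zeros 0) (zeros 0) := by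
    ext x y
    rw [ketbra₂_apply, Subsingleton.elim x (zeros 0), Subsingleton.elim y (zeros 0)]
    simp [blank]
  have start : loadInput (4 * n + 1 + G.width + D.width) blank =
      place _ (4 * n + 1) (loadInput G.width blank) := by
    have hz : ∀ N, writeReg 0 (zeros 0) (zeros N) = zeros N := by
      intro N
      refine bits_ext fun k hk => ?_
      rw [getBit_writeReg _ _ _ _ hk, if_neg (by omega)]
    have : ket (4 * n + 1 + G.width + D.width) (shiftBits (4 * n + 1) (zeros G.width)) =
        zeros _ := by
      funext k
      simp [ket, shiftBits_apply, getBit_zeros, zeros]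
    rw [hb, loadInput_ketbra₂ (by omega), loadInput_ketbra₂ (by omega), place_ketbra₂, hz, hz, kb,
      this]
  have key : ∀ ρ : Op G.width, runGates [classicalOracle φ] (4 * n + 1 + G.width + D.width)
      ((if b then [] else resetBlock (4 * n + 1) n) ++ transferGates n e G.width)
      (place _ (4 * n + 1) ρ) = place _ (4 * n + 1 + G.width) (loadInput D.width
        (tensorId (padEnc φ) e ((if b then LinearMap.id else zeroFstMap n e)
          (keepOutput (n + e) ρ)))) := by
    intro ρ
    cases b with
    | true => exact run_transfer φ hGW hDV le_rfl ρ
    | false => exact run_reset_transfer φ hGW hDV le_rfl ρ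
  rw [prOne, gameValue, prOne, QCircuit.run_eq, QCircuit.run_eq, gameCircuit, gameGates]
  simp only
  rw [runGates_append, runGates_append, List.append_assoc, runGates_append, start,
    run_compile φ (by omega) (by omega) _ hGg, key, run_compile φ (by omega) (by omega) _
      fun g hg => (hDg g hg).append (sig' := [(2 * n + n, n)]),
    run_copy_answer hD₁ (by omega) le_rfl, QCircuit.run_eq]
  have := runGates_eq_of_wf (O := [padDecOracle φ]) (Φ := padEnc φ) hDg
  rw [padEncOracle, this]

end Game

end QCrypt

/-! ### Quantum circuits that realise the scheme -/

namespace QCrypt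

/-! ### Evaluating a Boolean circuit with quantum gates -/

/-- Gates that perform a NAND gate on the register at `8 * n + 4`, with three scratch wires. -/
def nandGates (n : ℕ) (g : BGate) : List Gate :=
  [.cnot (8 * n + 4 + g.src₁) (4 * n + 1), .cnot (8 * n + 4 + g.src₂) (4 * n + 2),
    .ccx (4 * n + 1) (4 * n + 2) (4 * n + 3), .x (4 * n + 3), .reset (4 * n + 1),
    .reset (4 * n + 2), .reset (8 * n + 4 + g.dst), .cnot (4 * n + 3) (8 * n + 4 + g.dst),
    .reset (4 * n + 3)]

/-- Gates that answer a query for the function computed by a Boolean circuit with `w` wires, for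
the key in the register of `n` wires at `4 * n + 4`. -/
def evalGates (n w : ℕ) (gs : List BGate) : List Gate :=
  measureBlock 0 (8 * n + 4 + n) (2 * n) ++ copyBlock (4 * n + 4) (8 * n + 4) n ++
    copyBlock 0 (8 * n + 4 + n) (2 * n) ++ gs.flatMap (nandGates n) ++
    copyBlock (8 * n + 4) (2 * n) (2 * n) ++ resetBlock (8 * n + 4) w ++ resetBlock 0 (2 * n)

/-- The wires for the answer and the scratch wires are zero, and the key register holds `k`. -/
def Ready (n w : ℕ) (k : Bits n) (s : ℕ → Bool) : Prop :=
  (∀ i, 2 * n ≤ i → i < 4 * n + 4 → s i = false) ∧ readWires (4 * n + 4) n s = k ∧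
    ∀ l < w, s (8 * n + 4 + l) = false

section Eval

variable {N n w : ℕ}

/-- Both inputs are copied to scratch wires, so the gate is also correct if its wires coincide, for
instance if the target is one of the sources. The old target value is overwritten only after the
result has been computed. -/
theorem act_nandGates (n : ℕ) (g : BGate) (t : ℕ → Bool)
    (z₁ : t (4 * n + 1) = false) (z₂ : t (4 * n + 2) = false) (z₃ : t (4 * n + 3) = false) :
    actGates (nandGates n g) t = Function.update t (8 * n + 4 + g.dst)
        (!(t (8 * n + 4 + g.src₁) && t (8 * n + 4 + g.src₂))) ∧
      leakGates (nandGates n g) t =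
        [t (8 * n + 4 + g.src₁), t (8 * n + 4 + g.src₂), t (8 * n + 4 + g.dst),
          !(t (8 * n + 4 + g.src₁) && t (8 * n + 4 + g.src₂))] := by
  have n₁ : ∀ a, 8 * n + 4 + a ≠ 4 * n + 1 := fun a => by omega
  have n₂ : ∀ a, 8 * n + 4 + a ≠ 4 * n + 2 := fun a => by omega
  have n₃ : ∀ a, 8 * n + 4 + a ≠ 4 * n + 3 := fun a => by omega
  constructor
  · funext k
    simp only [nandGates, actGates, Gate.act]
    by_cases k₁ : k = 4 * n + 1
    · subst k₁
      simp [Function.update_apply, z₁, (n₁ _).symm]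
    by_cases k₂ : k = 4 * n + 2
    · subst k₂
      simp [Function.update_apply, z₂, (n₂ _).symm]
    by_cases k₃ : k = 4 * n + 3
    · subst k₃
      simp [Function.update_apply, z₃, (n₃ _).symm]
    by_cases k₄ : k = 8 * n + 4 + g.dst
    · subst k₄
      simp [Function.update_apply,
      z₁, z₂, z₃, n₁, n₂, n₃, (n₁ _).symm, (n₂ _).symm, (n₃ _).symm]
    · simp [Function.update_apply, k₁, k₂, k₃, k₄]
  · simp [nandGates, leakGates, actGates, Gate.act, Gate.leak, Function.update_apply,
      z₁, z₂, z₃, n₁, n₂, n₃, (n₁ _).symm, (n₂ _).symm, (n₃ _).symm]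

theorem act_nandGates_writeWires (g : BGate) (h₁ : g.src₁ < w) (h₂ : g.src₂ < w) (x : Bits w)
    (s : ℕ → Bool) (hs : ∀ i, 2 * n ≤ i → i < 4 * n + 4 → s i = false) (h₃ : g.dst < w) :
    actGates (nandGates n g) (writeWires (8 * n + 4) x s) =
        writeWires (8 * n + 4) (g.apply x) s ∧
      leakGates (nandGates n g) (writeWires (8 * n + 4) x s) =
        [getBit x g.src₁, getBit x g.src₂, getBit x g.dst,
          !(getBit x g.src₁ && getBit x g.src₂)] := by
  have z : ∀ i, 2 * n ≤ i → i < 4 * n + 4 → writeWires (8 * n + 4) x s i = false :=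
    fun i hi hi' => by rw [writeWires_of_notMem _ _ (by omega), hs i hi hi']
  have e : ∀ i, i < w → writeWires (8 * n + 4) x s (8 * n + 4 + i) = getBit x i :=
    fun i hi => by rw [writeWires_of_mem _ _ hi, getBit_of_lt _ hi]
  obtain ⟨ha, hl⟩ := act_nandGates n g (writeWires (8 * n + 4) x s)
    (z _ (by omega) (by omega)) (z _ (by omega) (by omega)) (z _ (by omega) (by omega))
  rw [ha, hl, e _ h₁, e _ h₂, e _ h₃]
  refine ⟨?_, rfl⟩
  funext k
  rw [Function.update_apply, writeWires_apply, writeWires_apply, BGate.apply, getBit_setBit]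
  grind

/-- The evaluation discards much garbage, but all of it is a function of the initial contents `x` of
the simulated circuit and independent of the other wires. -/
theorem act_flatMap_nandGates (gs : List BGate)
    (hgs : ∀ g ∈ gs, g.src₁ < w ∧ g.src₂ < w ∧ g.dst < w) (x : Bits w) (s t : ℕ → Bool)
    (hs : ∀ i, 2 * n ≤ i → i < 4 * n + 4 → s i = false)
    (ht : ∀ i, 2 * n ≤ i → i < 4 * n + 4 → t i = false) :
    actGates (gs.flatMap (nandGates n)) (writeWires (8 * n + 4) x s) =
        writeWires (8 * n + 4) (gs.foldl (fun x g => g.apply x) x) s ∧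
      leakGates (gs.flatMap (nandGates n)) (writeWires (8 * n + 4) x s) =
        leakGates (gs.flatMap (nandGates n)) (writeWires (8 * n + 4) x t) := by
  induction gs generalizing x with
  | nil => exact ⟨rfl, rfl⟩
  | cons g gs ih =>
    obtain ⟨h₁, h₂, h₃⟩ := hgs g List.mem_cons_self
    obtain ⟨ha, hl⟩ := act_nandGates_writeWires (n := n) g h₁ h₂ x s hs h₃
    obtain ⟨ha', hl'⟩ := act_nandGates_writeWires (n := n) g h₁ h₂ x t ht h₃
    obtain ⟨ih₁, ih₂⟩ := ih (fun g' h => hgs g' (List.mem_cons_of_mem _ h)) (g.apply x)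
    rw [List.flatMap_cons, actGates_append, leakGates_append, leakGates_append, ha, ha', hl, hl',
      ih₁, ih₂]
    exact ⟨rfl, rfl⟩

theorem isClassical_append {gs hs : List Gate} (hg : ∀ g ∈ gs, g.IsClassical N)
    (hh : ∀ g ∈ hs, g.IsClassical N) : ∀ g ∈ gs ++ hs, g.IsClassical N := fun g h =>
  (List.mem_append.1 h).elim (hg g) (hh g)

theorem isClassical_evalGates {gs : List BGate} (hw : n + 2 * n ≤ w) (hN : 8 * n + 4 + w ≤ N)
    (hgs : ∀ g ∈ gs, g.src₁ < w ∧ g.src₂ < w ∧ g.dst < w) :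
    ∀ g ∈ evalGates n w gs, g.IsClassical N := by
  refine isClassical_append (isClassical_append (isClassical_append (isClassical_append
    (isClassical_append (isClassical_append ?_ ?_) ?_) ?_) ?_) ?_) ?_
  · exact isClassical_measureBlock (by omega) (by omega)
  · exact isClassical_copyBlock (by omega) (by omega)
  · exact isClassical_copyBlock (by omega) (by omega)
  · intro g' hg'
    obtain ⟨g, hg, hg'⟩ := List.mem_flatMap.1 hg'
    obtain ⟨h₁, h₂, h₃⟩ := hgs g hg
    simp only [nandGates, List.mem_cons, List.not_mem_nil, or_false] at hg'
    rcases hg' with rfl | rfl | rfl | rfl | rfl | rfl | rfl | rfl | rfl <;>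
      simp only [Gate.IsClassical] <;> omega
  · exact isClassical_copyBlock (by omega) (by omega)
  · exact isClassical_resetBlock (by omega)
  · exact isClassical_resetBlock (by omega)

/-- The Boolean circuit answers queries. -/
theorem answers_evalGates {C : BCircuit} (hC : C.WF (n + 2 * n) (2 * n)) (k : Bits n)
    (hN : 8 * n + 4 + C.width ≤ N) :
    Answers [] N (evalGates n C.width C.gates) (fun q => C.eval (2 * n) (Fin.append k q))
      (Ready n C.width k) := by
  obtain ⟨hw, -, hgs⟩ := hC
  intro s t hs ht
  rw [runGates_classical [] _ (isClassical_evalGates hw hN hgs)]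
  let x₀ (s : ℕ → Bool) : Bits C.width :=
    writeReg 0 (Fin.append k (readWires 0 (2 * n) s)) (zeros C.width)
  let x₁ (s : ℕ → Bool) : Bits C.width := C.gates.foldl (fun x g => g.apply x) (x₀ s)
  have copied : ∀ s, Ready n C.width k s → actGates (copyBlock 0 (8 * n + 4 + n) (2 * n))
      (actGates (copyBlock (4 * n + 4) (8 * n + 4) n) s) = writeWires (8 * n + 4) (x₀ s) s := by
    intro s hs
    obtain ⟨h₁, h₂, h₃⟩ := hs
    rw [act_copyBlock (by omega), act_copyBlock (by omega)]
    funext i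
    simp only [addWires, writeWires_apply]
    by_cases hi : 8 * n + 4 ≤ i ∧ i < 8 * n + 4 + C.width
    · obtain ⟨l, rfl⟩ := Nat.exists_eq_add_of_le hi.1
      rw [if_pos hi, Nat.add_sub_cancel_left, h₃ l (by omega)]
      simp only [x₀]
      rw [getBit_writeReg _ _ _ _ (by omega), getBit_zeros]
      by_cases hl : l < n
      · rw [if_neg (by omega), if_pos (by omega), if_pos (by omega), Nat.sub_zero, getBit_append,
          if_pos hl, Bool.false_xor, getBit_of_lt _ hl, ← h₂]
        simp only [readWires]
        congr 1; omega
      · by_cases hl' : l < n + 2 * n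
        · rw [if_pos (by omega), if_neg (by omega), if_neg (by omega), if_pos (by omega),
            Nat.sub_zero, getBit_append, if_neg hl, Bool.false_xor, getBit_of_lt _ (by omega)]
          simp only [readWires]
          congr 1; omega
        · rw [if_neg (by omega), if_neg (by omega), if_neg (by omega)]
    · rw [if_neg (by omega), if_neg (by omega), if_neg hi]
  have final : ∀ s, Ready n C.width k s → actGates (resetBlock 0 (2 * n))
      (actGates (resetBlock (8 * n + 4) C.width) (actGates (copyBlock (8 * n + 4) (2 * n) (2 * n))
        (writeWires (8 * n + 4) (x₁ s) s))) =
      answered (fun q => C.eval (2 * n) (Fin.append k q)) s := by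
    intro s hs
    obtain ⟨h₁, h₂, h₃⟩ := hs
    rw [act_copyBlock (by omega), act_resetBlock, act_resetBlock]
    funext i
    simp only [clearWires, addWires, answered, writeWires_apply, getBit_zeros]
    by_cases hi : i < 2 * n
    · rw [if_pos (by omega), if_pos (by omega)]
    · have c₀ : (0 ≤ i ∧ i < 0 + 2 * n) = False := eq_false (by omega)
      by_cases hi' : i < 2 * n + 2 * n
      · have c₁ : (2 * n ≤ i ∧ i < 2 * n + 2 * n) = True := eq_true (by omega)
        have c₂ : (8 * n + 4 ≤ i ∧ i < 8 * n + 4 + C.width) = False := eq_false (by omega)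
        have c₃ : (8 * n + 4 ≤ i - 2 * n + (8 * n + 4) ∧
          i - 2 * n + (8 * n + 4) < 8 * n + 4 + C.width) = True := eq_true (by omega)
        simp only [c₀, c₁, c₂, c₃, if_true, if_false, h₁ i (by omega) (by omega), Bool.false_xor,
          Nat.add_sub_cancel]
        rw [getBit_of_lt (C.eval _ _) (by omega)]
        simp only [BCircuit.eval, readReg, x₁, x₀, Nat.zero_add]
      · have c₁ : (2 * n ≤ i ∧ i < 2 * n + 2 * n) = False := eq_false (by omega)
        simp only [c₀, c₁, if_false]
        split_ifs with hc
        · obtain ⟨l, rfl⟩ := Nat.exists_eq_add_of_le hc.1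
          rw [h₃ l (by omega)]
        · rfl
  have measured : ∀ s, Ready n C.width k s →
      actGates (measureBlock 0 (8 * n + 4 + n) (2 * n)) s = s := by
    intro s hs
    refine act_measureBlock (by omega) s fun l hl => ?_
    rw [add_assoc]; exact hs.2.2 _ (by omega)
  have nands := fun (x : Bits C.width) (s t : ℕ → Bool) (hs : Ready n C.width k s)
    (ht : Ready n C.width k t) => act_flatMap_nandGates (n := n) C.gates hgs x s t hs.1 ht.1
  have act : ∀ s, Ready n C.width k s → actGates (evalGates n C.width C.gates) s =
      answered (fun q => C.eval (2 * n) (Fin.append k q)) s := by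
    intro s hs
    simp only [evalGates, actGates_append]
    rw [measured s hs, copied s hs, (nands _ s s hs hs).1, ← final s hs]
  -- The query is measured at the beginning. Everything discarded later depends on the key and the
  -- query only, and both agree once the queries agree; so the irreversible evaluation loses no
  -- coherence beyond that measurement.
  have leak : leakGates (evalGates n C.width C.gates) s = leakGates (evalGates n C.width C.gates) t ↔
      readWires 0 (2 * n) s = readWires 0 (2 * n) t := by
    simp only [evalGates, leakGates_append_eq_iff, actGates_append, leak_copyBlock]
    rw [measured s hs, measured t ht, copied s hs, copied t ht, (nands _ s s hs hs).1,
      (nands _ t t ht ht).1, leak_measureBlock_iff (by omega) s t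
        (fun l hl => by rw [add_assoc]; exact hs.2.2 _ (by omega))
        (fun l hl => by rw [add_assoc]; exact ht.2.2 _ (by omega)), readWires_eq_iff]
    refine ⟨fun h => h.1.1.1.1.1.1, fun h => ?_⟩
    have hx : x₀ s = x₀ t := by
      simp only [x₀]
      rw [readWires_eq_iff.2 h]
    refine ⟨⟨⟨⟨⟨⟨h, trivial⟩, trivial⟩, ?_⟩, trivial⟩, ?_⟩, ?_⟩
    · rw [hx]; exact (nands _ s t hs ht).2
    · rw [leak_resetBlock_iff]
      intro l hl
      rw [act_copyBlock (by omega), act_copyBlock (by omega)]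
      simp only [addWires, hx]
      rw [if_neg (by omega), if_neg (by omega), writeWires_of_mem _ _ hl, writeWires_of_mem _ _ hl]
    · rw [leak_resetBlock_iff]
      intro l hl
      rw [act_resetBlock, act_copyBlock (by omega), act_resetBlock, act_copyBlock (by omega)]
      simp only [clearWires, addWires]
      rw [if_neg (by omega), if_neg (by omega), if_neg (by omega), if_neg (by omega),
        writeWires_of_notMem _ _ (by omega), writeWires_of_notMem _ _ (by omega)]
      exact h l hl
  rw [act s hs, act t ht]
  simp only [leak]

end Eval

end QCrypt

namespace QCrypt

/-! ### The circuits of the scheme -/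

/-- The circuit for key generation. -/
def keyGenCircuit (n : ℕ) : QCircuit := ⟨n + 1, coinBlock n 0 n⟩

/-- The circuit for encryption, with a Boolean circuit for the function family. -/
def encCircuit (n : ℕ) (C : BCircuit) : QCircuit :=
  ⟨8 * n + 4 + C.width, swapBlock 0 (4 * n + 4) n ++ swapBlock n (7 * n + 4) n ++
    encCore n (evalGates n C.width C.gates) (5 * n + 4) ++ swapBlock 0 (5 * n + 4) (3 * n)⟩

/-- The circuit for decryption, with a Boolean circuit for the function family. -/
def decCircuit (n : ℕ) (C : BCircuit) : QCircuit :=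
  ⟨8 * n + 4 + C.width, swapBlock 0 (4 * n + 4) (4 * n) ++
    decCore n (evalGates n C.width C.gates) (5 * n + 4) ++ swapBlock 0 (7 * n + 4) n⟩

theorem relocate_id {n : ℕ} (A : Op n) : relocate id id A = A := (op_eq_sum A).symm

/-- `tensor ρ` as a linear map. -/
def tensorMap {a : ℕ} (b : ℕ) (ρ : Op a) : Op b →ₗ[ℂ] Op (a + b) where
  toFun := tensor ρ
  map_add' σ τ := by ext x y; simp [tensor, mul_add]
  map_smul' c σ := by ext x y; simp [tensor]; ring

theorem loadInput_kb {a N : ℕ} (ha : a ≤ N) (u v : Bits a) :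
    loadInput N (ketbra₂ u v) = kb N (shiftBits 0 u) (shiftBits 0 v) := loadInput_ketbra₂ ha u v

section Run

variable {n : ℕ}

theorem keyGenCircuit_run :
    (keyGenCircuit n).run [] n blank = (1 / 2 : ℂ) ^ n • ∑ k : Bits n, ketbra k := by
  have hb : blank = ketbra₂ (zeros 0) (zeros 0) := by
    ext x y
    rw [ketbra₂_apply, Subsingleton.elim x (zeros 0), Subsingleton.elim y (zeros 0)]
    simp [blank]
  have hz : ∀ i, shiftBits 0 (zeros 0) i = false := by
    intro i
    rw [shiftBits_apply, getBit_zeros, ite_self]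
  rw [QCircuit.run_eq, hb, keyGenCircuit]
  simp only
  rw [loadInput_kb (by omega), run_coinBlock [] (by omega) (by omega) (by omega) _ _
    (fun l _ => hz _) (fun l _ => hz _) (hz _) (hz _)]
  change keepOutputMap (n + 1) n _ = _
  rw [map_smul, map_sum]
  congr 1
  refine Finset.sum_congr rfl fun r _ => ?_
  change keepOutput n _ = _
  rw [keepOutput_ketbra₂ (by omega), if_pos fun _ _ _ => rfl, readReg_ket (by omega),
    readWires_writeWires]
  rfl

variable {C : BCircuit}

/-- The key goes to the wires from `4 * n + 4`, the ciphertext is formed from `5 * n + 4` with the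
message in its last `n` wires, and the Boolean circuit works from `8 * n + 4`. The last swap puts
the ciphertext in front. -/
theorem encCircuit_run (hC : C.WF (n + 2 * n) (2 * n)) (k : Bits n) (ρ : Op n) :
    (encCircuit n C).run [] (2 * n + n) (tensor (ketbra k) ρ) =
      padEnc (fun q => C.eval (2 * n) (Fin.append k q)) ρ := by
  have hw := hC.1
  let s (u : Bits n) : ℕ → Bool := fun i =>
    if 4 * n + 4 ≤ i ∧ i < 5 * n + 4 then getBit k (i - (4 * n + 4)) else
      if 7 * n + 4 ≤ i ∧ i < 8 * n + 4 then getBit u (i - (7 * n + 4)) else false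
  have hs : ∀ u : Bits n, swapWires n (7 * n + 4) n (swapWires 0 (4 * n + 4) n
      (shiftBits 0 (Fin.append k u))) = s u := by
    intro u
    have out : ∀ i, n + n ≤ i → getBit (Fin.append k u) i = false := fun i hi => by
      simp [getBit, show ¬ i < n + n by omega]
    funext i
    simp only [s, swapWires, shiftBits_apply, Nat.zero_le, if_true, true_and, Nat.sub_zero,
      Nat.zero_add]
    by_cases h₁ : i < n
    · rw [if_neg (by omega), if_neg (by omega), if_pos h₁, out _ (by omega), if_neg (by omega),
        if_neg (by omega)]
    by_cases h₂ : i < n + n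
    · rw [if_pos (by omega), if_neg (by omega), if_neg (by omega), out _ (by omega),
        if_neg (by omega), if_neg (by omega)]
    by_cases h₃ : 4 * n + 4 ≤ i ∧ i < 5 * n + 4
    · rw [if_neg (by omega), if_neg (by omega), if_neg (by omega), if_pos (by omega), if_pos h₃,
        getBit_append, if_pos (by omega)]
      rfl
    by_cases h₄ : 7 * n + 4 ≤ i ∧ i < 8 * n + 4
    · rw [if_neg (by omega), if_pos (by omega), if_neg (by omega), if_neg (by omega), if_neg h₃,
        if_pos h₄, getBit_append, if_neg (by omega)]
      congr 1; omega
    · rw [if_neg (by omega), if_neg (by omega), if_neg (by omega), if_neg (by omega), if_neg h₃,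
        if_neg h₄, out _ (by omega)]
  have ready : ∀ u (r : Bits (2 * n)),
      Ready n C.width k (writeWires 0 r (writeWires (5 * n + 4) r (s u))) := by
    intro u r
    refine ⟨fun i h₁ h₂ => ?_, ?_, fun l hl => ?_⟩
    · rw [writeWires_of_notMem _ _ (by omega), writeWires_of_notMem _ _ (by omega)]
      simp only [s]
      rw [if_neg (by omega), if_neg (by omega)]
    · rw [readWires_writeWires_of_disjoint _ _ (by omega),
        readWires_writeWires_of_disjoint _ _ (by omega)]
      funext l
      have := l.2
      simp only [readWires, s]
      rw [if_pos (by omega), Nat.add_sub_cancel_left, getBit_val]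
    · rw [writeWires_of_notMem _ _ (by omega), writeWires_of_notMem _ _ (by omega)]
      simp only [s]
      rw [if_neg (by omega), if_neg (by omega)]
  have s₀ : ∀ u, ∀ i ≤ 4 * n, s u i = false := by
    intro u i hi
    simp only [s]
    rw [if_neg (by omega), if_neg (by omega)]
  have s₁ : ∀ u, ∀ l < 2 * n, s u (5 * n + 4 + l) = false := by
    intro u l hl
    simp only [s]
    rw [if_neg (by omega), if_neg (by omega)]
  have s₂ : ∀ u, readWires (5 * n + 4 + 2 * n) n (s u) = u := by
    intro u
    funext l
    have := l.2
    simp only [readWires, s]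
    rw [if_neg (by omega), if_pos (by omega), show 5 * n + 4 + 2 * n + (l : ℕ) - (7 * n + 4) = l by
      omega, getBit_val]
  have out : ∀ (u v : Bits n) (p q : Bits (2 * n + n)), keepOutput (2 * n + n)
      (kb (8 * n + 4 + C.width) (swapWires 0 (5 * n + 4) (3 * n) (writeWires (5 * n + 4) p (s u)))
        (swapWires 0 (5 * n + 4) (3 * n) (writeWires (5 * n + 4) q (s v)))) = ketbra₂ p q := by
    intro u v p q
    have r : ∀ (u : Bits n) (p : Bits (2 * n + n)), readReg 0 (2 * n + n)
        (ket (8 * n + 4 + C.width)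
          (swapWires 0 (5 * n + 4) (3 * n) (writeWires (5 * n + 4) p (s u)))) = p := by
      intro u p
      rw [readReg_ket (by omega)]
      funext l
      have := l.2
      simp only [readWires, swapWires]
      rw [if_pos (by omega), show 0 + (l : ℕ) - 0 + (5 * n + 4) = 5 * n + 4 + l by omega,
        writeWires_of_mem _ _ l.2]
    -- Apart from the output only the key is left on the wires. It is the same in row and column, so
    -- the final trace is harmless.
    have z : ∀ (u : Bits n) (p : Bits (2 * n + n)) i, 2 * n + n ≤ i →
        swapWires 0 (5 * n + 4) (3 * n) (writeWires (5 * n + 4) p (s u)) i =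
        if 4 * n + 4 ≤ i ∧ i < 5 * n + 4 then getBit k (i - (4 * n + 4)) else false := by
      intro u p i hi
      simp only [swapWires]
      rw [if_neg (by omega)]
      by_cases h : 5 * n + 4 ≤ i ∧ i < 5 * n + 4 + 3 * n
      · rw [if_pos h, if_neg (by omega), writeWires_of_notMem _ _ (by omega), s₀ _ _ (by omega)]
      · rw [if_neg h, writeWires_of_notMem _ _ (by omega)]
        simp only [s]
        rw [if_neg (show ¬(7 * n + 4 ≤ i ∧ i < 8 * n + 4) by omega)]
    rw [keepOutput_ketbra₂ (by omega), r, r, if_pos]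
    intro i hi hi'
    rw [getBit_ket _ hi, getBit_ket _ hi, z _ _ _ hi', z _ _ _ hi']
  rw [QCircuit.run_eq]
  refine LinearMap.congr_fun (f := keepOutputMap _ (2 * n + n) ∘ₗ runGates [] _ (encCircuit n C).gates
    ∘ₗ loadInputMap (n + n) (encCircuit n C).width ∘ₗ tensorMap n (ketbra k))
    (linearMap_op_ext fun u v => ?_) ρ
  change keepOutput (2 * n + n) (runGates [] (8 * n + 4 + C.width) _
    (loadInput (8 * n + 4 + C.width) (tensor (ketbra k) (ketbra₂ u v)))) = _
  rw [tensor_ketbra_ketbra₂, loadInput_kb (by omega), encCircuit]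
  simp only
  rw [runGates_append, runGates_append, runGates_append,
    run_swapBlock [] (by omega) (by omega) (by omega),
    run_swapBlock [] (by omega) (by omega) (by omega), hs, hs,
    run_encCore (answers_evalGates hC k le_rfl) (by omega) (by omega) (ready u) (ready v) (s₀ u)
      (s₀ v) (s₁ u) (s₁ v), s₂, s₂]
  refine (map_relocate (keepOutputMap _ (2 * n + n) ∘ₗ runGates [] _ _) _ _ id id _
    fun p q => ?_).trans (relocate_id _)
  rw [LinearMap.comp_apply, run_swapBlock [] (by omega) (by omega) (by omega)]
  exact out u v p q

theorem decCircuit_run (hC : C.WF (n + 2 * n) (2 * n)) (k : Bits n) (σ : Op (2 * n + n)) :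
    (decCircuit n C).run [] n (tensor (ketbra k) σ) =
      padDec (fun q => C.eval (2 * n) (Fin.append k q)) σ := by
  have hw := hC.1
  let s (p : Bits (2 * n + n)) : ℕ → Bool := fun i =>
    if 4 * n + 4 ≤ i ∧ i < 8 * n + 4 then getBit (Fin.append k p) (i - (4 * n + 4)) else false
  have hs : ∀ p : Bits (2 * n + n), swapWires 0 (4 * n + 4) (4 * n)
      (shiftBits 0 (Fin.append k p)) = s p := by
    intro p
    have out : ∀ i, n + (2 * n + n) ≤ i → getBit (Fin.append k p) i = false := fun i hi => by
      simp [getBit, show ¬ i < n + (2 * n + n) by omega]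
    funext i
    simp only [s, swapWires, shiftBits_apply, Nat.zero_le, if_true, true_and, Nat.sub_zero,
      Nat.zero_add]
    by_cases h₁ : i < 4 * n
    · rw [if_pos h₁, if_neg (by omega), out _ (by omega)]
    · rw [if_neg h₁]
      by_cases h₂ : 4 * n + 4 ≤ i ∧ i < 8 * n + 4
      · rw [if_pos (by omega), if_pos h₂]; rfl
      · rw [if_neg (by omega), if_neg h₂, out _ (by omega)]
  have ready : ∀ p, Ready n C.width k (writeWires 0 (readWires (5 * n + 4) (2 * n) (s p)) (s p)) := by
    intro u
    refine ⟨fun i h₁ h₂ => ?_, ?_, fun l hl => ?_⟩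
    · rw [writeWires_of_notMem _ _ (by omega)]
      simp only [s]
      rw [if_neg (by omega)]
    · rw [readWires_writeWires_of_disjoint _ _ (by omega)]
      funext l
      have := l.2
      simp only [readWires, s]
      rw [if_pos (by omega), Nat.add_sub_cancel_left, getBit_append, if_pos l.2, getBit_val]
    · rw [writeWires_of_notMem _ _ (by omega)]
      simp only [s]
      rw [if_neg (by omega)]
  have s₀ : ∀ u, ∀ i < 4 * n, s u i = false := by
    intro u i hi
    simp only [s]
    rw [if_neg (by omega)]
  have s₂ : ∀ p, readWires (5 * n + 4) (2 * n + n) (s p) = p := by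
    intro u
    funext l
    have := l.2
    simp only [readWires, s]
    rw [if_pos (by omega), getBit_append, if_neg (by omega),
      show 5 * n + 4 + (l : ℕ) - (4 * n + 4) - n = l by omega, getBit_val]
  rw [QCircuit.run_eq]
  refine LinearMap.congr_fun (f := keepOutputMap _ n ∘ₗ runGates [] _ (decCircuit n C).gates
    ∘ₗ loadInputMap (n + (2 * n + n)) (decCircuit n C).width ∘ₗ tensorMap (2 * n + n) (ketbra k))
    (linearMap_op_ext fun p q => ?_) σ
  change keepOutput n (runGates [] (8 * n + 4 + C.width) _
    (loadInput (8 * n + 4 + C.width) (tensor (ketbra k) (ketbra₂ p q)))) = _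
  rw [tensor_ketbra_ketbra₂, loadInput_kb (by omega), decCircuit]
  simp only
  rw [runGates_append, runGates_append,
    run_swapBlock [] (by omega) (by omega) (by omega), hs, hs,
    run_decCore (answers_evalGates hC k le_rfl) (by omega) (by omega) (ready p) (ready q) (s₀ p)
      (s₀ q), s₂, s₂, padDec_ketbra₂]
  split_ifs with hpq
  · have out : ∀ (x y : Bits n), keepOutput n
        (kb (8 * n + 4 + C.width) (swapWires 0 (7 * n + 4) n (writeWires (5 * n + 4 + 2 * n) x (s p)))
          (swapWires 0 (7 * n + 4) n (writeWires (5 * n + 4 + 2 * n) y (s q)))) = ketbra₂ x y := by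
      intro x y
      have r : ∀ (p) (x : Bits n), readReg 0 n (ket (8 * n + 4 + C.width)
          (swapWires 0 (7 * n + 4) n (writeWires (5 * n + 4 + 2 * n) x (s p)))) = x := by
        intro p x
        rw [readReg_ket (by omega)]
        funext l
        have := l.2
        simp only [readWires, swapWires]
        rw [if_pos (by omega),
          show 0 + (l : ℕ) - 0 + (7 * n + 4) = 5 * n + 4 + 2 * n + l by omega,
          writeWires_of_mem _ _ l.2]
      -- Apart from the output, the key and the measured string are left on the wires. The latter
      -- agrees in row and column by `hpq`, so the final trace is harmless.
      have z : ∀ (p) (x : Bits n) i, n ≤ i →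
          swapWires 0 (7 * n + 4) n (writeWires (5 * n + 4 + 2 * n) x (s p)) i =
          if 4 * n + 4 ≤ i ∧ i < 5 * n + 4 then getBit k (i - (4 * n + 4)) else
          if 5 * n + 4 ≤ i ∧ i < 7 * n + 4 then getBit (fstBits p) (i - (5 * n + 4)) else false := by
        intro p x i hi
        simp only [swapWires]
        rw [if_neg (by omega)]
        by_cases h : 7 * n + 4 ≤ i ∧ i < 7 * n + 4 + n
        · rw [if_pos h, if_neg (by omega), if_neg (by omega), writeWires_of_notMem _ _ (by omega),
            s₀ _ _ (by omega)]
        · rw [if_neg h, writeWires_of_notMem _ _ (by omega)]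
          simp only [s]
          by_cases h₁ : 4 * n + 4 ≤ i ∧ i < 5 * n + 4
          · rw [if_pos (by omega), if_pos h₁, getBit_append, if_pos (by omega)]
          · rw [if_neg h₁]
            by_cases h₂ : 5 * n + 4 ≤ i ∧ i < 7 * n + 4
            · rw [if_pos (by omega), if_pos h₂, getBit_append, if_neg (by omega),
                getBit_of_lt _ (by omega), getBit_of_lt _ (by omega)]
              simp only [fstBits]
              congr 1; ext; simp only [Fin.val_castAdd]; omega
            · rw [if_neg (by omega), if_neg h₂]
      rw [keepOutput_ketbra₂ (by omega), r, r, if_pos]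
      intro i hi hi'
      rw [getBit_ket _ hi, getBit_ket _ hi, z _ _ _ hi', z _ _ _ hi', hpq]
    rw [map_smul, relocate_ketbra₂, map_smul, run_swapBlock [] (by omega) (by omega) (by omega)]
    change keepOutputMap _ n _ = _
    rw [map_smul]
    congr 1
    exact out _ _
  · rw [map_zero, map_zero]
    exact map_zero (keepOutputMap _ n)

/-- Decryption inverts encryption. -/
theorem padDec_comp_padEnc (g : Bits (2 * n) → Bits (2 * n)) :
    padDec g ∘ₗ padEnc g = LinearMap.id := by
  refine linearMap_op_ext fun u v => ?_
  rw [LinearMap.comp_apply, padEnc_ketbra₂, map_smul, map_sum, LinearMap.id_apply]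
  have h : ∀ r : Bits (2 * n), padDec g ((padSign (g r) u * padSign (g r) v) •
      ketbra₂ (Fin.append r (padShift (g r) u)) (Fin.append r (padShift (g r) v))) =
      ketbra₂ u v := by
    intro r
    have hf : ∀ u : Bits n, fstBits (Fin.append r u) = r := fun u => by
      funext i; simp [fstBits]
    have hl : ∀ u : Bits n, sndBits (Fin.append r u) = u := fun u => by
      funext i; simp [sndBits]
    -- Applying the pad twice multiplies by a sign that depends on the key but not on `u`, because
    -- `X` and `Z` anticommute. This sign occurs in row and column and cancels, so decryption may
    -- use the pad itself in place of its adjoint.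
    have sg : ∀ (s : Bits (2 * n)) (u : Bits n), padSign s (padShift s u) * padSign s u =
        ∏ j : Fin n, sgn (s ⟨2 * j + 1, by omega⟩ && s ⟨2 * j, by omega⟩) := by
      intro s u
      simp only [padSign, padShift, ← Finset.prod_mul_distrib]
      refine Finset.prod_congr rfl fun j _ => ?_
      generalize s ⟨2 * j + 1, _⟩ = a
      generalize s ⟨2 * j, _⟩ = b
      generalize u j = c
      cases a <;> cases b <;> cases c <;> simp [sgn]
    rw [map_smul, padDec_ketbra₂, hf, hf, hl, hl, if_pos rfl, padShift_padShift, padShift_padShift,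
      smul_smul]
    have : padSign (g r) u * padSign (g r) v *
        (padSign (g r) (padShift (g r) u) * padSign (g r) (padShift (g r) v)) = 1 := by
      rw [mul_mul_mul_comm, mul_comm (padSign (g r) u), mul_comm (padSign (g r) v), sg, sg,
        ← Finset.prod_mul_distrib]
      exact Finset.prod_eq_one fun j _ => sgn_mul_self _
    rw [this, one_smul]
  simp only [h, Finset.sum_const, Finset.card_univ, Fintype.card_fun, Fintype.card_bool,
    Fintype.card_fin]
  rw [← Nat.cast_smul_eq_nsmul ℂ, smul_smul]
  simp

theorem traceNorm_zero : traceNorm (0 : Op n) = 0 := by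
  have : (0 : Op n).conjTranspose * (0 : Op n) = 0 := by simp
  rw [traceNorm]
  refine Finset.sum_eq_zero fun x _ => ?_
  have h := (Matrix.isHermitian_conjTranspose_mul_self (0 : Op n)).eigenvalues_eq_zero_iff.2 this
  rw [h]; simp

theorem diamondNorm_zero {a b : ℕ} : diamondNorm (0 : QMap a b) = 0 := by
  have : ∀ (e : ℕ) (ρ : Op (a + e)), tensorId (0 : QMap a b) e ρ = 0 := by
    intro e ρ
    ext x y
    simp [tensorId]
  simp [diamondNorm, this, traceNorm_zero]

end Run

end QCrypt

/-! ### Admissibility of the constructed circuits -/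

namespace QCrypt

/-! ### Well-formedness -/

section WF

variable {N n : ℕ} {sig : List (ℕ × ℕ)}

theorem wf_flatMap_range {body : ℕ → List Gate} {c : ℕ}
    (h : ∀ l < c, ∀ g ∈ body l, g.WF sig N) :
    ∀ g ∈ (List.range c).flatMap body, g.WF sig N := by
  intro g hg
  obtain ⟨l, hl, hg⟩ := List.mem_flatMap.1 hg
  exact h l (List.mem_range.1 hl) g hg

theorem wf_append {gs hs : List Gate} (hg : ∀ g ∈ gs, g.WF sig N) (hh : ∀ g ∈ hs, g.WF sig N) :
    ∀ g ∈ gs ++ hs, g.WF sig N := fun g h => (List.mem_append.1 h).elim (hg g) (hh g)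

theorem wf_swapBlock {i j c : ℕ} (hi : i + c ≤ N) (hj : j + c ≤ N) (h : i + c ≤ j ∨ j + c ≤ i) :
    ∀ g ∈ swapBlock i j c, g.WF sig N :=
  wf_flatMap_range fun l hl g hg => by
    simp only [List.mem_cons, List.not_mem_nil, or_false] at hg
    rcases hg with rfl | rfl | rfl <;> simp only [Gate.WF] <;> omega

theorem wf_copyBlock {i j c : ℕ} (hi : i + c ≤ N) (hj : j + c ≤ N) (h : i + c ≤ j ∨ j + c ≤ i) :
    ∀ g ∈ copyBlock i j c, g.WF sig N :=
  wf_flatMap_range fun l hl g hg => by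
    simp only [List.mem_cons, List.not_mem_nil, or_false] at hg
    subst hg; simp only [Gate.WF]; omega

theorem wf_resetBlock {i c : ℕ} (hi : i + c ≤ N) : ∀ g ∈ resetBlock i c, g.WF sig N :=
  wf_flatMap_range fun l hl g hg => by
    simp only [List.mem_cons, List.not_mem_nil, or_false] at hg
    subst hg; simp only [Gate.WF]; omega

theorem wf_measureBlock {i j c : ℕ} (hi : i + c ≤ N) (hj : j + c ≤ N)
    (h : i + c ≤ j ∨ j + c ≤ i) : ∀ g ∈ measureBlock i j c, g.WF sig N :=
  wf_flatMap_range fun l hl g hg => by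
    simp only [List.mem_cons, List.not_mem_nil, or_false] at hg
    rcases hg with rfl | rfl <;> simp only [Gate.WF] <;> omega

theorem wf_coinBlock {m i c : ℕ} (hm : m < N) (hi : i + c ≤ N) (h : m < i ∨ i + c ≤ m) :
    ∀ g ∈ coinBlock m i c, g.WF sig N :=
  wf_flatMap_range fun l hl g hg => by
    simp only [List.mem_cons, List.not_mem_nil, or_false] at hg
    rcases hg with rfl | rfl | rfl <;> simp only [Gate.WF] <;> omega

theorem wf_padBlock {d : ℕ} (hd : 4 * n ≤ d) (hN : d + n ≤ N) :
    ∀ g ∈ padBlock n d, g.WF sig N :=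
  wf_flatMap_range fun l hl g hg => by
    simp only [List.mem_cons, List.not_mem_nil, or_false] at hg
    rcases hg with rfl | rfl | rfl | rfl <;> simp only [Gate.WF] <;> omega

theorem wf_encCore {orc : List Gate} (ho : ∀ g ∈ orc, g.WF sig N) {j : ℕ} (hj : 4 * n < j)
    (hN : j + 3 * n ≤ N) : ∀ g ∈ encCore n orc j, g.WF sig N :=
  wf_append (wf_append (wf_append (wf_append (wf_coinBlock (by omega) (by omega) (by omega))
    (wf_copyBlock (by omega) (by omega) (by omega))) ho) (wf_padBlock (by omega) (by omega)))
    (wf_resetBlock (by omega))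

theorem wf_decCore {orc : List Gate} (ho : ∀ g ∈ orc, g.WF sig N) {i : ℕ} (hi : 4 * n < i)
    (hN : i + 3 * n ≤ N) : ∀ g ∈ decCore n orc i, g.WF sig N :=
  wf_append (wf_append (wf_append (wf_copyBlock (by omega) (by omega) (by omega)) ho)
    (wf_padBlock (by omega) (by omega))) (wf_resetBlock (by omega))

theorem wf_evalGates {w : ℕ} {gs : List BGate} (hw : n + 2 * n ≤ w) (hN : 8 * n + 4 + w ≤ N)
    (hgs : ∀ g ∈ gs, g.src₁ < w ∧ g.src₂ < w ∧ g.dst < w) :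
    ∀ g ∈ evalGates n w gs, g.WF sig N := by
  refine wf_append (wf_append (wf_append (wf_append (wf_append (wf_append ?_ ?_) ?_) ?_) ?_) ?_) ?_
  · exact wf_measureBlock (by omega) (by omega) (by omega)
  · exact wf_copyBlock (by omega) (by omega) (by omega)
  · exact wf_copyBlock (by omega) (by omega) (by omega)
  · intro g' hg'
    obtain ⟨g, hg, hg'⟩ := List.mem_flatMap.1 hg'
    obtain ⟨h₁, h₂, h₃⟩ := hgs g hg
    simp only [nandGates, List.mem_cons, List.not_mem_nil, or_false] at hg'
    rcases hg' with rfl | rfl | rfl | rfl | rfl | rfl | rfl | rfl | rfl <;>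
      simp only [Gate.WF] <;> omega
  · exact wf_copyBlock (by omega) (by omega) (by omega)
  · exact wf_resetBlock (by omega)
  · exact wf_resetBlock (by omega)

theorem wf_keyGenCircuit : (keyGenCircuit n).WF sig 0 n :=
  ⟨Nat.zero_le _, Nat.le_succ n, wf_coinBlock (N := n + 1) (by omega) (by omega) (by omega)⟩

theorem wf_encCircuit {C : BCircuit} (hC : C.WF (n + 2 * n) (2 * n)) :
    (encCircuit n C).WF sig (n + n) (2 * n + n) := by
  have hw := hC.1
  refine ⟨?_, ?_, ?_⟩
  · simp only [encCircuit]; omega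
  · simp only [encCircuit]; omega
  · exact wf_append (N := 8 * n + 4 + C.width) (wf_append (wf_append
      (wf_swapBlock (by omega) (by omega) (by omega))
      (wf_swapBlock (by omega) (by omega) (by omega)))
      (wf_encCore (wf_evalGates hw le_rfl hC.2.2) (by omega) (by omega)))
      (wf_swapBlock (by omega) (by omega) (by omega))

theorem wf_decCircuit {C : BCircuit} (hC : C.WF (n + 2 * n) (2 * n)) :
    (decCircuit n C).WF sig (n + (2 * n + n)) n := by
  have hw := hC.1
  refine ⟨?_, ?_, ?_⟩
  · simp only [decCircuit]; omega
  · simp only [decCircuit]; omega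
  · exact wf_append (N := 8 * n + 4 + C.width) (wf_append
      (wf_swapBlock (by omega) (by omega) (by omega))
      (wf_decCore (wf_evalGates hw le_rfl hC.2.2) (by omega) (by omega)))
      (wf_swapBlock (by omega) (by omega) (by omega))

theorem wf_query (hN : 4 * n ≤ N) :
    ∀ g ∈ [Gate.oracle 0 0 (2 * n)], g.WF [(2 * n, 2 * n)] N := by
  intro g hg
  rw [List.mem_singleton] at hg
  subst hg
  exact ⟨2 * n, 2 * n, rfl, by omega, by omega, by omega⟩

theorem wf_compileGate {W off : ℕ} (hoff : 4 * n < off) (hN : off + W ≤ N) {g : Gate}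
    (hg : g.WF [(n, 2 * n + n), (2 * n + n, n)] W) :
    ∀ g' ∈ compileGate n off g, g'.WF [(2 * n, 2 * n)] N := by
  cases g with
  | oracle q i j =>
    obtain ⟨a, b, hab, hi, hj, hij⟩ := hg
    match q, hab with
    | 0, hab =>
      simp only [List.getElem?_cons_zero, Option.some.injEq, Prod.mk.injEq] at hab
      obtain ⟨rfl, rfl⟩ := hab
      exact wf_append (wf_append (wf_resetBlock (by omega))
        (wf_swapBlock (by omega) (by omega) (by omega)))
        (wf_encCore (wf_query (by omega)) (by omega) (by omega))
    | 1, hab =>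
      simp only [List.getElem?_cons_succ, List.getElem?_cons_zero, Option.some.injEq,
        Prod.mk.injEq] at hab
      obtain ⟨rfl, rfl⟩ := hab
      exact wf_append (wf_append (wf_append (wf_resetBlock (by omega))
        (wf_decCore (wf_query (by omega)) (by omega) (by omega)))
        (wf_swapBlock (by omega) (by omega) (by omega))) (wf_resetBlock (by omega))
    | q + 2, hab => simp at hab
  | _ =>
    simp only [compileGate, List.mem_singleton, forall_eq]
    simp only [Gate.WF] at hg ⊢
    omega

theorem wf_gameCircuit {e : ℕ} {b : Bool} {G D : QCircuit}
    (hG : G.WF [(n, 2 * n + n), (2 * n + n, n)] 0 (n + e))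
    (hD : D.WF [(n, 2 * n + n)] (2 * n + n + e) 1) :
    (gameCircuit n e b G D).WF [(2 * n, 2 * n)] 0 1 := by
  obtain ⟨-, hGW, hGg⟩ := hG
  obtain ⟨hDV, hD₁, hDg⟩ := hD
  refine ⟨Nat.zero_le _, ?_, ?_⟩
  · simp only [gameCircuit]; omega
  · refine wf_append (N := 4 * n + 1 + G.width + D.width) (wf_append (wf_append (wf_append
      ?_ ?_) ?_) ?_) ?_
    · intro g' hg'
      obtain ⟨g, hg, hg'⟩ := List.mem_flatMap.1 hg'
      exact wf_compileGate (by omega) (by omega) (hGg g hg) g' hg'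
    · cases b
      · exact wf_resetBlock (by omega)
      · intro g hg; simp at hg
    · exact wf_append (wf_append (wf_swapBlock (by omega) (by omega) (by omega))
        (wf_encCore (wf_query (by omega)) (by omega) (by omega))) (wf_resetBlock (by omega))
    · intro g' hg'
      obtain ⟨g, hg, hg'⟩ := List.mem_flatMap.1 hg'
      exact wf_compileGate (by omega) (by omega)
        ((hDg g hg).append (sig' := [(2 * n + n, n)])) g' hg'
    · intro g hg
      rw [List.mem_singleton] at hg
      subst hg
      simp only [Gate.WF]; omega

end WF

end QCrypt

/-! ### Printing the constructed circuits by polynomial-time machines -/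

namespace QCrypt

/-! ### Translating descriptions of circuits -/

theorem PolyBdd.sum {ι : Type} (s : Finset ι) {t : ι → ℕ → ℕ} (h : ∀ i ∈ s, PolyBdd (t i)) :
    PolyBdd fun n => ∑ i ∈ s, t i n := by
  classical
  induction s using Finset.induction_on with
  | empty => simpa using PolyBdd.const 0
  | insert i s hi ih =>
    simp only [Finset.sum_insert hi]
    exact (h i (Finset.mem_insert_self i s)).add
      (ih fun j hj => h j (Finset.mem_insert_of_mem hj))

section Length

variable {K : Type} [DecidableEq K] [Fintype K]

/-- The stacks of a polynomial-time machine have polynomial length. -/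
theorem Prep.length {S : ℕ → K → List Sym} (h : Prep S) (k : K) :
    PolyBdd fun n => (S n k).length := by
  obtain ⟨X, _, _, Γ, x₀, e, Λ, _, σ, _, v₀, main, M, p, hM⟩ := h
  obtain ⟨B, hB⟩ := exists_pushCount_le M
  refine PolyBdd.mono (t := fun n => p.eval n * B)
    ((PolyBdd.id.eval p).mul (PolyBdd.const B)) fun n => ?_
  obtain ⟨t, ht, h⟩ := hM n
  have h := length_steps_le hB h (.inl k)
  change (S n k).length ≤ ([] : List Sym).length + t * B at h
  rw [List.length_nil, Nat.zero_add] at h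
  exact h.trans (Nat.mul_le_mul_right B ht)

/-- Move the stack `k` to the stack `k'`. -/
def Frag.move (k k' : K) : Frag K :=
  .popLoop k (fun s => s.elim (.emit []) fun c => .emit [(k', c)]) Option.isSome

theorem Frag.runs_move {k k' : K} (hk : k' ≠ k) (l : List Sym) (S : K → List Sym) (hl : S k = l) :
    (Frag.move k k').Runs S (2 * l.length + 2)
      (Function.update (Function.update S k []) k' (l.reverse ++ S k')) := by
  induction l generalizing S with
  | nil =>
    refine (Runs.popLoop_exit (t := 1) (by simp [hl]) ?_).mono (by omega)
    have e : Function.update (Function.update S k []) k' ([].reverse ++ S k') = S := by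
      rw [List.reverse_nil, List.nil_append, ← hl, Function.update_eq_self, Function.update_eq_self]
    rw [e, hl, List.tail_nil]
    conv => arg 2; rw [← hl, Function.update_eq_self]
    exact runs_emit [] S
  | cons c l ih =>
    have h₁ := runs_emit [(k', c)] (Function.update S k l)
    have h₂ := ih (pushAll [(k', c)] (Function.update S k l)) (by
      simp [pushAll, Function.update_of_ne hk.symm])
    have h := (Runs.popLoop_cont (k := k) (M := fun s => s.elim (emit []) fun c => emit [(k', c)])
      (c := Option.isSome) (S := S) (t := 1) (by simp [hl]) (by rw [hl]; exact h₁) h₂).mono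
      (t := 2 * (c :: l).length + 2) (by rw [List.length_cons]; omega)
    have e : ∀ A B : K → List Sym, B = A → (move k k').Runs S (2 * (c :: l).length + 2) A →
        (move k k').Runs S (2 * (c :: l).length + 2) B := fun A B hAB h => hAB ▸ h
    refine e _ _ ?_ h
    funext j
    by_cases hj : j = k'
    · subst hj; simp [pushAll, Function.update_of_ne hk]
    · by_cases hj' : j = k
      · subst hj'; simp [Function.update_of_ne hj]
      · simp [pushAll, Function.update_of_ne hj, Function.update_of_ne hj']

theorem Prep.move {S : ℕ → K → List Sym} (h : Prep S) {k k' : K} (hk : k' ≠ k) :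
    Prep fun n => Function.update (Function.update (S n) k []) k' ((S n k).reverse ++ S n k') :=
  h.run (Frag.move k k') (((PolyBdd.const 2).mul (h.length k)).add (PolyBdd.const 2))
    fun n => Frag.runs_move hk _ (S n) rfl

end Length

section Stores

variable {s : ℕ → Store}

theorem Prep.size (h : Prep fun n => (s n).contents) : PolyBdd fun n => (s n).size := by
  have e : ∀ n, (s n).size = ((s n).contents .tmp).length + ((s n).contents .rem).length +
      ∑ i, ((s n).contents (.num i)).length + ∑ b, ((s n).contents (.src b)).length := by
    intro n
    simp [Store.size, Store.contents]
  simp only [e]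
  exact (((h.length _).add (h.length _)).add (PolyBdd.sum _ fun i _ => h.length _)).add
    (PolyBdd.sum _ fun b _ => h.length _)

/-- Stores that are prepared in polynomial time have polynomial size, so time bounds in terms of the
size become time bounds in terms of `n`. -/
theorem Prep.does (h : Prep fun n => (s n).contents) {F : Frag Reg} {P : Store → Prop}
    {f : Store → Store} (hF : F.Does P f) (hP : ∀ n, P (s n)) :
    Prep fun n => (f (s n)).contents :=
  let ⟨_, ht, hF⟩ := hF
  h.run F (ht.comp h.size) fun n => hF _ (s n) (hP n) le_rfl

theorem Prep.clearNum (h : Prep fun n => (s n).contents) (i : Fin 10) :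
    Prep fun n => { s n with num := Function.update (s n).num i 0 }.contents :=
  h.run (Frag.clearNum i) (t := fun n => 2 * (s n).size + 2)
    (((PolyBdd.const 2).mul h.size).add (PolyBdd.const 2)) fun n =>
    (Frag.runs_clearNum i (s n)).mono (by have := (s n).num_le_size i; omega)

theorem Prep.print (h : Prep fun n => (s n).contents) (hs : ∀ n, (s n).Clean) (l : List PrintCmd) :
    Prep fun n => ((s n).write (printAll (s n).num l)).contents :=
  h.does (does_printFrag l) hs

theorem Prep.readNum (h : Prep fun n => (s n).contents) (b : Bool) (i : Fin 10) {a : ℕ → ℕ}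
    {rest : ℕ → List Sym} (hs : ∀ n, (s n).src b = encodeNum (a n) ++ rest n) :
    Prep fun n => { s n with
      num := Function.update (s n).num i ((s n).num i + a n)
      src := Function.update (s n).src b (rest n) }.contents :=
  h.run (Frag.readNum b i) (t := fun n => 2 * (s n).size + 2)
    (((PolyBdd.const 2).mul h.size).add (PolyBdd.const 2)) fun n =>
    (Frag.runs_readNum b i _ _ (s n) (hs n)).mono (by
      have := (s n).length_src_le_size b
      rw [hs, List.length_append, encodeNum, List.length_append, List.length_replicate] at this
      omega)

/-- A program that translates the gates of a circuit. -/
structure Translator (G : Type) where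
  tag : G → Sym
  enc : G → List Sym
  frag : Bool → Sym → Frag Reg
  out : (Fin 10 → ℕ) → G → List Sym
  time : ℕ → ℕ
  polyBdd : PolyBdd time
  runs : ∀ (b : Bool) (g : G) (s : Store) (M : ℕ) (rest : List Sym), s.Clean → s.size ≤ M →
    (∀ i : Fin 10, i ∈ [1, 2, 3] → s.num i = 0) → s.src b = enc g ++ rest →
    (frag b (tag g)).Runs s.contents (time M)
      { s.write (out s.num g) with src := Function.update s.src b rest }.contents

theorem Prep.translate {G : Type} (T : Translator G) (h : Prep fun n => (s n).contents)
    (hs : ∀ n, (s n).Clean) (hs' : ∀ n, ∀ i : Fin 10, i ∈ [1, 2, 3] → (s n).num i = 0) (b : Bool)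
    (gs : ℕ → List G) (hgs : ∀ n, (s n).src b = (gs n).flatMap fun g => T.tag g :: T.enc g) :
    Prep fun n => { (s n).write ((gs n).flatMap (T.out (s n).num)) with
      src := Function.update (s n).src b [] }.contents :=
  h.run (Frag.forSrc b (T.frag b)) (t := fun n => (s n).size * (T.time (s n).size + 1) + 2)
    ((h.size.mul ((T.polyBdd.comp h.size).add (PolyBdd.const 1))).add (PolyBdd.const 2)) fun n =>
    Frag.runs_forSrc (hs n) (hs' n) (gs n) (fun g _ s' h₁ h₂ h₃ rest h₄ => by
      have := T.runs b g s' (s n).size rest h₁ h₃ (by rw [h₂]; exact hs' n) h₄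
      rwa [h₂] at this) (hgs n)

end Stores

/-- The numbers available to a printing program. -/
def numbers (n w w' c : ℕ) : Fin 10 → ℕ := ![0, 0, 0, 0, n, w, w', c, 0, 0]

/-- A description that is printed from two other descriptions. -/
theorem PolyTimeUniform.translate {d d' : ℕ → List Sym} (hd : PolyTimeUniform d)
    (hd' : PolyTimeUniform d') {G G' : Type} (T : Translator G) (T' : Translator G')
    {a b w a' b' w' : ℕ → ℕ} {gs : ℕ → List G} {gs' : ℕ → List G'}
    (e : ∀ n, d n = encodeNum (a n) ++ encodeNum (b n) ++ encodeNum (w n) ++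
      (gs n).flatMap fun g => T.tag g :: T.enc g)
    (e' : ∀ n, d' n = encodeNum (a' n) ++ encodeNum (b' n) ++ encodeNum (w' n) ++
      (gs' n).flatMap fun g => T'.tag g :: T'.enc g)
    (P₀ P₁ P₂ : List PrintCmd) :
    PolyTimeUniform fun n => printAll (numbers n (w n) (w' n) (b n)) P₀ ++
      (gs n).flatMap (T.out (numbers n (w n) (w' n) (b n))) ++
      printAll (numbers n (w n) (w' n) (b n)) P₁ ++
      (gs' n).flatMap (T'.out (numbers n (w n) (w' n) (b n))) ++
      printAll (numbers n (w n) (w' n) (b n)) P₂ := by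
  -- the input, and copies of it
  have h₀ : Prep fun n => (⟨[], [], n, (fun _ => 0), fun _ => []⟩ : Store).contents := by
    convert Prep.input Reg.rem using 2 with n
    funext k
    cases k <;> simp [Store.contents]
  -- Three copies of the input are needed: number 4 is kept for printing, numbers 8 and 9 are
  -- consumed by the two calls.
  have h₁ : Prep fun n => (⟨[], [], 0,
      fun i => if i = 4 ∨ i = 8 ∨ i = 9 then n else 0, fun _ => []⟩ : Store).contents := by
    refine h₀.run (Frag.forTicks .rem (.emit [(.num 4, Sym.tick), (.num 8, Sym.tick),
      (.num 9, Sym.tick)])) (t := fun n => n * (1 + 1) + 2)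
      ((PolyBdd.id.mul (PolyBdd.const 2)).add (PolyBdd.const 2)) fun n => ?_
    have := Frag.runs_forTicks (k := .rem) (F := .emit [(.num 4, Sym.tick), (.num 8, Sym.tick),
      (.num 9, Sym.tick)]) (t := 1) n (fun l => (⟨[], [], n - l,
        fun i => if i = 4 ∨ i = 8 ∨ i = 9 then l else 0, fun _ => []⟩ : Store).contents)
      (fun l _ => rfl) fun l hl => by
      convert Frag.runs_emit (K := Reg) _ _ using 1
      funext k
      cases k with
      | num i =>
        fin_cases i <;> simp [Frag.pushAll, Store.contents, List.replicate_succ]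
      | _ => simp [Frag.pushAll, Store.contents]
    simpa using this
  -- the first description
  have h₂ := (h₁.call hd (k := .num 8) (k' := .tmp) (by simp) (fun n => rfl) fun n => rfl).move
    (k := .tmp) (k' := .src true) (by simp)
  have h₃ : Prep fun n => (⟨[], [], 0, fun i => if i = 4 ∨ i = 9 then n else 0,
      fun c => bif c then d n else []⟩ : Store).contents := by
    convert h₂ using 2 with n
    funext k
    cases k with
    | num i =>
      fin_cases i <;> simp [Store.contents]
    | src c => cases c <;> simp [Store.contents]
    | _ => simp [Store.contents]
  -- A called description arrives reversed on `tmp`; moving it to its stack restores the order.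
  have h₄ := (h₃.call hd' (k := .num 9) (k' := .tmp) (by simp) (fun n => rfl) fun n => rfl).move
    (k := .tmp) (k' := .src false) (by simp)
  have h₅ : Prep fun n => (⟨[], [], 0, fun i => if i = 4 then n else 0,
      fun c => bif c then d n else d' n⟩ : Store).contents := by
    convert h₄ using 2 with n
    funext k
    cases k with
    | num i =>
      fin_cases i <;> simp [Store.contents]
    | src c => cases c <;> simp [Store.contents]
    | _ => simp [Store.contents]
  -- the headers
  have h₆ := (((h₅.readNum true 8 (a := a) (rest := fun n => encodeNum (b n) ++ (encodeNum (w n) ++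
      (gs n).flatMap fun g => T.tag g :: T.enc g)) fun n => by simp [e]).readNum true 7 (a := b)
      (rest := fun n => encodeNum (w n) ++ (gs n).flatMap fun g => T.tag g :: T.enc g)
      fun n => by simp).readNum true 5 (a := w)
      (rest := fun n => (gs n).flatMap fun g => T.tag g :: T.enc g) fun n => by simp)
  -- Number 8 collects the entries of the headers that are not needed, and is cleared in the end.
  -- The two widths and the first output size are kept as numbers 5, 6 and 7.
  have h₇ := (((h₆.readNum false 8 (a := a') (rest := fun n => encodeNum (b' n) ++
      (encodeNum (w' n) ++ (gs' n).flatMap fun g => T'.tag g :: T'.enc g))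
      fun n => by simp [e']).readNum false 8 (a := b')
      (rest := fun n => encodeNum (w' n) ++ (gs' n).flatMap fun g => T'.tag g :: T'.enc g)
      fun n => by simp).readNum false 6 (a := w')
      (rest := fun n => (gs' n).flatMap fun g => T'.tag g :: T'.enc g)
      fun n => by simp).clearNum 8
  have h₈ : Prep fun n => (⟨[], [], 0, numbers n (w n) (w' n) (b n),
      fun c => bif c then (gs n).flatMap fun g => T.tag g :: T.enc g
        else (gs' n).flatMap fun g => T'.tag g :: T'.enc g⟩ : Store).contents := by
    convert h₇ using 3 with n
    congr 1
    · funext i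
      fin_cases i <;> simp [numbers]
    · funext c
      cases c <;> simp
  -- the output
  have clean : ∀ (n : ℕ) o sr, (⟨o, [], 0, numbers n (w n) (w' n) (b n), sr⟩ : Store).Clean :=
    fun n o sr => ⟨rfl, rfl, rfl⟩
  have args : ∀ n, ∀ i : Fin 10, i ∈ [1, 2, 3] → numbers n (w n) (w' n) (b n) i = 0 := by
    intro n i hi
    simp only [List.mem_cons, List.not_mem_nil, or_false] at hi
    rcases hi with rfl | rfl | rfl <;> rfl
  have h₉ := ((((h₈.print (fun n => clean n _ _) P₀).translate T (fun n => clean n _ _) args true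
    gs fun n => rfl).print (fun n => clean n _ _) P₁).translate T' (fun n => clean n _ _) args
    false gs' fun n => rfl).print (fun n => clean n _ _) P₂
  -- The final stacks must be empty except for the printed text, so the numbers are cleared. The
  -- output was collected in reverse, and moving it to `tmp` reverses it once more.
  have h₁₀ := ((((h₉.clearNum 4).clearNum 5).clearNum 6).clearNum 7).move (k := .out) (k' := .tmp)
    (by simp)
  refine Prep.polyTimeUniform (k := Reg.tmp) ?_
  convert h₁₀ using 2 with n
  funext k
  cases k with
  | num i =>
    fin_cases i <;> simp [Store.contents, Store.write, numbers]
  | src c => cases c <;> simp [Store.contents, Store.write]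
  | _ => simp [Store.contents, Store.write]

end QCrypt

namespace QCrypt

/-! ### Symbolic gates -/

/-- A constant plus a sum of numbers that do not change in loops. -/
structure SNum where
  const : ℕ
  regs : List (Fin 9)

namespace SNum

def val (v : Fin 10 → ℕ) (a : SNum) : ℕ := a.const + sumNum v (a.regs.map Fin.succ)

instance : Add SNum := ⟨fun a b => ⟨a.const + b.const, a.regs ++ b.regs⟩⟩

def lit (c : ℕ) : SNum := ⟨c, []⟩

/-- The multiple `m * v i.succ`. -/
def reg (m : ℕ) (i : Fin 9) : SNum := ⟨0, List.replicate m i⟩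

variable (v : Fin 10 → ℕ)

@[simp] theorem val_add (a b : SNum) : (a + b).val v = a.val v + b.val v := by
  change _ + sumNum v ((a.regs ++ b.regs).map _) = _
  simp only [val, sumNum, List.map_append, List.sum_append]
  change a.const + b.const + _ = _
  omega

@[simp] theorem val_lit (c : ℕ) : (lit c).val v = c := by simp [val, lit, sumNum]

theorem sumNum_replicate (m : ℕ) (i : Fin 9) :
    sumNum v ((List.replicate m i).map Fin.succ) = m * v i.succ := by
  rw [List.map_replicate, sumNum, List.map_replicate, List.sum_replicate, smul_eq_mul]

@[simp] theorem val_reg (m : ℕ) (i : Fin 9) : (reg m i).val v = m * v i.succ := by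
  rw [val, reg, sumNum_replicate, Nat.zero_add]

theorem val_congr {v v' : Fin 10 → ℕ} {a : SNum} (h : ∀ i ∈ a.regs, v i.succ = v' i.succ) :
    a.val v = a.val v' := by
  simp only [val, sumNum, List.map_map]
  congr 2
  exact List.map_congr_left h

end SNum

/-- The sum of a number and a multiple of the loop counter. -/
structure SArg where
  num : SNum
  loop : ℕ

namespace SArg

def val (v : Fin 10 → ℕ) (a : SArg) : ℕ := a.num.val v + a.loop * v 0

def items (a : SArg) : List Item :=
  List.replicate a.num.const (.sym Sym.tick) ++ a.num.regs.map (fun i => .num i.succ) ++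
    List.replicate a.loop (.num 0) ++ [.sym Sym.sep]

theorem printItems_items (v : Fin 10 → ℕ) (a : SArg) :
    printItems v a.items = encodeNum (a.val v) := by
  have h : ∀ l : List (Fin 9), printItems v (l.map fun i => .num i.succ) =
      List.replicate (sumNum v (l.map Fin.succ)) Sym.tick := by
    intro l
    induction l with
    | nil => rfl
    | cons i l ih =>
      simp only [printItems, List.map_cons, List.flatMap_cons, sumNum, List.sum_cons,
        List.replicate_add] at ih ⊢
      rw [ih]; rfl
  have h₁ : ∀ m, printItems v (List.replicate m (.sym Sym.tick)) = List.replicate m Sym.tick := by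
    intro m
    induction m with
    | zero => rfl
    | succ m ih => rw [List.replicate_succ, List.replicate_succ, ← ih]; rfl
  have h₂ : ∀ m, printItems v (List.replicate m (.num 0)) =
      List.replicate (m * v 0) Sym.tick := by
    intro m
    induction m with
    | zero => simp [printItems]
    | succ m ih =>
      rw [List.replicate_succ, Nat.succ_mul, Nat.add_comm, List.replicate_add, ← ih]; rfl
  have h₃ : ∀ l l' : List Item, printItems v (l ++ l') = printItems v l ++ printItems v l' :=
    fun l l' => List.flatMap_append
  rw [items, h₃, h₃, h₃, h, h₁, h₂, encodeNum, val, SNum.val, List.replicate_add,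
    List.replicate_add]
  rfl

/-- Symbolic constants refer to numbers with index `i.succ` only, so the loop counter, which has
index zero, enters through the coefficient `loop` alone. -/
theorem val_update (v : Fin 10 → ℕ) (l : ℕ) (a : SArg) :
    a.val (Function.update v 0 l) = a.num.val v + a.loop * l := by
  rw [val, Function.update_self]
  congr 1
  exact SNum.val_congr fun i _ => Function.update_of_ne (Fin.succ_ne_zero i) _ _

end SArg

/-- A gate on symbolic wires. -/
inductive SGate : Type
  | x (i : SArg)
  | h (i : SArg)
  | t (i : SArg)
  | cnot (c i : SArg)
  | ccx (c d i : SArg)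
  | reset (i : SArg)
  | oracle (q i j : SArg)

namespace SGate

def eval (v : Fin 10 → ℕ) : SGate → Gate
  | x i => .x (i.val v)
  | h i => .h (i.val v)
  | t i => .t (i.val v)
  | cnot c i => .cnot (c.val v) (i.val v)
  | ccx c d i => .ccx (c.val v) (d.val v) (i.val v)
  | reset i => .reset (i.val v)
  | oracle q i j => .oracle (q.val v) (i.val v) (j.val v)

def items : SGate → List Item
  | x i => .sym Sym.x :: i.items
  | h i => .sym Sym.h :: i.items
  | t i => .sym Sym.t :: i.items
  | cnot c i => .sym Sym.cnot :: (c.items ++ i.items)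
  | ccx c d i => .sym Sym.ccx :: (c.items ++ d.items ++ i.items)
  | reset i => .sym Sym.reset :: i.items
  | oracle q i j => .sym Sym.oracle :: (q.items ++ i.items ++ j.items)

theorem printItems_items (v : Fin 10 → ℕ) (g : SGate) :
    printItems v g.items = (g.eval v).encode := by
  have h : ∀ c l, printItems v (.sym c :: l) = c :: printItems v l := fun c l => rfl
  have h' : ∀ l l' : List Item, printItems v (l ++ l') = printItems v l ++ printItems v l' :=
    fun l l' => List.flatMap_append
  cases g <;> simp only [items, eval, Gate.encode, h, h', SArg.printItems_items]

end SGate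

/-- A gate or a loop of gates. -/
inductive SCmd : Type
  | gate (g : SGate)
  | loop (bound : List (Fin 9)) (body : List SGate)

namespace SCmd

def eval (v : Fin 10 → ℕ) : SCmd → List Gate
  | gate g => [g.eval v]
  | loop bound body => (List.range (sumNum v (bound.map Fin.succ))).flatMap fun l =>
      body.map (SGate.eval (Function.update v 0 l))

def toPrint : SCmd → List PrintCmd
  | gate g => g.items.map .item
  | loop bound body => [.loop (bound.map Fin.succ) (body.flatMap SGate.items)]

/-- The gates of a list of commands. -/
def evalAll (v : Fin 10 → ℕ) (l : List SCmd) : List Gate := l.flatMap (eval v)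

/-- The program that prints the gates of a list of commands. -/
def print (l : List SCmd) : List PrintCmd := l.flatMap toPrint

theorem printAll_append (v : Fin 10 → ℕ) (l l' : List PrintCmd) :
    printAll v (l ++ l') = printAll v l ++ printAll v l' := List.flatMap_append

/-- A list of commands has two readings, as gates and as a printing program. Their agreement reduces
uniformity of a circuit to writing down its commands. -/
theorem printAll_print (v : Fin 10 → ℕ) (l : List SCmd) :
    printAll v (print l) = (evalAll v l).flatMap Gate.encode := by
  induction l with
  | nil => rfl
  | cons a l ih =>
    rw [print, List.flatMap_cons, printAll_append, ← print, ih,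
      show evalAll v (a :: l) = a.eval v ++ evalAll v l from rfl, List.flatMap_append]
    congr 1
    have h' : ∀ (v : Fin 10 → ℕ) (l l' : List Item), printItems v (l ++ l') =
        printItems v l ++ printItems v l' := fun v l l' => List.flatMap_append
    cases a with
    | gate g =>
      rw [eval, List.flatMap_singleton, ← SGate.printItems_items, printItems, toPrint, printAll,
        List.flatMap_map]
      rfl
    | loop bound body =>
      rw [toPrint, printAll, List.flatMap_singleton, PrintCmd.print, eval, List.flatMap_assoc]
      congr 1
      funext l
      induction body with
      | nil => rfl
      | cons g body ih =>
        rw [List.flatMap_cons, h', ih, List.map_cons, List.flatMap_cons, SGate.printItems_items]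

@[simp] theorem evalAll_nil (v : Fin 10 → ℕ) : evalAll v [] = [] := rfl

@[simp] theorem evalAll_append (v : Fin 10 → ℕ) (l l' : List SCmd) :
    evalAll v (l ++ l') = evalAll v l ++ evalAll v l' := List.flatMap_append

@[simp] theorem evalAll_cons (v : Fin 10 → ℕ) (a : SCmd) (l : List SCmd) :
    evalAll v (a :: l) = a.eval v ++ evalAll v l := rfl

theorem eval_gate (v : Fin 10 → ℕ) (g : SGate) : (gate g).eval v = [g.eval v] := rfl

section Blocks

variable (v : Fin 10 → ℕ) (i j : SNum) (c : List (Fin 9))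

def swap : SCmd :=
  .loop c [.cnot ⟨i, 1⟩ ⟨j, 1⟩, .cnot ⟨j, 1⟩ ⟨i, 1⟩, .cnot ⟨i, 1⟩ ⟨j, 1⟩]

def copy : SCmd := .loop c [.cnot ⟨i, 1⟩ ⟨j, 1⟩]

def reset : SCmd := .loop c [.reset ⟨i, 1⟩]

def measure : SCmd := .loop c [.cnot ⟨i, 1⟩ ⟨j, 1⟩, .reset ⟨j, 1⟩]

/-- Coins at `i`, with the scratch wire `j`. -/
def coin : SCmd := .loop c [.h ⟨i, 1⟩, .cnot ⟨i, 1⟩ ⟨j, 0⟩, .reset ⟨j, 0⟩]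

/-- The pad; the number `n` is in the register `4`. -/
def pad : SCmd :=
  .loop [3] [.h ⟨i, 1⟩, .cnot ⟨.reg 2 3 + .lit 1, 2⟩ ⟨i, 1⟩, .h ⟨i, 1⟩, .cnot ⟨.reg 2 3, 2⟩ ⟨i, 1⟩]

@[simp] theorem eval_swap : (swap i j c).eval v =
    swapBlock (i.val v) (j.val v) (sumNum v (c.map Fin.succ)) := by
  simp [swap, eval, swapBlock, SGate.eval, SArg.val_update]

@[simp] theorem eval_copy : (copy i j c).eval v =
    copyBlock (i.val v) (j.val v) (sumNum v (c.map Fin.succ)) := by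
  simp [copy, eval, copyBlock, SGate.eval, SArg.val_update]

@[simp] theorem eval_reset : (reset i c).eval v =
    resetBlock (i.val v) (sumNum v (c.map Fin.succ)) := by
  simp [reset, eval, resetBlock, SGate.eval, SArg.val_update]

@[simp] theorem eval_measure : (measure i j c).eval v =
    measureBlock (i.val v) (j.val v) (sumNum v (c.map Fin.succ)) := by
  simp [measure, eval, measureBlock, SGate.eval, SArg.val_update]

@[simp] theorem eval_coin : (coin i j c).eval v =
    coinBlock (j.val v) (i.val v) (sumNum v (c.map Fin.succ)) := by
  simp [coin, eval, coinBlock, SGate.eval, SArg.val_update]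

@[simp] theorem eval_pad : (pad i).eval v = padBlock (v 4) (i.val v) := by
  have : sumNum v ([3].map Fin.succ) = v 4 := by simp [sumNum]
  rw [pad, eval, this, padBlock]
  simp only [List.map_cons, List.map_nil, SGate.eval, SArg.val_update, SNum.val_add, SNum.val_reg,
    SNum.val_lit, one_mul]
  congr 1
  funext l
  simp only [List.cons.injEq, Gate.cnot.injEq, and_true, true_and]
  change 2 * v 4 + 1 + 2 * l = _ ∧ 2 * v 4 + 2 * l = _
  omega

/-- The commands for `encCore`. -/
def encCmds (orc : List SCmd) (j : SNum) : List SCmd :=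
  coin j (.reg 4 3) [3, 3] :: copy j (.lit 0) [3, 3] :: orc ++
    [pad (j + .reg 2 3), reset (.reg 2 3) [3, 3]]

/-- The commands for `decCore`. -/
def decCmds (orc : List SCmd) (i : SNum) : List SCmd :=
  copy i (.lit 0) [3, 3] :: orc ++ [pad (i + .reg 2 3), reset (.reg 2 3) [3, 3]]

theorem sumNum_two : sumNum v (([3, 3] : List (Fin 9)).map Fin.succ) = 2 * v 4 := by
  simp [sumNum]
  omega

theorem evalAll_encCmds (orc : List SCmd) (j : SNum) :
    evalAll v (encCmds orc j) = encCore (v 4) (evalAll v orc) (j.val v) := by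
  simp only [encCmds, encCore, evalAll_cons, evalAll_append, evalAll_nil, eval_coin, eval_copy,
    eval_pad, eval_reset, SNum.val_add, SNum.val_reg, SNum.val_lit, sumNum_two, List.append_assoc,
    List.append_nil, List.cons_append]
  rfl

theorem evalAll_decCmds (orc : List SCmd) (j : SNum) :
    evalAll v (decCmds orc j) = decCore (v 4) (evalAll v orc) (j.val v) := by
  simp only [decCmds, decCore, evalAll_cons, evalAll_append, evalAll_nil, eval_copy,
    eval_pad, eval_reset, SNum.val_add, SNum.val_reg, SNum.val_lit, sumNum_two, List.append_assoc,
    List.append_nil, List.cons_append]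
  rfl

/-- A query to the classical oracle. -/
def query : List SCmd := [.gate (.oracle ⟨.lit 0, 0⟩ ⟨.lit 0, 0⟩ ⟨.reg 2 3, 0⟩)]

theorem evalAll_query : evalAll v query = [.oracle 0 0 (2 * v 4)] := by
  simp [query, evalAll, eval, SGate.eval, SArg.val]

/-- The commands for `encGates`. -/
def encQueryCmds : List SCmd :=
  reset j [3, 3, 3] :: swap i (j + .reg 2 3) [3] :: encCmds query j

/-- The commands for `decGates`. -/
def decQueryCmds : List SCmd :=
  reset j [3] :: decCmds query i ++ [swap (i + .reg 2 3) j [3], reset i [3, 3]]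

theorem sumNum_one : sumNum v (([3] : List (Fin 9)).map Fin.succ) = v 4 := by
  simp [sumNum]

theorem sumNum_three : sumNum v (([3, 3, 3] : List (Fin 9)).map Fin.succ) = 3 * v 4 := by
  simp [sumNum]
  omega

theorem evalAll_encQueryCmds : evalAll v (encQueryCmds i j) =
    encGates (v 4) [.oracle 0 0 (2 * v 4)] (i.val v) (j.val v) := by
  simp only [encQueryCmds, encGates, evalAll_cons, eval_reset, eval_swap, evalAll_encCmds,
    evalAll_query, SNum.val_add, SNum.val_reg, sumNum_one, sumNum_three, List.append_assoc]
  rfl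

theorem evalAll_decQueryCmds : evalAll v (decQueryCmds i j) =
    decGates (v 4) [.oracle 0 0 (2 * v 4)] (i.val v) (j.val v) := by
  simp only [decQueryCmds, decGates, evalAll_cons, evalAll_append, evalAll_nil, eval_reset,
    eval_swap, evalAll_decCmds, evalAll_query, SNum.val_add, SNum.val_reg, sumNum_one, sumNum_two,
    List.append_assoc, List.append_nil, List.cons_append]
  rfl

end Blocks

end SCmd

/-- The program that prints the numbers in the header of a description. -/
def headerCmds (a b w : SNum) : List PrintCmd :=
  ((SArg.mk a 0).items ++ (SArg.mk b 0).items ++ (SArg.mk w 0).items).map .item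

theorem printAll_headerCmds (v : Fin 10 → ℕ) (a b w : SNum) :
    printAll v (headerCmds a b w) =
      encodeNum (a.val v) ++ encodeNum (b.val v) ++ encodeNum (w.val v) := by
  have h : ∀ l : List Item, printAll v (l.map .item) = printItems v l := by
    intro l
    rw [printAll, List.flatMap_map]; rfl
  have h' : ∀ l l' : List Item, printItems v (l ++ l') = printItems v l ++ printItems v l' :=
    fun l l' => List.flatMap_append
  rw [headerCmds, h, h', h', SArg.printItems_items, SArg.printItems_items, SArg.printItems_items]
  simp [SArg.val]

end QCrypt

/-! ### Translation of the gates of given circuits -/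

namespace QCrypt

/-! ### Translators for gates -/

theorem addNums_of_notMem (v : Fin 10 → ℕ) (l : List (Fin 10)) (a : List ℕ) {i : Fin 10}
    (hi : i ∉ l) : Frag.addNums v l a i = v i := by
  induction l generalizing v a with
  | nil => rfl
  | cons j l ih =>
    cases a with
    | nil => rfl
    | cons c a =>
      rw [List.mem_cons, not_or] at hi
      exact (ih (Function.update v j (v j + c)) a hi.2).trans (Function.update_of_ne hi.1 _ _)

theorem sum_addNums_le (v : Fin 10 → ℕ) (l : List (Fin 10)) (a : List ℕ) :
    ∑ i, Frag.addNums v l a i ≤ ∑ i, v i + a.sum := by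
  induction l generalizing v a with
  | nil => exact Nat.le_add_right _ _
  | cons j l ih =>
    cases a with
    | nil => exact Nat.le_add_right _ _
    | cons c a =>
      refine (ih (Function.update v j (v j + c)) a).trans ?_
      have : Function.update v j (v j + c) = v + Pi.single j c := by
        funext i
        by_cases h : i = j
        · subst h; simp
        · simp [h]
      rw [this]
      simp only [Pi.add_apply, Finset.sum_add_distrib, List.sum_cons, Fintype.sum_pi_single']
      omega

theorem sum_le_length_flatMap_encodeNum (a : List ℕ) : a.sum ≤ (a.flatMap encodeNum).length := by
  induction a with
  | nil => exact le_rfl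
  | cons c a ih =>
    rw [List.sum_cons, List.flatMap_cons, List.length_append, encodeNum, List.length_append,
      List.length_replicate]
    omega

/-- A program that prints, and changes no numbers but the ones of the current gate. -/
theorem Frag.Does.onGate {F : Frag Reg} {w : (Fin 10 → ℕ) → List Sym}
    {u : (Fin 10 → ℕ) → Fin 10 → ℕ}
    (hF : F.Does Store.Clean fun s => { s.write (w s.num) with num := u s.num })
    (hu : ∀ v i, i ∉ ([1, 2, 3] : List (Fin 10)) → u v i = v i) (hu' : ∀ v i, u v i ≤ v i)
    {l : List (Fin 10)} (hl : l ⊆ [1, 2, 3]) (hl' : l.length ≤ 3) :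
    ∃ t, PolyBdd t ∧ ∀ (b : Bool) (a : List ℕ) (s : Store) (M : ℕ) (rest : List Sym),
      l.length = a.length → s.Clean → s.size ≤ M →
      (∀ i : Fin 10, i ∈ [1, 2, 3] → s.num i = 0) → s.src b = a.flatMap encodeNum ++ rest →
      (onGate b l F).Runs s.contents (t M)
        { s.write (w (addNums s.num l a)) with src := Function.update s.src b rest }.contents := by
  obtain ⟨t, ht, h⟩ := hF
  refine ⟨fun M => 20 * M + 20 + t M, (((PolyBdd.const 20).mul PolyBdd.id).add
    (PolyBdd.const 20)).add ht, fun b a s M rest ha hs hM hs' hsrc => ?_⟩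
  -- Reading an argument moves ticks from the description to a number, so the size does not grow.
  have hsz : ({ s with
      num := addNums s.num l a
      src := Function.update s.src b rest } : Store).size ≤ s.size := by
    have h₁ := sum_addNums_le s.num l a
    have h₂ := sum_le_length_flatMap_encodeNum a
    have h₃ : (s.src b).length = (a.flatMap encodeNum).length + rest.length := by
      rw [hsrc, List.length_append]
    simp only [Store.size, Fintype.sum_bool]
    cases b <;> simp <;> omega
  have h₁ := runs_onGate (b := b) (F := F) ha (by omega) hs' hsrc (w := w (addNums s.num l a))
    (v := u (addNums s.num l a)) (t := t M)
    (h M { s with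
      num := addNums s.num l a
      src := Function.update s.src b rest }
      ⟨hs.tmp, hs.rem, (addNums_of_notMem _ _ _ fun h => by simpa using hl h).trans hs.num⟩
      (hsz.trans hM))
    (fun i hi => (hu _ _ hi).trans (addNums_of_notMem _ _ _ fun h => hi (hl h)))
    (fun i _ => (hu' _ _).trans ((Store.num_le_size { s with
      num := addNums s.num l a
      src := Function.update s.src b rest } i).trans hsz))
  refine h₁.mono ?_
  change _ ≤ 20 * M + 20 + t M
  omega

/-- The numbers are not changed by a printing program. -/
theorem does_printFrag' (l : List PrintCmd) : (printFrag l).Does Store.Clean fun s =>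
    { s.write (printAll s.num l) with num := s.num } := does_printFrag l

/-- The test consumes a tick of the tested number, so in the nonzero case printing sees the
predecessor; in the zero case truncated subtraction makes the same formula correct. -/
theorem does_ifZero_printFrag (P Q : List PrintCmd) :
    (Frag.ifZero 1 (printFrag P) (printFrag Q)).Does Store.Clean fun s =>
      { s.write (if s.num 1 = 0 then printAll s.num P else
          printAll (Function.update s.num 1 (s.num 1 - 1)) Q) with
        num := Function.update s.num 1 (s.num 1 - 1) } := by
  obtain ⟨t, ht, h⟩ := does_printFrag P
  obtain ⟨t', ht', h'⟩ := does_printFrag Q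
  refine ⟨fun M => t M + t' M + 1, (ht.add ht').add (PolyBdd.const 1), fun M s hs hM => ?_⟩
  rcases Nat.eq_zero_or_pos (s.num 1) with h0 | h0
  · have := Frag.runs_ifZero_zero (G := printFrag Q) h0 (h M s hs hM)
    simp only [h0, if_true]
    rw [show Function.update s.num 1 (0 - 1) = s.num by
      rw [Nat.zero_sub, ← h0, Function.update_eq_self]]
    exact this.mono (by omega)
  · obtain ⟨a, ha⟩ := Nat.exists_eq_succ_of_ne_zero h0.ne'
    have hsz : ({ s with num := Function.update s.num 1 a } : Store).size ≤ s.size := by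
      have : ∑ i, Function.update s.num 1 a i ≤ ∑ i, s.num i := by
        refine Finset.sum_le_sum fun i _ => ?_
        by_cases hi : i = 1
        · subst hi; simp [ha]
        · simp [hi]
      simp only [Store.size]
      omega
    have := Frag.runs_ifZero_succ (F := printFrag P) ha (h' M
      { s with num := Function.update s.num 1 a } ⟨hs.tmp, hs.rem, by simpa using hs.num⟩
      (hsz.trans hM))
    simp only [ha, Nat.succ_ne_zero, if_false, Nat.succ_sub_one]
    exact this.mono (by omega)

def Gate.tag : Gate → Sym
  | .x _ => .x
  | .h _ => .h
  | .t _ => .t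
  | .cnot _ _ => .cnot
  | .ccx _ _ _ => .ccx
  | .reset _ => .reset
  | .oracle _ _ _ => .oracle

def Gate.args : Gate → List ℕ
  | .x i => [i]
  | .h i => [i]
  | .t i => [i]
  | .cnot c i => [c, i]
  | .ccx c d i => [c, d, i]
  | .reset i => [i]
  | .oracle q i j => [q, i, j]

theorem Gate.encode_eq (g : Gate) : g.encode = g.tag :: g.args.flatMap encodeNum := by
  cases g <;> simp [encode, tag, args]

/-- The numbers that describe a gate with the given tag. -/
def argRegs : Sym → List (Fin 10)
  | .x | .h | .t | .reset => [1]
  | .cnot => [1, 2]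
  | .ccx | .oracle | .nand => [1, 2, 3]
  | _ => []

theorem argRegs_subset (c : Sym) : argRegs c ⊆ [1, 2, 3] := by cases c <;> decide

theorem length_argRegs_le (c : Sym) : (argRegs c).length ≤ 3 := by cases c <;> decide

/-- The wire with the number in the register `i + 1`, after an offset. -/
def wireArg (off : SNum) (i : Fin 9) : SArg := ⟨off + .reg 1 i, 0⟩

/-- The commands that print the translation of a gate which is not an oracle gate. -/
def plainCmds (off : SNum) : Sym → List SCmd
  | .x => [.gate (.x (wireArg off 0))]
  | .h => [.gate (.h (wireArg off 0))]
  | .t => [.gate (.t (wireArg off 0))]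
  | .cnot => [.gate (.cnot (wireArg off 0) (wireArg off 1))]
  | .ccx => [.gate (.ccx (wireArg off 0) (wireArg off 1) (wireArg off 2))]
  | .reset => [.gate (.reset (wireArg off 0))]
  | _ => []

/-- Whether an oracle gate is an encryption or a decryption query depends on the oracle index, an
argument that is known only after reading. Hence the test at run time instead of a separate tag. -/
def compileFrag (off : SNum) (c : Sym) : Frag Reg :=
  if c = .oracle then
    .ifZero 1 (printFrag (SCmd.print (SCmd.encQueryCmds (off + .reg 1 1) (off + .reg 1 2))))
      (printFrag (SCmd.print (SCmd.decQueryCmds (off + .reg 1 1) (off + .reg 1 2))))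
  else printFrag (SCmd.print (plainCmds off c))

def compileOut (off : SNum) (c : Sym) (v : Fin 10 → ℕ) : List Gate :=
  if c = .oracle then
    if v 1 = 0 then SCmd.evalAll v (SCmd.encQueryCmds (off + .reg 1 1) (off + .reg 1 2))
    else SCmd.evalAll (Function.update v 1 (v 1 - 1))
      (SCmd.decQueryCmds (off + .reg 1 1) (off + .reg 1 2))
  else SCmd.evalAll v (plainCmds off c)

/-- The program for an oracle gate decrements the number that holds the oracle index; the other
programs leave all numbers unchanged. The function `u` records the difference. -/
theorem exists_does_compileFrag (off : SNum) (c : Sym) : ∃ u : (Fin 10 → ℕ) → Fin 10 → ℕ,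
    (∀ v i, i ∉ ([1, 2, 3] : List (Fin 10)) → u v i = v i) ∧ (∀ v i, u v i ≤ v i) ∧
    (compileFrag off c).Does Store.Clean fun s =>
      { s.write ((compileOut off c s.num).flatMap Gate.encode) with num := u s.num } := by
  by_cases hc : c = .oracle
  · refine ⟨fun v => Function.update v 1 (v 1 - 1), fun v i hi => ?_, fun v i => ?_, ?_⟩
    · exact Function.update_of_ne (by rintro rfl; simp at hi) _ _
    · by_cases hi : i = 1
      · subst hi; simp
      · simp [hi]
    · simp only [compileFrag, compileOut, if_pos hc]
      simp only [apply_ite (List.flatMap Gate.encode), ← SCmd.printAll_print]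
      exact does_ifZero_printFrag _ _
  · refine ⟨fun v => v, fun _ _ _ => rfl, fun _ _ => le_rfl, ?_⟩
    simp only [compileFrag, compileOut, if_neg hc, ← SCmd.printAll_print]
    exact does_printFrag' _

/-- Under `hoff` the offset refers to numbers with index at least 4, since indices are shifted by
`Fin.succ`. It is therefore insensitive to the argument numbers 1, 2 and 3. -/
theorem SNum.val_addNums {off : SNum} (hoff : ∀ i ∈ off.regs, 3 ≤ i) (v : Fin 10 → ℕ)
    (l : List (Fin 10)) (a : List ℕ) (hl : l ⊆ [1, 2, 3]) :
    off.val (Frag.addNums v l a) = off.val v :=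
  SNum.val_congr fun i hi => addNums_of_notMem _ _ _ fun h => by
    have h₁ := hoff i hi
    have h₂ := hl h
    clear hi h
    revert h₁ h₂
    revert i
    decide

/-- The argument numbers start at zero, so adding the arguments of the gate stores exactly these
arguments. -/
theorem compileOut_eq {off : SNum} (hoff : ∀ i ∈ off.regs, 3 ≤ i) (v : Fin 10 → ℕ)
    (hv : ∀ i : Fin 10, i ∈ [1, 2, 3] → v i = 0) (g : Gate) :
    compileOut off g.tag (Frag.addNums v (argRegs g.tag) g.args) =
      compileGate (v 4) (off.val v) g := by
  have h₁ := hv 1 (by simp)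
  have h₂ := hv 2 (by simp)
  have h₃ := hv 3 (by simp)
  have ho := SNum.val_addNums hoff v (argRegs g.tag) g.args (argRegs_subset _)
  have h4 : Frag.addNums v (argRegs g.tag) g.args 4 = v 4 :=
    addNums_of_notMem _ _ _ fun h => by
      have := argRegs_subset _ h
      revert this; decide
  cases g with
  | oracle q i j =>
    have e₁ : Frag.addNums v [1, 2, 3] [q, i, j] 1 = q := by simp [Frag.addNums, h₁]
    have e₂ : Frag.addNums v [1, 2, 3] [q, i, j] 2 = i := by simp [Frag.addNums, h₂]
    have e₃ : Frag.addNums v [1, 2, 3] [q, i, j] 3 = j := by simp [Frag.addNums, h₃]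
    simp only [Gate.tag, Gate.args, argRegs] at ho h4 ⊢
    simp only [compileOut, if_true, e₁]
    cases q with
    | zero =>
      rw [if_pos rfl, SCmd.evalAll_encQueryCmds, compileGate, h4]
      simp only [SNum.val_add, SNum.val_reg, ho, one_mul]
      change encGates _ _ (_ + Frag.addNums v [1, 2, 3] [0, i, j] 2)
        (_ + Frag.addNums v [1, 2, 3] [0, i, j] 3) = _
      rw [e₂, e₃]
    | succ q =>
      have ho' : off.val (Function.update (Frag.addNums v [1, 2, 3] [q + 1, i, j]) 1 q) =
          off.val v := by
        rw [← ho]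
        refine SNum.val_congr fun k hk => Function.update_of_ne ?_ _ _
        have := hoff k hk
        clear hk
        revert this; revert k; decide
      rw [if_neg (Nat.succ_ne_zero q), SCmd.evalAll_decQueryCmds, compileGate, Nat.add_sub_cancel]
      simp only [SNum.val_add, SNum.val_reg, ho', one_mul]
      rw [Function.update_of_ne (by decide), Function.update_of_ne (by decide),
        Function.update_of_ne (by decide), h4]
      change decGates _ _ (_ + Frag.addNums v [1, 2, 3] [q + 1, i, j] 2)
        (_ + Frag.addNums v [1, 2, 3] [q + 1, i, j] 3) = _
      rw [e₂, e₃]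
  | _ =>
    simp only [Gate.tag, Gate.args, argRegs] at ho ⊢
    simp only [compileOut, reduceCtorEq, if_false, plainCmds, SCmd.evalAll_cons, SCmd.evalAll_nil,
      List.append_nil, SCmd.eval, SGate.eval, SArg.val, wireArg, SNum.val_add, SNum.val_reg, ho,
      compileGate]
    simp [Frag.addNums, h₁, h₂, h₃]

/-- The translation of the gates of adversaries. -/
theorem exists_translator_gate (off : SNum) (hoff : ∀ i ∈ off.regs, 3 ≤ i) :
    ∃ T : Translator Gate, (∀ g, T.tag g :: T.enc g = g.encode) ∧
      (∀ v, (∀ i : Fin 10, i ∈ [1, 2, 3] → v i = 0) → ∀ g,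
        T.out v g = (compileGate (v 4) (off.val v) g).flatMap Gate.encode) := by
  choose u hu hu' hF using exists_does_compileFrag off
  choose t ht h using fun c =>
    Frag.Does.onGate (F := compileFrag off c)
      (w := fun v => (compileOut off c v).flatMap Gate.encode)
      (hF c) (hu c) (hu' c) (argRegs_subset c) (length_argRegs_le c)
  refine ⟨⟨Gate.tag, fun g => g.args.flatMap encodeNum,
    fun b c => .onGate b (argRegs c) (compileFrag off c),
    fun v g => (compileOut off g.tag (Frag.addNums v (argRegs g.tag) g.args)).flatMap Gate.encode,
    fun M => ∑ c ∈ Finset.univ, t c M,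
    PolyBdd.sum _ fun c _ => ht c, fun b g s M rest hs hM hs' hsrc => ?_⟩,
    fun g => (Gate.encode_eq g).symm, fun v hv g => by
      simp only [compileOut_eq hoff v hv g]⟩
  refine (h g.tag b g.args s M rest (by cases g <;> rfl) hs hM hs' hsrc).mono ?_
  exact Finset.single_le_sum (f := fun c => t c M) (fun _ _ => Nat.zero_le _)
    (Finset.mem_univ g.tag)

/-- The commands that print the translation of a gate of a Boolean circuit. -/
def nandCmds : List SCmd :=
  let w (i : Fin 9) : SArg := wireArg (.reg 8 3 + .lit 4) i
  let m (c : ℕ) : SArg := ⟨.reg 4 3 + .lit c, 0⟩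
  [.gate (.cnot (w 0) (m 1)), .gate (.cnot (w 1) (m 2)), .gate (.ccx (m 1) (m 2) (m 3)),
    .gate (.x (m 3)), .gate (.reset (m 1)), .gate (.reset (m 2)), .gate (.reset (w 2)),
    .gate (.cnot (m 3) (w 2)), .gate (.reset (m 3))]

theorem BGate.encode_eq (g : BGate) :
    g.encode = Sym.nand :: [g.src₁, g.src₂, g.dst].flatMap encodeNum := by
  simp [encode]

/-- A translation of the gates of Boolean circuits. -/
theorem exists_translator_bgate (P : List PrintCmd) :
    ∃ T : Translator BGate, (∀ g, T.tag g :: T.enc g = g.encode) ∧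
      ∀ v g, T.out v g = printAll (Frag.addNums v [1, 2, 3] [g.src₁, g.src₂, g.dst]) P := by
  obtain ⟨t, ht, h⟩ := Frag.Does.onGate (F := printFrag P) (w := fun v => printAll v P)
    (does_printFrag' P) (u := fun v => v) (fun _ _ _ => rfl)
    (fun _ _ => le_rfl) (l := [1, 2, 3]) (fun _ h => h) le_rfl
  exact ⟨⟨fun _ => Sym.nand, fun g => [g.src₁, g.src₂, g.dst].flatMap encodeNum,
    fun b _ => .onGate b [1, 2, 3] (printFrag P),
    fun v g => printAll (Frag.addNums v [1, 2, 3] [g.src₁, g.src₂, g.dst]) P, t, ht,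
    fun b g s M rest hs hM hs' hsrc => h b _ s M rest rfl hs hM hs' hsrc⟩,
    fun g => (BGate.encode_eq g).symm, fun _ _ => rfl⟩

theorem printAll_nandCmds (v : Fin 10 → ℕ) (hv : ∀ i : Fin 10, i ∈ [1, 2, 3] → v i = 0)
    (g : BGate) :
    printAll (Frag.addNums v [1, 2, 3] [g.src₁, g.src₂, g.dst]) (SCmd.print nandCmds) =
      (nandGates (v 4) g).flatMap Gate.encode := by
  have h₁ := hv 1 (by simp)
  have h₂ := hv 2 (by simp)
  have h₃ := hv 3 (by simp)
  rw [SCmd.printAll_print]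
  congr 1
  simp [nandCmds, SCmd.eval, SGate.eval, SArg.val, wireArg, nandGates, Frag.addNums, h₁, h₂, h₃]

end QCrypt

/-! ### Uniformity of the scheme and of the game -/

namespace QCrypt

/-! ### The circuits are uniform -/

theorem PolyTimeUniform.congr {d d' : ℕ → List Sym} (h : PolyTimeUniform d)
    (e : ∀ n, d n = d' n) : PolyTimeUniform d' := funext e ▸ h

section Numbers

variable (n w w' c : ℕ) (m : ℕ)

@[simp] theorem numbers_four : numbers n w w' c 4 = n := rfl

@[simp] theorem numbers_five : numbers n w w' c 5 = w := rfl

@[simp] theorem numbers_six : numbers n w w' c 6 = w' := rfl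

@[simp] theorem val_reg_three : (SNum.reg m 3).val (numbers n w w' c) = m * n := SNum.val_reg _ _ _

@[simp] theorem val_reg_four : (SNum.reg m 4).val (numbers n w w' c) = m * w := SNum.val_reg _ _ _

@[simp] theorem val_reg_five : (SNum.reg m 5).val (numbers n w w' c) = m * w' := SNum.val_reg _ _ _

@[simp] theorem sumNum_numbers_four : sumNum (numbers n w w' c) [4] = n := SCmd.sumNum_one _

@[simp] theorem sumNum_numbers_four_two : sumNum (numbers n w w' c) [4, 4] = 2 * n :=
  SCmd.sumNum_two _

@[simp] theorem sumNum_numbers_four_three : sumNum (numbers n w w' c) [4, 4, 4] = 3 * n :=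
  SCmd.sumNum_three _

@[simp] theorem sumNum_numbers_four_four : sumNum (numbers n w w' c) [4, 4, 4, 4] = 4 * n := by
  change n + (n + (n + (n + 0))) = _
  omega

@[simp] theorem sumNum_numbers_five : sumNum (numbers n w w' c) [5] = w := rfl

@[simp] theorem sumNum_numbers_seven : sumNum (numbers n w w' c) [7] = c := rfl

theorem numbers_args (i : Fin 10) (hi : i ∈ ([1, 2, 3] : List (Fin 10))) :
    numbers n w w' c i = 0 := by
  simp only [List.mem_cons, List.not_mem_nil, or_false] at hi
  rcases hi with rfl | rfl | rfl <;> rfl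

end Numbers

section Schemes

variable {C : ℕ → BCircuit}



/-- A circuit whose description is printed from the description of a Boolean circuit. -/
theorem PolyTimeUniform.bcircuit
    (hC : PolyTimeUniform fun n => (C n).encode (n + 2 * n) (2 * n))
    (P₀ P₂ : List PrintCmd) (Q : List PrintCmd) :
    PolyTimeUniform fun n => printAll (numbers n (C n).width (C n).width (2 * n)) P₀ ++
      (C n).gates.flatMap (fun g => printAll (Frag.addNums
        (numbers n (C n).width (C n).width (2 * n)) [1, 2, 3] [g.src₁, g.src₂, g.dst]) Q) ++
      printAll (numbers n (C n).width (C n).width (2 * n)) P₂ := by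
  obtain ⟨T, hT, hT'⟩ := exists_translator_bgate Q
  -- The printing theorem merges two descriptions. Here the same description is supplied twice, and
  -- the second copy is read by a translator that prints nothing.
  obtain ⟨T₀, hT₀, hT₀'⟩ := exists_translator_bgate []
  have e : ∀ n, (C n).encode (n + 2 * n) (2 * n) = encodeNum (n + 2 * n) ++ encodeNum (2 * n) ++
      encodeNum (C n).width ++ (C n).gates.flatMap fun g => T.tag g :: T.enc g := by
    intro n; simp only [hT, BCircuit.encode]
  have e₀ : ∀ n, (C n).encode (n + 2 * n) (2 * n) = encodeNum (n + 2 * n) ++ encodeNum (2 * n) ++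
      encodeNum (C n).width ++ (C n).gates.flatMap fun g => T₀.tag g :: T₀.enc g := by
    intro n; simp only [hT₀, BCircuit.encode]
  have := PolyTimeUniform.translate hC hC T T₀ e e₀ P₀ [] P₂
  simp only [fun v => funext (hT' v), fun v => funext (hT₀' v)] at this
  have h : ∀ l : List BGate, (l.flatMap fun _ => ([] : List Sym)) = [] := by simp
  have h' : ∀ v, printAll v [] = [] := fun _ => rfl
  simpa only [h, h', List.append_nil] using this

/-- Key generation does not involve the Boolean circuit: its description is read but its gates print
nothing, which makes the general printing theorem applicable. -/
theorem uniform_keyGenCircuit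
    (hC : PolyTimeUniform fun n => (C n).encode (n + 2 * n) (2 * n)) :
    PolyTimeUniform fun n => (keyGenCircuit n).encode 0 n := by
  have := PolyTimeUniform.bcircuit hC (headerCmds (.lit 0) (.reg 1 3) (.reg 1 3 + .lit 1))
    (SCmd.print [.coin (.lit 0) (.reg 1 3) [3]]) []
  have h : ∀ l : List BGate, (l.flatMap fun _ => ([] : List Sym)) = [] := by simp
  have h' : ∀ v, printAll v [] = [] := fun _ => rfl
  refine this.congr fun n => ?_
  simp [printAll_headerCmds, SCmd.printAll_print, h, h', keyGenCircuit, QCircuit.encode]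

/-- The commands for the first part of `evalGates`. -/
def evalCmds₁ : List SCmd :=
  [.measure (.lit 0) (.reg 8 3 + .lit 4 + .reg 1 3) [3, 3],
    .copy (.reg 4 3 + .lit 4) (.reg 8 3 + .lit 4) [3],
    .copy (.lit 0) (.reg 8 3 + .lit 4 + .reg 1 3) [3, 3]]

/-- The commands for the last part of `evalGates`. -/
def evalCmds₂ : List SCmd :=
  [.copy (.reg 8 3 + .lit 4) (.reg 2 3) [3, 3], .reset (.reg 8 3 + .lit 4) [4],
    .reset (.lit 0) [3, 3]]

/-- The `NAND` gates are translated from the given description and everything else is printed by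
fixed commands. Hence `encCore` is cut into the commands before and after the evaluation of the
gates. -/
theorem uniform_encCircuit
    (hC : PolyTimeUniform fun n => (C n).encode (n + 2 * n) (2 * n)) :
    PolyTimeUniform fun n => (encCircuit n (C n)).encode (n + n) (2 * n + n) := by
  have := PolyTimeUniform.bcircuit hC (headerCmds (.reg 2 3) (.reg 3 3)
      (.reg 8 3 + .lit 4 + .reg 1 4) ++
      SCmd.print ([.swap (.lit 0) (.reg 4 3 + .lit 4) [3], .swap (.reg 1 3) (.reg 7 3 + .lit 4) [3],
        .coin (.reg 5 3 + .lit 4) (.reg 4 3) [3, 3], .copy (.reg 5 3 + .lit 4) (.lit 0) [3, 3]] ++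
        evalCmds₁))
    (SCmd.print (evalCmds₂ ++ [.pad (.reg 5 3 + .lit 4 + .reg 2 3), .reset (.reg 2 3) [3, 3],
      .swap (.lit 0) (.reg 5 3 + .lit 4) [3, 3, 3]])) (SCmd.print nandCmds)
  refine this.congr fun n => ?_
  simp only [printAll_nandCmds _ (numbers_args _ _ _ _)]
  simp [printAll_headerCmds, SCmd.printAll_print, SCmd.printAll_append, QCircuit.encode,
    evalCmds₁, evalCmds₂, encCircuit, encCore, evalGates, List.flatMap_append, List.flatMap_assoc]
  rw [show 3 * n = 2 * n + n by omega, show n + n = 2 * n by omega]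

theorem uniform_decCircuit
    (hC : PolyTimeUniform fun n => (C n).encode (n + 2 * n) (2 * n)) :
    PolyTimeUniform fun n => (decCircuit n (C n)).encode (n + (2 * n + n)) n := by
  have := PolyTimeUniform.bcircuit hC (headerCmds (.reg 4 3) (.reg 1 3)
      (.reg 8 3 + .lit 4 + .reg 1 4) ++
      SCmd.print ([.swap (.lit 0) (.reg 4 3 + .lit 4) [3, 3, 3, 3],
        .copy (.reg 5 3 + .lit 4) (.lit 0) [3, 3]] ++ evalCmds₁))
    (SCmd.print (evalCmds₂ ++ [.pad (.reg 5 3 + .lit 4 + .reg 2 3), .reset (.reg 2 3) [3, 3],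
      .swap (.lit 0) (.reg 7 3 + .lit 4) [3]])) (SCmd.print nandCmds)
  refine this.congr fun n => ?_
  simp only [printAll_nandCmds _ (numbers_args _ _ _ _)]
  simp [printAll_headerCmds, SCmd.printAll_print, SCmd.printAll_append, QCircuit.encode,
    evalCmds₁, evalCmds₂, decCircuit, decCore, evalGates, List.flatMap_append, List.flatMap_assoc]
  rw [show n + (2 * n + n) = 4 * n by omega]

end Schemes

/-- The commands for the middle part of `gameGates`. -/
def gameCmds (b : Bool) : List SCmd :=
  (if b then [] else [.reset (.reg 4 3 + .lit 1) [3]]) ++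
    .swap (.reg 4 3 + .lit 1) (.reg 4 3 + .lit 1 + .reg 1 4 + .reg 2 3) [6] ::
      SCmd.encCmds SCmd.query (.reg 4 3 + .lit 1 + .reg 1 4) ++ [.reset (.reg 4 3 + .lit 1) [4]]

/-- No machine for `e` itself is needed: the output size `n + e n` is read off from the header of
the description of the generator and kept as number 7, to which the index 6 in `gameCmds` refers. -/
theorem uniform_gameCircuit {e : ℕ → ℕ} {G D : ℕ → QCircuit}
    (hG : PolyTimeUniform fun n => (G n).encode 0 (n + e n))
    (hD : PolyTimeUniform fun n => (D n).encode (2 * n + n + e n) 1) (b : Bool) :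
    PolyTimeUniform fun n => (gameCircuit n (e n) b (G n) (D n)).encode 0 1 := by
  obtain ⟨T, hT, hT'⟩ := exists_translator_gate (.reg 4 3 + .lit 1) (by decide)
  obtain ⟨T₀, hT₀, hT₀'⟩ := exists_translator_gate (.reg 4 3 + .lit 1 + .reg 1 4) (by decide)
  have h := PolyTimeUniform.translate hG hD T T₀ (fun n => by simp only [hT]; rfl)
    (fun n => by simp only [hT₀]; rfl)
    (headerCmds (.lit 0) (.lit 1) (.reg 4 3 + .lit 1 + .reg 1 4 + .reg 1 5))
    (SCmd.print (gameCmds b))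
    (SCmd.print [.gate (.cnot ⟨.reg 4 3 + .lit 1 + .reg 1 4, 0⟩ ⟨.lit 0, 0⟩)])
  refine h.congr fun n => ?_
  have e₁ := hT' (numbers n (G n).width (D n).width (n + e n)) (numbers_args _ _ _ _)
  have e₂ := hT₀' (numbers n (G n).width (D n).width (n + e n)) (numbers_args _ _ _ _)
  have e₁' := funext e₁
  have e₂' := funext e₂
  rw [e₁', e₂']
  cases b <;>
  simp [printAll_headerCmds, SCmd.printAll_print, QCircuit.encode, gameCircuit, gameCmds, gameGates,
    transferGates, SCmd.evalAll_encCmds, SCmd.evalAll_query, SCmd.eval_gate, SGate.eval, SArg.val,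
    List.flatMap_append, List.flatMap_assoc]

end QCrypt

/-! ### Security with a random function: positivity and trace -/

namespace QCrypt

/-! ### Positivity -/

open Matrix
open scoped ComplexOrder

/-- A completely positive map, as a combination of maps `ρ ↦ K ρ K†`. -/
inductive IsCP {a b : ℕ} : QMap a b → Prop
  | conj (K : Matrix (Bits b) (Bits a) ℂ) (Φ : QMap a b) (h : ∀ ρ, Φ ρ = K * ρ * Kᴴ) : IsCP Φ
  | zero : IsCP 0
  | add {Φ Ψ : QMap a b} : IsCP Φ → IsCP Ψ → IsCP (Φ + Ψ)
  | smul {Φ : QMap a b} (c : ℝ) (hc : 0 ≤ c) : IsCP Φ → IsCP ((c : ℂ) • Φ)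

theorem IsCP.sum {a b : ℕ} {ι : Type*} (s : Finset ι) {Φ : ι → QMap a b} (h : ∀ i, IsCP (Φ i)) :
    IsCP (∑ i ∈ s, Φ i) := by
  classical
  induction s using Finset.induction_on with
  | empty => exact .zero
  | insert i s hi ih => rw [Finset.sum_insert hi]; exact (h i).add ih

/-- The matrix is `K * ρ' * K†`, where `ρ'` arises from `ρ` by selecting, possibly repeatedly, rows
and columns according to `F`. All operations on registers are sums of operations of this form, which
gives their positivity. -/
theorem posSemidef_mix {X Y U : Type*} [Fintype X] [DecidableEq X] [Fintype Y] [Fintype U]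
    {ρ : Matrix Y Y ℂ} (hρ : ρ.PosSemidef) (F : U → X → Y) (K : X → U → ℂ) :
    (Matrix.of fun x y => ∑ u, ∑ v, K x u * ρ (F u x) (F v y) * star (K y v)).PosSemidef := by
  have h := (hρ.submatrix fun p : X × U => F p.2 p.1).mul_mul_conjTranspose_same
    (Matrix.of fun x (p : X × U) => if p.1 = x then K x p.2 else 0 : Matrix X (X × U) ℂ)
  convert h using 1
  ext x y
  simp only [Matrix.mul_apply, Matrix.of_apply, Matrix.conjTranspose_apply, Matrix.submatrix_apply,
    Fintype.sum_prod_type, apply_ite star, star_zero, ite_mul, mul_ite, zero_mul, mul_zero]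
  rw [Finset.sum_eq_single y (fun z _ hz => by simp [hz]) (by simp), Finset.sum_comm]
  refine Finset.sum_congr rfl fun v _ => ?_
  rw [if_pos rfl, Finset.sum_mul, Finset.sum_eq_single x (fun z _ hz => by simp [hz]) (by simp)]
  simp [Finset.sum_mul]

theorem posSemidef_smul {X : Type*} [Fintype X] {A : Matrix X X ℂ} (hA : A.PosSemidef) {c : ℝ}
    (hc : 0 ≤ c) : ((c : ℂ) • A).PosSemidef :=
  hA.smul (by exact_mod_cast hc)

section Maps

variable {N a b : ℕ}

/-- `applyReg` as a linear map. -/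
def applyRegMap (N : ℕ) (Φ : QMap a b) (s t : ℕ) : Op N →ₗ[ℂ] Op N where
  toFun := applyReg Φ s t
  map_add' := applyReg_add Φ s t
  map_smul' c ρ := applyReg_smul Φ s t c ρ

/-- Linearity in the map, as opposed to the state, is what carries positivity through the inductive
construction of completely positive maps and what splits an oracle into pieces. -/
theorem applyRegMap_add (Φ Ψ : QMap a b) (s t : ℕ) :
    applyRegMap N (Φ + Ψ) s t = applyRegMap N Φ s t + applyRegMap N Ψ s t := by
  ext ρ x y
  simp only [applyRegMap, applyReg, LinearMap.coe_mk, AddHom.coe_mk, LinearMap.add_apply,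
    Matrix.add_apply, Matrix.of_apply, Finset.sum_add_distrib]
  split_ifs <;> simp

theorem applyRegMap_smul (c : ℂ) (Φ : QMap a b) (s t : ℕ) :
    applyRegMap N (c • Φ) s t = c • applyRegMap N Φ s t := by
  ext ρ x y
  simp only [applyRegMap, applyReg, LinearMap.coe_mk, AddHom.coe_mk, LinearMap.smul_apply,
    Matrix.smul_apply, Matrix.of_apply, ← Finset.smul_sum]
  split_ifs <;> simp

theorem applyRegMap_zero (s t : ℕ) : applyRegMap N (0 : QMap a b) s t = 0 := by
  simpa using applyRegMap_smul (N := N) 0 (0 : QMap a b) s t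

theorem applyRegMap_sum {ι : Type*} (S : Finset ι) (Φ : ι → QMap a b) (s t : ℕ) :
    applyRegMap N (∑ i ∈ S, Φ i) s t = ∑ i ∈ S, applyRegMap N (Φ i) s t := by
  classical
  induction S using Finset.induction_on with
  | empty => exact applyRegMap_zero s t
  | insert i S hi ih => rw [Finset.sum_insert hi, Finset.sum_insert hi, applyRegMap_add, ih]

theorem tensorIdMap_add (Φ Ψ : QMap a b) (e : ℕ) :
    tensorIdMap (Φ + Ψ) e = tensorIdMap Φ e + tensorIdMap Ψ e := by
  ext ρ x y; rfl

theorem tensorIdMap_smul (c : ℂ) (Φ : QMap a b) (e : ℕ) :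
    tensorIdMap (c • Φ) e = c • tensorIdMap Φ e := by
  ext ρ x y; rfl

theorem tensorIdMap_zero (e : ℕ) : tensorIdMap (0 : QMap a b) e = 0 := by
  ext ρ x y; rfl

theorem tensorIdMap_sum {ι : Type*} (S : Finset ι) (Φ : ι → QMap a b) (e : ℕ) :
    tensorIdMap (∑ i ∈ S, Φ i) e = ∑ i ∈ S, tensorIdMap (Φ i) e := by
  classical
  induction S using Finset.induction_on with
  | empty => exact tensorIdMap_zero e
  | insert i S hi ih => rw [Finset.sum_insert hi, Finset.sum_insert hi, tensorIdMap_add, ih]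

theorem mul_mul_conjTranspose_apply {X Y : Type*} [Fintype Y] (K : Matrix X Y ℂ) (ρ : Matrix Y Y ℂ)
    (x y : X) : (K * ρ * Kᴴ) x y = ∑ u, ∑ v, K x u * ρ u v * star (K y v) := by
  simp only [Matrix.mul_apply, Matrix.conjTranspose_apply, Finset.sum_mul]
  exact Finset.sum_comm

/-- For a single Kraus operator, the auxiliary bits are spectators that enter only through the
selection of rows and columns; the other constructors follow by linearity. -/
theorem IsCP.tensorId {Φ : QMap a b} (hΦ : IsCP Φ) {e : ℕ} {ρ : Op (a + e)}
    (hρ : ρ.PosSemidef) : (tensorIdMap Φ e ρ).PosSemidef := by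
  induction hΦ with
  | conj K Φ h =>
    convert posSemidef_mix hρ (fun u x => Fin.append u (sndBits x)) (fun x : Bits (b + e) =>
      K (fstBits x)) using 1
    ext x y
    change Φ _ (fstBits x) (fstBits y) = _
    rw [h, mul_mul_conjTranspose_apply]
    rfl
  | zero => rw [tensorIdMap_zero]; exact PosSemidef.zero
  | add _ _ h₁ h₂ => rw [tensorIdMap_add]; exact h₁.add h₂
  | smul c hc _ h => rw [tensorIdMap_smul]; exact posSemidef_smul h hc

/-- As for `IsCP.tensorId`, with a sum over the discarded contents `w` of the output register; the
condition that the input register ends at zero is absorbed into the Kraus operator. -/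
theorem IsCP.applyReg {Φ : QMap a b} (hΦ : IsCP Φ) (s t : ℕ) {ρ : Op N}
    (hρ : ρ.PosSemidef) : (applyRegMap N Φ s t ρ).PosSemidef := by
  induction hΦ with
  | conj K Φ h =>
    have e : applyRegMap N Φ s t ρ = ∑ w : Bits b, Matrix.of fun x y => ∑ u, ∑ v,
        (if readReg s a x = zeros a then K (readReg t b x) u else 0) *
        ρ (writeReg s u (writeReg t w x)) (writeReg s v (writeReg t w y)) *
        star (if readReg s a y = zeros a then K (readReg t b y) v else 0) := by
      ext x y
      change (if _ then _ else _) = _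
      rw [Matrix.sum_apply]
      by_cases hx : readReg s a x = zeros a
      · by_cases hy : readReg s a y = zeros a
        · simp only [hx, hy, and_self, if_true, h, mul_mul_conjTranspose_apply, Matrix.of_apply]
        · simp [hy]
      · simp [hx]
    rw [e]
    exact posSemidef_sum _ fun w _ =>
      posSemidef_mix hρ (fun u x => writeReg s u (writeReg t w x)) _
  | zero => rw [applyRegMap_zero]; exact PosSemidef.zero
  | add _ _ h₁ h₂ => rw [applyRegMap_add]; exact h₁.add h₂
  | smul c hc _ h => rw [applyRegMap_smul]; exact posSemidef_smul h hc

theorem posSemidef_resetWire (i : ℕ) {ρ : Op N} (hρ : ρ.PosSemidef) :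
    (resetWire i ρ).PosSemidef := by
  have e : resetWire i ρ = ∑ w : Bool, Matrix.of fun x y => ∑ _u : Unit, ∑ _v : Unit,
      (if getBit x i = false then 1 else 0) * ρ (setBit x i w) (setBit y i w) *
        star (if getBit y i = false then 1 else 0 : ℂ) := by
    ext x y
    rw [resetWire, Matrix.of_apply, Matrix.sum_apply]
    by_cases hx : getBit x i = false
    · by_cases hy : getBit y i = false
      · simp [hx, hy]
      · simp [hy]
    · simp [hx]
  rw [e]
  exact posSemidef_sum _ fun w _ =>
    posSemidef_mix hρ (fun (_ : Unit) x => setBit x i w) fun x _ => if getBit x i = false then 1 else 0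

theorem posSemidef_loadInput {ρ : Op a} (hρ : ρ.PosSemidef) : (loadInput N ρ).PosSemidef := by
  convert posSemidef_mix hρ (fun (_ : Unit) (x : Bits N) => readReg 0 a x)
    (fun x _ => if ∀ j : Fin N, a ≤ (j : ℕ) → x j = false then 1 else 0) using 1
  ext x y
  have : (∀ j : Fin N, a ≤ (j : ℕ) → x j = false ∧ y j = false) ↔
      (∀ j : Fin N, a ≤ (j : ℕ) → x j = false) ∧ ∀ j : Fin N, a ≤ (j : ℕ) → y j = false :=
    ⟨fun h => ⟨fun j hj => (h j hj).1, fun j hj => (h j hj).2⟩, fun h j hj => ⟨h.1 j hj, h.2 j hj⟩⟩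
  simp only [loadInput, Matrix.of_apply, this, Finset.univ_unique, Finset.sum_singleton,
    apply_ite star, star_one, star_zero]
  split_ifs <;> simp_all

theorem posSemidef_keepOutput {ρ : Op N} (hρ : ρ.PosSemidef) :
    (keepOutput b ρ).PosSemidef := by
  have e : keepOutput b ρ = ∑ z : Bits N, if readReg 0 b z = zeros b then
      ρ.submatrix (fun u => writeReg 0 u z) (fun u => writeReg 0 u z) else 0 := by
    ext u v
    rw [keepOutput, Matrix.of_apply, Matrix.sum_apply]
    refine Finset.sum_congr rfl fun z _ => ?_
    split_ifs <;> rfl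
  rw [e]
  refine posSemidef_sum _ fun z _ => ?_
  split_ifs
  · exact hρ.submatrix _
  · exact PosSemidef.zero

theorem posSemidef_zeroFstMap {n e : ℕ} {ρ : Op (n + e)} (hρ : ρ.PosSemidef) :
    (zeroFstMap n e ρ).PosSemidef := by
  have h : zeroFstMap n e ρ = ∑ w : Bits n, Matrix.of fun x y => ∑ _u : Unit, ∑ _v : Unit,
      (if fstBits x = zeros n then 1 else 0) *
        ρ (Fin.append w (sndBits x)) (Fin.append w (sndBits y)) *
        star (if fstBits y = zeros n then 1 else 0 : ℂ) := by
    ext x y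
    change ketbra₂ _ _ _ _ * ∑ _, _ = _
    rw [Matrix.sum_apply, ketbra₂_apply, Finset.mul_sum]
    refine Finset.sum_congr rfl fun w _ => ?_
    by_cases hx : fstBits x = zeros n <;> by_cases hy : fstBits y = zeros n <;> simp [hx, hy]
  rw [h]
  exact posSemidef_sum _ fun w _ =>
    posSemidef_mix hρ (fun (_ : Unit) x => Fin.append w (sndBits x)) fun x _ =>
      if fstBits x = zeros n then 1 else 0

end Maps

/-! ### Traces -/

section Traces

variable {N a b : ℕ}

theorem trace_ketbra₂ (x y : Bits N) : (ketbra₂ x y).trace = if x = y then 1 else 0 := by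
  by_cases h : x = y
  · subst h; simp
  · simp [h, Matrix.trace_single_eq_of_ne _ _ _ h]

/-- Both sides are linear in `ρ`, so scaling of the trace can be tested on matrix units. -/
theorem trace_of_ketbra₂ (f : Op a →ₗ[ℂ] Op b) (c : ℂ)
    (h : ∀ x y, (f (ketbra₂ x y)).trace = if x = y then c else 0) (ρ : Op a) :
    (f ρ).trace = c * ρ.trace := by
  have : Matrix.traceLinearMap _ ℂ ℂ ∘ₗ f = c • Matrix.traceLinearMap _ ℂ ℂ :=
    linearMap_op_ext fun x y => by
      rw [LinearMap.comp_apply, LinearMap.smul_apply, Matrix.traceLinearMap_apply,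
        Matrix.traceLinearMap_apply, h, trace_ketbra₂]
      split_ifs <;> simp
  exact LinearMap.congr_fun this ρ

/-- The proposition `p` stands for agreement of the spectator wires, without which all relocated
units are off-diagonal. -/
theorem trace_relocate (F G : Bits b → Bits N) (p : Prop) [Decidable p]
    (h : ∀ u v, F u = G v ↔ u = v ∧ p) (A : Op b) :
    (relocate F G A).trace = if p then A.trace else 0 := by
  rw [relocate_apply, Matrix.trace_sum]
  simp only [Matrix.trace_sum, Matrix.trace_smul, trace_ketbra₂, h]
  by_cases hp : p
  · simp [hp, Matrix.trace]
  · simp [hp]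

theorem setBit_eq_setBit_iff {i : ℕ} (hi : i < N) (x y : Bits N) (b c : Bool) :
    setBit x i b = setBit y i c ↔ b = c ∧ setBit x i false = setBit y i false := by
  constructor
  · intro h
    refine ⟨by rw [← getBit_setBit_self x hi b, h, getBit_setBit_self y hi c], ?_⟩
    funext j
    have := congrFun h j
    simp only [setBit] at this ⊢
    split_ifs with hj
    · rfl
    · simpa [hj] using this
  · rintro ⟨rfl, h⟩
    funext j
    have := congrFun h j
    simp only [setBit] at this ⊢
    split_ifs with hj
    · rfl
    · simpa [hj] using this

theorem bits_eq_iff {i : ℕ} (hi : i < N) (x y : Bits N) :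
    x = y ↔ getBit x i = getBit y i ∧ setBit x i false = setBit y i false := by
  conv_lhs => rw [← setBit_getBit x i, ← setBit_getBit y i]
  exact setBit_eq_setBit_iff hi ..

/-- Conjugation by `U`, as a linear map. -/
def conjByMap (U : Op N) : Op N →ₗ[ℂ] Op N where
  toFun := conjBy U
  map_add' := conjBy_add U
  map_smul' c ρ := conjBy_smul U ρ c

/-- The hypothesis `hu` says that the columns of `u` are orthonormal. -/
theorem trace_conjBy_oneQubit {u : Matrix Bool Bool ℂ}
    (hu : ∀ p q, ∑ b, u b p * star (u b q) = if p = q then 1 else 0) {i : ℕ} (hi : i < N)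
    (ρ : Op N) : (conjBy (oneQubit u i) ρ).trace = ρ.trace := by
  refine (trace_of_ketbra₂ (conjByMap (oneQubit u i)) 1 (fun x y => ?_) ρ).trans (one_mul _)
  change (conjBy _ _).trace = _
  rw [conjBy_oneQubit u hi]
  simp only [Matrix.trace_sum, Matrix.trace_smul, trace_ketbra₂]
  by_cases h : setBit x i false = setBit y i false
  · have h₁ : ∀ b c, setBit x i b = setBit y i c ↔ b = c := fun b c =>
      (setBit_eq_setBit_iff hi x y b c).trans (and_iff_left h)
    have h₂ : x = y ↔ getBit x i = getBit y i := (bits_eq_iff hi x y).trans (and_iff_left h)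
    simp only [h₁, h₂]
    rw [← hu]
    simp
  · have h₁ : ∀ b c, setBit x i b ≠ setBit y i c := fun b c h' =>
      h ((setBit_eq_setBit_iff hi x y b c).1 h').2
    have h₂ : x ≠ y := fun h' => h ((bits_eq_iff hi x y).1 h').2
    simp [h₁, h₂]

theorem trace_conjBy_basisMap {g : Bits N → Bits N} (hg : Function.Injective g) (ρ : Op N) :
    (conjBy (basisMap g) ρ).trace = ρ.trace := by
  refine (trace_of_ketbra₂ (conjByMap (basisMap g)) 1 (fun x y => ?_) ρ).trans (one_mul _)
  change (conjBy _ _).trace = _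
  rw [conjBy_basisMap, trace_ketbra₂]
  simp only [hg.eq_iff]

/-- Resetting a wire, as a linear map. -/
def resetWireMap (N i : ℕ) : Op N →ₗ[ℂ] Op N where
  toFun := resetWire i
  map_add' := resetWire_add i
  map_smul' c ρ := resetWire_smul i c ρ

theorem trace_resetWire {i : ℕ} (hi : i < N) (ρ : Op N) : (resetWire i ρ).trace = ρ.trace := by
  refine (trace_of_ketbra₂ (resetWireMap N i) 1 (fun x y => ?_) ρ).trans (one_mul _)
  change (resetWire _ _).trace = _
  rw [resetWire_ketbra₂ hi]
  simp only [bits_eq_iff hi x y]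
  by_cases h : getBit x i = getBit y i
  · simp only [h, if_true, true_and, trace_ketbra₂]
  · simp [h]

/-- A general factor `c` is allowed, because an encryption oracle with a hole scales the trace by a
constant below one. -/
theorem trace_applyReg {Φ : QMap a b} {c : ℂ} (hΦ : ∀ A, (Φ A).trace = c * A.trace) {i j : ℕ}
    (hi : i + a ≤ N) (hj : j + b ≤ N) (hij : i + a ≤ j ∨ j + b ≤ i) (ρ : Op N) :
    (applyRegMap N Φ i j ρ).trace = c * ρ.trace := by
  refine trace_of_ketbra₂ _ c (fun x y => ?_) ρ
  change (applyReg _ _ _ _).trace = _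
  rw [applyReg_ketbra₂ Φ hi hj hij]
  let Agree : Prop := ∀ k < N, ¬(i ≤ k ∧ k < i + a) → ¬(j ≤ k ∧ k < j + b) → getBit x k = getBit y k
  have key := writeReg_writeReg_eq_iff (N := N) hi hj hij
  have hxy : x = y ↔ readReg i a x = readReg i a y ∧ readReg j b x = readReg j b y ∧ Agree := by
    rw [← key]
    constructor
    · rintro rfl
      exact (key _ _ _ _).2 ⟨rfl, rfl, fun _ _ _ _ => rfl⟩
    · intro h
      rw [← h]
      exact ((key _ _ _ _).2 ⟨rfl, rfl, fun _ _ _ _ => rfl⟩).symm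
  classical
  by_cases h : readReg j b x = readReg j b y
  · rw [if_pos h, trace_relocate _ _ Agree, hΦ, trace_ketbra₂]
    · simp only [hxy, h, true_and]
      by_cases h₁ : Agree <;> by_cases h₂ : readReg i a x = readReg i a y <;> simp [h₁, h₂]
    · intro u v
      have h₁ := (key (zeros a) v y _).1 rfl
      rw [key, ← h₁.1, ← h₁.2.1]
      simp only [true_and, Agree]
      refine and_congr_right fun _ => forall₄_congr fun k hk hk₁ hk₂ => ?_
      rw [h₁.2.2 k hk hk₁ hk₂]
  · simp [h, hxy]

theorem trace_loadInput (ha : a ≤ N) (ρ : Op a) : (loadInput N ρ).trace = ρ.trace := by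
  refine (trace_of_ketbra₂ (loadInputMap a N) 1 (fun x y => ?_) ρ).trans (one_mul _)
  change (loadInput _ _).trace = _
  rw [loadInput_ketbra₂ ha, trace_ketbra₂]
  have : writeReg 0 x (zeros N) = writeReg 0 y (zeros N) ↔ x = y := by
    refine ⟨fun h => ?_, fun h => h ▸ rfl⟩
    have h0 : 0 + a ≤ N := by omega
    rw [((writeReg_eq_iff h0 x (zeros N) _).1 rfl).1, h,
      ← ((writeReg_eq_iff h0 y (zeros N) _).1 rfl).1]
  simp only [this]

theorem trace_keepOutput (hb : b ≤ N) (ρ : Op N) : (keepOutput b ρ).trace = ρ.trace := by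
  refine (trace_of_ketbra₂ (keepOutputMap N b) 1 (fun x y => ?_) ρ).trans (one_mul _)
  change (keepOutput _ _).trace = _
  rw [keepOutput_ketbra₂ hb]
  have : x = y ↔ (∀ k < N, b ≤ k → getBit x k = getBit y k) ∧ readReg 0 b x = readReg 0 b y := by
    refine ⟨fun h => h ▸ ⟨fun _ _ _ => rfl, rfl⟩, fun h => bits_ext fun k hk => ?_⟩
    by_cases hk' : b ≤ k
    · exact h.1 k hk hk'
    · simpa using readReg_eq_iff.1 h.2 k (by omega)
  by_cases h : ∀ k < N, b ≤ k → getBit x k = getBit y k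
  · rw [if_pos h, trace_ketbra₂]
    simp only [this, eq_true h, true_and]
  · rw [if_neg h, if_neg fun h' => h (this.1 h').1, Matrix.trace_zero]

theorem append_eq_iff {u : Bits a} {w : Bits b} {p : Bits (a + b)} :
    Fin.append u w = p ↔ u = fstBits p ∧ w = sndBits p := by
  constructor
  · rintro rfl
    exact ⟨funext fun i => by simp [fstBits], funext fun i => by simp [sndBits]⟩
  · rintro ⟨rfl, rfl⟩
    exact Fin.append_castAdd_natAdd (f := p)

theorem fstBits_append (u : Bits a) (w : Bits b) : fstBits (Fin.append u w) = u :=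
  (append_eq_iff.1 rfl).1.symm

theorem sndBits_append (u : Bits a) (w : Bits b) : sndBits (Fin.append u w) = w :=
  (append_eq_iff.1 rfl).2.symm

theorem bits_eq_iff_fst_snd {x y : Bits (a + b)} :
    x = y ↔ fstBits x = fstBits y ∧ sndBits x = sndBits y := by
  rw [← append_eq_iff]
  conv_lhs => rw [← Fin.append_castAdd_natAdd (f := x)]
  rfl

theorem trace_tensorId {Φ : QMap a b} {c : ℂ} (hΦ : ∀ A, (Φ A).trace = c * A.trace) (e : ℕ)
    (ρ : Op (a + e)) : (tensorIdMap Φ e ρ).trace = c * ρ.trace := by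
  refine trace_of_ketbra₂ _ c (fun x y => ?_) ρ
  change (tensorId _ _ _).trace = _
  rw [tensorId_ketbra₂, trace_relocate _ _ (sndBits x = sndBits y), hΦ, trace_ketbra₂]
  · simp only [bits_eq_iff_fst_snd (x := x)]
    by_cases h₁ : sndBits x = sndBits y <;> by_cases h₂ : fstBits x = fstBits y <;> simp [h₁, h₂]
  · intro u v
    rw [append_eq_iff, fstBits_append, sndBits_append]

theorem trace_zeroFstMap {n e : ℕ} (ρ : Op (n + e)) : (zeroFstMap n e ρ).trace = ρ.trace := by
  refine (trace_of_ketbra₂ _ 1 (fun x y => ?_) ρ).trans (one_mul _)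
  change (tensor _ (traceFst _)).trace = _
  rw [traceFst_ketbra₂]
  simp only [bits_eq_iff_fst_snd (x := x)]
  by_cases h : fstBits x = fstBits y
  · rw [if_pos h, tensor_ketbra_ketbra₂, trace_ketbra₂]
    simp only [append_eq_iff, fstBits_append, sndBits_append, h, true_and]
  · rw [if_neg h]
    have : tensor (ketbra (zeros n)) (0 : Op e) = 0 := by ext x y; simp [tensor]
    simp [this, h]

end Traces

end QCrypt

/-! ### Comparison of runs with and without a hole -/

namespace QCrypt

open Matrix
open scoped ComplexOrder

/-! ### Oracles with a hole -/

/-- The real part of the trace. -/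
def reTrace {N : ℕ} (ρ : Op N) : ℝ := ρ.trace.re

section Trace

variable {N : ℕ} {ρ σ : Op N}

theorem reTrace_sub (ρ σ : Op N) : reTrace (ρ - σ) = reTrace ρ - reTrace σ := by
  simp [reTrace]

theorem reTrace_nonneg (hρ : ρ.PosSemidef) : 0 ≤ reTrace ρ :=
  (Complex.le_def.1 hρ.trace_nonneg).1

theorem reTrace_le (h : (ρ - σ).PosSemidef) : reTrace σ ≤ reTrace ρ := by
  have := reTrace_nonneg h
  rw [reTrace_sub] at this
  linarith

theorem reTrace_smul (c : ℝ) (h : σ.trace = (c : ℂ) * ρ.trace) : reTrace σ = c * reTrace ρ := by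
  rw [reTrace, h, Complex.re_ofReal_mul, reTrace]

end Trace

theorem prOne_sub (ρ σ : Op 1) : prOne (ρ - σ) = prOne ρ - prOne σ := rfl

theorem prOne_nonneg {ρ : Op 1} (hρ : ρ.PosSemidef) : 0 ≤ prOne ρ :=
  (Complex.le_def.1 hρ.diag_nonneg).1

theorem prOne_le_reTrace {ρ : Op 1} (hρ : ρ.PosSemidef) : prOne ρ ≤ reTrace ρ := by
  rw [reTrace, Matrix.trace, Complex.re_sum]
  exact Finset.single_le_sum (f := fun i => (ρ.diag i).re)
    (fun i _ => (Complex.le_def.1 (hρ.diag_nonneg (i := i))).1) (Finset.mem_univ _)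

/-- An oracle that is a sum of maps. -/
structure PieceOracle (ι : Type) where
  inN : ℕ
  outN : ℕ
  piece : ι → QMap inN outN

section Pieces

variable {ι : Type} [Fintype ι] [DecidableEq ι]

namespace PieceOracle

/-- The oracle. -/
def full (o : PieceOracle ι) : QOracle := ⟨o.inN, o.outN, ∑ r, o.piece r⟩

/-- The oracle without the part `r`. -/
def hole (r : ι) (o : PieceOracle ι) : QOracle := ⟨o.inN, o.outN, ∑ r' ∈ Finset.univ.erase r, o.piece r'⟩

def size (o : PieceOracle ι) : ℕ × ℕ := (o.inN, o.outN)

/-- The parts are completely positive, and the oracle preserves the trace. -/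
structure Valid (o : PieceOracle ι) : Prop where
  cp : ∀ r, IsCP (o.piece r)
  trace : ∀ A, (o.full.map A).trace = A.trace

theorem full_map (o : PieceOracle ι) (r : ι) : (∑ r, o.piece r) =
    (∑ r' ∈ Finset.univ.erase r, o.piece r') + o.piece r :=
  (Finset.sum_erase_add _ _ (Finset.mem_univ r)).symm

theorem applyReg_full (o : PieceOracle ι) (r : ι) {N : ℕ} (i j : ℕ) (σ : Op N) :
    applyRegMap N o.full.map i j σ =
      applyRegMap N (o.hole r).map i j σ + applyRegMap N (o.piece r) i j σ := by
  change applyRegMap N (∑ r, o.piece r) i j σ = _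
  rw [full_map o r, applyRegMap_add]
  rfl

end PieceOracle

/-- Gates that are not oracle gates. -/
def Gate.IsPlain : Gate → Prop
  | .oracle _ _ _ => False
  | _ => True

section Gates

variable {N : ℕ}

theorem Gate.lin_eq_of_isPlain {g : Gate} (hg : g.IsPlain) (O O' : List QOracle) :
    g.lin O N = g.lin O' N := by
  cases g <;> first | rfl | exact hg.elim

theorem Gate.posSemidef_of_isPlain {g : Gate} (hg : g.IsPlain) (O : List QOracle) {ρ : Op N}
    (hρ : ρ.PosSemidef) : (g.lin O N ρ).PosSemidef := by
  cases g with
  | oracle q i j => exact hg.elim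
  | reset i => exact posSemidef_resetWire i hρ
  | _ => exact hρ.mul_mul_conjTranspose_same _

/-- Adding to a wire a value that does not depend on this wire is an involution. -/
theorem setBit_injective {i : ℕ} {f : Bits N → Bool}
    (hf : ∀ (x : Bits N) b, f (setBit x i b) = f x) :
    Function.Injective fun y : Bits N => setBit y i (xor (getBit y i) (f y)) := by
  by_cases hi : i < N
  · have : Function.Involutive fun y : Bits N => setBit y i (xor (getBit y i) (f y)) := by
      intro y
      simp only [hf y, getBit_setBit_self _ hi]
      refine bits_ext fun k hk => ?_
      rw [getBit_setBit, getBit_setBit]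
      by_cases h : k = i
      · subst h; simp [hk]
      · simp [h]
    exact this.injective
  · intro x y h
    have e : ∀ (x : Bits N) b, setBit x i b = x := fun x b => funext fun j => by
      simp only [setBit]; rw [if_neg (by omega)]
    simpa only [e] using h

theorem Gate.trace_of_isPlain {g : Gate} (hg : g.IsPlain) {sig : List (ℕ × ℕ)} (hw : g.WF sig N)
    (O : List QOracle) (ρ : Op N) : (g.lin O N ρ).trace = ρ.trace := by
  cases g with
  | oracle q i j => exact hg.elim
  | reset i => exact trace_resetWire hw ρ
  | x i =>
    refine trace_conjBy_oneQubit (fun p q => ?_) hw ρ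
    cases p <;> cases q <;> simp [pauliX]
  | h i =>
    refine trace_conjBy_oneQubit (fun p q => ?_) hw ρ
    have h2 : ((Real.sqrt 2 : ℝ) : ℂ)⁻¹ * ((Real.sqrt 2 : ℝ) : ℂ)⁻¹ = 1 / 2 := by
      rw [← mul_inv, ← Complex.ofReal_mul, Real.mul_self_sqrt (by norm_num)]
      norm_num
    cases p <;> cases q <;> simp [hadamard, h2] <;> norm_num
  | t i =>
    refine trace_conjBy_oneQubit (fun p q => ?_) hw ρ
    have h1 : Complex.exp (Real.pi / 4 * Complex.I) *
        star (Complex.exp (Real.pi / 4 * Complex.I)) = 1 := by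
      rw [show star (Complex.exp (Real.pi / 4 * Complex.I)) = (starRingEnd ℂ) _ from rfl,
        ← Complex.exp_conj, ← Complex.exp_add]
      simp [Complex.conj_ofNat]
    cases p <;> cases q <;> simp [tGate, Matrix.diagonal_apply]
    exact h1
  | cnot c i =>
    refine trace_conjBy_basisMap (setBit_injective (f := fun y => getBit y c) fun x b => ?_) ρ
    exact getBit_setBit_of_ne _ hw.2.2 _
  | ccx c d i =>
    refine trace_conjBy_basisMap
      (setBit_injective (f := fun y => getBit y c && getBit y d) fun x b => ?_) ρ
    rw [getBit_setBit_of_ne _ hw.2.2.2.2.1, getBit_setBit_of_ne _ hw.2.2.2.2.2]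

theorem Gate.lin_oracle_some {O : List QOracle} {q : ℕ} {Φ : QOracle} (h : O[q]? = some Φ)
    (i j : ℕ) : (Gate.oracle q i j).lin O N = applyRegMap N Φ.map i j := by
  ext1 ρ
  change (match O[q]? with | some Φ => applyReg Φ.map i j ρ | none => ρ) = _
  rw [h]
  rfl

theorem Gate.lin_oracle_none {O : List QOracle} {q : ℕ} (h : O[q]? = none)
    (i j : ℕ) : (Gate.oracle q i j).lin O N = LinearMap.id := by
  ext1 ρ
  change (match O[q]? with | some Φ => applyReg Φ.map i j ρ | none => ρ) = _
  rw [h]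
  rfl

/-- If all oracles scale the trace by `c`, then every gate does so, or preserves it. -/
theorem Gate.trace_lin {O : List QOracle} {c : ℝ}
    (hO : ∀ Φ ∈ O, ∀ A, (Φ.map A).trace = (c : ℂ) * A.trace) {g : Gate}
    (hg : g.WF (O.map fun Φ => (Φ.inN, Φ.outN)) N) (ρ : Op N) :
    reTrace (g.lin O N ρ) = reTrace ρ ∨ reTrace (g.lin O N ρ) = c * reTrace ρ := by
  by_cases hp : g.IsPlain
  · left
    rw [reTrace, Gate.trace_of_isPlain hp hg, reTrace]
  · cases g with
    | oracle q i j =>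
      obtain ⟨a, b, h, hi, hj, hij⟩ := hg
      rw [List.getElem?_map, Option.map_eq_some_iff] at h
      obtain ⟨⟨a', b', Φ⟩, h, e⟩ := h
      obtain ⟨rfl, rfl⟩ := Prod.mk.inj e
      right
      rw [Gate.lin_oracle_some h]
      exact reTrace_smul c (trace_applyReg (hO _ (List.mem_of_getElem? h)) hi hj hij ρ)
    | _ => exact absurd trivial hp

/-- Each gate keeps the trace or multiplies it by `c`, so at most one factor `c` is lost per gate.
-/
theorem reTrace_runGates {O : List QOracle} {c : ℝ} (hc : 0 ≤ c) (hc' : c ≤ 1)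
    (hO : ∀ Φ ∈ O, ∀ A, (Φ.map A).trace = (c : ℂ) * A.trace) {gs : List Gate}
    (hg : ∀ g ∈ gs, g.WF (O.map fun Φ => (Φ.inN, Φ.outN)) N) {ρ : Op N} (hρ : 0 ≤ reTrace ρ) :
    c ^ gs.length * reTrace ρ ≤ reTrace (runGates O N gs ρ) ∧
      reTrace (runGates O N gs ρ) ≤ reTrace ρ := by
  induction gs generalizing ρ with
  | nil => simp
  | cons g gs ih =>
    have h₁ : 0 ≤ reTrace (g.lin O N ρ) ∧ c * reTrace ρ ≤ reTrace (g.lin O N ρ) ∧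
        reTrace (g.lin O N ρ) ≤ reTrace ρ := by
      rcases Gate.trace_lin hO (hg g (by simp)) ρ with h | h <;> rw [h]
      · exact ⟨hρ, mul_le_of_le_one_left hρ hc', le_rfl⟩
      · exact ⟨mul_nonneg hc hρ, le_rfl, mul_le_of_le_one_left hρ hc'⟩
    have h₂ := ih (fun g hg' => hg g (by simp [hg'])) h₁.1
    rw [runGates_cons, List.length_cons, pow_succ, mul_assoc]
    exact ⟨(mul_le_mul_of_nonneg_left h₁.2.1 (pow_nonneg hc _)).trans h₂.1, h₂.2.trans h₁.2.2⟩

variable {O : List (PieceOracle ι)}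

/-- The oracles with a hole are dominated by the oracles. -/
theorem Gate.dominates (hO : ∀ o ∈ O, o.Valid) (r : ι) (g : Gate) {ρ σ : Op N}
    (hσ : σ.PosSemidef) (h : (ρ - σ).PosSemidef) :
    (g.lin (O.map (PieceOracle.hole r)) N σ).PosSemidef ∧
      (g.lin (O.map PieceOracle.full) N ρ - g.lin (O.map (PieceOracle.hole r)) N σ).PosSemidef := by
  by_cases hp : g.IsPlain
  · rw [Gate.lin_eq_of_isPlain hp (O.map PieceOracle.full) (O.map (PieceOracle.hole r)), ← map_sub]
    exact ⟨Gate.posSemidef_of_isPlain hp _ hσ, Gate.posSemidef_of_isPlain hp _ h⟩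
  · cases g with
    | oracle q i j =>
      cases hq : O[q]? with
      | none =>
        rw [Gate.lin_oracle_none (by simp [hq]), Gate.lin_oracle_none (by simp [hq])]
        exact ⟨hσ, h⟩
      | some o =>
        have hv := hO o (List.mem_of_getElem? hq)
        rw [Gate.lin_oracle_some (O := O.map PieceOracle.full) (Φ := o.full) (by simp [hq]),
          Gate.lin_oracle_some (O := O.map (PieceOracle.hole r)) (Φ := o.hole r) (by simp [hq])]
        -- Full oracle on `ρ` minus punctured oracle on `σ` is the full oracle on `ρ - σ` plus the
        -- missing piece on `σ`; both terms are positive.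
        have e : applyRegMap N o.full.map i j ρ - applyRegMap N (o.hole r).map i j σ =
            applyRegMap N o.full.map i j (ρ - σ) + applyRegMap N (o.piece r) i j σ := by
          rw [map_sub, o.applyReg_full r i j σ]
          abel
        rw [e]
        exact ⟨(IsCP.sum _ hv.cp).applyReg i j hσ,
          ((IsCP.sum _ hv.cp).applyReg i j h).add ((hv.cp r).applyReg i j hσ)⟩
    | _ => exact absurd trivial hp

theorem runGates_dominates (hO : ∀ o ∈ O, o.Valid) (r : ι) (gs : List Gate) {ρ σ : Op N}
    (hσ : σ.PosSemidef) (h : (ρ - σ).PosSemidef) :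
    (runGates (O.map (PieceOracle.hole r)) N gs σ).PosSemidef ∧
      (runGates (O.map PieceOracle.full) N gs ρ -
        runGates (O.map (PieceOracle.hole r)) N gs σ).PosSemidef := by
  induction gs generalizing ρ σ with
  | nil => exact ⟨hσ, h⟩
  | cons g gs ih => exact ih (g.dominates hO r hσ h).1 (g.dominates hO r hσ h).2

/-- The total loss of a gate. -/
theorem Gate.sum_loss_le (hO : ∀ o ∈ O, o.Valid) {g : Gate}
    (hg : g.WF (O.map PieceOracle.size) N) {ρ : Op N}
    (hρ : ρ.PosSemidef) {σ : ι → Op N} (h : ∀ r, (ρ - σ r).PosSemidef) :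
    ∑ r, (reTrace (σ r) - reTrace (g.lin (O.map (PieceOracle.hole r)) N (σ r))) ≤ reTrace ρ := by
  by_cases hp : g.IsPlain
  · refine (Finset.sum_eq_zero fun r _ => ?_).trans_le (reTrace_nonneg hρ)
    rw [reTrace, reTrace, Gate.trace_of_isPlain hp hg, sub_self]
  · cases g with
    | oracle q i j =>
      obtain ⟨a, b, hq, hi, hj, hij⟩ := hg
      rw [List.getElem?_map, Option.map_eq_some_iff] at hq
      obtain ⟨o, hq, e⟩ := hq
      obtain ⟨rfl, rfl⟩ := Prod.mk.inj e
      have hv := hO o (List.mem_of_getElem? hq)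
      have ht : ∀ τ : Op N, reTrace (applyRegMap N o.full.map i j τ) = reTrace τ := fun τ => by
        have := reTrace_smul 1 (trace_applyReg (N := N) (c := ((1 : ℝ) : ℂ)) (Φ := o.full.map)
          (fun A => by rw [hv.trace, Complex.ofReal_one, one_mul]) hi hj hij τ)
        rwa [one_mul] at this
      -- The loss at the hole `r` is the trace of the missing piece on `σ r`, at most its trace on
      -- `ρ`. Since `ρ` does not depend on `r`, the pieces then sum up to the full oracle, which
      -- preserves the trace.
      have hl : ∀ r, reTrace (σ r) -
          reTrace ((Gate.oracle q i j).lin (O.map (PieceOracle.hole r)) N (σ r)) ≤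
          reTrace (applyRegMap N (o.piece r) i j ρ) := by
        intro r
        rw [Gate.lin_oracle_some (O := O.map (PieceOracle.hole r)) (Φ := o.hole r) (by simp [hq]),
          ← ht (σ r)]
        rw [← reTrace_sub, o.applyReg_full r i j (σ r), add_sub_cancel_left]
        refine reTrace_le ?_
        rw [← map_sub]
        exact (hv.cp r).applyReg i j (h r)
      refine (Finset.sum_le_sum fun r _ => hl r).trans_eq ?_
      rw [← ht ρ]
      change _ = reTrace (applyRegMap N (∑ r, o.piece r) i j ρ)
      rw [applyRegMap_sum, LinearMap.sum_apply, reTrace, Matrix.trace_sum, Complex.re_sum]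
      rfl
    | _ => exact absurd trivial hp

/-- The total loss of a list of gates. -/
theorem sum_loss_runGates_le (hO : ∀ o ∈ O, o.Valid) {gs : List Gate}
    (hg : ∀ g ∈ gs, g.WF (O.map PieceOracle.size) N) {ρ : Op N} (hρ : ρ.PosSemidef) {σ : ι → Op N}
    (hσ : ∀ r, (σ r).PosSemidef) (h : ∀ r, (ρ - σ r).PosSemidef) :
    ∑ r, (reTrace (σ r) - reTrace (runGates (O.map (PieceOracle.hole r)) N gs (σ r))) ≤
      gs.length * reTrace ρ := by
  induction gs generalizing ρ σ with
  | nil => simp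
  | cons g gs ih =>
    have hw := hg g (by simp)
    -- The comparison state evolves with the full oracles and keeps its trace, so every further gate
    -- again loses at most `reTrace ρ` in total.
    have ht : reTrace (g.lin (O.map PieceOracle.full) N ρ) = reTrace ρ := by
      have := Gate.trace_lin (O := O.map PieceOracle.full) (c := 1) (N := N) (g := g)
        (fun Φ hΦ A => by
          obtain ⟨o, ho, rfl⟩ := List.mem_map.1 hΦ
          rw [(hO o ho).trace, Complex.ofReal_one, one_mul]) (by rw [List.map_map]; exact hw) ρ
      rwa [one_mul, or_self] at this
    have hρ' : (g.lin (O.map PieceOracle.full) N ρ).PosSemidef := by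
      by_cases hp : g.IsPlain
      · exact Gate.posSemidef_of_isPlain hp _ hρ
      · cases g with
        | oracle q i j =>
          obtain ⟨a, b, hq, -⟩ := hw
          rw [List.getElem?_map, Option.map_eq_some_iff] at hq
          obtain ⟨o, hq, -⟩ := hq
          rw [Gate.lin_oracle_some (O := O.map PieceOracle.full) (Φ := o.full) (by simp [hq])]
          exact (IsCP.sum _ (hO o (List.mem_of_getElem? hq)).cp).applyReg i j hρ
        | _ => exact absurd trivial hp
    have h₁ := Gate.sum_loss_le hO hw hρ h
    have h₂ := ih (fun g hg' => hg g (by simp [hg'])) hρ'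
      (fun r => (g.dominates hO r (hσ r) (h r)).1) (fun r => (g.dominates hO r (hσ r) (h r)).2)
    rw [ht] at h₂
    simp only [runGates_cons, List.length_cons, Nat.cast_add, Nat.cast_one, add_mul, one_mul]
    rw [Finset.sum_sub_distrib] at h₁ h₂ ⊢
    linarith

end Gates

/-- The run of a circuit, as a linear map. -/
noncomputable def QCircuit.runMap (O : List QOracle) (C : QCircuit) (a b : ℕ) : Op a →ₗ[ℂ] Op b :=
  keepOutputMap C.width b ∘ₗ runGates O C.width C.gates ∘ₗ loadInputMap a C.width

theorem QCircuit.run_eq_runMap (O : List QOracle) (C : QCircuit) {a b : ℕ} (ρ : Op a) :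
    C.run O b ρ = C.runMap O a b ρ := C.run_eq O b ρ

section Circuits

variable {a b : ℕ} {C : QCircuit} {O : List (PieceOracle ι)}

theorem QCircuit.dominates (hO : ∀ o ∈ O, o.Valid) (r : ι) {ρ σ : Op a}
    (hσ : σ.PosSemidef) (h : (ρ - σ).PosSemidef) :
    (C.runMap (O.map (PieceOracle.hole r)) a b σ).PosSemidef ∧
      (C.runMap (O.map PieceOracle.full) a b ρ -
        C.runMap (O.map (PieceOracle.hole r)) a b σ).PosSemidef := by
  have h' : (loadInputMap a C.width ρ - loadInputMap a C.width σ).PosSemidef := by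
    rw [← map_sub]; exact posSemidef_loadInput h
  have h₁ := runGates_dominates hO r C.gates (posSemidef_loadInput (N := C.width) hσ) h'
  refine ⟨posSemidef_keepOutput h₁.1, ?_⟩
  simp only [QCircuit.runMap, LinearMap.comp_apply]
  rw [← map_sub]
  exact posSemidef_keepOutput h₁.2

theorem QCircuit.reTrace_runMap {O : List QOracle} {c : ℝ} (hc : 0 ≤ c) (hc' : c ≤ 1)
    (hO : ∀ Φ ∈ O, ∀ A, (Φ.map A).trace = (c : ℂ) * A.trace)
    (hC : C.WF (O.map fun Φ => (Φ.inN, Φ.outN)) a b) {ρ : Op a} (hρ : 0 ≤ reTrace ρ) :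
    c ^ C.gates.length * reTrace ρ ≤ reTrace (C.runMap O a b ρ) ∧
      reTrace (C.runMap O a b ρ) ≤ reTrace ρ := by
  have e : reTrace (loadInput C.width ρ) = reTrace ρ := by rw [reTrace, trace_loadInput hC.1, reTrace]
  have h := reTrace_runGates (N := C.width) hc hc' hO hC.2.2 (ρ := loadInput C.width ρ) (by rwa [e])
  rw [e] at h
  have e' : ∀ τ : Op C.width, reTrace (keepOutput b τ) = reTrace τ := fun τ => by
    rw [reTrace, trace_keepOutput hC.2.1, reTrace]
  change _ ≤ reTrace (keepOutput b _) ∧ reTrace (keepOutput b _) ≤ _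
  rw [e']
  exact h

theorem QCircuit.reTrace_runMap_full (hO : ∀ o ∈ O, o.Valid) (hC : C.WF (O.map PieceOracle.size) a b)
    {ρ : Op a} (hρ : 0 ≤ reTrace ρ) : reTrace (C.runMap (O.map PieceOracle.full) a b ρ) = reTrace ρ := by
  have := QCircuit.reTrace_runMap (O := O.map PieceOracle.full) zero_le_one le_rfl (fun Φ hΦ A => by
    obtain ⟨o, ho, rfl⟩ := List.mem_map.1 hΦ
    rw [(hO o ho).trace, Complex.ofReal_one, one_mul]) (by rw [List.map_map]; exact hC) hρ
  rw [one_pow, one_mul] at this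
  exact le_antisymm this.2 this.1

theorem QCircuit.sum_loss_le (hO : ∀ o ∈ O, o.Valid) (hC : C.WF (O.map PieceOracle.size) a b) {ρ : Op a}
    (hρ : ρ.PosSemidef) :
    ∑ r, (reTrace ρ - reTrace (C.runMap (O.map (PieceOracle.hole r)) a b ρ)) ≤
      C.gates.length * reTrace ρ := by
  have e : reTrace (loadInput C.width ρ) = reTrace ρ := by rw [reTrace, trace_loadInput hC.1, reTrace]
  -- All punctured runs start from the same state as the full run.
  have h := sum_loss_runGates_le hO hC.2.2 (posSemidef_loadInput hρ)
    (σ := fun _ => loadInput C.width ρ) (fun _ => posSemidef_loadInput hρ)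
    fun _ => by rw [sub_self]; exact PosSemidef.zero
  rw [e] at h
  refine le_trans (le_of_eq ?_) h
  refine Finset.sum_congr rfl fun r _ => ?_
  have e' : ∀ τ : Op C.width, reTrace (keepOutput b τ) = reTrace τ := fun τ => by
    rw [reTrace, trace_keepOutput hC.2.1, reTrace]
  change _ - reTrace (keepOutput b _) = _
  rw [e']
  rfl

end Circuits

end Pieces

end QCrypt

/-! ### Pieces of the oracles and perfect secrecy of the pad -/

namespace QCrypt

open Matrix
open scoped ComplexOrder

/-! ### The parts of encryption and decryption -/

section Parts

variable {a b n : ℕ}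

/-- The map `ρ ↦ K ρ K†`. -/
noncomputable def conjMap (K : Matrix (Bits b) (Bits a) ℂ) : QMap a b where
  toFun ρ := K * ρ * Kᴴ
  map_add' ρ σ := by rw [Matrix.mul_add, Matrix.add_mul]
  map_smul' c ρ := by rw [Matrix.mul_smul, Matrix.smul_mul, RingHom.id_apply]

theorem conjMap_apply (K : Matrix (Bits b) (Bits a) ℂ) (ρ : Op a) (x y : Bits b) :
    conjMap K ρ x y = ∑ u, ∑ v, K x u * ρ u v * star (K y v) := mul_mul_conjTranspose_apply K ρ x y

/-- Encryption with the pad key `s`, if the random string is `r`. -/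
noncomputable def encPart (r s : Bits (2 * n)) : QMap n (2 * n + n) :=
  conjMap (Matrix.of fun x u => if fstBits x = r then pad s (sndBits x) u else 0)

/-- Decryption with the pad key `s`, if the measured string is `r`. -/
noncomputable def decPart (r s : Bits (2 * n)) : QMap (2 * n + n) n :=
  conjMap (Matrix.of fun x p => if fstBits p = r then pad s x (sndBits p) else 0)

theorem encPart_apply (r s : Bits (2 * n)) (ρ : Op n) :
    encPart r s ρ = tensor (ketbra r) (conjBy (pad s) ρ) := by
  ext x y
  change _ = ketbra₂ r r (fstBits x) (fstBits y) * (pad s * ρ * (pad s)ᴴ) _ _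
  rw [encPart, conjMap_apply, mul_mul_conjTranspose_apply, ketbra₂_apply]
  by_cases hx : fstBits x = r
  · by_cases hy : fstBits y = r
    · simp [hx, hy]
    · simp [hy]
  · simp [hx]

theorem sum_bits_add {M : Type*} [AddCommMonoid M] (f : Bits (a + b) → M) :
    ∑ p, f p = ∑ u : Bits a, ∑ w : Bits b, f (Fin.append u w) := by
  rw [← Fintype.sum_prod_type']
  exact (Equiv.sum_comp (Fin.appendEquiv a b) f).symm

theorem decPart_apply (r s : Bits (2 * n)) (σ : Op (2 * n + n)) :
    decPart r s σ = conjBy (pad s) (Matrix.of fun x y => σ (Fin.append r x) (Fin.append r y)) := by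
  ext x y
  change _ = (pad s * _ * (pad s)ᴴ) x y
  rw [decPart, conjMap_apply, mul_mul_conjTranspose_apply]
  simp only [Matrix.of_apply, sum_bits_add, fstBits_append, sndBits_append]
  rw [Finset.sum_eq_single r]
  · refine Finset.sum_congr rfl fun u _ => ?_
    rw [Finset.sum_eq_single r]
    · simp
    · intro r' _ h; simp [h]
    · simp
  · intro r' _ h; simp [h]
  · simp

theorem encPart_ketbra₂ (r s : Bits (2 * n)) (u v : Bits n) :
    encPart r s (ketbra₂ u v) = (padSign s u * padSign s v) •
      ketbra₂ (Fin.append r (padShift s u)) (Fin.append r (padShift s v)) := by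
  rw [encPart_apply, conjBy_pad]
  change tensorMap n (ketbra r) _ = _
  rw [map_smul]
  change _ • tensor _ _ = _
  rw [tensor_ketbra_ketbra₂]

theorem padShift_injective (s : Bits (2 * n)) : Function.Injective (padShift s) :=
  Function.Involutive.injective (padShift_padShift s)

theorem trace_encPart (r s : Bits (2 * n)) (ρ : Op n) : (encPart r s ρ).trace = ρ.trace := by
  refine (trace_of_ketbra₂ _ 1 (fun u v => ?_) ρ).trans (one_mul _)
  rw [encPart_ketbra₂, Matrix.trace_smul, trace_ketbra₂]
  simp only [append_eq_iff, fstBits_append, sndBits_append, (padShift_injective s).eq_iff,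
    true_and]
  by_cases h : u = v
  · subst h; simp [padSign_mul_self]
  · simp [h]

theorem trace_padDec (φ : Bits (2 * n) → Bits (2 * n)) (σ : Op (2 * n + n)) :
    (padDec φ σ).trace = σ.trace := by
  refine (trace_of_ketbra₂ _ 1 (fun p q => ?_) σ).trans (one_mul _)
  rw [padDec_ketbra₂]
  simp only [bits_eq_iff_fst_snd (x := p)]
  by_cases h : fstBits p = fstBits q
  · rw [if_pos h, Matrix.trace_smul, trace_ketbra₂]
    simp only [(padShift_injective _).eq_iff]
    by_cases h' : sndBits p = sndBits q
    · simp [h, h', padSign_mul_self]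
    · simp [h']
  · simp [h]

/-- The encryption oracle, as the sum over the random strings. -/
noncomputable def encPieces (φ : Bits (2 * n) → Bits (2 * n)) : PieceOracle (Bits (2 * n)) :=
  ⟨n, 2 * n + n, fun r => ((1 / Fintype.card (Bits (2 * n)) : ℝ) : ℂ) • encPart r (φ r)⟩

/-- The decryption oracle, as the sum over the measured strings. -/
noncomputable def decPieces (φ : Bits (2 * n) → Bits (2 * n)) : PieceOracle (Bits (2 * n)) :=
  ⟨2 * n + n, n, fun r => decPart r (φ r)⟩

theorem padEnc_eq_sum (φ : Bits (2 * n) → Bits (2 * n)) : padEnc φ =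
    ((1 / Fintype.card (Bits (2 * n)) : ℝ) : ℂ) • ∑ r, encPart r (φ r) := by
  ext1 ρ
  rw [LinearMap.smul_apply, LinearMap.sum_apply]
  simp only [encPart_apply]
  push_cast
  rfl

theorem full_encPieces (φ : Bits (2 * n) → Bits (2 * n)) :
    (encPieces φ).full = padEncOracle φ := by
  rw [padEncOracle, padEnc_eq_sum, Finset.smul_sum]
  rfl

theorem padDec_eq_sum (φ : Bits (2 * n) → Bits (2 * n)) : padDec φ = ∑ r, decPart r (φ r) := by
  ext1 σ
  rw [LinearMap.sum_apply]
  simp only [decPart_apply]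
  rfl

theorem full_decPieces (φ : Bits (2 * n) → Bits (2 * n)) :
    (decPieces φ).full = padDecOracle φ := by
  rw [padDecOracle, padDec_eq_sum]
  rfl

/-- Every piece of encryption preserves the trace up to its weight, so only the number of pieces
matters; this covers the full oracle and the oracle with a hole. -/
theorem trace_sum_encPart (φ : Bits (2 * n) → Bits (2 * n)) (c : ℝ) (S : Finset (Bits (2 * n)))
    (A : Op n) : ((∑ r ∈ S, (c : ℂ) • encPart r (φ r)) A).trace = ((S.card * c : ℝ) : ℂ) * A.trace := by
  simp only [LinearMap.sum_apply, LinearMap.smul_apply, Matrix.trace_sum, Matrix.trace_smul]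
  rw [Finset.sum_congr rfl fun r _ => congrArg _ (trace_encPart r (φ r) A), Finset.sum_const,
    nsmul_eq_mul, smul_eq_mul, ← mul_assoc]
  push_cast
  rfl

theorem valid_encPieces (φ : Bits (2 * n) → Bits (2 * n)) : (encPieces φ).Valid where
  cp r := .smul _ (by positivity) (.conj _ _ fun _ => rfl)
  trace A := by
    refine (trace_sum_encPart φ _ _ A).trans ?_
    rw [Finset.card_univ, mul_one_div_cancel (Nat.cast_ne_zero.2 Fintype.card_ne_zero),
      Complex.ofReal_one, one_mul]
    rfl

theorem valid_decPieces (φ : Bits (2 * n) → Bits (2 * n)) : (decPieces φ).Valid where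
  cp r := .conj _ _ fun _ => rfl
  trace A := by
    refine Eq.trans ?_ (trace_padDec φ A)
    rw [padDec_eq_sum]
    rfl

/-- The loss is the same fraction for every state, since the random string of an encryption is
independent of the input. Decryption has no such property: its string is chosen by the caller. -/
theorem trace_hole_encPieces (φ : Bits (2 * n) → Bits (2 * n)) (r : Bits (2 * n)) (A : Op n) :
    (((encPieces φ).hole r).map A).trace =
      ((1 - 1 / Fintype.card (Bits (2 * n)) : ℝ) : ℂ) * A.trace := by
  refine (trace_sum_encPart φ _ _ A).trans ?_
  congr 2
  rw [Finset.card_erase_of_mem (Finset.mem_univ r), Finset.card_univ, Nat.cast_sub Fintype.card_pos,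
    Nat.cast_one, sub_mul, one_mul, mul_one_div_cancel (Nat.cast_ne_zero.2 Fintype.card_ne_zero)]

theorem PieceOracle.hole_congr {ι : Type} [Fintype ι] [DecidableEq ι] {p p' : ι → QMap a b} {r : ι}
    (h : ∀ r', r' ≠ r → p r' = p' r') :
    PieceOracle.hole r ⟨a, b, p⟩ = PieceOracle.hole r ⟨a, b, p'⟩ :=
  congrArg (QOracle.mk a b) (Finset.sum_congr rfl fun r' hr' => h r' (Finset.ne_of_mem_erase hr'))

/-- The purpose of the hole: the remaining pieces do not depend on the value of `φ` at `r`. -/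
theorem hole_encPieces_update (φ : Bits (2 * n) → Bits (2 * n)) (r s : Bits (2 * n)) :
    (encPieces (Function.update φ r s)).hole r = (encPieces φ).hole r :=
  PieceOracle.hole_congr fun r' hr' => by rw [Function.update_of_ne hr']

theorem hole_decPieces_update (φ : Bits (2 * n) → Bits (2 * n)) (r s : Bits (2 * n)) :
    (decPieces (Function.update φ r s)).hole r = (decPieces φ).hole r :=
  PieceOracle.hole_congr fun r' hr' => by rw [Function.update_of_ne hr']

/-! ### The pad with a random key -/

/-- Flip the sign bit `j` of the key of a pad. -/
def flipSign (j : Fin n) (s : Bits (2 * n)) : Bits (2 * n) :=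
  fun k => if (k : ℕ) = 2 * j + 1 then !s k else s k

theorem flipSign_flipSign (j : Fin n) (s : Bits (2 * n)) : flipSign j (flipSign j s) = s := by
  funext k
  simp only [flipSign]
  split_ifs <;> simp

theorem padShift_flipSign (j : Fin n) (s : Bits (2 * n)) (u : Bits n) :
    padShift (flipSign j s) u = padShift s u := by
  funext i
  simp only [padShift, flipSign]
  rw [if_neg (by omega)]

theorem padSign_flipSign (j : Fin n) (s : Bits (2 * n)) (u : Bits n) :
    padSign (flipSign j s) u = padSign s u * sgn (u j) := by
  have : ∀ i : Fin n, sgn (flipSign j s ⟨2 * i + 1, by omega⟩ && u i) =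
      sgn (s ⟨2 * i + 1, by omega⟩ && u i) * if i = j then sgn (u i) else 1 := by
    intro i
    by_cases h : i = j
    · subst h
      simp only [flipSign, if_true]
      generalize s _ = c
      generalize u i = d
      cases c <;> cases d <;> simp [sgn]
    · rw [if_neg h, mul_one, flipSign, if_neg]
      simp only
      exact fun h' => h (Fin.ext (by omega))
  simp only [padSign, this, Finset.prod_mul_distrib, Finset.prod_ite_eq', Finset.mem_univ, if_true]

/-- Add the string `u` to the shift bits of the key of a pad. -/
def addShift (u : Bits n) (s : Bits (2 * n)) : Bits (2 * n) :=
  fun k => if (k : ℕ) % 2 = 0 then xor (s k) (u ⟨k / 2, by omega⟩) else s k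

theorem addShift_addShift (u : Bits n) (s : Bits (2 * n)) : addShift u (addShift u s) = s := by
  funext k
  simp only [addShift]
  split_ifs <;> simp

theorem padShift_addShift (u : Bits n) (s : Bits (2 * n)) :
    padShift (addShift u s) (zeros n) = padShift s u := by
  funext i
  simp only [padShift, addShift, zeros]
  rw [if_pos (by omega)]
  have : (⟨2 * (i : ℕ) / 2, by omega⟩ : Fin n) = i := Fin.ext (by simp)
  rw [this, Bool.false_xor, Bool.xor_comm]

/-- On the diagonal, signs cancel and the bijection `addShift u` of the keys turns the shift of `u`
into the shift of zero. Off the diagonal, `u` and `v` differ at some `j`; flipping the sign bit `j`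
of the key permutes the keys and negates each term, so the sum is its own negative. -/
theorem sum_encPart_ketbra₂ (r : Bits (2 * n)) (u v : Bits n) :
    ∑ s, encPart r s (ketbra₂ u v) =
      if u = v then ∑ s, encPart r s (ketbra₂ (zeros n) (zeros n)) else 0 := by
  by_cases h : u = v
  · subst h
    rw [if_pos rfl]
    refine Fintype.sum_bijective (addShift u)
      (Function.Involutive.bijective (addShift_addShift u)) _ _ fun s => ?_
    rw [encPart_ketbra₂, encPart_ketbra₂, padSign_mul_self, padSign_mul_self, padShift_addShift]
  · rw [if_neg h]
    obtain ⟨j, hj⟩ := Function.ne_iff.1 h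
    have hs : sgn (u j) * sgn (v j) = -1 := by
      revert hj
      generalize u j = c
      generalize v j = d
      cases c <;> cases d <;> simp [sgn]
    have e : ∀ s, encPart r (flipSign j s) (ketbra₂ u v) = -encPart r s (ketbra₂ u v) := by
      intro s
      rw [encPart_ketbra₂, encPart_ketbra₂, padShift_flipSign, padShift_flipSign, padSign_flipSign,
        padSign_flipSign, mul_mul_mul_comm, hs, mul_neg_one, neg_smul]
    have h₁ := Equiv.sum_comp (Function.Involutive.toPerm _ (flipSign_flipSign j))
      fun s => encPart r s (ketbra₂ u v)
    change ∑ s, encPart r (flipSign j s) (ketbra₂ u v) = _ at h₁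
    rw [Finset.sum_congr rfl fun s _ => e s, Finset.sum_neg_distrib] at h₁
    ext x y
    exact self_eq_neg.1 (congrFun (congrFun h₁ x) y).symm

/-- Encryption with a random pad key hides the plaintext. -/
theorem sum_tensorId_encPart (r : Bits (2 * n)) (e : ℕ) (ρ : Op (n + e)) :
    ∑ s, tensorIdMap (encPart r s) e (zeroFstMap n e ρ) = ∑ s, tensorIdMap (encPart r s) e ρ := by
  have : (∑ s, tensorIdMap (encPart r s) e) ∘ₗ zeroFstMap n e =
      ∑ s, tensorIdMap (encPart r s) e := by
    refine linearMap_op_ext fun p q => ?_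
    -- After summation over the keys only the reduced operator on the auxiliary register matters,
    -- and zeroing the plaintext does not change it.
    have h : ∀ p q : Bits (n + e), (∑ s, tensorIdMap (encPart r s) e) (ketbra₂ p q) =
        if fstBits p = fstBits q then relocate (fun x => Fin.append x (sndBits p))
          (fun x => Fin.append x (sndBits q))
          (∑ s, encPart r s (ketbra₂ (zeros n) (zeros n))) else 0 := by
      intro p q
      rw [LinearMap.sum_apply]
      change ∑ s, tensorId (encPart r s) e (ketbra₂ p q) = _
      simp only [tensorId_ketbra₂]
      rw [← map_sum, sum_encPart_ketbra₂]
      split_ifs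
      · rfl
      · rw [map_zero]
    have hz : zeroFstMap n e (ketbra₂ p q) = if fstBits p = fstBits q then
        ketbra₂ (Fin.append (zeros n) (sndBits p)) (Fin.append (zeros n) (sndBits q)) else 0 := by
      change tensor _ (traceFst _) = _
      rw [traceFst_ketbra₂]
      split_ifs
      · rw [tensor_ketbra_ketbra₂]
      · ext x y; simp [tensor]
    rw [LinearMap.comp_apply, hz, h p q]
    split_ifs
    · rw [h, fstBits_append, fstBits_append, sndBits_append, sndBits_append, if_pos rfl]
    · rw [map_zero]
  have := LinearMap.congr_fun this ρ
  simpa only [LinearMap.comp_apply, LinearMap.sum_apply] using this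

end Parts

/-! ### Random functions -/

/-- A random value of a random function can be replaced by a fresh random value, if the rest does
not depend on it. -/
theorem card_mul_sum_apply {ι β : Type*} [Fintype ι] [DecidableEq ι] [Fintype β] (r : ι)
    (F : (ι → β) → β → ℝ) (hF : ∀ φ s s', F (Function.update φ r s') s = F φ s) :
    Fintype.card β * ∑ φ, F φ (φ r) = ∑ φ, ∑ s, F φ s := by
  have h₁ : ∀ φ s, F φ s = F (Function.update φ r s) (Function.update φ r s r) := by
    intro φ s
    rw [hF, Function.update_self]
  -- Exchanging the value at `r` with the fresh value is an involution on pairs, hence preserves the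
  -- sum over all pairs.
  have hi : Function.Involutive fun p : (ι → β) × β => (Function.update p.1 r p.2, p.1 r) := by
    rintro ⟨φ, s⟩
    simp
  have h₂ := Equiv.sum_comp hi.toPerm fun p : (ι → β) × β => F p.1 (p.1 r)
  simp only [Function.Involutive.coe_toPerm, Fintype.sum_prod_type] at h₂
  rw [Finset.sum_congr rfl fun φ _ => Finset.sum_congr rfl fun s _ => h₁ φ s, h₂]
  simp [Finset.mul_sum]

end QCrypt

/-! ### The average game value for a random function -/

namespace QCrypt

open Matrix
open scoped ComplexOrder

/-! ### The game with a random function -/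

section Hybrid

variable {n : ℕ} (e : ℕ) (G D : QCircuit) (b : Bool)

/-- The plaintext register is kept or replaced by zeros. -/
def plainMap (n e : ℕ) (b : Bool) : Op (n + e) →ₗ[ℂ] Op (n + e) :=
  if b then LinearMap.id else zeroFstMap n e

/-- The result of the game with the given oracles, if the challenge is encrypted with the random
string `r` and the pad key `s`. -/
noncomputable def partValue (OG OD : List QOracle) (r s : Bits (2 * n)) : ℝ :=
  prOne (D.runMap OD (2 * n + n + e) 1 (tensorIdMap (encPart r s) e
    (plainMap n e b (G.runMap OG 0 (n + e) blank))))

theorem prOne_sum {ι : Type*} (s : Finset ι) (ρ : ι → Op 1) :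
    prOne (∑ i ∈ s, ρ i) = ∑ i ∈ s, prOne (ρ i) := by
  simp only [prOne, Matrix.sum_apply, Complex.re_sum]

/-- Only the encryption of the challenge is expanded over its random string; the oracles remain
complete here and are punctured separately for each `r`. -/
theorem gameValue_eq_sum (φ : Bits (2 * n) → Bits (2 * n)) :
    gameValue e G D b φ = 1 / Fintype.card (Bits (2 * n)) * ∑ r,
      partValue e G D b [padEncOracle φ, padDecOracle φ] [padEncOracle φ] r (φ r) := by
  simp only [partValue]
  rw [gameValue, QCircuit.run_eq_runMap, QCircuit.run_eq_runMap, ← prOne_sum, ← map_sum]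
  change prOne (D.runMap [padEncOracle φ] (2 * n + n + e) 1 (tensorIdMap (padEnc φ) e
    (plainMap n e b (G.runMap [padEncOracle φ, padDecOracle φ] 0 (n + e) blank)))) = _
  rw [padEnc_eq_sum, tensorIdMap_smul, tensorIdMap_sum, LinearMap.smul_apply, LinearMap.sum_apply,
    map_smul]
  simp only [prOne, Matrix.smul_apply, smul_eq_mul, Complex.re_ofReal_mul]

theorem posSemidef_blank : blank.PosSemidef := PosSemidef.one

theorem reTrace_blank : reTrace blank = 1 := by simp [reTrace, blank]

theorem posSemidef_plainMap {ρ : Op (n + e)} (hρ : ρ.PosSemidef) :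
    (plainMap n e b ρ).PosSemidef := by
  cases b
  · exact posSemidef_zeroFstMap hρ
  · exact hρ

theorem trace_plainMap (ρ : Op (n + e)) : (plainMap n e b ρ).trace = ρ.trace := by
  cases b
  · exact trace_zeroFstMap ρ
  · rfl

/-- The game with a hole at `r`, in which the challenge is encrypted with the random string `r` and
the pad key `s`. -/
noncomputable def holeValue (r : Bits (2 * n)) (φ : Bits (2 * n) → Bits (2 * n))
    (s : Bits (2 * n)) : ℝ :=
  partValue e G D b [(encPieces φ).hole r, (decPieces φ).hole r] [(encPieces φ).hole r] r s

variable {G D}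

/-- A hole in the oracles changes the result of the game only by a small amount on average. -/
theorem partValue_hole
    (hG : G.WF [(n, 2 * n + n), (2 * n + n, n)] 0 (n + e))
    (hD : D.WF [(n, 2 * n + n)] (2 * n + n + e) 1) (φ : Bits (2 * n) → Bits (2 * n)) :
    (∀ r, holeValue e G D b r φ (φ r) ≤
        partValue e G D b [padEncOracle φ, padDecOracle φ] [padEncOracle φ] r (φ r)) ∧
      ∑ r, (partValue e G D b [padEncOracle φ, padDecOracle φ] [padEncOracle φ] r (φ r) -
        holeValue e G D b r φ (φ r)) ≤ G.gates.length + D.gates.length := by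
  set OG : List (PieceOracle (Bits (2 * n))) := [encPieces φ, decPieces φ]
  set OD : List (PieceOracle (Bits (2 * n))) := [encPieces φ]
  have hOG : ∀ o ∈ OG, o.Valid := by
    intro o ho
    simp only [OG, List.mem_cons, List.not_mem_nil, or_false] at ho
    rcases ho with rfl | rfl
    · exact valid_encPieces φ
    · exact valid_decPieces φ
  have hOD : ∀ o ∈ OD, o.Valid := by
    intro o ho
    simp only [OD, List.mem_cons, List.not_mem_nil, or_false] at ho
    subst ho
    exact valid_encPieces φ
  have eG : [padEncOracle φ, padDecOracle φ] = OG.map PieceOracle.full := by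
    simp only [OG, List.map_cons, List.map_nil, full_encPieces, full_decPieces]
  have eD : [padEncOracle φ] = OD.map PieceOracle.full := by
    simp only [OD, List.map_cons, List.map_nil, full_encPieces]
  have hG' : G.WF (OG.map PieceOracle.size) 0 (n + e) := hG
  have hD' : D.WF (OD.map PieceOracle.size) (2 * n + n + e) 1 := hD
  -- the states of the two games
  set ρ : Op (n + e) := G.runMap (OG.map PieceOracle.full) 0 (n + e) blank with hρ
  set σ : Bits (2 * n) → Op (n + e) := fun r =>
    G.runMap (OG.map (PieceOracle.hole r)) 0 (n + e) blank with hσ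
  have h₁ : ∀ r, (σ r).PosSemidef ∧ (ρ - σ r).PosSemidef := fun r =>
    QCircuit.dominates hOG r posSemidef_blank (by rw [sub_self]; exact PosSemidef.zero)
  have tρ : reTrace ρ = 1 := by
    rw [hρ, QCircuit.reTrace_runMap_full hOG hG' (by rw [reTrace_blank]; exact zero_le_one),
      reTrace_blank]
  let M (r : Bits (2 * n)) : Op (n + e) →ₗ[ℂ] Op (2 * n + n + e) :=
    tensorIdMap (encPart r (φ r)) e ∘ₗ plainMap n e b
  have hM : ∀ r (τ : Op (n + e)), τ.PosSemidef → (M r τ).PosSemidef := fun r τ hτ =>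
    IsCP.tensorId (.conj _ _ fun _ => rfl) (posSemidef_plainMap e b hτ)
  have tM : ∀ r (τ : Op (n + e)), reTrace (M r τ) = reTrace τ := fun r τ => by
    have := trace_tensorId (c := 1) (fun A => by rw [trace_encPart r (φ r) A, one_mul]) e
      (plainMap n e b τ)
    rw [one_mul, trace_plainMap] at this
    exact congrArg Complex.re this
  -- The fraction of the trace that survives a query to the encryption oracle with a hole.
  set c : ℝ := 1 - 1 / Fintype.card (Bits (2 * n)) with hc
  have hN : (0 : ℝ) < Fintype.card (Bits (2 * n)) := Nat.cast_pos.2 Fintype.card_pos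
  have hN' : (1 : ℝ) ≤ Fintype.card (Bits (2 * n)) := Nat.one_le_cast.2 Fintype.card_pos
  have hc₀ : 0 ≤ c := by rw [hc, sub_nonneg, div_le_one hN]; exact hN'
  have hc₁ : c ≤ 1 := by rw [hc]; linarith [one_div_pos.2 hN]
  have h₂ : ∀ r, (D.runMap (OD.map (PieceOracle.hole r)) (2 * n + n + e) 1 (M r (σ r))).PosSemidef ∧
      (D.runMap (OD.map PieceOracle.full) (2 * n + n + e) 1 (M r ρ) -
        D.runMap (OD.map (PieceOracle.hole r)) (2 * n + n + e) 1 (M r (σ r))).PosSemidef :=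
    fun r => QCircuit.dominates hOD r (hM r _ (h₁ r).1) (by rw [← map_sub]; exact hM r _ (h₁ r).2)
  have hdiff : ∀ r, partValue e G D b [padEncOracle φ, padDecOracle φ] [padEncOracle φ] r (φ r) -
        holeValue e G D b r φ (φ r) = prOne (D.runMap (OD.map PieceOracle.full) (2 * n + n + e) 1 (M r ρ) -
        D.runMap (OD.map (PieceOracle.hole r)) (2 * n + n + e) 1 (M r (σ r))) := by
    intro r
    rw [prOne_sub, eG, eD]
    rfl
  refine ⟨fun r => ?_, ?_⟩
  · have := prOne_nonneg (h₂ r).2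
    rw [← hdiff] at this
    linarith
  -- The first term is the loss in the generator and is small only after summation over `r`. The
  -- second is the loss in the distinguisher, whose input depends on `r`, so it needs a bound for
  -- every single `r`.
  · have hr : ∀ r, partValue e G D b [padEncOracle φ, padDecOracle φ] [padEncOracle φ] r (φ r) -
        holeValue e G D b r φ (φ r) ≤ (1 - reTrace (σ r)) +
            D.gates.length * (1 / Fintype.card (Bits (2 * n))) := by
      intro r
      rw [hdiff]
      refine (prOne_le_reTrace (h₂ r).2).trans ?_
      have t₀ := reTrace_nonneg (h₁ r).1
      have t₁ := reTrace_le (h₁ r).2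
      rw [tρ] at t₁
      rw [reTrace_sub, QCircuit.reTrace_runMap_full hOD hD' (by rw [tM, tρ]; exact zero_le_one), tM,
        tρ]
      have h := (QCircuit.reTrace_runMap (O := OD.map (PieceOracle.hole r)) (C := D) (b := 1) hc₀ hc₁
        (fun Φ hΦ A => by
          simp only [OD, List.map_cons, List.map_nil, List.mem_cons, List.not_mem_nil,
            or_false] at hΦ
          subst hΦ
          exact trace_hole_encPieces φ r A) hD (ρ := M r (σ r)) (by rw [tM]; exact t₀)).1
      rw [tM] at h
      -- Bernoulli's inequality for `c ^ D.gates.length`.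
      have hp : 1 + (D.gates.length : ℝ) * (-(1 / Fintype.card (Bits (2 * n)))) ≤
          c ^ D.gates.length := by
        have := one_add_mul_le_pow (a := -(1 / (Fintype.card (Bits (2 * n)) : ℝ))) (by linarith)
          D.gates.length
        rwa [← sub_eq_add_neg 1 (1 / (Fintype.card (Bits (2 * n)) : ℝ))] at this
      have h3 : 0 ≤ (D.gates.length : ℝ) * (1 / Fintype.card (Bits (2 * n))) := by positivity
      -- The trace `t` of `σ r` lies in `[0, 1]`, so with `x = D.gates.length / card` the lower
      -- bound `(1 - x) * t` for the final trace is at least `t - x`.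
      nlinarith
    refine (Finset.sum_le_sum fun r _ => hr r).trans ?_
    rw [Finset.sum_add_distrib, Finset.sum_const, Finset.card_univ, nsmul_eq_mul]
    have h := QCircuit.sum_loss_le hOG hG' posSemidef_blank
    rw [reTrace_blank, mul_one] at h
    refine add_le_add h (le_of_eq ?_)
    field_simp

/-- The value of `φ` at `r` enters only through the explicit pad key, which makes
`card_mul_sum_apply` applicable. -/
theorem holeValue_update (G D : QCircuit) (r : Bits (2 * n)) (φ : Bits (2 * n) → Bits (2 * n))
    (s s' : Bits (2 * n)) :
    holeValue e G D b r (Function.update φ r s') s = holeValue e G D b r φ s := by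
  rw [holeValue, hole_encPieces_update, hole_decPieces_update, holeValue]

/-- The generator with a hole produces the same state for both challenges, and encryption summed
over the pad keys does not see the plaintext. -/
theorem sum_holeValue_eq (G D : QCircuit) (r : Bits (2 * n)) (φ : Bits (2 * n) → Bits (2 * n)) :
    ∑ s, holeValue e G D true r φ s = ∑ s, holeValue e G D false r φ s := by
  simp only [holeValue, partValue]
  rw [← prOne_sum, ← prOne_sum, ← map_sum, ← map_sum]
  refine congrArg prOne (congrArg _ ?_)
  exact (sum_tensorId_encPart r e _).symm

/-- The game with a hole has the same average result for both challenges. -/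
theorem sum_holeValue (G D : QCircuit) (r : Bits (2 * n)) :
    ∑ φ : Bits (2 * n) → Bits (2 * n), holeValue e G D true r φ (φ r) =
      ∑ φ : Bits (2 * n) → Bits (2 * n), holeValue e G D false r φ (φ r) := by
  have h := fun b => card_mul_sum_apply r (holeValue e G D b r) (holeValue_update e b G D r)
  refine mul_left_cancel₀ (Nat.cast_ne_zero.2 (Fintype.card_ne_zero (α := Bits (2 * n)))) ?_
  rw [h, h]
  exact Finset.sum_congr rfl fun φ _ => sum_holeValue_eq e G D r φ

/-- With a random function, the two challenges are hardly distinguishable. -/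
theorem abs_avg_gameValue_sub_le
    (hG : G.WF [(n, 2 * n + n), (2 * n + n, n)] 0 (n + e))
    (hD : D.WF [(n, 2 * n + n)] (2 * n + n + e) 1) :
    |(∑ φ : Bits (2 * n) → Bits (2 * n), gameValue e G D true φ) /
        Fintype.card (Bits (2 * n) → Bits (2 * n)) -
      (∑ φ : Bits (2 * n) → Bits (2 * n), gameValue e G D false φ) /
        Fintype.card (Bits (2 * n) → Bits (2 * n))| ≤
      (G.gates.length + D.gates.length) / Fintype.card (Bits (2 * n)) := by
  set N : ℝ := ((Fintype.card (Bits (2 * n)) : ℕ) : ℝ) with hN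
  set K : ℝ := ((Fintype.card (Bits (2 * n) → Bits (2 * n)) : ℕ) : ℝ) with hK
  set q : ℝ := G.gates.length + D.gates.length
  have hN₀ : 0 < N := Nat.cast_pos.2 Fintype.card_pos
  have hK₀ : 0 < K := Nat.cast_pos.2 Fintype.card_pos
  let hv (b : Bool) (φ : Bits (2 * n) → Bits (2 * n)) : ℝ := ∑ r, holeValue e G D b r φ (φ r)
  have hE : ∑ φ, hv true φ = ∑ φ, hv false φ := by
    simp only [hv]
    rw [Finset.sum_comm, Finset.sum_congr rfl fun r _ => sum_holeValue e G D r,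
      Finset.sum_comm]
  -- Up to the factor `N`, each game value lies in an interval of length `q` above the value with
  -- holes.
  have hb : ∀ b φ, hv b φ ≤ N * gameValue e G D b φ ∧ N * gameValue e G D b φ ≤ hv b φ + q := by
    intro b φ
    have h := partValue_hole e b hG hD φ
    rw [gameValue_eq_sum, ← mul_assoc, mul_one_div_cancel hN₀.ne', one_mul]
    rw [Finset.sum_sub_distrib] at h
    exact ⟨Finset.sum_le_sum fun r _ => h.1 r, by linarith [h.2]⟩
  have hs : ∀ b, ∑ φ, hv b φ ≤ N * ∑ φ : Bits (2 * n) → Bits (2 * n), gameValue e G D b φ ∧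
      N * ∑ φ : Bits (2 * n) → Bits (2 * n), gameValue e G D b φ ≤ ∑ φ, hv b φ + K * q := by
    intro b
    rw [Finset.mul_sum]
    refine ⟨Finset.sum_le_sum fun φ _ => (hb b φ).1,
      (Finset.sum_le_sum fun φ _ => (hb b φ).2).trans_eq ?_⟩
    rw [Finset.sum_add_distrib, Finset.sum_const, Finset.card_univ, nsmul_eq_mul]
  have h₁ := hs true
  have h₂ := hs false
  rw [hE] at h₁
  -- Both averages lie in the same interval of length `q / N`, since the values with holes have
  -- equal averages by `hE`.
  rw [← sub_div, abs_div, abs_of_pos hK₀, div_le_div_iff₀ hK₀ hN₀, mul_comm,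
    ← le_div_iff₀' hN₀, abs_le, neg_le, le_div_iff₀' hN₀, le_div_iff₀' hN₀]
  constructor <;> linarith [h₁.1, h₁.2, h₂.1, h₂.2]

end Hybrid

end QCrypt

/-! ### Conclusion: correctness of the scheme and negligible advantage -/

namespace QCrypt

open Filter Topology

/-! ### Negligible functions -/

theorem Negligible.mono {ε δ : ℕ → ℝ} (h : Negligible δ) (h₀ : ∀ n, 0 ≤ ε n)
    (hle : ∀ n, ε n ≤ δ n) : Negligible ε :=
  Asymptotics.SuperpolynomialDecay.trans_abs_le h fun n => by
    rw [abs_of_nonneg (h₀ n)]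
    exact (hle n).trans (le_abs_self _)

theorem negligible_zero : Negligible fun _ => 0 := Asymptotics.superpolynomialDecay_zero _ _

/-- A polynomial divided by an exponential function is negligible. -/
theorem negligible_div_card {t : ℕ → ℕ} (ht : PolyBdd t) :
    Negligible fun n => (t n : ℝ) / Fintype.card (Bits (2 * n)) := by
  obtain ⟨p, hp⟩ := ht
  -- The cardinality is `4 ^ n`, which outgrows every power of `n`.
  have h : Negligible fun n => 1 / (Fintype.card (Bits (2 * n)) : ℝ) := by
    intro d
    refine (tendsto_pow_const_div_const_pow_of_one_lt d (r := 4) (by norm_num)).congr fun n => ?_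
    have : (Fintype.card (Bits (2 * n)) : ℝ) = 4 ^ n := by
      simp [pow_mul]
    simp only [this, mul_one_div]
  have h' : Negligible _ := h.polynomial_mul (p.map (Nat.castRingHom ℝ))
  refine Negligible.mono h' (fun n => by positivity) fun n => ?_
  simp only [Polynomial.eval_natCast_map, mul_one_div]
  exact div_le_div_of_nonneg_right (Nat.cast_le.2 (hp n)) (Nat.cast_nonneg _)

/-- Each gate occupies at least its tag in the description. Together with `PolyTimeUniform.length`
this bounds the number of queries of an adversary by a polynomial. -/
theorem length_gates_le (a b : ℕ) (C : QCircuit) : C.gates.length ≤ (C.encode a b).length := by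
  have : ∀ gs : List Gate, gs.length ≤ (gs.flatMap Gate.encode).length := by
    intro gs
    induction gs with
    | nil => exact le_rfl
    | cons g gs ih =>
      rw [List.flatMap_cons, List.length_append, List.length_cons, Gate.encode_eq, List.length_cons]
      omega
  rw [QCircuit.encode, List.length_append]
  exact (this _).trans (Nat.le_add_left _ _)

/-! ### The scheme -/

theorem toReal_uniformOfFintype (n : ℕ) (k : Bits n) :
    (PMF.uniformOfFintype (Bits n) k).toReal = 1 / Fintype.card (Bits n) := by
  rw [PMF.uniformOfFintype_apply, ENNReal.toReal_inv, ENNReal.toReal_natCast, one_div]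

section Scheme

variable {f : ∀ n : ℕ, Bits n → Bits (2 * n) → Bits (2 * n)}

/-- Only computability of the family is needed. The circuits are exact, and the negligible error may
be taken to be zero. -/
theorem isScheme_prfScheme (hf : PTComputable (m := fun n => 2 * n) (l := fun n => 2 * n) f) :
    (prfScheme f).IsScheme := by
  obtain ⟨C, hwf, hu, he⟩ := hf
  have hφ : ∀ n k, (fun q => (C n).eval (2 * n) (Fin.append k q)) = f n k :=
    fun n k => funext fun q => he n k q
  refine ⟨⟨⟨keyGenCircuit, fun n => wf_keyGenCircuit, uniform_keyGenCircuit hu⟩, fun n => ?_⟩,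
    ⟨⟨fun n => encCircuit n (C n), fun n => wf_encCircuit (hwf n), uniform_encCircuit hu⟩,
      fun n k ρ => ?_⟩,
    ⟨⟨fun n => decCircuit n (C n), fun n => wf_decCircuit (hwf n), uniform_decCircuit hu⟩,
      fun n k σ => ?_⟩,
    fun _ => 0, negligible_zero, fun n k _ => ?_⟩
  · refine keyGenCircuit_run.trans ?_
    rw [Finset.smul_sum]
    refine Finset.sum_congr rfl fun k _ => ?_
    change _ = (((PMF.uniformOfFintype (Bits n) k).toReal : ℝ) : ℂ) • _
    rw [toReal_uniformOfFintype]
    simp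
  · refine (encCircuit_run (hwf n) k ρ).trans ?_
    rw [hφ]
    rfl
  · refine (decCircuit_run (hwf n) k σ).trans ?_
    rw [hφ]
    rfl
  · change diamondNorm (padDec (f n k) ∘ₗ padEnc (f n k) - LinearMap.id) ≤ _
    rw [padDec_comp_padEnc, sub_self, diamondNorm_zero]
    exact zero_le

/-- The algorithm that runs the game with the classical oracle. -/
def gameQPT (A : CCA1Adversary (fun n => n) (fun n => 2 * n + n)) (b : Bool) :
    QPT (fun n => [(2 * n, 2 * n)]) (fun _ => 0) (fun _ => 1) where
  circuit n := gameCircuit n (A.e n) b (A.generator.circuit n) (A.distinguisher.circuit n)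
  wf n := wf_gameCircuit (A.generator.wf n) (A.distinguisher.wf n)
  uniform := uniform_gameCircuit A.generator.uniform A.distinguisher.uniform b

/-- The path goes from the pseudorandom game with the challenge to the random one, then to the
random game with the zero state, and back to the pseudorandom one. The outer moves are attacks on
the pseudorandom function by `gameQPT A true` and `gameQPT A false`; the middle one is statistical.
-/
theorem indCCA1_prfScheme (hf : IsQPRF (m := fun n => 2 * n) (l := fun n => 2 * n) f) :
    (prfScheme f).INDCCA1 := by
  intro A
  let V (b : Bool) (n : ℕ) (φ : Bits (2 * n) → Bits (2 * n)) : ℝ :=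
    gameValue (A.e n) (A.generator.circuit n) (A.distinguisher.circuit n) b φ
  let avgKey (b : Bool) (n : ℕ) : ℝ := (∑ k, V b n (f n k)) / Fintype.card (Bits n)
  let avgFun (b : Bool) (n : ℕ) : ℝ :=
    (∑ φ, V b n φ) / Fintype.card (Bits (2 * n) → Bits (2 * n))
  have hV : ∀ b n φ, prOne ((gameQPT A b).run n [classicalOracle φ] blank) = V b n φ :=
    fun b n φ => prOne_gameCircuit φ (A.e n) b (A.generator.wf n) (A.distinguisher.wf n)
  have hprf : ∀ b, Negligible fun n => |avgKey b n - avgFun b n| := by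
    intro b
    have := hf.2 (gameQPT A b)
    simp only [hV] at this
    exact this
  have hstat : Negligible fun n =>
      ((((A.generator.circuit n).gates.length + (A.distinguisher.circuit n).gates.length : ℕ) : ℝ) /
        Fintype.card (Bits (2 * n))) :=
    negligible_div_card ((A.generator.uniform.length.mono fun n => length_gates_le _ _ _).add
      (A.distinguisher.uniform.length.mono fun n => length_gates_le _ _ _))
  -- The three terms of the triangle inequality.
  have hsum := ((hprf true).add hstat).add (hprf false)
  refine Negligible.mono hsum (fun n => abs_nonneg _) fun n => ?_
  have h₁ : ∑ k : Bits n, ((prfScheme f).keyGen n k).toReal *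
      A.prAccept (prfScheme f) n k (A.challenge (prfScheme f) n k) = avgKey true n := by
    simp only [avgKey]
    rw [Finset.sum_div]
    refine Finset.sum_congr rfl fun k _ => ?_
    change (PMF.uniformOfFintype (Bits n) k).toReal * _ = _
    rw [toReal_uniformOfFintype, one_div_mul_eq_div]
    rfl
  have h₂ : ∑ k : Bits n, ((prfScheme f).keyGen n k).toReal *
      A.prAccept (prfScheme f) n k (tensor (ketbra (zeros n))
        (traceFst (A.challenge (prfScheme f) n k))) = avgKey false n := by
    simp only [avgKey]
    rw [Finset.sum_div]
    refine Finset.sum_congr rfl fun k _ => ?_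
    change (PMF.uniformOfFintype (Bits n) k).toReal * _ = _
    rw [toReal_uniformOfFintype, one_div_mul_eq_div]
    rfl
  have h₃ : |avgFun true n - avgFun false n| ≤
      (((A.generator.circuit n).gates.length + (A.distinguisher.circuit n).gates.length : ℕ) : ℝ) /
        Fintype.card (Bits (2 * n)) := by
    rw [Nat.cast_add]
    exact abs_avg_gameValue_sub_le (A.e n) (A.generator.wf n) (A.distinguisher.wf n)
  rw [h₁, h₂]
  change _ ≤ |avgKey true n - avgFun true n| + _ + |avgKey false n - avgFun false n|
  have h₄ := abs_sub_le (avgKey true n) (avgFun true n) (avgKey false n)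
  have h₅ := abs_sub_le (avgFun true n) (avgFun false n) (avgKey false n)
  rw [abs_sub_comm (avgFun false n)] at h₅
  linarith

end Scheme

end QCrypt

theorem mainTheorem4
    (f : ∀ n : ℕ, QCrypt.Bits n → QCrypt.Bits (2 * n) → QCrypt.Bits (2 * n))
    (hf : QCrypt.IsQPRF (m := fun n => 2 * n) (l := fun n => 2 * n) f) :
    (QCrypt.prfScheme f).IsScheme ∧ (QCrypt.prfScheme f).INDCCA1 :=
  ⟨QCrypt.isScheme_prfScheme hf.1, QCrypt.indCCA1_prfScheme hf⟩
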